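/- Let $g\ge 1$. Let $\mathsf H=\mathbb R^g\times\mathbb R^g\times\mathbb R$ be the Heisenberg group with product $(x,\xi,t)(x',\xi',t')=\bigl(x+x',\xi+\xi',t+t'+\tfrac12(\xi\cdot x'-\xi'\cdot x)\bigr)$, let $\Gamma=\mathbb Z^g\times\mathbb Z^g\times\tfrac12\mathbb Z$ and $M=\mathsf H/\Gamma$, with normalised Haar measure. Every $V$ in the Lie algebra $\mathfrak h=\mathbb R^g\times\mathbb R^g\times\mathbb R$ acts on $C^\infty(M)$ by $(V.f)(m)=\frac{d}{dt}\big|_{t=0}f(\exp(-tV)m)$. Let $(X_i,\Xi_j,T)$ be the standard basis of $\mathfrak h$, and let $\alpha=\begin{pmatrix}A&B\\C&D\end{pmatrix}\in \mathrm{Sp}_{2g}(\mathbb R)$ act on $\mathfrak h$ by $(x,\xi,t)\mapsto(Ax+B\xi,Cx+D\xi,t)$. Put $\Delta_\alpha=-\bigl(\sum_i(\alpha^{-1}X_i)^2+\sum_i(\alpha^{-1}\Xi_i)^2+T^2\bigr)$, $L_\alpha=1+\Delta_\alpha$ (a positive, essentially self-adjoint elliptic operator on $L^2(M)$). Let $L^2_0(M)$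 be the space of the functions in $L^2(M)$ with zero average along the fibres of the toral projection $M\to\mathbb R^{2g}/\mathbb Z^{2g}$, that is, along the orbits of the centre of $\mathsf H$. For $s\ge 0$ let $W^s_\alpha(M)=L_\alpha^{-s/2}L^2_0(M)$ with norm $\|f\|_{s,\alpha}=\|L_\alpha^{s/2}f\|_{L^2(M)}$, and, for $s>g+\tfrac12$, let $$B_s(\alpha)=\sup_{f\in W^s_\alpha(M)\setminus\{0\}}\frac{\|f\|_\infty}{\|f\|_{s,\alpha}}$$ be the best constant of the Sobolev embedding $W^s_\alpha(M)\subset C(M)$, where $\|f\|_\infty$ is the sup norm of the continuous representative of $f$. Let $\mathrm{Sp}_{2g}(\mathbb R)$ act on the Siegel upper half-space of symmetric complex $g\times g$ matrices with positive definite imaginary part by $Z\mapsto (AZ+B)(CZ+D)^{-1}$, and put $$\mathrm{Hgt}([[\alpha]])=\max_{\gamma\in \mathrm{Sp}_{2g}(\mathbb Z)}\det\operatorname{Im}\bigl(\gamma(\alpha^{-1}(i\,1_g))\bigr).$$ Then for every $s>g+\tfrac12$ there is a constant $C(s)>0$ (depending only on $g$ and $s$) such that for all $\alpha\in \mathrm{Sp}_{2g}(\mathbb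 R)$ $$B_s(\alpha)\le C(s)\,\mathrm{Hgt}([[\alpha]])^{1/4}.$$ -/

import Mathlib

open scoped ENNReal ContDiff

noncomputable section

namespace HeisNil

/-! ### The Heisenberg group, its standard lattice and the standard nilmanifold -/

/-- The Heisenberg Lie algebra `ℝ^g × ℝ^g × ℝ`, as a vector space. Its elements are `(q, p, r)`. -/
abbrev HeisAlg (g : ℕ) : Type := (Fin g → ℝ) × (Fin g → ℝ) × ℝ

/-- The canonical symplectic form `ω((x, ξ), (x', ξ')) = ξ ⬝ x' - ξ' ⬝ x`. -/
def omegaForm {g : ℕ} (x ξ x' ξ' : Fin g → ℝ) : ℝ := ξ ⬝ᵥ x' - ξ' ⬝ᵥ x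

/-- The Heisenberg group: the set `ℝ^g × ℝ^g × ℝ` with the group law given below. -/
@[ext]
structure Heis (g : ℕ) where
  x : Fin g → ℝ
  ξ : Fin g → ℝ
  t : ℝ

/-- The exponential map. In these coordinates it is the identity, because `t ↦ t • V` is a
one-parameter subgroup for each `V`. -/
def expo {g : ℕ} (V : HeisAlg g) : Heis g := ⟨V.1, V.2.1, V.2.2⟩

/-- The inverse of the exponential map. -/
def coords {g : ℕ} (h : Heis g) : HeisAlg g := (h.x, h.ξ, h.t)

/-- The topology of `ℝ^(2g+1)`. -/
instance (g : ℕ) : TopologicalSpace (Heis g) := TopologicalSpace.induced coords inferInstance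

/-- The Borel sets of `ℝ^(2g+1)`. -/
instance (g : ℕ) : MeasurableSpace (Heis g) := MeasurableSpace.comap coords inferInstance

/-- `(x, ξ, t) * (x', ξ', t') = (x + x', ξ + ξ', t + t' + ω((x, ξ), (x', ξ')) / 2)`. -/
instance (g : ℕ) : Mul (Heis g) :=
  ⟨fun h k => ⟨h.x + k.x, h.ξ + k.ξ, h.t + k.t + (1 / 2) * omegaForm h.x h.ξ k.x k.ξ⟩⟩

instance (g : ℕ) : One (Heis g) := ⟨⟨0, 0, 0⟩⟩

instance (g : ℕ) : Inv (Heis g) := ⟨fun h => ⟨-h.x, -h.ξ, -h.t⟩⟩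

theorem mul_def {g : ℕ} (h k : Heis g) :
    h * k = ⟨h.x + k.x, h.ξ + k.ξ, h.t + k.t + (1 / 2) * omegaForm h.x h.ξ k.x k.ξ⟩ := rfl

theorem one_def {g : ℕ} : (1 : Heis g) = ⟨0, 0, 0⟩ := rfl

theorem inv_def {g : ℕ} (h : Heis g) : h⁻¹ = ⟨-h.x, -h.ξ, -h.t⟩ := rfl

instance (g : ℕ) : Group (Heis g) :=
  Group.ofLeftAxioms
    (by
      intro a b c
      simp only [mul_def, omegaForm, add_dotProduct, dotProduct_add, Heis.mk.injEq]
      refine ⟨add_assoc _ _ _, add_assoc _ _ _, ?_⟩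
      ring)
    (by
      intro a
      simp [mul_def, one_def, omegaForm])
    (by
      intro a
      simp [mul_def, one_def, inv_def, omegaForm, dotProduct_comm])

/-- The standard lattice `ℤ^g × ℤ^g × (1/2)ℤ`. -/
def lattice (g : ℕ) : Subgroup (Heis g) where
  carrier := {h | ∃ (n m : Fin g → ℤ) (k : ℤ),
    h = ⟨fun i => (n i : ℝ), fun i => (m i : ℝ), (k : ℝ) / 2⟩}
  mul_mem' := by
    rintro _ _ ⟨n, m, k, rfl⟩ ⟨n', m', k', rfl⟩
    refine ⟨n + n', m + m', k + k' + (m ⬝ᵥ n' - m' ⬝ᵥ n), ?_⟩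
    simp only [mul_def, omegaForm, dotProduct, Heis.mk.injEq]
    refine ⟨?_, ?_, ?_⟩
    · ext i; simp
    · ext i; simp
    · push_cast; ring
  one_mem' := ⟨0, 0, 0, by
    ext <;> simp [one_def]⟩
  inv_mem' := by
    rintro _ ⟨n, m, k, rfl⟩
    refine ⟨-n, -m, -k, ?_⟩
    simp only [inv_def, Heis.mk.injEq]
    refine ⟨?_, ?_, ?_⟩
    · ext i; simp
    · ext i; simp
    · push_cast; ring

/-- The standard Heisenberg nilmanifold `M = Heis / Γ` (left cosets `hΓ`), on which the Heisenberg
group acts by left translations. -/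
abbrev Nil (g : ℕ) : Type := Heis g ⧸ lattice g

/-- The normalised Haar measure of `M`: the image of twice the Lebesgue measure on the fundamental
domain `[0,1]^g × [0,1]^g × [0,1/2]`. -/
def haarNil (g : ℕ) : MeasureTheory.Measure (Nil g) :=
  MeasureTheory.Measure.map (fun v : HeisAlg g => (QuotientGroup.mk (expo v) : Nil g))
    ((2 : ℝ≥0∞) • MeasureTheory.volume.restrict
      (Set.Icc ((0, 0, 0) : HeisAlg g) ((1, 1, 1 / 2) : HeisAlg g)))

/-- The Hilbert space `L²(M)`. -/
abbrev L2 (g : ℕ) : Type := MeasureTheory.Lp ℂ 2 (haarNil g)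

/-! ### The Laplacians -/

/-- `f ∈ C^∞(M)`: the lift of `f` to `Heis = ℝ^(2g+1)` is smooth. -/
def IsSmooth {g : ℕ} (f : Nil g → ℂ) : Prop :=
  ContDiff ℝ ∞ (fun v : HeisAlg g => f (QuotientGroup.mk (expo v)))

/-- `(V.f)(m) = d/dt f(exp(-tV) m)` at `t = 0`. -/
def lieDer {g : ℕ} (V : HeisAlg g) (f : Nil g → ℂ) (m : Nil g) : ℂ :=
  deriv (fun t : ℝ => f (expo (-(t • V)) • m)) 0

/-- The real symplectic group `Sp_{2g}(ℝ)`. -/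
abbrev SpR (g : ℕ) : Type := Matrix.symplecticGroup (Fin g) ℝ

/-- The integral symplectic group `Sp_{2g}(ℤ)`. -/
abbrev SpZ (g : ℕ) : Type := Matrix.symplecticGroup (Fin g) ℤ

/-- A symplectic matrix with blocks `A B C D` acts by
`(x, ξ, t) ↦ (A x + B ξ, C x + D ξ, t)`. -/
def act {g : ℕ} (α : SpR g) (V : HeisAlg g) : HeisAlg g :=
  (fun i => (α.1.mulVec (Sum.elim V.1 V.2.1)) (Sum.inl i),
    fun i => (α.1.mulVec (Sum.elim V.1 V.2.1)) (Sum.inr i), V.2.2)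

/-- The standard basis vectors `X_i`. -/
def basisX {g : ℕ} (i : Fin g) : HeisAlg g := (Pi.single i 1, 0, 0)

/-- The standard basis vectors `Ξ_i`. -/
def basisXi {g : ℕ} (i : Fin g) : HeisAlg g := (0, Pi.single i 1, 0)

/-- The central basis vector `T`. -/
def basisT {g : ℕ} : HeisAlg g := (0, 0, 1)

/-- `Δ_α = -(∑ (α⁻¹ X_i)² + ∑ (α⁻¹ Ξ_i)² + T²)`. -/
def laplacian {g : ℕ} (α : SpR g) (f : Nil g → ℂ) (m : Nil g) : ℂ :=
  -((∑ i, lieDer (act α⁻¹ (basisX i)) (lieDer (act α⁻¹ (basisX i)) f) m) +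
    (∑ i, lieDer (act α⁻¹ (basisXi i)) (lieDer (act α⁻¹ (basisXi i)) f) m) +
    lieDer basisT (lieDer basisT f) m)

/-- `L_α = 1 + Δ_α`, acting on functions on `M`. -/
def opL {g : ℕ} (α : SpR g) (f : Nil g → ℂ) (m : Nil g) : ℂ := f m + laplacian α f m

/-! ### Sobolev spaces and the best Sobolev constant

`L_α` is elliptic, positive and essentially self-adjoint on the compact manifold `M`, so that its
closure has pure point spectrum with smooth eigenfunctions; the powers `L_α^s` of the spectral
calculus act as `lam ^ s` on the eigenspace of `lam`. -/

/-- The eigenspace of `L_α` for `lam`, in `L²(M)`. (It is finite dimensional, so that the closure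
changes nothing; it makes the orthogonal projection available.) -/
def eigenspaceL {g : ℕ} (α : SpR g) (lam : ℝ) : Submodule ℂ (L2 g) :=
  (Submodule.span ℂ {u : L2 g | ∃ f : Nil g → ℂ, IsSmooth f ∧
    (∀ m, opL α f m = (lam : ℂ) * f m) ∧ u =ᵐ[haarNil g] f}).topologicalClosure

instance {g : ℕ} (α : SpR g) (lam : ℝ) : CompleteSpace (eigenspaceL α lam) :=
  (Submodule.isClosed_topologicalClosure _).completeSpace_coe

/-- `‖u‖_{s,α} = ⟨u, L_α^s u⟩^{1/2} = (∑ lam ^ s ‖P_lam u‖²)^{1/2}`, with value `∞` when `u` is not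
in the domain of `L_α^{s/2}`. -/
def sobNorm {g : ℕ} (s : ℝ) (α : SpR g) (u : L2 g) : ℝ≥0∞ :=
  (∑' lam : ℝ, ENNReal.ofReal (lam ^ s) *
    ‖(eigenspaceL α lam).starProjection u‖ₑ ^ (2 : ℕ)) ^ (1 / 2 : ℝ)

/-- `u ∈ L²_0(M)`: `u` has zero average along the fibres of the toral projection, that is along the
orbits of the centre, which are circles parametrised by `t ∈ [0, 1/2]`. -/
def ZeroFibreAverage {g : ℕ} (u : L2 g) : Prop :=
  ∀ᵐ m ∂(haarNil g), ∫ t in (0 : ℝ)..(1 / 2), u (expo (t • (basisT : HeisAlg g)) • m) = 0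

/-- The Sobolev space `W^s_α(M) = L_α^{-s/2} L²_0(M)`, for `s ≥ 0`. -/
def sobSpace {g : ℕ} (s : ℝ) (α : SpR g) : Set (L2 g) :=
  {u | ZeroFibreAverage u ∧ sobNorm s α u < ⊤}

/-- The sup norm of the continuous representative of `u` (`∞` if there is none). -/
def supNorm {g : ℕ} (u : L2 g) : ℝ≥0∞ :=
  ⨅ (f : C(Nil g, ℂ)) (_ : u =ᵐ[haarNil g] f), ⨆ m, ‖f m‖ₑ

/-- The best Sobolev constant `B_s(α)`, the supremum of `‖u‖_∞ / ‖u‖_{s,α}` over the nonzero `u`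
in `W^s_α(M)`. -/
def bestSobolev {g : ℕ} (s : ℝ) (α : SpR g) : ℝ≥0∞ :=
  ⨆ (u : L2 g) (_ : u ∈ sobSpace s α) (_ : u ≠ 0), supNorm u / sobNorm s α u

/-! ### The height function -/

/-- The generalised Möbius action `Z ↦ (A Z + B) (C Z + D)⁻¹`. -/
def moebius {g : ℕ} (M : Matrix (Fin g ⊕ Fin g) (Fin g ⊕ Fin g) ℝ)
    (Z : Matrix (Fin g) (Fin g) ℂ) : Matrix (Fin g) (Fin g) ℂ :=
  (M.toBlocks₁₁.map (fun x : ℝ => (x : ℂ)) * Z + M.toBlocks₁₂.map (fun x : ℝ => (x : ℂ))) *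
    (M.toBlocks₂₁.map (fun x : ℝ => (x : ℂ)) * Z + M.toBlocks₂₂.map (fun x : ℝ => (x : ℂ)))⁻¹

/-- `hgt Z = det (Im Z)`. -/
def hgt {g : ℕ} (Z : Matrix (Fin g) (Fin g) ℂ) : ℝ := (Z.map Complex.im).det

/-- The point `α⁻¹(i)` of the Siegel upper half-space, with `i = i · 1_g`. -/
def siegelPoint {g : ℕ} (α : SpR g) : Matrix (Fin g) (Fin g) ℂ :=
  moebius (α⁻¹ : SpR g).1 (Complex.I • (1 : Matrix (Fin g) (Fin g) ℂ))

/-- `Hgt [[α]]`: the maximal height of the `Sp_{2g}(ℤ)`-orbit of the point `α⁻¹(i)`. -/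
def siegelHeight {g : ℕ} (α : SpR g) : ℝ :=
  ⨆ γ : SpZ g, hgt (moebius (γ.1.map (fun n : ℤ => (n : ℝ))) (siegelPoint α))

end HeisNil

end

/-! The centre of `M` is a circle of length 1/2, so a function of zero fibre average only has
central frequencies `ν = 4πn` with `n ≠ 0`. On the eigenfunctions of one frequency the heat flow of
`L_α` is explicit: it is `e^{-(1+ν²)t}` times the average along the horizontal orbit `y ↦
exp(-α⁻¹y)m` against Mehler's kernel `C(t) e^{-A(t)|y|²}`, where `A(t) = (|ν|/4) coth(|ν|t)`
(`mehler_gaussAvg`). Since `A(t) ≥ |ν|/4 ≥ π` at every time, Cauchy–Schwarz bounds the square of the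
heat flow at `m` by `(4πt)^{-g}` times the single integral of `e^{-π|y|²} |f|²` along the orbit of
`m` (`exists_heat_bound`).

Unfolding that integral onto `M` bounds it by `‖f‖²` times the largest Gaussian sum over a translate
of the lattice `αℤ^{2g}` (`lintegral_orbit_le`, `exists_gaussWindow_sum_bound`). This is where the
geometry of `α` enters, and `exists_theta_bound` shows that the sum is `O(Hgt^{1/2})`. Indeed, let
`γ` almost maximise the height in the orbit and let `Y` be the imaginary part of `γα⁻¹(i)`. A
symplectic transvection would raise the height by a factor 2 if some nonzero integral `m` had `mᵀYm
< 1/2` (`exists_reduced`). In the Lagrangian frame of `γα⁻¹` the sum splits into `g` directions in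
which the lattice has no short vectors, which contribute `O(1)`, and `g` directions in which it is
the dual lattice; by Poisson summation these contribute `O((det Y)^{1/2})` (`gaussian_sum_le_dual`).

Writing `λ^{-s/2}` as a Laplace integral of `e^{-λt}` turns the heat bound into a pointwise bound on
one frequency, with the factor `(1+ν²)^{-(s-g)/2}` and, after the square root, `Hgt^{1/4}`
(`exists_sector_bound`). Cauchy–Schwarz over the frequencies needs `∑ n^{-2(s-g)}` to converge,
which is the condition `s > g + 1/2` (`exists_sum_secRep_bound`).

The expansion itself is proved with averaging operators. An average along orbits against a Hermitian
kernel of Gaussian decay maps `L²` to bounded functions, so it is Hilbert–Schmidt and self-adjoint.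
When the kernel is radial and projects to one frequency it commutes with `L_α`, because the first
order magnetic terms of the twisted Laplacian cancel on radial functions (`sum_twist2`). For smooth
compactly supported profiles the eigenspaces of nonzero eigenvalue are finite dimensional, consist
of smooth functions and are stable under the symmetric operator `L_α`, which is therefore
diagonalised on them. A vector orthogonal to all joint eigenfunctions is killed by all these
averages; Lebesgue differentiation and Fourier series in the centre then show that it is zero
(`eq_zero_of_orthogonal_secEig`). -/

noncomputable section
namespace HeisNil
open Matrix

/-! ### Heights of the points of the orbit of `i` -/

section Height
variable {g : ℕ}

/-- `C Cᵀ + D Dᵀ`, for the lower blocks `C, D` of a matrix: the inverse of the imaginary part of the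
image of `i`. -/
def lowerGram (σ : Matrix (Fin g ⊕ Fin g) (Fin g ⊕ Fin g) ℝ) : Matrix (Fin g) (Fin g) ℝ :=
  σ.toBlocks₂₁ * σ.toBlocks₂₁ᵀ + σ.toBlocks₂₂ * σ.toBlocks₂₂ᵀ

/-- The matrix `i C + D`. -/
def lowerAt (σ : Matrix (Fin g ⊕ Fin g) (Fin g ⊕ Fin g) ℝ) : Matrix (Fin g) (Fin g) ℂ :=
  σ.toBlocks₂₁.map (fun x : ℝ => (x : ℂ)) * (Complex.I • (1 : Matrix (Fin g) (Fin g) ℂ)) +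
    σ.toBlocks₂₂.map (fun x : ℝ => (x : ℂ))

/-- The matrix `i A + B`. -/
def upperAt (σ : Matrix (Fin g ⊕ Fin g) (Fin g ⊕ Fin g) ℝ) : Matrix (Fin g) (Fin g) ℂ :=
  σ.toBlocks₁₁.map (fun x : ℝ => (x : ℂ)) * (Complex.I • (1 : Matrix (Fin g) (Fin g) ℂ)) +
    σ.toBlocks₁₂.map (fun x : ℝ => (x : ℂ))

/-- The criterion for block matrices relates the block columns; applied to the transpose it relates
the block rows, which are the ones that occur in `iA + B` and `iC + D`. -/
theorem symplectic_block_relations {σ : Matrix (Fin g ⊕ Fin g) (Fin g ⊕ Fin g) ℝ}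
    (h : σ ∈ symplecticGroup (Fin g) ℝ) :
    σ.toBlocks₂₁ * σ.toBlocks₂₂ᵀ = σ.toBlocks₂₂ * σ.toBlocks₂₁ᵀ ∧
    σ.toBlocks₁₁ * σ.toBlocks₂₂ᵀ - σ.toBlocks₁₂ * σ.toBlocks₂₁ᵀ = 1 ∧
    σ.toBlocks₁₁ * σ.toBlocks₁₂ᵀ = σ.toBlocks₁₂ * σ.toBlocks₁₁ᵀ := by
  have h1 := SymplecticGroup.transpose_mem h
  rw [← fromBlocks_toBlocks σ, fromBlocks_transpose, SymplecticGroup.fromBlocks_mem_iff] at h1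
  simp only [transpose_transpose] at h1
  exact ⟨h1.2.1, h1.2.2, h1.1⟩

/-- If `Cᵀx` and `Dᵀx` both vanish, then `x = (A Dᵀ - B Cᵀ)x = 0`. -/
theorem lowerGram_posDef {σ : Matrix (Fin g ⊕ Fin g) (Fin g ⊕ Fin g) ℝ}
    (h : σ ∈ symplecticGroup (Fin g) ℝ) : (lowerGram σ).PosDef := by
  obtain ⟨-, h2, -⟩ := symplectic_block_relations h
  refine Matrix.PosDef.of_dotProduct_mulVec_pos ?_ ?_
  · simp [Matrix.IsHermitian, lowerGram, conjTranspose_eq_transpose_of_trivial]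
  · intro x hx
    have key : star x ⬝ᵥ (lowerGram σ *ᵥ x) =
        (σ.toBlocks₂₁ᵀ *ᵥ x) ⬝ᵥ (σ.toBlocks₂₁ᵀ *ᵥ x) +
        (σ.toBlocks₂₂ᵀ *ᵥ x) ⬝ᵥ (σ.toBlocks₂₂ᵀ *ᵥ x) := by
      simp only [lowerGram, star_trivial, add_mulVec, dotProduct_add, ← mulVec_mulVec]
      congr 1 <;> rw [dotProduct_mulVec, ← mulVec_transpose]
    rw [key]
    have n1 : ∀ y : Fin g → ℝ, 0 ≤ y ⬝ᵥ y := fun y =>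
      Finset.sum_nonneg fun i _ => mul_self_nonneg _
    refine lt_of_le_of_ne (add_nonneg (n1 _) (n1 _)) fun h0 => hx ?_
    have hc : σ.toBlocks₂₁ᵀ *ᵥ x = 0 :=
      dotProduct_self_eq_zero.1 (le_antisymm (by linarith [n1 (σ.toBlocks₂₂ᵀ *ᵥ x)]) (n1 _))
    have hd : σ.toBlocks₂₂ᵀ *ᵥ x = 0 :=
      dotProduct_self_eq_zero.1 (le_antisymm (by linarith [n1 (σ.toBlocks₂₁ᵀ *ᵥ x)]) (n1 _))
    have := congrArg (fun M => M *ᵥ x) h2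
    simpa [sub_mulVec, ← mulVec_mulVec, hc, hd] using this.symm

/-- The cross terms `i(C Dᵀ - D Cᵀ)` cancel because `C Dᵀ` is symmetric. -/
theorem lowerAt_mul_conjTranspose {σ : Matrix (Fin g ⊕ Fin g) (Fin g ⊕ Fin g) ℝ}
    (h : σ ∈ symplecticGroup (Fin g) ℝ) :
    lowerAt σ * (lowerAt σ)ᴴ = (lowerGram σ).map (fun x : ℝ => (x : ℂ)) := by
  obtain ⟨h1, -, -⟩ := symplectic_block_relations h
  have h1' := congrArg (fun M => M.map (Complex.ofRealHom)) h1
  have e : ∀ M : Matrix (Fin g) (Fin g) ℝ, (M.map (fun x : ℝ => (x : ℂ)))ᴴ =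
      Mᵀ.map (fun x : ℝ => (x : ℂ)) := by
    intro M; ext i j; simp
  have hh : ∀ M N : Matrix (Fin g) (Fin g) ℝ, (M * N).map (fun x : ℝ => (x : ℂ)) =
      M.map (fun x : ℝ => (x : ℂ)) * N.map (fun x : ℝ => (x : ℂ)) := fun M N =>
    Matrix.map_mul (f := Complex.ofRealHom)
  have h1'' : (σ.toBlocks₂₁ * σ.toBlocks₂₂ᵀ).map (fun x : ℝ => (x : ℂ)) =
    (σ.toBlocks₂₂ * σ.toBlocks₂₁ᵀ).map (fun x : ℝ => (x : ℂ)) := h1'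
  rw [hh, hh] at h1''
  have hadd : (lowerGram σ).map (fun x : ℝ => (x : ℂ)) =
     (σ.toBlocks₂₁ * σ.toBlocks₂₁ᵀ).map (fun x : ℝ => (x : ℂ)) +
     (σ.toBlocks₂₂ * σ.toBlocks₂₂ᵀ).map (fun x : ℝ => (x : ℂ)) := by
    ext i j; simp [lowerGram]
  rw [hadd, hh, hh]
  simp only [lowerAt, conjTranspose_add, e, conjTranspose_smul, Matrix.mul_smul, Matrix.smul_mul,
    Matrix.mul_one, Matrix.add_mul, Matrix.mul_add, h1'']
  have hI : ∀ X : Matrix (Fin g) (Fin g) ℂ, Complex.I • Complex.I • X = -X := fun X => by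
    rw [smul_smul, Complex.I_mul_I, neg_smul, one_smul]
  simp [hI]

/-- Here the cross terms `i(A Dᵀ - B Cᵀ)` add up to `i`, which is why the imaginary part of `σ(i)`
is exactly the inverse of `lowerGram σ`. -/
theorem upperAt_mul_conjTranspose {σ : Matrix (Fin g ⊕ Fin g) (Fin g ⊕ Fin g) ℝ}
    (h : σ ∈ symplecticGroup (Fin g) ℝ) :
    upperAt σ * (lowerAt σ)ᴴ =
      (σ.toBlocks₁₁ * σ.toBlocks₂₁ᵀ + σ.toBlocks₁₂ * σ.toBlocks₂₂ᵀ).map (fun x : ℝ => (x : ℂ)) +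
        Complex.I • 1 := by
  obtain ⟨-, h1, -⟩ := symplectic_block_relations h
  have e : ∀ M : Matrix (Fin g) (Fin g) ℝ, (M.map (fun x : ℝ => (x : ℂ)))ᴴ =
      Mᵀ.map (fun x : ℝ => (x : ℂ)) := by
    intro M; ext i j; simp
  have hh : ∀ M N : Matrix (Fin g) (Fin g) ℝ, (M * N).map (fun x : ℝ => (x : ℂ)) =
      M.map (fun x : ℝ => (x : ℂ)) * N.map (fun x : ℝ => (x : ℂ)) := fun M N =>
    Matrix.map_mul (f := Complex.ofRealHom)
  have h1'' : (σ.toBlocks₁₁ * σ.toBlocks₂₂ᵀ).map (fun x : ℝ => (x : ℂ)) =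
      1 + (σ.toBlocks₁₂ * σ.toBlocks₂₁ᵀ).map (fun x : ℝ => (x : ℂ)) := by
    rw [← sub_eq_iff_eq_add, ← Matrix.map_one (fun x : ℝ => (x : ℂ)) (by simp) (by simp), ← h1]
    ext i j; simp
  rw [hh, hh] at h1''
  have hadd : (σ.toBlocks₁₁ * σ.toBlocks₂₁ᵀ + σ.toBlocks₁₂ * σ.toBlocks₂₂ᵀ).map
      (fun x : ℝ => (x : ℂ)) =
     (σ.toBlocks₁₁ * σ.toBlocks₂₁ᵀ).map (fun x : ℝ => (x : ℂ)) +
     (σ.toBlocks₁₂ * σ.toBlocks₂₂ᵀ).map (fun x : ℝ => (x : ℂ)) := by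
    ext i j; simp
  rw [hadd, hh, hh]
  simp only [upperAt, lowerAt, conjTranspose_add, e, conjTranspose_smul, Matrix.mul_smul,
    Matrix.smul_mul, Matrix.mul_one, Matrix.add_mul, Matrix.mul_add, h1'']
  have hI : ∀ X : Matrix (Fin g) (Fin g) ℂ, Complex.I • Complex.I • X = -X := fun X => by
    rw [smul_smul, Complex.I_mul_I, neg_smul, one_smul]
  simp [hI]
  abel

theorem det_lowerGram_ofReal {σ : Matrix (Fin g ⊕ Fin g) (Fin g ⊕ Fin g) ℝ} :
    ((lowerGram σ).map (fun x : ℝ => (x : ℂ))).det = ((lowerGram σ).det : ℂ) :=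
  (Complex.ofRealHom.map_det (lowerGram σ)).symm

theorem isUnit_det_lowerAt {σ : Matrix (Fin g ⊕ Fin g) (Fin g ⊕ Fin g) ℝ}
    (h : σ ∈ symplecticGroup (Fin g) ℝ) : IsUnit (lowerAt σ).det := by
  have h1 := congrArg Matrix.det (lowerAt_mul_conjTranspose h)
  rw [det_mul, det_lowerGram_ofReal] at h1
  refine isUnit_iff_ne_zero.2 fun h0 => ?_
  rw [h0, zero_mul] at h1
  exact (lowerGram_posDef h).det_pos.ne (by exact_mod_cast h1)

theorem normSq_det_lowerAt {σ : Matrix (Fin g ⊕ Fin g) (Fin g ⊕ Fin g) ℝ}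
    (h : σ ∈ symplecticGroup (Fin g) ℝ) :
    Complex.normSq (lowerAt σ).det = (lowerGram σ).det := by
  have h1 := congrArg Matrix.det (lowerAt_mul_conjTranspose h)
  rw [det_mul, det_conjTranspose, det_lowerGram_ofReal] at h1
  rw [← Complex.ofReal_inj, ← h1, Complex.normSq_eq_conj_mul_self, mul_comm]
  rfl

/-- The point `σ(i)` of the Siegel upper half-space. -/
theorem upperAt_mul_inv {σ : Matrix (Fin g ⊕ Fin g) (Fin g ⊕ Fin g) ℝ}
    (h : σ ∈ symplecticGroup (Fin g) ℝ) :
    upperAt σ * (lowerAt σ)⁻¹ =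
      ((σ.toBlocks₁₁ * σ.toBlocks₂₁ᵀ + σ.toBlocks₁₂ * σ.toBlocks₂₂ᵀ) *
        (lowerGram σ)⁻¹).map (fun x : ℝ => (x : ℂ)) +
        Complex.I • (lowerGram σ)⁻¹.map (fun x : ℝ => (x : ℂ)) := by
  have hG : IsUnit (lowerGram σ).det := (lowerGram_posDef h).det_pos.ne'.isUnit
  have hh : ∀ M N : Matrix (Fin g) (Fin g) ℝ, (M * N).map (fun x : ℝ => (x : ℂ)) =
      M.map (fun x : ℝ => (x : ℂ)) * N.map (fun x : ℝ => (x : ℂ)) := fun M N =>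
    Matrix.map_mul (f := Complex.ofRealHom)
  have hinv : (lowerAt σ)⁻¹ = (lowerAt σ)ᴴ * (lowerGram σ)⁻¹.map (fun x : ℝ => (x : ℂ)) := by
    refine Matrix.inv_eq_right_inv ?_
    rw [← Matrix.mul_assoc, lowerAt_mul_conjTranspose h, ← hh, Matrix.mul_nonsing_inv _ hG]
    exact Matrix.map_one _ (by simp) (by simp)
  rw [hinv, ← Matrix.mul_assoc, upperAt_mul_conjTranspose h, Matrix.add_mul, ← hh,
    Matrix.smul_mul, Matrix.one_mul]

theorem moebius_I (σ : Matrix (Fin g ⊕ Fin g) (Fin g ⊕ Fin g) ℝ) :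
    moebius σ (Complex.I • 1) = upperAt σ * (lowerAt σ)⁻¹ := rfl

theorem hgt_moebius_I {σ : Matrix (Fin g ⊕ Fin g) (Fin g ⊕ Fin g) ℝ}
    (h : σ ∈ symplecticGroup (Fin g) ℝ) :
    hgt (moebius σ (Complex.I • 1)) = (lowerGram σ).det⁻¹ := by
  have : (moebius σ (Complex.I • 1)).map Complex.im = (lowerGram σ)⁻¹ := by
    rw [moebius_I, upperAt_mul_inv h]
    ext i j; simp
  rw [hgt, this, det_nonsing_inv, Ring.inverse_eq_inv']

theorem lowerAt_mul (τ σ : Matrix (Fin g ⊕ Fin g) (Fin g ⊕ Fin g) ℝ) :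
    lowerAt (τ * σ) = τ.toBlocks₂₁.map (fun x : ℝ => (x : ℂ)) * upperAt σ +
      τ.toBlocks₂₂.map (fun x : ℝ => (x : ℂ)) * lowerAt σ := by
  have hh : ∀ M N : Matrix (Fin g) (Fin g) ℝ, (M * N).map (fun x : ℝ => (x : ℂ)) =
      M.map (fun x : ℝ => (x : ℂ)) * N.map (fun x : ℝ => (x : ℂ)) := fun M N =>
    Matrix.map_mul (f := Complex.ofRealHom)
  have ha : ∀ M N : Matrix (Fin g) (Fin g) ℝ, (M + N).map (fun x : ℝ => (x : ℂ)) =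
      M.map (fun x : ℝ => (x : ℂ)) + N.map (fun x : ℝ => (x : ℂ)) := fun M N => by
    ext i j; simp
  conv_lhs => rw [← fromBlocks_toBlocks τ, ← fromBlocks_toBlocks σ, fromBlocks_multiply]
  simp only [lowerAt, upperAt, toBlocks_fromBlocks₂₁, toBlocks_fromBlocks₂₂, hh, ha,
    Matrix.mul_smul, Matrix.mul_one, Matrix.mul_add, smul_add]
  abel

theorem upperAt_mul (τ σ : Matrix (Fin g ⊕ Fin g) (Fin g ⊕ Fin g) ℝ) :
    upperAt (τ * σ) = τ.toBlocks₁₁.map (fun x : ℝ => (x : ℂ)) * upperAt σ +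
      τ.toBlocks₁₂.map (fun x : ℝ => (x : ℂ)) * lowerAt σ := by
  have hh : ∀ M N : Matrix (Fin g) (Fin g) ℝ, (M * N).map (fun x : ℝ => (x : ℂ)) =
      M.map (fun x : ℝ => (x : ℂ)) * N.map (fun x : ℝ => (x : ℂ)) := fun M N =>
    Matrix.map_mul (f := Complex.ofRealHom)
  have ha : ∀ M N : Matrix (Fin g) (Fin g) ℝ, (M + N).map (fun x : ℝ => (x : ℂ)) =
      M.map (fun x : ℝ => (x : ℂ)) + N.map (fun x : ℝ => (x : ℂ)) := fun M N => by
    ext i j; simp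
  conv_lhs => rw [← fromBlocks_toBlocks τ, ← fromBlocks_toBlocks σ, fromBlocks_multiply]
  simp only [lowerAt, upperAt, toBlocks_fromBlocks₁₁, toBlocks_fromBlocks₁₂, hh, ha,
    Matrix.mul_smul, Matrix.mul_one, Matrix.mul_add, smul_add]
  abel

/-- The automorphy factor `iC + D` of `σ` is invertible and cancels between the numerator and the
denominator of the outer action. -/
theorem moebius_moebius_I {τ σ : Matrix (Fin g ⊕ Fin g) (Fin g ⊕ Fin g) ℝ}
    (h : σ ∈ symplecticGroup (Fin g) ℝ) :
    moebius τ (moebius σ (Complex.I • 1)) = moebius (τ * σ) (Complex.I • 1) := by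
  have hu := isUnit_det_lowerAt h
  have e : ∀ M N : Matrix (Fin g) (Fin g) ℂ, M * (upperAt σ * (lowerAt σ)⁻¹) + N =
      (M * upperAt σ + N * lowerAt σ) * (lowerAt σ)⁻¹ := by
    intro M N
    rw [Matrix.add_mul, Matrix.mul_assoc, Matrix.mul_assoc N, Matrix.mul_nonsing_inv _ hu,
      Matrix.mul_one]
  rw [moebius_I, moebius_I, moebius, e, e, ← lowerAt_mul, ← upperAt_mul, Matrix.mul_inv_rev,
    Matrix.nonsing_inv_nonsing_inv _ hu, ← Matrix.mul_assoc, Matrix.mul_assoc (upperAt (τ * σ)),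
    Matrix.nonsing_inv_mul _ hu, Matrix.mul_one]

/-- An integral symplectic matrix as a real one. -/
def realOf (γ : SpZ g) : SpR g := ⟨γ.1.map (fun n : ℤ => (n : ℝ)), by
  have h := SymplecticGroup.map_mem γ.2 (Int.castRingHom ℝ)
  exact h⟩

theorem siegelHeight_eq (α : SpR g) :
    siegelHeight α = ⨆ γ : SpZ g, (lowerGram (realOf γ * α⁻¹ : SpR g).1).det⁻¹ := by
  unfold siegelHeight
  congr 1
  ext γ
  rw [siegelPoint, moebius_moebius_I (α⁻¹).2, hgt_moebius_I]
  · rfl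
  · exact (realOf γ * α⁻¹).2

end Height
end HeisNil
end

/-! ### Reduction theory: an almost highest point of a `Sp_{2g}(ℤ)`-orbit -/

noncomputable section
namespace HeisNil
open Matrix

section Reduction

/-- Evaluating the form on unit eigenvectors shows that all eigenvalues are at least 1. -/
theorem one_le_det_of_dotProduct_le {n : Type*} [Fintype n] [DecidableEq n] {M : Matrix n n ℝ}
    (hM : M.IsHermitian) (h : ∀ x : n → ℝ, x ⬝ᵥ x ≤ x ⬝ᵥ (M *ᵥ x)) : 1 ≤ M.det := by
  rw [hM.det_eq_prod_eigenvalues]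
  have h1 : ∀ i, 1 ≤ hM.eigenvalues i := by
    intro i
    have e := hM.mulVec_eigenvectorBasis i
    have h2 := h (hM.eigenvectorBasis i)
    rw [e] at h2
    have hn : ((hM.eigenvectorBasis i : EuclideanSpace ℝ n) : n → ℝ) ⬝ᵥ
        (hM.eigenvectorBasis i : EuclideanSpace ℝ n) = 1 := by
      have h3 := hM.eigenvectorBasis.orthonormal.1 i
      have h4 := EuclideanSpace.real_norm_sq_eq (hM.eigenvectorBasis i)
      rw [h3] at h4
      simp only [dotProduct]
      rw [show (1 : ℝ) = 1 ^ 2 by norm_num, h4]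
      exact Finset.sum_congr rfl fun j _ => by ring
    rw [dotProduct_smul, hn] at h2
    simpa using h2
  have h5 : (1 : ℝ) ≤ ∏ i, hM.eigenvalues i := by
    calc (1 : ℝ) = ∏ i : n, (1 : ℝ) := by simp
      _ ≤ _ := Finset.prod_le_prod (fun _ _ => zero_le_one) fun i _ => h1 i
  simpa using h5

open scoped MatrixOrder in
theorem exists_transpose_mul_self {n : Type*} [Fintype n] [DecidableEq n] {N : Matrix n n ℝ}
    (hN : N.PosDef) : ∃ B : Matrix n n ℝ, IsUnit B.det ∧ N = Bᵀ * B := by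
  obtain ⟨B, hB⟩ := CStarAlgebra.nonneg_iff_eq_star_mul_self.mp hN.posSemidef.nonneg
  rw [star_eq_conjTranspose, conjTranspose_eq_transpose_of_trivial] at hB
  refine ⟨B, isUnit_iff_ne_zero.2 fun h0 => hN.det_pos.ne' ?_, hB⟩
  rw [hB, det_mul, h0, mul_zero]

/-- The determinant is monotone for the Loewner order, up to a scalar factor. -/
theorem smul_pow_det_le {n : Type*} [Fintype n] [DecidableEq n] {M N : Matrix n n ℝ}
    (hM : M.IsHermitian) (hN : N.PosDef) {ε : ℝ} (hε : 0 < ε)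
    (h : ∀ x : n → ℝ, ε * (x ⬝ᵥ (N *ᵥ x)) ≤ x ⬝ᵥ (M *ᵥ x)) :
    ε ^ Fintype.card n * N.det ≤ M.det := by
  obtain ⟨B, hB, rfl⟩ := exists_transpose_mul_self hN
  -- In the coordinates in which `N` is the identity, `M` becomes `B⁻ᵀ M B⁻¹ ≥ ε`.
  have h1 : 1 ≤ (ε⁻¹ • ((B⁻¹)ᵀ * M * B⁻¹)).det := by
    refine one_le_det_of_dotProduct_le ?_ fun x => ?_
    · have hM' : Mᵀ = M := by
        rw [← conjTranspose_eq_transpose_of_trivial]; exact hM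
      rw [Matrix.IsHermitian, conjTranspose_eq_transpose_of_trivial]
      simp only [transpose_smul, transpose_mul, transpose_transpose, hM', Matrix.mul_assoc]
    · have h2 := h (B⁻¹ *ᵥ x)
      have e1 : (B⁻¹ *ᵥ x) ⬝ᵥ ((Bᵀ * B) *ᵥ (B⁻¹ *ᵥ x)) = x ⬝ᵥ x := by
        rw [← mulVec_mulVec, mulVec_mulVec x B, Matrix.mul_nonsing_inv _ hB, one_mulVec,
          dotProduct_mulVec, vecMul_transpose, mulVec_mulVec, Matrix.mul_nonsing_inv _ hB,
          one_mulVec]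
      have e2 : (B⁻¹ *ᵥ x) ⬝ᵥ (M *ᵥ (B⁻¹ *ᵥ x)) = x ⬝ᵥ (((B⁻¹)ᵀ * M * B⁻¹) *ᵥ x) := by
        rw [← mulVec_mulVec, ← mulVec_mulVec, dotProduct_mulVec x, vecMul_transpose]
      rw [e1, e2] at h2
      rw [smul_mulVec, dotProduct_smul, smul_eq_mul, inv_mul_eq_div, le_div_iff₀ hε]
      linarith
  have hd : B.det ≠ 0 := hB.ne_zero
  rw [det_smul, det_mul, det_mul, det_transpose, det_nonsing_inv, Ring.inverse_eq_inv',
    inv_pow, inv_mul_eq_div, le_div_iff₀ (by positivity), one_mul] at h1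
  rw [det_mul, det_transpose]
  calc _ ≤ (B.det⁻¹ * M.det * B.det⁻¹) * (B.det * B.det) :=
        mul_le_mul_of_nonneg_right h1 (mul_self_nonneg _)
    _ = M.det := by field_simp

theorem sum_sq_mulVec_le {m n : Type*} [Fintype m] [Fintype n] (A : Matrix m n ℝ) (x : n → ℝ) :
    (A *ᵥ x) ⬝ᵥ (A *ᵥ x) ≤ (∑ i, ∑ j, A i j ^ 2) * (x ⬝ᵥ x) := by
  rw [Finset.sum_mul]
  refine Finset.sum_le_sum fun i _ => ?_
  have := Finset.sum_mul_sq_le_sq_mul_sq Finset.univ (A i) x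
  simp only [dotProduct, mulVec]
  calc _ = (∑ j, A i j * x j) ^ 2 := by ring
    _ ≤ _ := this
    _ = _ := by simp only [sq]

variable {g : ℕ}

/-- For `γ` alone the determinant is a positive integer, hence at least 1. Right multiplication by
`α⁻¹` shrinks the quadratic form of `lowerGram` by at most a factor that depends on `α` only. This
makes the supremum that defines the height finite. -/
theorem exists_lower_bound_det_lowerGram (α : SpR g) :
    ∃ ε : ℝ, 0 < ε ∧ ∀ γ : SpZ g, ε ≤ (lowerGram (realOf γ * α⁻¹ : SpR g).1).det := by
  -- The sum of squares bounds the squared operator norm of `αᵀ`; adding 1 keeps `K` positive even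
  -- when there are no entries.
  set K : ℝ := (∑ i, ∑ j, (α.1)ᵀ i j ^ 2) + 1 with hK
  have hK0 : 0 < K := by positivity
  refine ⟨K⁻¹ ^ Fintype.card (Fin g), by positivity, fun γ => ?_⟩
  have hN : (lowerGram (realOf γ).1).PosDef := lowerGram_posDef (realOf γ).2
  have hint : ∃ n : ℤ, (lowerGram (realOf γ).1).det = n := by
    refine ⟨(γ.1.toBlocks₂₁ * γ.1.toBlocks₂₁ᵀ + γ.1.toBlocks₂₂ * γ.1.toBlocks₂₂ᵀ).det, ?_⟩
    rw [← eq_intCast (Int.castRingHom ℝ), RingHom.map_det]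
    congr 1
    ext i j
    simp [lowerGram, realOf, Matrix.mul_apply, toBlocks₂₁, toBlocks₂₂]
  have hone : 1 ≤ (lowerGram (realOf γ).1).det := by
    obtain ⟨n, hn⟩ := hint
    have := hN.det_pos
    rw [hn] at this ⊢
    exact_mod_cast this
  have quad : ∀ (σ : Matrix (Fin g ⊕ Fin g) (Fin g ⊕ Fin g) ℝ) (x : Fin g → ℝ),
      x ⬝ᵥ (lowerGram σ *ᵥ x) = (σᵀ *ᵥ Sum.elim 0 x) ⬝ᵥ (σᵀ *ᵥ Sum.elim 0 x) := by
    intro σ x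
    have e : σᵀ *ᵥ Sum.elim 0 x = Sum.elim (σ.toBlocks₂₁ᵀ *ᵥ x) (σ.toBlocks₂₂ᵀ *ᵥ x) := by
      conv_lhs => rw [← fromBlocks_toBlocks σ, fromBlocks_transpose, fromBlocks_mulVec]
      simp
    rw [e, sumElim_dotProduct_sumElim, lowerGram, add_mulVec, dotProduct_add, ← mulVec_mulVec,
      ← mulVec_mulVec, dotProduct_mulVec x, dotProduct_mulVec x, ← mulVec_transpose,
      ← mulVec_transpose]
  have key := smul_pow_det_le (M := lowerGram (realOf γ * α⁻¹ : SpR g).1)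
    (lowerGram_posDef (realOf γ * α⁻¹).2).1 hN (ε := K⁻¹) (by positivity) (fun x => by
      rw [quad, quad, inv_mul_le_iff₀ hK0]
      have e : ((realOf γ).1)ᵀ *ᵥ Sum.elim 0 x =
          (α.1)ᵀ *ᵥ (((realOf γ * α⁻¹ : SpR g).1)ᵀ *ᵥ Sum.elim 0 x) := by
        rw [mulVec_mulVec, ← transpose_mul, ← Submonoid.coe_mul]
        simp
      rw [e]
      refine (sum_sq_mulVec_le _ _).trans ?_
      gcongr
      · exact Finset.sum_nonneg fun i _ => mul_self_nonneg _
      · linarith)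
  calc _ ≤ K⁻¹ ^ Fintype.card (Fin g) * (lowerGram (realOf γ).1).det :=
        le_mul_of_one_le_right (by positivity) hone
    _ ≤ _ := key

theorem bddAbove_heights (α : SpR g) :
    BddAbove (Set.range fun γ : SpZ g => (lowerGram (realOf γ * α⁻¹ : SpR g).1).det⁻¹) := by
  obtain ⟨ε, hε, h⟩ := exists_lower_bound_det_lowerGram α
  refine ⟨ε⁻¹, ?_⟩
  rintro _ ⟨γ, rfl⟩
  exact inv_anti₀ hε (h γ)

theorem inv_det_le_siegelHeight (α : SpR g) (γ : SpZ g) :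
    (lowerGram (realOf γ * α⁻¹ : SpR g).1).det⁻¹ ≤ siegelHeight α := by
  rw [siegelHeight_eq]
  exact le_ciSup (bddAbove_heights α) γ

theorem siegelHeight_pos (α : SpR g) : 0 < siegelHeight α :=
  (inv_pos.2 (lowerGram_posDef (realOf 1 * α⁻¹).2).det_pos).trans_le (inv_det_le_siegelHeight α 1)

/-- The integral symplectic transvection `w ↦ w + ω(v, w) v`. -/
def transvection (v : Fin g ⊕ Fin g → ℤ) : SpZ g :=
  ⟨1 + vecMulVec v v * J (Fin g) ℤ, by
    have hJ : (J (Fin g) ℤ) * (J (Fin g) ℤ)ᵀ = 1 := by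
      rw [J_transpose, Matrix.mul_neg, J_squared, neg_neg]
    have hv : v ᵥ* J (Fin g) ℤ ⬝ᵥ v = 0 := by
      rw [← dotProduct_mulVec]
      have : v ⬝ᵥ (J (Fin g) ℤ *ᵥ v) = - (v ⬝ᵥ (J (Fin g) ℤ *ᵥ v)) := by
        conv_lhs => rw [dotProduct_mulVec, ← mulVec_transpose, J_transpose, neg_mulVec,
          neg_dotProduct, dotProduct_comm]
      omega
    have hvv : (vecMulVec v v)ᵀ = vecMulVec v v := transpose_vecMulVec v v
    rw [SymplecticGroup.mem_iff, transpose_add, transpose_mul, hvv, transpose_one]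
    -- The term quadratic in `v vᵀ` contains the factor `ω(v, v) = 0`; the two linear terms cancel
    -- each other.
    have h3 : vecMulVec v v * J (Fin g) ℤ * J (Fin g) ℤ *
        ((J (Fin g) ℤ)ᵀ * vecMulVec v v) = 0 := by
      rw [← Matrix.mul_assoc, Matrix.mul_assoc _ _ (J (Fin g) ℤ)ᵀ, hJ, Matrix.mul_one,
        vecMulVec_mul, vecMulVec_mul_vecMulVec, hv]
      simp
    rw [Matrix.add_mul, Matrix.mul_add, Matrix.mul_one, Matrix.add_mul _ _ ((J (Fin g) ℤ)ᵀ * _),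
      h3, Matrix.one_mul, ← Matrix.mul_assoc (J (Fin g) ℤ), hJ, Matrix.mul_assoc,
      J_squared]
    simp⟩

/-- The lower blocks of the transvection along `v = (a, m)` are `m mᵀ` and `1 - m aᵀ`, so at the
point `Z = σ(i)` its automorphy factor is the rank one perturbation `1 + m (mᵀZ - aᵀ)`, with
determinant `1 + mᵀZm - a·m`. The height of `Z` is divided by the squared modulus of that number. -/
theorem det_lowerGram_transvection (a m : Fin g → ℤ) (σ : SpR g) :
    (lowerGram (realOf (transvection (Sum.elim a m)) * σ : SpR g).1).det =
      Complex.normSq (1 + ((fun i => (m i : ℂ)) ᵥ* (upperAt σ.1 * (lowerAt σ.1)⁻¹) -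
        fun i => (a i : ℂ)) ⬝ᵥ (fun i => (m i : ℂ))) * (lowerGram σ.1).det := by
  have hu := isUnit_det_lowerAt σ.2
  have h21 : (realOf (transvection (Sum.elim a m))).1.toBlocks₂₁.map (fun x : ℝ => (x : ℂ)) =
      vecMulVec (fun i => (m i : ℂ)) (fun i => (m i : ℂ)) := by
    ext i j
    simp [realOf, transvection, toBlocks₂₁, J, Matrix.mul_apply, vecMulVec_apply, fromBlocks,
      Matrix.one_apply]
  have h22 : (realOf (transvection (Sum.elim a m))).1.toBlocks₂₂.map (fun x : ℝ => (x : ℂ)) =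
      1 - vecMulVec (fun i => (m i : ℂ)) (fun i => (a i : ℂ)) := by
    ext i j
    simp [realOf, transvection, toBlocks₂₂, J, Matrix.mul_apply, vecMulVec_apply, fromBlocks,
      Matrix.one_apply, sub_eq_add_neg]
    split_ifs <;> simp
  rw [← normSq_det_lowerAt (realOf (transvection (Sum.elim a m)) * σ).2, ← normSq_det_lowerAt σ.2,
    ← Complex.normSq_mul, Submonoid.coe_mul, lowerAt_mul, h21, h22]
  congr 1
  have e : vecMulVec (fun i => (m i : ℂ)) (fun i => (m i : ℂ)) * upperAt σ.1 +
      (1 - vecMulVec (fun i => (m i : ℂ)) (fun i => (a i : ℂ))) * lowerAt σ.1 =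
      (1 + replicateCol Unit (fun i => (m i : ℂ)) * replicateRow Unit
        ((fun i => (m i : ℂ)) ᵥ* (upperAt σ.1 * (lowerAt σ.1)⁻¹) - fun i => (a i : ℂ))) *
        lowerAt σ.1 := by
    rw [← vecMulVec_eq, vecMulVec_sub, ← vecMulVec_mul, Matrix.add_mul, Matrix.sub_mul,
      Matrix.sub_mul, Matrix.mul_assoc _ _ (lowerAt σ.1), Matrix.mul_assoc (upperAt σ.1),
      Matrix.nonsing_inv_mul _ hu, Matrix.mul_one, Matrix.one_mul]
    abel
  rw [e, det_mul, det_one_add_replicateCol_mul_replicateRow]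

/-- Near a maximum of the height, the imaginary part has no short integral vectors. -/
theorem exists_reduced (α : SpR g) : ∃ γ : SpZ g, ∀ m : Fin g → ℤ, m ≠ 0 →
    1 / 2 ≤ (fun i => (m i : ℝ)) ⬝ᵥ
      ((lowerGram (realOf γ * α⁻¹ : SpR g).1)⁻¹ *ᵥ fun i => (m i : ℝ)) := by
  -- Attainment of the supremum is not needed: a point within a factor 2 of it already gives the
  -- bound 1/2.
  obtain ⟨γ, hγ⟩ : ∃ γ : SpZ g,
      siegelHeight α / 2 < (lowerGram (realOf γ * α⁻¹ : SpR g).1).det⁻¹ := by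
    have h := half_lt_self (siegelHeight_pos α)
    conv_rhs at h => rw [siegelHeight_eq]
    exact exists_lt_of_lt_ciSup h
  refine ⟨γ, fun m hm => ?_⟩
  set σ : SpR g := realOf γ * α⁻¹ with hσ
  set Y := (lowerGram σ.1)⁻¹ with hY
  have hYpos : Y.PosDef := (lowerGram_posDef σ.2).inv
  -- the primitive case
  have prim : ∀ m b : Fin g → ℤ, m ⬝ᵥ b = 1 →
      1 / 2 ≤ (fun i => (m i : ℝ)) ⬝ᵥ (Y *ᵥ fun i => (m i : ℝ)) := by
    intro m b hb
    set R := (σ.1.toBlocks₁₁ * σ.1.toBlocks₂₁ᵀ + σ.1.toBlocks₁₂ * σ.1.toBlocks₂₂ᵀ) * Y with hR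
    set r : ℝ := 1 + (fun i => (m i : ℝ)) ⬝ᵥ (R *ᵥ fun i => (m i : ℝ)) with hr
    set t : ℝ := (fun i => (m i : ℝ)) ⬝ᵥ (Y *ᵥ fun i => (m i : ℝ)) with ht
    have ht0 : 0 ≤ t := by
      have := hYpos.posSemidef.dotProduct_mulVec_nonneg (fun i => (m i : ℝ))
      simpa using this
    -- Taking `a = k b` with `m·b = 1` gives `a·m = k`, so the real part of the automorphy factor
    -- becomes `r - k`, of modulus at most 1/2.
    set k : ℤ := round r with hk
    have h1 := det_lowerGram_transvection (fun i => k * b i) m σ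
    have hc : (1 + ((fun i => (m i : ℂ)) ᵥ* (upperAt σ.1 * (lowerAt σ.1)⁻¹) -
        fun i => ((k * b i : ℤ) : ℂ)) ⬝ᵥ (fun i => (m i : ℂ))) = ((r - k : ℝ) : ℂ) +
          (t : ℝ) * Complex.I := by
      have hmap : ∀ M : Matrix (Fin g) (Fin g) ℝ,
          ((fun i => (m i : ℂ)) ᵥ* M.map (fun x : ℝ => (x : ℂ))) ⬝ᵥ (fun i => (m i : ℂ)) =
          (((fun i => (m i : ℝ)) ⬝ᵥ (M *ᵥ fun i => (m i : ℝ)) : ℝ) : ℂ) := by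
        intro M
        rw [dotProduct_mulVec]
        simp [dotProduct, vecMul]
      have hbk : (fun i => ((k * b i : ℤ) : ℂ)) ⬝ᵥ (fun i => (m i : ℂ)) = k := by
        have : ((m ⬝ᵥ b : ℤ) : ℂ) = 1 := by rw [hb]; simp
        calc _ = (k : ℂ) * ((m ⬝ᵥ b : ℤ) : ℂ) := by
              simp only [dotProduct, Int.cast_sum, Finset.mul_sum]
              refine Finset.sum_congr rfl fun i _ => ?_
              push_cast; ring
          _ = k := by rw [this, mul_one]
      rw [sub_dotProduct, hbk, upperAt_mul_inv σ.2, vecMul_add, add_dotProduct, hmap,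
        vecMul_smul, smul_dotProduct, hmap]
      simp only [hr, ht]
      push_cast
      rw [smul_eq_mul]
      ring
    rw [hc, Complex.normSq_add_mul_I] at h1
    have h2 := inv_det_le_siegelHeight α (transvection (Sum.elim (fun i => k * b i) m) * γ)
    have e2 : realOf (transvection (Sum.elim (fun i => k * b i) m) * γ) * α⁻¹ =
        realOf (transvection (Sum.elim (fun i => k * b i) m)) * σ := by
      rw [hσ, ← mul_assoc]
      congr 1
      ext i j
      simp [realOf, Matrix.mul_apply]
    rw [e2, h1] at h2
    have hd : 0 < (lowerGram σ.1).det := (lowerGram_posDef σ.2).det_pos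
    -- Otherwise the transvection at least doubles a height that exceeds half the supremum. Since
    -- `(r - k)² ≤ 1/4`, this leaves `t² > 1/4`.
    have h3 : 1 / 2 < (r - k) ^ 2 + t ^ 2 := by
      by_contra hcon
      push Not at hcon
      have hpos : 0 < ((r - k) ^ 2 + t ^ 2) * (lowerGram σ.1).det := by
        rw [← h1]
        exact (lowerGram_posDef (realOf (transvection (Sum.elim (fun i => k * b i) m)) * σ).2).det_pos
      have h4 : (1 / 2 * (lowerGram σ.1).det)⁻¹ ≤ siegelHeight α :=
        (inv_anti₀ hpos (mul_le_mul_of_nonneg_right hcon hd.le)).trans h2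
      rw [mul_inv] at h4
      norm_num at h4
      linarith
    have h5 : (r - k) ^ 2 ≤ (1 / 2) ^ 2 := by
      rw [← sq_abs]
      gcongr
      exact abs_sub_round r
    nlinarith
  -- reduction to a primitive vector
  obtain ⟨i, hi⟩ : ∃ i, m i ≠ 0 := by
    by_contra h
    push Not at h
    exact hm (funext h)
  obtain ⟨m', hm', hg⟩ := Finset.extract_gcd m ⟨i, Finset.mem_univ i⟩
  obtain ⟨b, hb⟩ := Finset.gcd_eq_sum_mul Finset.univ m'
  set d : ℤ := Finset.univ.gcd m with hd
  have hd0 : d ≠ 0 := fun h0 => hi (by rw [hm' i (Finset.mem_univ i), h0, zero_mul])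
  have hp := prim m' b (by rw [dotProduct, ← hb, hg])
  have hmm : (fun i => (m i : ℝ)) = (d : ℝ) • fun i => (m' i : ℝ) := by
    ext i
    simp [hm' i (Finset.mem_univ i)]
  rw [hmm, mulVec_smul, smul_dotProduct, dotProduct_smul, smul_eq_mul, smul_eq_mul, ← mul_assoc]
  have hd1 : (1 : ℝ) ≤ (d : ℝ) * d := by
    have : (1 : ℤ) ≤ d * d := by
      have := mul_self_pos.2 hd0
      omega
    exact_mod_cast this
  exact hp.trans (le_mul_of_one_le_left (by linarith) hd1)

end Reduction
end HeisNil
end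

/-! ### Gaussian sums over lattices and Poisson summation -/

noncomputable section
namespace HeisNil
open Matrix MeasureTheory

section GaussianSums

/-- The balls of radius `δ/2` about the points are disjoint, and on each of them `e^{-c|P|²} ≤
e^{cδ²/4} e^{-c|w|²/2}`. So the sum is at most the integral of the right-hand side divided by the
volume of one ball. -/
theorem exists_gaussian_sum_bound_of_separated (n : ℕ) {c δ : ℝ} (hc : 0 < c) (hδ : 0 < δ) :
    ∃ C : ℝ, 0 < C ∧ ∀ P : (Fin n → ℤ) → EuclideanSpace ℝ (Fin n),
      (∀ p q, p ≠ q → δ ≤ dist (P p) (P q)) →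
      ∑' p, ENNReal.ofReal (Real.exp (-c * ‖P p‖ ^ 2)) ≤ ENNReal.ofReal C := by
  set E := EuclideanSpace ℝ (Fin n)
  set V : ℝ≥0∞ := volume (Metric.ball (0 : E) (δ / 2)) with hV
  have hV0 : V ≠ 0 := (Metric.measure_ball_pos volume _ (by positivity)).ne'
  have hVt : V ≠ ⊤ := measure_ball_lt_top.ne
  set h : E → ℝ := fun w => Real.exp (c * δ ^ 2 / 4) * Real.exp (-(c / 2) * ‖w‖ ^ 2) with hh
  have hint : Integrable h := by
    refine Integrable.const_mul ?_ _
    have := GaussianFourier.integrable_cexp_neg_mul_sq_norm_add (V := E) (b := ((c / 2 : ℝ) : ℂ))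
      (by simpa using hc) 0 0
    have h2 := this.norm
    refine h2.congr (Filter.Eventually.of_forall fun w => ?_)
    simp [Complex.norm_exp, ← Complex.ofReal_pow]
  have hfin : ∫⁻ w, ENNReal.ofReal (h w) ≠ ⊤ := by
    have := hint.lintegral_lt_top
    exact this.ne
  set C : ℝ := ((∫⁻ w, ENNReal.ofReal (h w)) / V).toReal + 1 with hC
  refine ⟨C, by positivity, fun P hP => ?_⟩
  have hlt : (∫⁻ w, ENNReal.ofReal (h w)) / V ≠ ⊤ := ENNReal.div_ne_top hfin hV0
  refine le_trans ?_ (show (∫⁻ w, ENNReal.ofReal (h w)) / V ≤ ENNReal.ofReal C by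
    rw [hC, ENNReal.ofReal_add ENNReal.toReal_nonneg zero_le_one, ENNReal.ofReal_toReal hlt]
    exact le_self_add)
  rw [ENNReal.le_div_iff_mul_le (Or.inl hV0) (Or.inl hVt), ← ENNReal.tsum_mul_right]
  calc ∑' p, ENNReal.ofReal (Real.exp (-c * ‖P p‖ ^ 2)) * V
      ≤ ∑' p, ∫⁻ w in Metric.ball (P p) (δ / 2), ENNReal.ofReal (h w) := by
        refine ENNReal.tsum_le_tsum fun p => ?_
        have hv : V = volume (Metric.ball (P p) (δ / 2)) := by
          exact (Measure.addHaar_ball_center volume (P p) (δ / 2)).symm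
        rw [hv, ← setLIntegral_const]
        refine setLIntegral_mono_ae (by fun_prop) (Filter.Eventually.of_forall fun w hw => ?_)
        refine ENNReal.ofReal_le_ofReal ?_
        rw [hh]
        simp only
        rw [← Real.exp_add]
        refine Real.exp_le_exp.2 ?_
        have h1 : ‖w‖ ≤ ‖P p‖ + δ / 2 := by
          have := norm_sub_norm_le w (P p)
          rw [← dist_eq_norm] at this
          have h2 := Metric.mem_ball.1 hw
          linarith
        have h2 : ‖w‖ ^ 2 ≤ 2 * ‖P p‖ ^ 2 + δ ^ 2 / 2 := by
          have := pow_le_pow_left₀ (norm_nonneg w) h1 2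
          nlinarith [sq_nonneg (‖P p‖ - δ / 2)]
        nlinarith
    _ = ∫⁻ w in ⋃ p, Metric.ball (P p) (δ / 2), ENNReal.ofReal (h w) := by
        rw [lintegral_iUnion (fun p => measurableSet_ball)]
        intro p q hpq
        refine Metric.ball_disjoint_ball ?_
        have := hP p q hpq
        linarith
    _ ≤ ∫⁻ w, ENNReal.ofReal (h w) := setLIntegral_le_lintegral _ _

variable {g : ℕ}

/-- The real vector of an integral vector. -/
def castVec {ι : Type*} (p : ι → ℤ) : ι → ℝ := fun i => (p i : ℝ)

/-- The constant depends on the lattice `Bℤⁿ` only through a lower bound for its shortest vector,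
and it does not depend on the translate. -/
theorem exists_gaussian_sum_bound (n : ℕ) {c δ : ℝ} (hc : 0 < c) (hδ : 0 < δ) :
    ∃ C : ℝ, 0 < C ∧ ∀ (B : Matrix (Fin n) (Fin n) ℝ) (b : Fin n → ℝ),
      (∀ m : Fin n → ℤ, m ≠ 0 → δ ^ 2 ≤ (B *ᵥ castVec m) ⬝ᵥ (B *ᵥ castVec m)) →
      ∑' p : Fin n → ℤ, ENNReal.ofReal (Real.exp (-c * ((B *ᵥ (castVec p + b)) ⬝ᵥ
        (B *ᵥ (castVec p + b))))) ≤ ENNReal.ofReal C := by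
  obtain ⟨C, hC, h⟩ := exists_gaussian_sum_bound_of_separated n hc hδ
  refine ⟨C, hC, fun B b hB => ?_⟩
  have hsq : ∀ v : Fin n → ℝ, ‖WithLp.toLp 2 v‖ ^ 2 = v ⬝ᵥ v := fun v => by
    rw [EuclideanSpace.real_norm_sq_eq]
    simp [dotProduct, sq]
  have := h (fun p => WithLp.toLp 2 (B *ᵥ (castVec p + b))) (fun p q hpq => by
    rw [dist_eq_norm]
    refine le_of_sq_le_sq ?_ (norm_nonneg _)
    rw [← WithLp.toLp_sub, hsq, ← mulVec_sub]
    have e : castVec p + b - (castVec q + b) = castVec (p - q) := by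
      ext i; simp [castVec]
    rw [e]
    exact hB _ (sub_ne_zero.2 hpq))
  simpa only [hsq] using this

/-- An invertible matrix does not shrink integral vectors too much. -/
theorem exists_separation {n : ℕ} {B : Matrix (Fin n) (Fin n) ℝ} (hB : IsUnit B.det) :
    ∃ δ : ℝ, 0 < δ ∧ ∀ m : Fin n → ℤ, m ≠ 0 →
      δ ^ 2 ≤ (B *ᵥ castVec m) ⬝ᵥ (B *ᵥ castVec m) := by
  set K : ℝ := (∑ i, ∑ j, B⁻¹ i j ^ 2) + 1 with hK
  have hK0 : 0 < K := by positivity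
  refine ⟨Real.sqrt K⁻¹, by positivity, fun m hm => ?_⟩
  rw [Real.sq_sqrt (by positivity), inv_le_iff_one_le_mul₀ hK0]
  have h1 := sum_sq_mulVec_le B⁻¹ (B *ᵥ castVec m)
  rw [mulVec_mulVec, Matrix.nonsing_inv_mul _ hB, one_mulVec] at h1
  have h2 : (1 : ℝ) ≤ castVec m ⬝ᵥ castVec m := by
    obtain ⟨i, hi⟩ : ∃ i, m i ≠ 0 := by
      by_contra h
      push Not at h
      exact hm (funext h)
    have : (1 : ℤ) ≤ m i * m i := by
      have := mul_self_pos.2 hi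
      omega
    calc (1 : ℝ) ≤ castVec m i * castVec m i := by unfold castVec; exact_mod_cast this
      _ ≤ _ := Finset.single_le_sum (f := fun i => castVec m i * castVec m i)
        (fun j _ => mul_self_nonneg _) (Finset.mem_univ i)
  have h3 : 0 ≤ (B *ᵥ castVec m) ⬝ᵥ (B *ᵥ castVec m) :=
    Finset.sum_nonneg fun i _ => mul_self_nonneg _
  nlinarith

theorem summable_gaussian {n : ℕ} {B : Matrix (Fin n) (Fin n) ℝ} (hB : IsUnit B.det) {c : ℝ}
    (hc : 0 < c) (b : Fin n → ℝ) :
    Summable fun p : Fin n → ℤ => Real.exp (-c * ((B *ᵥ (castVec p + b)) ⬝ᵥ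
        (B *ᵥ (castVec p + b)))) := by
  obtain ⟨δ, hδ, h⟩ := exists_separation hB
  obtain ⟨C, -, hC⟩ := exists_gaussian_sum_bound n hc hδ
  have h1 := (hC B b h).trans_lt ENNReal.ofReal_lt_top
  have h2 := ENNReal.summable_toReal h1.ne
  refine h2.congr fun p => ?_
  rw [ENNReal.toReal_ofReal (Real.exp_pos _).le]

/-- The unfolding of an integral over integral translates of the unit cube. The cube is `(0, 1]ⁿ`,
the domain on which Fourier coefficients on the torus are computed below. -/
theorem integral_eq_integral_tsum_box {n : ℕ} {φ : (Fin n → ℝ) → ℂ} (hφ : Integrable φ) :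
    ∫ x, φ x = ∫ x in {x : Fin n → ℝ | ∀ i, x i ∈ Set.Ioc (0 : ℝ) (0 + 1)},
      ∑' p : Fin n → ℤ, φ (castVec p + x) := by
  set D : Set (Fin n → ℝ) := {x | ∀ i, x i ∈ Set.Ioc (0 : ℝ) (0 + 1)} with hD
  have hDm : MeasurableSet D := by
    have : D = Set.univ.pi fun _ => Set.Ioc (0 : ℝ) (0 + 1) := by ext; simp [hD]
    rw [this]
    exact MeasurableSet.univ_pi fun _ => measurableSet_Ioc
  set Dp : (Fin n → ℤ) → Set (Fin n → ℝ) := fun p => (fun x => castVec p + x) '' D with hDp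
  have hpre : ∀ p, Dp p = (fun x => -castVec p + x) ⁻¹' D := fun p => by
    rw [hDp]
    simp only [Set.image_add_left]
  have hm : ∀ p, MeasurableSet (Dp p) := fun p => by
    rw [hpre]
    exact (measurable_const_add _) hDm
  have hdis : Pairwise (Function.onFun Disjoint Dp) := by
    intro p q hpq
    refine Set.disjoint_left.2 fun x hx hy => hpq ?_
    rw [hpre] at hx hy
    ext i
    have h1 := hx i
    have h2 := hy i
    simp only [castVec, Pi.add_apply, Pi.neg_apply, Set.mem_Ioc] at h1 h2
    have h3 : (p i : ℝ) < q i + 1 := by linarith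
    have h4 : (q i : ℝ) < p i + 1 := by linarith
    have h5 : p i < q i + 1 := by exact_mod_cast h3
    have h6 : q i < p i + 1 := by exact_mod_cast h4
    omega
  have hcov : ⋃ p, Dp p = Set.univ := by
    refine Set.eq_univ_of_forall fun x => Set.mem_iUnion.2 ⟨fun i => ⌈x i⌉ - 1, ?_⟩
    rw [hpre]
    intro i
    simp only [castVec, Pi.add_apply, Pi.neg_apply, Set.mem_Ioc]
    push_cast
    constructor
    · linarith [Int.ceil_lt_add_one (x i)]
    · linarith [Int.le_ceil (x i)]
  have hmp : ∀ p : Fin n → ℤ, MeasurePreserving (fun x : Fin n → ℝ => castVec p + x) volume volume :=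
    fun p => measurePreserving_add_left volume _
  have hemb : ∀ p : Fin n → ℤ, MeasurableEmbedding (fun x : Fin n → ℝ => castVec p + x) :=
    fun p => measurableEmbedding_addLeft _
  rw [← setIntegral_univ, ← hcov, integral_iUnion hm hdis hφ.integrableOn]
  have e : ∀ p, ∫ x in Dp p, φ x = ∫ x in D, φ (castVec p + x) := fun p =>
    (hmp p).setIntegral_image_emb (hemb p) φ D
  simp only [e]
  rw [integral_tsum_of_summable_integral_norm]
  · intro p
    exact ((hmp p).integrable_comp_of_integrable hφ).integrableOn
  · have h1 := (hasSum_integral_iUnion hm hdis hφ.norm.integrableOn).summable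
    refine h1.congr fun p => ?_
    exact (hmp p).setIntegral_image_emb (hemb p) (fun x => ‖φ x‖) D

/-- The Fourier transform of an anisotropic Gaussian, at integral frequencies. -/
theorem integral_gaussian_mul_mFourier {n : ℕ} {B : Matrix (Fin n) (Fin n) ℝ} (hB : IsUnit B.det)
    (k : Fin n → ℤ) :
    Integrable (fun x : Fin n → ℝ => UnitAddTorus.mFourier (-k) (fun i => (x i : UnitAddCircle)) *
      ((Real.exp (-Real.pi * ((B *ᵥ x) ⬝ᵥ (B *ᵥ x))) : ℝ) : ℂ)) ∧
    ∫ x : Fin n → ℝ, UnitAddTorus.mFourier (-k) (fun i => (x i : UnitAddCircle)) *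
      ((Real.exp (-Real.pi * ((B *ᵥ x) ⬝ᵥ (B *ᵥ x))) : ℝ) : ℂ) =
      ((|B.det|⁻¹ * Real.exp (-Real.pi * ((B⁻¹ᵀ *ᵥ castVec k) ⬝ᵥ (B⁻¹ᵀ *ᵥ castVec k))) : ℝ) : ℂ) := by
  -- Since `k·x = (B⁻ᵀk)·(Bx)`, the substitution `v = Bx` leaves a standard Gaussian with this
  -- linear term.
  set c : Fin n → ℂ := fun i => -(2 * Real.pi * Complex.I) * ((B⁻¹ᵀ *ᵥ castVec k) i : ℝ) with hc
  set ψ : (Fin n → ℝ) → ℂ := fun v =>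
    Complex.exp (-(Real.pi : ℂ) * ∑ i, (v i : ℂ) ^ 2 + ∑ i, c i * v i) with hψ
  have hpi : 0 < ((Real.pi : ℝ) : ℂ).re := by simpa using Real.pi_pos
  have hψi : Integrable ψ := GaussianFourier.integrable_cexp_neg_mul_sum_add hpi c
  have hψint : ∫ v, ψ v =
      ((Real.exp (-Real.pi * ((B⁻¹ᵀ *ᵥ castVec k) ⬝ᵥ (B⁻¹ᵀ *ᵥ castVec k))) : ℝ) : ℂ) := by
    rw [hψ, GaussianFourier.integral_cexp_neg_mul_sum_add hpi c]
    have hp0 : (Real.pi : ℂ) ≠ 0 := by exact_mod_cast Real.pi_ne_zero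
    rw [div_self hp0, Complex.one_cpow, one_mul, Complex.ofReal_exp]
    congr 1
    simp only [hc, dotProduct, mul_pow, ← Finset.mul_sum]
    push_cast
    rw [neg_sq, mul_pow, mul_pow, Complex.I_sq]
    field_simp
    simp [sq]
    ring
  have hcomp : ∀ x : Fin n → ℝ, ψ (B *ᵥ x) =
      UnitAddTorus.mFourier (-k) (fun i => (x i : UnitAddCircle)) *
      ((Real.exp (-Real.pi * ((B *ᵥ x) ⬝ᵥ (B *ᵥ x))) : ℝ) : ℂ) := by
    intro x
    have e1 : ∑ i, c i * ((B *ᵥ x) i : ℝ) = ∑ i, 2 * Real.pi * Complex.I * ((-k) i : ℤ) * (x i) := by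
      have : (B⁻¹ᵀ *ᵥ castVec k) ⬝ᵥ (B *ᵥ x) = castVec k ⬝ᵥ x := by
        rw [mulVec_transpose, ← dotProduct_mulVec, mulVec_mulVec, Matrix.nonsing_inv_mul _ hB,
          one_mulVec]
      have h2 := congrArg (fun r : ℝ => -(2 * Real.pi * Complex.I) * (r : ℂ)) this
      simp only [dotProduct] at h2
      push_cast at h2
      rw [Finset.mul_sum, Finset.mul_sum] at h2
      calc _ = ∑ i, -(2 * Real.pi * Complex.I) *
            (((B⁻¹ᵀ *ᵥ castVec k) i : ℝ) * ((B *ᵥ x) i : ℝ)) := by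
            simp only [hc, mul_assoc]
        _ = _ := h2
        _ = _ := by
            refine Finset.sum_congr rfl fun i _ => ?_
            simp [castVec]
            ring
    simp only [hψ]
    rw [e1, Complex.exp_add, mul_comm, Complex.exp_sum, Complex.ofReal_exp]
    congr 1
    · simp only [UnitAddTorus.mFourier, ContinuousMap.coe_mk, fourier_coe_apply]
      simp
    · congr 1
      simp [dotProduct, sq]
  have hd := hB.ne_zero
  have hmap := Real.map_matrix_volume_pi_eq_smul_volume_pi hd
  have hemb : MeasurableEmbedding (toLin' B) := by
    have : Function.Injective (toLin' B) := by
      intro x y hxy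
      have h1 := congrArg (fun v => B⁻¹ *ᵥ v) hxy
      simpa [mulVec_mulVec, Matrix.nonsing_inv_mul _ hB] using h1
    exact (LinearMap.continuous_of_finiteDimensional _).measurableEmbedding this
  constructor
  · have h1 : Integrable ψ (Measure.map (toLin' B) volume) := by
      rw [hmap]
      exact hψi.smul_measure ENNReal.ofReal_ne_top
    have h2 := (hemb.integrable_map_iff).1 h1
    exact h2.congr (Filter.Eventually.of_forall fun x => hcomp x)
  · have h1 := hemb.integral_map (μ := volume) ψ
    rw [hmap, integral_smul_measure, hψint] at h1
    simp only [← hcomp]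
    simp only [toLin'_apply] at h1
    rw [← h1, ENNReal.toReal_ofReal (by positivity), abs_inv]
    push_cast
    rw [Complex.real_smul]
    push_cast
    rfl

/-- The Fourier coefficients of the periodised Gaussian are positive Gaussians at the dual lattice
points, so its value at any `b` is at most the sum of its coefficients. The translate `b` drops out.
-/
theorem gaussian_sum_le_dual {n : ℕ} {B : Matrix (Fin n) (Fin n) ℝ} (hB : IsUnit B.det)
    (b : Fin n → ℝ) :
    ∑' p : Fin n → ℤ, ENNReal.ofReal (Real.exp (-Real.pi * ((B *ᵥ (castVec p + b)) ⬝ᵥ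
        (B *ᵥ (castVec p + b))))) ≤ ENNReal.ofReal |B.det|⁻¹ *
    ∑' k : Fin n → ℤ, ENNReal.ofReal (Real.exp (-Real.pi * ((B⁻¹ᵀ *ᵥ castVec k) ⬝ᵥ
        (B⁻¹ᵀ *ᵥ castVec k)))) := by
  set h : (Fin n → ℝ) → ℂ := fun x => ((Real.exp (-Real.pi * ((B *ᵥ x) ⬝ᵥ (B *ᵥ x))) : ℝ) : ℂ)
    with hh
  have hdet : IsUnit (B⁻¹ᵀ).det := by
    rw [det_transpose]
    exact (Matrix.isUnit_nonsing_inv_det_iff).2 hB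
  -- the periodization
  set Φ : (Fin n → ℝ) → ℂ := fun x => ∑' p : Fin n → ℤ, h (castVec p + x) with hΦ
  have hΦc : Continuous Φ := by
    rw [continuous_iff_continuousAt]
    intro x₀
    have hcont : Continuous fun x : Fin n → ℝ => (B *ᵥ x) ⬝ᵥ (B *ᵥ x) := by fun_prop
    set R := (B *ᵥ x₀) ⬝ᵥ (B *ᵥ x₀) + 1 with hR
    have hU : IsOpen {x : Fin n → ℝ | (B *ᵥ x) ⬝ᵥ (B *ᵥ x) < R} := isOpen_lt hcont continuous_const
    refine ContinuousOn.continuousAt ?_ (hU.mem_nhds (by simp [hR]))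
    -- Near `x₀` the inequality `|Bp|² ≤ 2|B(p+x)|² + 2|Bx|²` gives a summable majorant independent
    -- of `x`, at the cost of half the exponent.
    refine continuousOn_tsum (u := fun p : Fin n → ℤ => Real.exp (Real.pi * R) *
      Real.exp (-(Real.pi / 2) * ((B *ᵥ (castVec p + 0)) ⬝ᵥ (B *ᵥ (castVec p + 0))))) ?_ ?_ ?_
    · intro p
      simp only [hh]
      exact (Complex.continuous_ofReal.comp (by fun_prop)).continuousOn
    · exact (summable_gaussian hB (by positivity) 0).mul_left _
    · intro p x hx
      simp only [hh, Complex.norm_real, Real.norm_eq_abs, Real.abs_exp, ← Real.exp_add, add_zero]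
      refine Real.exp_le_exp.2 ?_
      have h1 : (B *ᵥ castVec p) ⬝ᵥ (B *ᵥ castVec p) ≤
          2 * ((B *ᵥ (castVec p + x)) ⬝ᵥ (B *ᵥ (castVec p + x))) +
          2 * ((B *ᵥ x) ⬝ᵥ (B *ᵥ x)) := by
        simp only [dotProduct, Finset.mul_sum, ← Finset.sum_add_distrib, mulVec_add, Pi.add_apply]
        refine Finset.sum_le_sum fun i _ => ?_
        nlinarith [sq_nonneg ((B *ᵥ castVec p) i + 2 * (B *ᵥ x) i)]
      have h2 : (B *ᵥ x) ⬝ᵥ (B *ᵥ x) < R := hx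
      have := Real.pi_pos
      nlinarith
  have hper : ∀ (x : Fin n → ℝ) (q : Fin n → ℤ), Φ (castVec q + x) = Φ x := by
    intro x q
    simp only [hΦ]
    rw [← (Equiv.addRight q).tsum_eq fun p => h (castVec p + x)]
    refine tsum_congr fun p => ?_
    congr 1
    ext i
    simp [castVec]
    ring
  have hquot : IsOpenQuotientMap (fun (x : Fin n → ℝ) (i : Fin n) => (x i : UnitAddCircle)) :=
    IsOpenQuotientMap.piMap fun _ => QuotientAddGroup.isOpenQuotientMap_mk
  obtain ⟨F, hF⟩ : ∃ F : C(UnitAddTorus (Fin n), ℂ), ∀ x : Fin n → ℝ,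
      F (fun i => (x i : UnitAddCircle)) = Φ x := by
    set F₀ : UnitAddTorus (Fin n) → ℂ := fun z => Φ (Function.surjInv hquot.surjective z) with hF₀
    have e : ∀ x : Fin n → ℝ, F₀ (fun i => (x i : UnitAddCircle)) = Φ x := by
      intro x
      have h1 := Function.surjInv_eq hquot.surjective (fun i => (x i : UnitAddCircle))
      set y := Function.surjInv hquot.surjective (fun i => (x i : UnitAddCircle)) with hy
      have h2 : ∀ i, ∃ q : ℤ, (q : ℝ) + x i = y i := by
        intro i
        have h3 := congrFun h1 i
        have h4 := (QuotientAddGroup.eq (s := AddSubgroup.zmultiples (1 : ℝ))).1 h3.symm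
        obtain ⟨q, hq⟩ := AddSubgroup.mem_zmultiples_iff.1 h4
        exact ⟨q, by rw [zsmul_eq_mul, mul_one] at hq; linarith⟩
      choose q hq using h2
      have h5 : y = castVec q + x := by
        ext i
        simp [castVec, hq]
      simp only [hF₀]
      rw [← hy, h5, hper]
    refine ⟨⟨F₀, ?_⟩, e⟩
    rw [hquot.isQuotientMap.continuous_iff]
    exact hΦc.congr fun x => (e x).symm
  have hcoef : ∀ k, UnitAddTorus.mFourierCoeff F k =
      ((|B.det|⁻¹ * Real.exp (-Real.pi * ((B⁻¹ᵀ *ᵥ castVec k) ⬝ᵥ (B⁻¹ᵀ *ᵥ castVec k))) : ℝ) : ℂ) := by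
    intro k
    obtain ⟨hi, he⟩ := integral_gaussian_mul_mFourier hB k
    rw [UnitAddTorus.mFourierCoeff_eq_integral F k 0, ← he, integral_eq_integral_tsum_box hi]
    congr 1
    ext x
    rw [hF, smul_eq_mul, hΦ, ← tsum_mul_left]
    refine tsum_congr fun p => ?_
    congr 2
    ext i
    simp only [Pi.add_apply, castVec]
    rw [AddCircle.coe_add, eq_comm, add_eq_right]
    exact (AddCircle.coe_eq_zero_iff 1).2 ⟨p i, by simp⟩
  have hsumK := summable_gaussian hdet Real.pi_pos 0
  simp only [add_zero] at hsumK
  have hsum : Summable (UnitAddTorus.mFourierCoeff F) := by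
    simp only [funext hcoef]
    exact Complex.ofRealCLM.summable (hsumK.mul_left _)
  have hval := UnitAddTorus.hasSum_mFourier_series_apply_of_summable hsum
    (fun i => (b i : UnitAddCircle))
  have hreal := summable_gaussian hB Real.pi_pos b
  rw [← ENNReal.ofReal_tsum_of_nonneg (fun p => (Real.exp_pos _).le) hreal,
    ← ENNReal.ofReal_tsum_of_nonneg (fun p => (Real.exp_pos _).le) hsumK,
    ← ENNReal.ofReal_mul (by positivity), ← tsum_mul_left]
  refine ENNReal.ofReal_le_ofReal ?_
  have h1 : Φ b = ((∑' p : Fin n → ℤ, Real.exp (-Real.pi * ((B *ᵥ (castVec p + b)) ⬝ᵥ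
        (B *ᵥ (castVec p + b)))) : ℝ) : ℂ) := by
    rw [Complex.ofReal_tsum]
  have h2 : ‖Φ b‖ = ∑' p : Fin n → ℤ, Real.exp (-Real.pi * ((B *ᵥ (castVec p + b)) ⬝ᵥ
        (B *ᵥ (castVec p + b)))) := by
    rw [h1, Complex.norm_real, Real.norm_of_nonneg (tsum_nonneg fun p => (Real.exp_pos _).le)]
  rw [← h2, ← hF, ← hval.tsum_eq]
  -- Each character of the torus has modulus at most 1.
  refine tsum_of_norm_bounded (hsumK.mul_left |B.det|⁻¹).hasSum fun k => ?_
  rw [hcoef, norm_smul, Complex.norm_real, Real.norm_of_nonneg (by positivity)]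
  refine mul_le_of_le_one_right (by positivity) ?_
  exact ((UnitAddTorus.mFourier k).norm_coe_le_norm _).trans UnitAddTorus.mFourier_norm.le

end GaussianSums
end HeisNil
end

/-! ### The theta bound: Gaussian sums over `αℤ^{2g}` -/

noncomputable section
namespace HeisNil
open Matrix

section Theta
variable {g : ℕ}

theorem coe_inv_blocks (σ : SpR g) : (σ⁻¹ : SpR g).1 =
    fromBlocks σ.1.toBlocks₂₂ᵀ (-σ.1.toBlocks₁₂ᵀ) (-σ.1.toBlocks₂₁ᵀ) σ.1.toBlocks₁₁ᵀ := by
  rw [SymplecticGroup.coe_inv]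
  conv_lhs => rw [← fromBlocks_toBlocks σ.1]
  simp [J, fromBlocks_transpose, fromBlocks_multiply, fromBlocks_neg]

/-- Splitting the Euclidean norm along the Lagrangian frame given by the lower rows of `σ`. -/
theorem dotProduct_self_eq_lagrangian (σ : SpR g) {B : Matrix (Fin g) (Fin g) ℝ}
    (hB : IsUnit B.det) (hG : lowerGram σ.1 = Bᵀ * B) (a b : Fin g → ℝ) :
    Sum.elim a b ⬝ᵥ Sum.elim a b =
      (B⁻¹ᵀ *ᵥ (σ.1.toBlocks₂₁ *ᵥ a + σ.1.toBlocks₂₂ *ᵥ b)) ⬝ᵥ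
      (B⁻¹ᵀ *ᵥ (σ.1.toBlocks₂₁ *ᵥ a + σ.1.toBlocks₂₂ *ᵥ b)) +
      (B⁻¹ᵀ *ᵥ (σ.1.toBlocks₂₂ *ᵥ a - σ.1.toBlocks₂₁ *ᵥ b)) ⬝ᵥ
      (B⁻¹ᵀ *ᵥ (σ.1.toBlocks₂₂ *ᵥ a - σ.1.toBlocks₂₁ *ᵥ b)) := by
  obtain ⟨h1, -, -⟩ := symplectic_block_relations σ.2
  set C := σ.1.toBlocks₂₁ with hC
  set D := σ.1.toBlocks₂₂ with hD
  set S := B⁻¹ᵀ with hS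
  have hG' : C * Cᵀ + D * Dᵀ = Bᵀ * B := hG
  have hSB : S * Bᵀ = 1 := by
    rw [hS, ← transpose_mul, Matrix.mul_nonsing_inv _ hB, transpose_one]
  have hBS : B * Sᵀ = 1 := by rw [hS, transpose_transpose, Matrix.mul_nonsing_inv _ hB]
  have hSG : S * (Bᵀ * B) * Sᵀ = 1 := by
    rw [← Matrix.mul_assoc, hSB, Matrix.one_mul, hBS]
  -- `P` is orthogonal: `S(C Cᵀ + D Dᵀ)Sᵀ = 1` gives the diagonal blocks of `P Pᵀ`, and the symmetry
  -- of `C Dᵀ` kills the others.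
  set P : Matrix (Fin g ⊕ Fin g) (Fin g ⊕ Fin g) ℝ := fromBlocks (S * C) (S * D) (S * D) (-(S * C))
    with hP
  have hPP : P * Pᵀ = 1 := by
    have e1 : S * C * (Cᵀ * Sᵀ) + S * D * (Dᵀ * Sᵀ) = 1 := by
      rw [← hSG, ← hG', Matrix.mul_add, Matrix.add_mul]
      simp only [Matrix.mul_assoc]
    have e2 : S * C * (Dᵀ * Sᵀ) = S * D * (Cᵀ * Sᵀ) := by
      have := congrArg (fun M => S * M * Sᵀ) h1
      simpa only [Matrix.mul_assoc] using this
    rw [hP, fromBlocks_transpose, fromBlocks_multiply, ← fromBlocks_one]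
    congr 1
    · rw [transpose_mul, transpose_mul, e1]
    · rw [transpose_mul, transpose_neg, transpose_mul, Matrix.mul_neg, e2]; abel
    · rw [transpose_mul, transpose_mul, Matrix.neg_mul, e2]; abel
    · rw [transpose_neg, transpose_mul, transpose_mul, Matrix.mul_neg, Matrix.neg_mul, neg_neg,
        add_comm, e1]
  have hPP' : Pᵀ * P = 1 := mul_eq_one_comm.1 hPP
  have e : P *ᵥ Sum.elim a b = Sum.elim (S *ᵥ (C *ᵥ a + D *ᵥ b)) (S *ᵥ (D *ᵥ a - C *ᵥ b)) := by
    rw [hP, fromBlocks_mulVec]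
    simp only [Sum.elim_comp_inl, Sum.elim_comp_inr, mulVec_add, mulVec_neg, mulVec_mulVec,
      neg_mulVec, sub_eq_add_neg]
  rw [← sumElim_dotProduct_sumElim, ← e, dotProduct_mulVec, ← mulVec_transpose, mulVec_mulVec, hPP',
    one_mulVec]

theorem siegel_sum_reindex (γ : SpZ g) (f : (Fin g ⊕ Fin g → ℤ) → ℝ≥0∞) :
    ∑' v, f (γ.1 *ᵥ v) = ∑' v, f v := by
  let e : (Fin g ⊕ Fin g → ℤ) ≃ (Fin g ⊕ Fin g → ℤ) :=
    { toFun := fun v => γ.1 *ᵥ v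
      invFun := fun v => (γ⁻¹ : SpZ g).1 *ᵥ v
      left_inv := fun v => by
        simp only [mulVec_mulVec]
        rw [← Submonoid.coe_mul, inv_mul_cancel]
        simp
      right_inv := fun v => by
        simp only [mulVec_mulVec]
        rw [← Submonoid.coe_mul, mul_inv_cancel]
        simp }
  exact e.tsum_eq f

/-- The Gaussian sums of the lattices `α ℤ^{2g}`, and of their translates, are bounded by the
square root of the height. -/
theorem exists_theta_bound (g : ℕ) : ∃ C : ℝ, 0 < C ∧ ∀ (α : SpR g) (y : Fin g ⊕ Fin g → ℝ),
    ∑' v : Fin g ⊕ Fin g → ℤ, ENNReal.ofReal (Real.exp (-Real.pi *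
      ((y + α.1 *ᵥ castVec v) ⬝ᵥ (y + α.1 *ᵥ castVec v)))) ≤
      ENNReal.ofReal (C * siegelHeight α ^ (1 / 2 : ℝ)) := by
  obtain ⟨C₁, hC₁, hsum⟩ := exists_gaussian_sum_bound g (c := Real.pi) (δ := Real.sqrt (1 / 2))
    Real.pi_pos (by positivity)
  refine ⟨C₁ * C₁, by positivity, fun α y => ?_⟩
  -- The lattice `αℤ^{2g}` equals `σ⁻¹ℤ^{2g}` for `σ = γα⁻¹`, so the sum may be taken over `σ⁻¹v`
  -- with `σ(i)` almost highest.
  obtain ⟨γ, hγ⟩ := exists_reduced α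
  set σ : SpR g := realOf γ * α⁻¹ with hσ
  obtain ⟨B, hB, hG⟩ := exists_transpose_mul_self (lowerGram_posDef σ.2)
  set S := B⁻¹ᵀ with hS
  -- `|Sm|² = mᵀYm` with `Y = (BᵀB)⁻¹`, so the reduction bounds the vectors of `Sℤ^g` from below.
  have hsep : ∀ m : Fin g → ℤ, m ≠ 0 →
      Real.sqrt (1 / 2) ^ 2 ≤ (S *ᵥ castVec m) ⬝ᵥ (S *ᵥ castVec m) := by
    intro m hm
    rw [Real.sq_sqrt (by norm_num)]
    have h1 := hγ m hm
    rw [hG, Matrix.mul_inv_rev, ← Matrix.transpose_nonsing_inv, ← mulVec_mulVec, dotProduct_mulVec,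
      ← mulVec_transpose] at h1
    exact h1
  have hα : α.1 = (σ⁻¹ : SpR g).1 * (realOf γ).1 := by
    rw [← Submonoid.coe_mul, hσ]
    simp
  have hcast : ∀ v, castVec (γ.1 *ᵥ v) = (realOf γ).1 *ᵥ castVec v := by
    intro v
    ext i
    simp [castVec, realOf, mulVec, dotProduct]
  have e1 : ∀ v, α.1 *ᵥ castVec v = (σ⁻¹ : SpR g).1 *ᵥ castVec (γ.1 *ᵥ v) := fun v => by
    rw [hα, hcast, mulVec_mulVec]
  simp only [e1]
  rw [siegel_sum_reindex γ fun v => ENNReal.ofReal (Real.exp (-Real.pi *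
      ((y + (σ⁻¹ : SpR g).1 *ᵥ castVec v) ⬝ᵥ (y + (σ⁻¹ : SpR g).1 *ᵥ castVec v))))]
  set C := σ.1.toBlocks₂₁ with hC
  set D := σ.1.toBlocks₂₂ with hD
  set y₁ : Fin g → ℝ := y ∘ Sum.inl with hy₁
  set y₂ : Fin g → ℝ := y ∘ Sum.inr with hy₂
  obtain ⟨h1, h2, -⟩ := symplectic_block_relations σ.2
  have h2' : D * σ.1.toBlocks₁₁ᵀ - C * σ.1.toBlocks₁₂ᵀ = 1 := by
    have := congrArg Matrix.transpose h2
    simpa using this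
  have hDG : D * Dᵀ + C * Cᵀ = Bᵀ * B := by rw [add_comm]; exact hG
  set c : (Fin g → ℤ) → Fin g → ℝ := fun q =>
    (D * (-σ.1.toBlocks₁₂ᵀ) - C * σ.1.toBlocks₁₁ᵀ) *ᵥ castVec q + (D *ᵥ y₁ - C *ᵥ y₂) with hc
  -- For `v = (p, q)` the symplectic relations make the first Lagrangian coordinate of `σ⁻¹v` equal
  -- to `q` and the second `BᵀB p` plus a vector depending on `q`. Applying `S = B⁻ᵀ` gives a
  -- translate of `Sq` and, for each `q`, a translate of `Bp`.
  have key : ∀ p q : Fin g → ℤ,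
      (y + (σ⁻¹ : SpR g).1 *ᵥ castVec (Sum.elim p q)) ⬝ᵥ
        (y + (σ⁻¹ : SpR g).1 *ᵥ castVec (Sum.elim p q)) =
      (S *ᵥ (castVec q + (C *ᵥ y₁ + D *ᵥ y₂))) ⬝ᵥ (S *ᵥ (castVec q + (C *ᵥ y₁ + D *ᵥ y₂))) +
      (B *ᵥ (castVec p + B⁻¹ *ᵥ (S *ᵥ c q))) ⬝ᵥ (B *ᵥ (castVec p + B⁻¹ *ᵥ (S *ᵥ c q))) := by
    intro p q
    set a := σ.1.toBlocks₂₂ᵀ *ᵥ castVec p + -σ.1.toBlocks₁₂ᵀ *ᵥ castVec q with ha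
    set b := -σ.1.toBlocks₂₁ᵀ *ᵥ castVec p + σ.1.toBlocks₁₁ᵀ *ᵥ castVec q with hb
    have e2 : y + (σ⁻¹ : SpR g).1 *ᵥ castVec (Sum.elim p q) = Sum.elim (y₁ + a) (y₂ + b) := by
      have e3 : castVec (Sum.elim p q) = Sum.elim (castVec p) (castVec q) := by
        ext i; cases i <;> rfl
      rw [e3, coe_inv_blocks, fromBlocks_mulVec]
      ext i
      cases i <;> simp [hy₁, hy₂, ha, hb]
    rw [e2, dotProduct_self_eq_lagrangian σ hB hG, ← hC, ← hD]
    have e4 : C *ᵥ (y₁ + a) + D *ᵥ (y₂ + b) = castVec q + (C *ᵥ y₁ + D *ᵥ y₂) := by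
      have : C *ᵥ a + D *ᵥ b = (C * Dᵀ - D * Cᵀ) *ᵥ castVec p +
          (D * σ.1.toBlocks₁₁ᵀ - C * σ.1.toBlocks₁₂ᵀ) *ᵥ castVec q := by
        simp only [ha, hb, mulVec_add, sub_mulVec, ← mulVec_mulVec, neg_mulVec, mulVec_neg]
        abel
      rw [h2', h1, sub_self, zero_mulVec, zero_add, one_mulVec] at this
      rw [← this, mulVec_add C, mulVec_add D]
      abel
    have e5 : D *ᵥ (y₁ + a) - C *ᵥ (y₂ + b) = (Bᵀ * B) *ᵥ castVec p + c q := by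
      rw [← hDG, hc, ha, hb]
      simp only [mulVec_add, sub_mulVec, add_mulVec, ← mulVec_mulVec, neg_mulVec, mulVec_neg]
      abel
    have e6 : ∀ z, S *ᵥ ((Bᵀ * B) *ᵥ castVec p + z) = B *ᵥ (castVec p + B⁻¹ *ᵥ (S *ᵥ z)) := by
      intro z
      have hSB : S * Bᵀ = 1 := by
        rw [hS, ← transpose_mul, Matrix.mul_nonsing_inv _ hB, transpose_one]
      rw [mulVec_add, mulVec_add, mulVec_mulVec, ← Matrix.mul_assoc, hSB, Matrix.one_mul,
        mulVec_mulVec _ B, Matrix.mul_nonsing_inv _ hB, one_mulVec]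
    rw [e4, e5, e6]
  have e7 : ∀ f : (Fin g ⊕ Fin g → ℤ) → ℝ≥0∞,
      ∑' v, f v = ∑' (q : Fin g → ℤ) (p : Fin g → ℤ), f (Sum.elim p q) := fun f => by
    rw [← (Equiv.sumArrowEquivProdArrow (Fin g) (Fin g) ℤ).symm.tsum_eq, ENNReal.tsum_comm]
    exact ENNReal.tsum_prod (f := fun p q => f (Sum.elim p q))
  rw [e7]
  simp only [key]
  simp only [mul_add, Real.exp_add]
  have hpos : ∀ r : ℝ, 0 ≤ Real.exp r := fun r => (Real.exp_pos r).le
  simp only [ENNReal.ofReal_mul (hpos _), ENNReal.tsum_mul_left]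
  have hS1 := hsum S
  -- The dual lattice of `Bℤ^g` is `Sℤ^g`, which has no short vectors either; Poisson summation
  -- costs the factor `|det B|⁻¹`.
  have hdual : ∀ b, ∑' p : Fin g → ℤ, ENNReal.ofReal (Real.exp (-Real.pi *
      ((B *ᵥ (castVec p + b)) ⬝ᵥ (B *ᵥ (castVec p + b))))) ≤
      ENNReal.ofReal |B.det|⁻¹ * ENNReal.ofReal C₁ := by
    intro b
    refine (gaussian_sum_le_dual hB b).trans ?_
    gcongr
    have := hS1 0 hsep
    simpa only [add_zero] using this
  -- `|det B|⁻²` is the height of the point `σ(i)` of the orbit.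
  have hdet : |B.det|⁻¹ ≤ siegelHeight α ^ (1 / 2 : ℝ) := by
    rw [← Real.sqrt_eq_rpow]
    refine Real.le_sqrt_of_sq_le ?_
    refine le_trans (le_of_eq ?_) (inv_det_le_siegelHeight α γ)
    rw [← hσ, hG, det_mul, det_transpose, inv_pow, sq_abs, sq]
  calc _ ≤ ∑' q : Fin g → ℤ, ENNReal.ofReal (Real.exp (-Real.pi *
        ((S *ᵥ (castVec q + (C *ᵥ y₁ + D *ᵥ y₂))) ⬝ᵥ
          (S *ᵥ (castVec q + (C *ᵥ y₁ + D *ᵥ y₂)))))) *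
          (ENNReal.ofReal |B.det|⁻¹ * ENNReal.ofReal C₁) := by
        refine ENNReal.tsum_le_tsum fun q => ?_
        gcongr
        simpa only [← mul_add, mulVec_add] using hdual _
    _ ≤ ENNReal.ofReal C₁ * (ENNReal.ofReal |B.det|⁻¹ * ENNReal.ofReal C₁) := by
        rw [ENNReal.tsum_mul_right]
        gcongr
        exact hS1 _ hsep
    _ = ENNReal.ofReal (C₁ * C₁ * |B.det|⁻¹) := by
        rw [ENNReal.ofReal_mul (by positivity), ENNReal.ofReal_mul (by positivity)]
        ring
    _ ≤ _ := by
        refine ENNReal.ofReal_le_ofReal ?_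
        gcongr

end Theta
end HeisNil
end

/-! ### The Heisenberg group in exponential coordinates -/

noncomputable section
namespace HeisNil
open MeasureTheory

section Group
variable {g : ℕ}

/-- The projection `Heis → M` in exponential coordinates. -/
def pt (v : HeisAlg g) : Nil g := QuotientGroup.mk (expo v)

/-- The symplectic form on the Lie algebra. -/
def om (v w : HeisAlg g) : ℝ := omegaForm v.1 v.2.1 w.1 w.2.1

/-- The group law in exponential coordinates. -/
def hmul (v w : HeisAlg g) : HeisAlg g :=
  (v.1 + w.1, v.2.1 + w.2.1, v.2.2 + w.2.2 + (1 / 2) * om v w)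

/-- Lattice points, in exponential coordinates. -/
def lat (γ : (Fin g → ℤ) × (Fin g → ℤ) × ℤ) : HeisAlg g :=
  (castVec γ.1, castVec γ.2.1, (γ.2.2 : ℝ) / 2)

theorem expo_hmul (v w : HeisAlg g) : expo (hmul v w) = expo v * expo w := rfl

theorem expo_neg (v : HeisAlg g) : expo (-v) = (expo v)⁻¹ := rfl

theorem expo_zero : expo (0 : HeisAlg g) = 1 := rfl

theorem expo_injective : Function.Injective (expo : HeisAlg g → Heis g) := by
  intro v w h
  have h1 := congrArg coords h
  exact h1

theorem expo_surjective : Function.Surjective (expo : HeisAlg g → Heis g) := fun h => ⟨coords h, rfl⟩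

theorem hmul_assoc (u v w : HeisAlg g) : hmul (hmul u v) w = hmul u (hmul v w) :=
  expo_injective (by simp only [expo_hmul, mul_assoc])

theorem neg_hmul_self (v : HeisAlg g) : hmul (-v) v = 0 :=
  expo_injective (by simp only [expo_hmul, expo_neg, inv_mul_cancel, expo_zero])

theorem hmul_zero (v : HeisAlg g) : hmul v 0 = v :=
  expo_injective (by simp only [expo_hmul, expo_zero, mul_one])

theorem zero_hmul (v : HeisAlg g) : hmul 0 v = v :=
  expo_injective (by simp only [expo_hmul, expo_zero, one_mul])

theorem neg_hmul (v w : HeisAlg g) : -hmul v w = hmul (-w) (-v) :=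
  expo_injective (by simp only [expo_hmul, expo_neg, mul_inv_rev])

theorem expo_smul_pt (v w : HeisAlg g) : expo v • pt w = pt (hmul v w) := rfl

theorem pt_surjective : Function.Surjective (pt : HeisAlg g → Nil g) := by
  intro m
  obtain ⟨h, rfl⟩ := QuotientGroup.mk_surjective m
  exact ⟨coords h, rfl⟩

theorem pt_hmul_lat (v : HeisAlg g) (γ) : pt (hmul v (lat γ)) = pt v := by
  refine (QuotientGroup.eq.2 ?_).symm
  rw [expo_hmul, inv_mul_cancel_left]
  exact ⟨γ.1, γ.2.1, γ.2.2, rfl⟩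

theorem pt_eq_iff {v w : HeisAlg g} : pt v = pt w ↔ ∃ γ, w = hmul v (lat γ) := by
  constructor
  · intro h
    obtain ⟨n, m, k, h1⟩ := QuotientGroup.eq.1 h
    refine ⟨(n, m, k), expo_injective ?_⟩
    rw [expo_hmul, ← mul_inv_cancel_left (expo v) (expo w), h1]
    rfl
  · rintro ⟨γ, rfl⟩
    rw [pt_hmul_lat]

theorem om_smul_left (c : ℝ) (v w : HeisAlg g) : om (c • v) w = c * om v w := by
  simp [om, omegaForm, mul_sub]

theorem om_smul_right (c : ℝ) (v w : HeisAlg g) : om v (c • w) = c * om v w := by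
  simp [om, omegaForm, mul_sub]

theorem om_add_left (u v w : HeisAlg g) : om (u + v) w = om u w + om v w := by
  simp [om, omegaForm]; ring

theorem om_add_right (u v w : HeisAlg g) : om u (v + w) = om u v + om u w := by
  simp [om, omegaForm]; ring

theorem om_neg_left (v w : HeisAlg g) : om (-v) w = -om v w := by
  simp [om, omegaForm]; ring

theorem om_neg_right (v w : HeisAlg g) : om v (-w) = -om v w := by
  simp [om, omegaForm]; ring

theorem om_self (v : HeisAlg g) : om v v = 0 := by
  simp [om, omegaForm]

theorem om_T_right (v : HeisAlg g) : om v basisT = 0 := by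
  simp [om, omegaForm, basisT]

theorem hmul_eq_add (v w : HeisAlg g) :
    hmul v w = v + w + ((1 / 2) * om v w) • (basisT : HeisAlg g) := by
  ext <;> simp [hmul, basisT]

theorem continuous_om : Continuous fun p : HeisAlg g × HeisAlg g => om p.1 p.2 := by
  unfold om omegaForm
  fun_prop

theorem continuous_hmul : Continuous fun p : HeisAlg g × HeisAlg g => hmul p.1 p.2 := by
  simp only [hmul]
  have := continuous_om (g := g)
  fun_prop

theorem contDiff_om : ContDiff ℝ ∞ fun p : HeisAlg g × HeisAlg g => om p.1 p.2 := by
  unfold om omegaForm dotProduct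
  fun_prop

theorem contDiff_hmul : ContDiff ℝ ∞ fun p : HeisAlg g × HeisAlg g => hmul p.1 p.2 := by
  simp only [hmul]
  have := contDiff_om (g := g)
  fun_prop

end Group

/-! ### Haar measure, fundamental box and unfolding -/

section Measure
variable {g : ℕ}

instance : (volume : Measure (HeisAlg g)).IsAddHaarMeasure :=
  haveI : ((volume : Measure (Fin g → ℝ)).prod (volume : Measure ℝ)).IsAddHaarMeasure :=
    Measure.prod.instIsAddHaarMeasure _ _
  Measure.prod.instIsAddHaarMeasure (volume : Measure (Fin g → ℝ))
    ((volume : Measure (Fin g → ℝ)).prod (volume : Measure ℝ))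

/-- Left and right translations of the Heisenberg group are such shears followed by a translation of
the vector space, so Lebesgue measure is bi-invariant. -/
theorem measurePreserving_shear {ℓ : (Fin g → ℝ) → (Fin g → ℝ) → ℝ}
    (hℓ : Measurable fun p : (Fin g → ℝ) × (Fin g → ℝ) => ℓ p.1 p.2) :
    MeasurePreserving (fun v : HeisAlg g => ((v.1, v.2.1, v.2.2 + ℓ v.1 v.2.1) : HeisAlg g))
      volume volume := by
  refine MeasurePreserving.skew_product (f := id)
    (g := fun x (w : (Fin g → ℝ) × ℝ) => (w.1, w.2 + ℓ x w.1)) (MeasurePreserving.id _) ?_ ?_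
  · fun_prop
  · refine Filter.Eventually.of_forall fun x => ?_
    refine (MeasurePreserving.skew_product (f := id) (μa := volume) (μb := volume)
      (g := fun (y : Fin g → ℝ) (t : ℝ) => t + ℓ x y) (MeasurePreserving.id volume) ?_ ?_).map_eq
    · fun_prop
    · refine Filter.Eventually.of_forall fun y => ?_
      exact (measurePreserving_add_right volume (ℓ x y)).map_eq

theorem measurePreserving_hmul_left (w : HeisAlg g) :
    MeasurePreserving (fun v : HeisAlg g => hmul w v) volume volume := by
  have h1 := measurePreserving_shear (g := g)
    (ℓ := fun x ξ => (1 / 2) * omegaForm w.1 w.2.1 x ξ)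
    (by unfold omegaForm dotProduct; fun_prop)
  have h2 := (measurePreserving_add_left (volume : Measure (HeisAlg g)) w).comp h1
  convert h2 using 1
  ext v <;> simp [hmul, om]
  ring

theorem measurePreserving_hmul_right (w : HeisAlg g) :
    MeasurePreserving (fun v : HeisAlg g => hmul v w) volume volume := by
  have h1 := measurePreserving_shear (g := g)
    (ℓ := fun x ξ => (1 / 2) * omegaForm x ξ w.1 w.2.1)
    (by unfold omegaForm dotProduct; fun_prop)
  have h2 := (measurePreserving_add_right (volume : Measure (HeisAlg g)) w).comp h1
  convert h2 using 1
  ext v <;> simp [hmul, om]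
  ring

theorem measurePreserving_neg_heis :
    MeasurePreserving (fun v : HeisAlg g => -v) volume volume :=
  (Measure.measurePreserving_neg (volume : Measure (Fin g → ℝ))).prod
    ((Measure.measurePreserving_neg (volume : Measure (Fin g → ℝ))).prod
      (Measure.measurePreserving_neg (volume : Measure ℝ)))

/-- The half-open fundamental box. -/
def boxD (g : ℕ) : Set (HeisAlg g) :=
  (Set.univ.pi fun _ => Set.Ico (0 : ℝ) 1) ×ˢ (Set.univ.pi fun _ => Set.Ico (0 : ℝ) 1) ×ˢ
    Set.Ico (0 : ℝ) (1 / 2)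

theorem measurableSet_boxD : MeasurableSet (boxD g) :=
  (MeasurableSet.univ_pi fun _ => measurableSet_Ico).prod
    ((MeasurableSet.univ_pi fun _ => measurableSet_Ico).prod measurableSet_Ico)

theorem boxD_ae_eq : boxD g =ᵐ[volume]
    Set.Icc ((0, 0, 0) : HeisAlg g) ((1, 1, 1 / 2) : HeisAlg g) := by
  rw [boxD, Set.Icc_prod_eq, Set.Icc_prod_eq]
  refine Measure.set_prod_ae_eq ?_ (Measure.set_prod_ae_eq ?_ ?_)
  · exact Measure.univ_pi_Ico_ae_eq_Icc
  · exact Measure.univ_pi_Ico_ae_eq_Icc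
  · exact Ico_ae_eq_Icc

theorem volume_boxD : volume (boxD g) = ENNReal.ofReal (1 / 2) := by
  rw [boxD, Measure.volume_eq_prod, Measure.prod_prod, Measure.volume_eq_prod, Measure.prod_prod,
    Real.volume_pi_Ico]
  simp

/-- The lattice translation that takes a point to the fundamental box. -/
def boxShift (v : HeisAlg g) : (Fin g → ℤ) × (Fin g → ℤ) × ℤ :=
  (fun i => -⌊v.1 i⌋, fun i => -⌊v.2.1 i⌋,
    -⌊2 * (v.2.2 + (1 / 2) * omegaForm v.1 v.2.1 (castVec fun i => -⌊v.1 i⌋)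
      (castVec fun i => -⌊v.2.1 i⌋))⌋)

/-- The box is a strict fundamental domain: the integral parts of `x` and `ξ` determine the
horizontal part of the lattice element, and only then, after the shift by the symplectic term, is
its central part determined. -/
theorem hmul_lat_mem_boxD_iff (v : HeisAlg g) (γ) :
    hmul v (lat γ) ∈ boxD g ↔ γ = boxShift v := by
  have aux : ∀ (x : ℝ) (n : ℤ), (0 ≤ x + n ∧ x + n < 1) ↔ n = -⌊x⌋ := by
    intro x n
    rw [eq_comm, neg_eq_iff_eq_neg, Int.floor_eq_iff]
    push_cast
    constructor <;> rintro ⟨h1, h2⟩ <;> constructor <;> linarith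
  have hmem : hmul v (lat γ) ∈ boxD g ↔
      ((∀ i, 0 ≤ v.1 i + γ.1 i ∧ v.1 i + γ.1 i < 1) ∧
      (∀ i, 0 ≤ v.2.1 i + γ.2.1 i ∧ v.2.1 i + γ.2.1 i < 1)) ∧
      (0 ≤ 2 * (v.2.2 + (1 / 2) * om v (lat γ)) + γ.2.2 ∧
        2 * (v.2.2 + (1 / 2) * om v (lat γ)) + γ.2.2 < 1) := by
    simp only [boxD, hmul, lat, Set.mem_prod, Set.mem_pi, Set.mem_univ, true_imp_iff, Set.mem_Ico,
      Pi.add_apply, castVec, ← and_assoc]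
    refine and_congr (and_congr_right fun _ => ?_) ?_
    · constructor <;> intro h <;> linarith
    · constructor <;> intro h <;> linarith
  rw [hmem]
  simp only [aux]
  obtain ⟨n, m, k⟩ := γ
  simp only [boxShift, Prod.mk.injEq]
  constructor
  · rintro ⟨⟨h1, h2⟩, h3⟩
    obtain rfl := funext h1
    obtain rfl := funext h2
    exact ⟨rfl, rfl, h3⟩
  · rintro ⟨rfl, rfl, h3⟩
    exact ⟨⟨fun _ => rfl, fun _ => rfl⟩, h3⟩

theorem lat_zero : lat (0 : (Fin g → ℤ) × (Fin g → ℤ) × ℤ) = 0 := by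
  ext <;> simp [lat, castVec]

/-- The representative of a point of `M` in the fundamental box. -/
def rep (m : Nil g) : HeisAlg g :=
  hmul (Function.surjInv pt_surjective m) (lat (boxShift (Function.surjInv pt_surjective m)))

theorem rep_mem (m : Nil g) : rep m ∈ boxD g := (hmul_lat_mem_boxD_iff _ _).2 rfl

theorem pt_rep (m : Nil g) : pt (rep m) = m := by
  rw [rep, pt_hmul_lat, Function.surjInv_eq pt_surjective]

theorem eq_of_mem_boxD {v w : HeisAlg g} (hv : v ∈ boxD g) (hw : w ∈ boxD g) (h : pt v = pt w) :
    v = w := by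
  obtain ⟨γ, rfl⟩ := pt_eq_iff.1 h
  have h1 := (hmul_lat_mem_boxD_iff v γ).1 hw
  have h2 := (hmul_lat_mem_boxD_iff v 0).1 (by rwa [lat_zero, hmul_zero])
  rw [h1, ← h2, lat_zero, hmul_zero]

theorem rep_pt (v : HeisAlg g) : rep (pt v) = hmul v (lat (boxShift v)) :=
  eq_of_mem_boxD (rep_mem _) ((hmul_lat_mem_boxD_iff _ _).2 rfl) (by rw [pt_rep, pt_hmul_lat])

theorem measurable_expo : Measurable (expo : HeisAlg g → Heis g) := by
  rw [measurable_comap_iff]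
  exact measurable_id

theorem measurable_pt : Measurable (pt : HeisAlg g → Nil g) :=
  measurable_quotient_mk''.comp measurable_expo

theorem measurable_nil_iff {β : Type*} [MeasurableSpace β] {f : Nil g → β} :
    Measurable f ↔ Measurable fun v : HeisAlg g => f (pt v) := by
  refine ⟨fun h => h.comp measurable_pt, fun h => ?_⟩
  refine measurable_from_quotient.2 ?_
  have hc : Measurable (coords : Heis g → HeisAlg g) := comap_measurable _
  exact h.comp hc

theorem measurable_rep : Measurable (rep : Nil g → HeisAlg g) := by
  rw [measurable_nil_iff]
  simp only [rep_pt, hmul, lat, boxShift, om, omegaForm, dotProduct, castVec]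
  fun_prop

theorem measurable_hmul : Measurable fun p : HeisAlg g × HeisAlg g => hmul p.1 p.2 :=
  continuous_hmul.measurable

/-- The action map is jointly measurable. -/
theorem measurable_expo_smul : Measurable fun p : HeisAlg g × Nil g => expo p.1 • p.2 := by
  have : (fun p : HeisAlg g × Nil g => expo p.1 • p.2) = fun p => pt (hmul p.1 (rep p.2)) := by
    ext p
    rw [← expo_smul_pt, pt_rep]
  rw [this]
  exact measurable_pt.comp (measurable_hmul.comp (measurable_fst.prodMk
    (measurable_rep.comp measurable_snd)))

theorem lintegral_haarNil {ψ : Nil g → ℝ≥0∞} (hψ : Measurable ψ) :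
    ∫⁻ m, ψ m ∂(haarNil g) = 2 * ∫⁻ v in boxD g, ψ (pt v) := by
  have h : haarNil g = Measure.map pt ((2 : ℝ≥0∞) • volume.restrict
    (Set.Icc ((0, 0, 0) : HeisAlg g) ((1, 1, 1 / 2) : HeisAlg g))) := rfl
  rw [h, lintegral_map hψ measurable_pt, lintegral_smul_measure,
    ← Measure.restrict_congr_set boxD_ae_eq]
  rfl

instance : IsProbabilityMeasure (haarNil g) := by
  constructor
  have h := lintegral_haarNil (g := g) (ψ := fun _ => 1) measurable_const
  simp only [lintegral_const, one_mul, Measure.restrict_apply MeasurableSet.univ, Set.univ_inter,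
    volume_boxD] at h
  rw [h, ← ENNReal.ofReal_ofNat 2, ← ENNReal.ofReal_mul (by norm_num)]
  norm_num

/-- Unfolding an integral over the Heisenberg group. -/
theorem lintegral_fold {φ : HeisAlg g → ℝ≥0∞} (hφ : Measurable φ) :
    ∫⁻ v, φ v = ∫⁻ v in boxD g, ∑' γ, φ (hmul v (lat γ)) := by
  set Dp : ((Fin g → ℤ) × (Fin g → ℤ) × ℤ) → Set (HeisAlg g) :=
    fun γ => {v | boxShift v = γ} with hDp
  have hpre : ∀ γ, Dp γ = (fun v => hmul v (lat γ)) ⁻¹' boxD g := fun γ => by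
    ext v
    rw [Set.mem_preimage, hmul_lat_mem_boxD_iff, eq_comm]
    rfl
  have hm : ∀ γ, MeasurableSet (Dp γ) := fun γ => by
    rw [hpre]
    exact (measurePreserving_hmul_right _).measurable measurableSet_boxD
  have hneg : ∀ γ, (lat γ : HeisAlg g) = -lat (-γ) := fun γ => by
    ext <;> simp [lat, castVec, neg_div]
  have hback : ∀ γ (v : HeisAlg g), hmul (hmul v (lat γ)) (lat (-γ)) = v := fun γ v => by
    rw [hmul_assoc, hneg, neg_hmul_self, hmul_zero]
  have hcov : ⋃ γ, Dp γ = Set.univ :=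
    Set.eq_univ_of_forall fun v => Set.mem_iUnion.2 ⟨boxShift v, rfl⟩
  have hmeas : ∀ γ, Measurable fun v => φ (hmul v (lat γ)) := fun γ =>
    hφ.comp (measurePreserving_hmul_right _).measurable
  rw [← setLIntegral_univ, ← hcov, lintegral_iUnion hm, lintegral_tsum fun γ =>
    (hmeas γ).aemeasurable,
    ← (Equiv.neg _).tsum_eq fun γ => ∫⁻ v in boxD g, φ (hmul v (lat γ))]
  · refine tsum_congr fun γ => ?_
    have h1 := (measurePreserving_hmul_right (lat γ)).setLIntegral_comp_preimage
      (measurableSet_boxD (g := g)) (f := fun v => φ (hmul v (lat (-γ))))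
      (hφ.comp (measurePreserving_hmul_right _).measurable)
    rw [← hpre] at h1
    simp only [hback] at h1
    exact h1
  · intro γ γ' hγ
    exact Set.disjoint_left.2 fun v h h' => hγ (h.symm.trans h')

theorem tsum_indicator_boxD (w : HeisAlg g) :
    ∑' γ, (boxD g).indicator (fun _ => (1 : ℝ≥0∞)) (hmul w (lat γ)) = 1 := by
  rw [tsum_eq_single (boxShift w)]
  · rw [Set.indicator_of_mem ((hmul_lat_mem_boxD_iff _ _).2 rfl)]
  · intro γ hγ
    rw [Set.indicator_of_notMem fun h => hγ ((hmul_lat_mem_boxD_iff _ _).1 h)]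

theorem measurable_smul_nil (h : Heis g) : Measurable fun m : Nil g => h • m := by
  obtain ⟨v, rfl⟩ := expo_surjective h
  exact measurable_expo_smul.comp (measurable_const.prodMk measurable_id)

/-- Write the integral over `M` as an integral over the group against the indicator of the box and
translate it. The translated box still meets each coset of the lattice exactly once, so folding back
gives the same integral. -/
theorem lintegral_smul_nil (w : HeisAlg g) {ψ : Nil g → ℝ≥0∞} (hψ : Measurable ψ) :
    ∫⁻ m, ψ (expo w • m) ∂(haarNil g) = ∫⁻ m, ψ m ∂(haarNil g) := by
  rw [lintegral_haarNil (ψ := fun m => ψ (expo w • m)) (hψ.comp (measurable_smul_nil _)),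
    lintegral_haarNil hψ]
  congr 1
  have hψ' : Measurable fun v : HeisAlg g => ψ (pt v) := hψ.comp measurable_pt
  have hind : Measurable ((boxD g).indicator fun _ => (1 : ℝ≥0∞)) :=
    measurable_const.indicator measurableSet_boxD
  calc ∫⁻ v in boxD g, ψ (expo w • pt v)
      = ∫⁻ v, (boxD g).indicator (fun _ => (1 : ℝ≥0∞)) v * ψ (pt (hmul w v)) := by
        rw [← lintegral_indicator measurableSet_boxD]
        refine lintegral_congr fun v => ?_
        by_cases h : v ∈ boxD g <;> simp [h, expo_smul_pt]
    _ = ∫⁻ v, (boxD g).indicator (fun _ => (1 : ℝ≥0∞)) (hmul (-w) v) * ψ (pt v) := by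
        rw [← (measurePreserving_hmul_left w).lintegral_comp
          (f := fun v => (boxD g).indicator (fun _ => (1 : ℝ≥0∞)) (hmul (-w) v) * ψ (pt v))]
        · refine lintegral_congr fun v => ?_
          rw [← hmul_assoc, neg_hmul_self, zero_hmul]
        · exact (hind.comp (measurePreserving_hmul_left _).measurable).mul hψ'
    _ = ∫⁻ v in boxD g, ψ (pt v) := by
        rw [lintegral_fold]
        · refine lintegral_congr fun v => ?_
          simp only [pt_hmul_lat, ENNReal.tsum_mul_right, ← hmul_assoc]
          rw [tsum_indicator_boxD, one_mul]
        · exact (hind.comp (measurePreserving_hmul_left _).measurable).mul hψ'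

/-- The measure of `M` is invariant. -/
theorem measurePreserving_smul_nil (w : HeisAlg g) :
    MeasurePreserving (fun m : Nil g => expo w • m) (haarNil g) (haarNil g) := by
  refine ⟨measurable_smul_nil _, ?_⟩
  ext s hs
  have h := lintegral_smul_nil w (ψ := s.indicator fun _ => 1) (measurable_const.indicator hs)
  rw [lintegral_indicator hs, setLIntegral_const, one_mul] at h
  rw [Measure.map_apply (measurable_smul_nil _) hs, ← h, ← one_mul (haarNil g _),
    ← setLIntegral_const, ← lintegral_indicator ((measurable_smul_nil _) hs)]
  rfl

/-- Averages over the orbits of a point are controlled by averages over `M`. -/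
theorem lintegral_orbit_le {φ : HeisAlg g → ℝ≥0∞} (hφ : Measurable φ) {ψ : Nil g → ℝ≥0∞}
    (hψ : Measurable ψ) {K : ℝ≥0∞} (m : Nil g)
    (hK : ∀ u v, ∑' γ, φ (hmul u (hmul (lat γ) v)) ≤ K) :
    ∫⁻ v, φ v * ψ (expo (-v) • m) ≤ K * ((1 / 2) * ∫⁻ m, ψ m ∂(haarNil g)) := by
  obtain ⟨w, rfl⟩ := pt_surjective m
  have hψ' : Measurable fun v : HeisAlg g => ψ (pt v) := hψ.comp measurable_pt
  have hm : Measurable fun v : HeisAlg g => hmul w (-v) := by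
    exact (measurePreserving_hmul_left w).measurable.comp measurable_neg
  have hneg : ∀ γ, -(lat γ : HeisAlg g) = lat (-γ) := fun γ => by
    ext <;> simp [lat, castVec, neg_div]
  have hmp : MeasurePreserving (fun v : HeisAlg g => hmul w (-v)) volume volume :=
    (measurePreserving_hmul_left w).comp measurePreserving_neg_heis
  calc ∫⁻ v, φ v * ψ (expo (-v) • pt w)
      -- The measure preserving substitution `v ↦ w v⁻¹` turns the point `v⁻¹m` into the coset of
      -- `v`. Folding then produces sums of `φ(w γ⁻¹ v⁻¹)` over the lattice, with `γ` between two
      -- group elements, which is the form of the bound `hK`.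
      = ∫⁻ v, φ (hmul w (-v)) * ψ (pt v) := by
        rw [← hmp.lintegral_comp]
        · refine lintegral_congr fun v => ?_
          rw [expo_smul_pt, neg_hmul, neg_neg, hmul_assoc, neg_hmul_self, hmul_zero]
        · refine hφ.mul ?_
          exact hψ'.comp ((measurePreserving_hmul_right w).measurable.comp measurable_neg)
    _ = ∫⁻ v in boxD g, (∑' γ, φ (hmul w (hmul (lat γ) (-v)))) * ψ (pt v) := by
        rw [lintegral_fold]
        · refine lintegral_congr fun v => ?_
          simp only [pt_hmul_lat, ENNReal.tsum_mul_right, neg_hmul, hneg]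
          congr 1
          exact (Equiv.neg _).tsum_eq fun γ => φ (hmul w (hmul (lat γ) (-v)))
        · exact (hφ.comp hm).mul hψ'
    _ ≤ ∫⁻ v in boxD g, K * ψ (pt v) := by
        refine lintegral_mono fun v => ?_
        gcongr
        exact hK _ _
    _ = K * ((1 / 2) * ∫⁻ m, ψ m ∂(haarNil g)) := by
        rw [lintegral_const_mul _ hψ', lintegral_haarNil hψ, ← mul_assoc (1 / 2 : ℝ≥0∞), one_div,
          ENNReal.inv_mul_cancel (by norm_num) (by norm_num), one_mul]

/-- A property that holds almost everywhere on `M` holds almost everywhere upstairs. -/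
theorem ae_pt_of_ae {p : Nil g → Prop} (h : ∀ᵐ m ∂(haarNil g), p m) :
    ∀ᵐ v : HeisAlg g, p (pt v) := by
  obtain ⟨s, hs, hsm, hs0⟩ := exists_measurable_superset_of_null h
  have hms : Measurable (s.indicator fun _ => (1 : ℝ≥0∞)) := measurable_const.indicator hsm
  have hmp : Measurable fun v : HeisAlg g => s.indicator (fun _ => (1 : ℝ≥0∞)) (pt v) :=
    hms.comp measurable_pt
  have h1 : ∫⁻ v : HeisAlg g, s.indicator (fun _ => (1 : ℝ≥0∞)) (pt v) = 0 := by
    rw [lintegral_fold hmp]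
    simp only [pt_hmul_lat]
    have h2 := lintegral_haarNil hms
    rw [lintegral_indicator hsm, setLIntegral_const, hs0, mul_zero] at h2
    have h3 : ∫⁻ v in boxD g, s.indicator (fun _ => (1 : ℝ≥0∞)) (pt v) = 0 := by
      simpa using h2.symm
    rw [lintegral_eq_zero_iff hmp] at h3
    rw [lintegral_eq_zero_iff (Measurable.tsum fun _ => hmp)]
    filter_upwards [h3] with v hv
    simp only [Pi.zero_apply] at hv
    simp [hv]
  rw [lintegral_eq_zero_iff hmp] at h1
  filter_upwards [h1] with v hv
  by_contra hp
  have : pt v ∈ s := hs hp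
  simp [this] at hv

end Measure
end HeisNil
end

/-! ### From lattice sums to orbit averages -/

noncomputable section
namespace HeisNil
open MeasureTheory Matrix

section Window
variable {g : ℕ}

/-- The squared Euclidean norm of `α (x, ξ)`. -/
def zSq (α : SpR g) (x ξ : Fin g → ℝ) : ℝ :=
  (α.1 *ᵥ Sum.elim x ξ) ⬝ᵥ (α.1 *ᵥ Sum.elim x ξ)

theorem contDiff_zSq (α : SpR g) :
    ContDiff ℝ ∞ fun p : (Fin g → ℝ) × (Fin g → ℝ) => zSq α p.1 p.2 := by
  unfold zSq dotProduct mulVec dotProduct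
  simp only [Fintype.sum_sum_type, Sum.elim_inl, Sum.elim_inr]
  fun_prop

/-- A Gaussian in the noncentral directions, cut off to one period of the centre. -/
def gaussWindow (α : SpR g) (v : HeisAlg g) : ℝ≥0∞ :=
  ENNReal.ofReal (Real.exp (-Real.pi * zSq α v.1 v.2.1)) *
    (Set.Ico (-1 / 4 : ℝ) (1 / 4)).indicator (fun _ => 1) v.2.2

theorem measurable_zSq (α : SpR g) : Measurable fun v : HeisAlg g => zSq α v.1 v.2.1 := by
  have h : Continuous fun v : HeisAlg g => (v.1, v.2.1) := by fun_prop
  exact ((contDiff_zSq α).continuous.comp h).measurable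

theorem measurable_gaussWindow (α : SpR g) : Measurable (gaussWindow α) := by
  have h2 := ENNReal.measurable_ofReal.comp
    (Real.measurable_exp.comp ((measurable_zSq α).const_mul (-Real.pi)))
  have h3 : Measurable ((Set.Ico (-1 / 4 : ℝ) (1 / 4)).indicator fun _ => (1 : ℝ≥0∞)) :=
    measurable_const.indicator measurableSet_Ico
  have h4 : Measurable fun v : HeisAlg g => v.2.2 := measurable_snd.comp measurable_snd
  unfold gaussWindow
  exact h2.mul (h3.comp h4)

theorem tsum_indicator_period (c : ℝ) :
    ∑' k : ℤ, (Set.Ico (-1 / 4 : ℝ) (1 / 4)).indicator (fun _ => (1 : ℝ≥0∞)) (c + k / 2) = 1 := by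
  have aux : ∀ k : ℤ, c + k / 2 ∈ Set.Ico (-1 / 4 : ℝ) (1 / 4) ↔ k = -⌊2 * c + 1 / 2⌋ := by
    intro k
    rw [eq_comm, neg_eq_iff_eq_neg, Int.floor_eq_iff, Set.mem_Ico]
    push_cast
    constructor <;> rintro ⟨h1, h2⟩ <;> constructor <;> linarith
  rw [tsum_eq_single (-⌊2 * c + 1 / 2⌋)]
  · rw [Set.indicator_of_mem ((aux _).2 rfl)]
  · intro k hk
    rw [Set.indicator_of_notMem fun h => hk ((aux k).1 h)]

/-- For fixed horizontal lattice coordinates the symplectic terms merely translate the central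
coordinate, so the sum of the window over the centre is 1. What remains is the theta sum of
`αℤ^{2g}` translated by the image under `α` of the horizontal part of `u + v`. -/
theorem exists_gaussWindow_sum_bound (g : ℕ) : ∃ C : ℝ, 0 < C ∧ ∀ (α : SpR g) (u v : HeisAlg g),
    ∑' γ, gaussWindow α (hmul u (hmul (lat γ) v)) ≤
      ENNReal.ofReal (C * siegelHeight α ^ (1 / 2 : ℝ)) := by
  obtain ⟨C, hC, h⟩ := exists_theta_bound g
  refine ⟨C, hC, fun α u v => ?_⟩
  set y := α.1 *ᵥ Sum.elim (u.1 + v.1) (u.2.1 + v.2.1) with hy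
  have hz : ∀ n m : Fin g → ℤ, zSq α (u.1 + (castVec n + v.1)) (u.2.1 + (castVec m + v.2.1)) =
      (y + α.1 *ᵥ castVec (Sum.elim n m)) ⬝ᵥ (y + α.1 *ᵥ castVec (Sum.elim n m)) := by
    intro n m
    have e : y + α.1 *ᵥ castVec (Sum.elim n m) =
        α.1 *ᵥ Sum.elim (u.1 + (castVec n + v.1)) (u.2.1 + (castVec m + v.2.1)) := by
      rw [hy, ← mulVec_add]
      congr 1
      ext i
      cases i <;> simp [castVec] <;> ring
    rw [e]
    rfl
  have e7 : ∀ f : (Fin g ⊕ Fin g → ℤ) → ℝ≥0∞,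
      ∑' v, f v = ∑' (n : Fin g → ℤ) (m : Fin g → ℤ), f (Sum.elim n m) := fun f => by
    rw [← (Equiv.sumArrowEquivProdArrow (Fin g) (Fin g) ℤ).symm.tsum_eq]
    exact ENNReal.tsum_prod (f := fun p q => f (Sum.elim p q))
  refine le_trans (le_of_eq ?_) (h α y)
  rw [e7, ENNReal.tsum_prod' ]
  refine tsum_congr fun n => ?_
  rw [ENNReal.tsum_prod']
  refine tsum_congr fun m => ?_
  rw [← hz]
  simp only [gaussWindow, hmul, lat]
  have hk : ∑' k : ℤ, (Set.Ico (-1 / 4 : ℝ) (1 / 4)).indicator (fun _ => (1 : ℝ≥0∞))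
      (u.2.2 + ((k : ℝ) / 2 + v.2.2 + 1 / 2 * om (castVec n, castVec m, (k : ℝ) / 2) v) +
        1 / 2 * om u (castVec n + v.1, castVec m + v.2.1, (k : ℝ) / 2 + v.2.2 +
          1 / 2 * om (castVec n, castVec m, (k : ℝ) / 2) v)) = 1 := by
    refine Eq.trans (tsum_congr fun k => ?_) (tsum_indicator_period (u.2.2 + v.2.2 +
      1 / 2 * omegaForm (castVec n) (castVec m) v.1 v.2.1 +
      1 / 2 * omegaForm u.1 u.2.1 (castVec n + v.1) (castVec m + v.2.1)))
    congr 1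
    unfold om
    ring
  rw [ENNReal.tsum_mul_left, hk, mul_one]

/-- Gaussian averages along the orbit of a point are bounded by averages over `M`, with a constant
that is the square root of the height. -/
theorem exists_orbit_gauss_le (g : ℕ) : ∃ C : ℝ, 0 < C ∧ ∀ (α : SpR g) (m : Nil g)
    (ψ : Nil g → ℝ≥0∞), Measurable ψ →
    ∫⁻ v, gaussWindow α v * ψ (expo (-v) • m) ≤
      ENNReal.ofReal (C * siegelHeight α ^ (1 / 2 : ℝ)) * ∫⁻ m, ψ m ∂(haarNil g) := by
  obtain ⟨C, hC, h⟩ := exists_gaussWindow_sum_bound g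
  refine ⟨C, hC, fun α m ψ hψ => ?_⟩
  refine (lintegral_orbit_le (measurable_gaussWindow α) hψ m (h α)).trans ?_
  gcongr
  refine mul_le_of_le_one_left' ?_
  norm_num

end Window
end HeisNil
end

/-! ### Lie derivatives on smooth functions and the symmetry of `L_α` -/

noncomputable section
namespace HeisNil
open MeasureTheory

section Calculus
variable {g : ℕ}

/-- The velocity at `w` of the flow of `V`, in exponential coordinates. -/
def lieDir (V w : HeisAlg g) : HeisAlg g := -(V + (1 / 2 * om V w) • (basisT : HeisAlg g))

theorem hmul_neg_smul (t : ℝ) (V w : HeisAlg g) : hmul (-(t • V)) w = w + t • lieDir V w := by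
  rw [hmul_eq_add, om_neg_left, om_smul_left, lieDir, smul_neg, smul_add, smul_smul]
  module

theorem om_basisT_left (v : HeisAlg g) : om basisT v = 0 := by
  simp [om, omegaForm, basisT]

/-- The velocity depends on the position only through `ω(V, ·)`, which is constant in the direction
of `V` and of the centre; the flow lines are straight. -/
theorem lieDir_add_smul_lieDir (t : ℝ) (V w : HeisAlg g) :
    lieDir V (w + t • lieDir V w) = lieDir V w := by
  have : om V (lieDir V w) = 0 := by
    rw [lieDir, om_neg_right, om_add_right, om_self, om_smul_right, om_T_right]
    simp
  rw [lieDir, om_add_right, om_smul_right, this, mul_zero, add_zero]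
  rfl

theorem contDiff_lieDir (V : HeisAlg g) : ContDiff ℝ ∞ (lieDir V) := by
  unfold lieDir
  have h : ContDiff ℝ ∞ fun w : HeisAlg g => om V w :=
    contDiff_om.comp (contDiff_const.prodMk contDiff_id)
  fun_prop

variable {f h : Nil g → ℂ}

theorem IsSmooth.contDiff (hf : IsSmooth f) : ContDiff ℝ ∞ fun v => f (pt v) := hf

theorem IsSmooth.differentiable (hf : IsSmooth f) : Differentiable ℝ fun v => f (pt v) :=
  hf.contDiff.differentiable (by simp)

theorem IsSmooth.hasDerivAt_pt (hf : IsSmooth f) (V w : HeisAlg g) (t : ℝ) :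
    HasDerivAt (fun t : ℝ => f (expo (-(t • V)) • pt w))
      (fderiv ℝ (fun v => f (pt v)) (w + t • lieDir V w) (lieDir V w)) t := by
  have h1 : HasDerivAt (fun t : ℝ => w + t • lieDir V w) (lieDir V w) t := by
    simpa using ((hasDerivAt_id t).smul_const (lieDir V w)).const_add w
  have h2 := (hf.differentiable (w + t • lieDir V w)).hasFDerivAt.comp_hasDerivAt t h1
  refine h2.congr_of_eventuallyEq (Filter.Eventually.of_forall fun s => ?_)
  simp only [Function.comp_apply]
  rw [expo_smul_pt, hmul_neg_smul]

theorem IsSmooth.lieDer_pt (hf : IsSmooth f) (V w : HeisAlg g) :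
    lieDer V f (pt w) = fderiv ℝ (fun v => f (pt v)) w (lieDir V w) := by
  have := (hf.hasDerivAt_pt V w 0).deriv
  rw [zero_smul, add_zero] at this
  exact this

theorem IsSmooth.hasDerivAt (hf : IsSmooth f) (V : HeisAlg g) (m : Nil g) (t : ℝ) :
    HasDerivAt (fun t : ℝ => f (expo (-(t • V)) • m)) (lieDer V f (expo (-(t • V)) • m)) t := by
  obtain ⟨w, rfl⟩ := pt_surjective m
  rw [expo_smul_pt, hf.lieDer_pt, hmul_neg_smul, lieDir_add_smul_lieDir]
  exact hf.hasDerivAt_pt V w t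

theorem IsSmooth.lieDer (hf : IsSmooth f) (V : HeisAlg g) : IsSmooth (lieDer V f) := by
  have h1 : ContDiff ℝ ∞ fun w => fderiv ℝ (fun v => f (pt v)) w (lieDir V w) :=
    (hf.contDiff.fderiv_right (m := ∞) (by simp)).clm_apply (contDiff_lieDir V)
  have e : (fun w => HeisNil.lieDer V f (pt w)) = _ := funext (hf.lieDer_pt V)
  change ContDiff ℝ ∞ fun w => HeisNil.lieDer V f (pt w)
  rw [e]
  exact h1

theorem lieDer_add_smul_basisT (hf : IsSmooth f) (V : HeisAlg g) (c : ℝ) (m : Nil g) :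
    lieDer (V + c • basisT) f m = lieDer V f m + c * lieDer basisT f m := by
  obtain ⟨w, rfl⟩ := pt_surjective m
  have e : lieDir (V + c • basisT) w = lieDir V w + c • lieDir basisT w := by
    simp only [lieDir, om_add_left, om_smul_left, om_basisT_left]
    module
  rw [hf.lieDer_pt, hf.lieDer_pt, hf.lieDer_pt, e, map_add, map_smul, Complex.real_smul]

theorem IsSmooth.add (hf : IsSmooth f) (hh : IsSmooth h) : IsSmooth fun m => f m + h m :=
  ContDiff.add hf.contDiff hh.contDiff

theorem IsSmooth.const_mul (c : ℂ) (hf : IsSmooth f) : IsSmooth fun m => c * f m :=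
  ContDiff.mul contDiff_const hf.contDiff

theorem IsSmooth.mul (hf : IsSmooth f) (hh : IsSmooth h) : IsSmooth fun m => f m * h m :=
  ContDiff.mul hf.contDiff hh.contDiff

theorem IsSmooth.conj (hf : IsSmooth f) : IsSmooth fun m => star (f m) :=
  Complex.conjCLE.contDiff.comp hf.contDiff

theorem IsSmooth.sum {ι : Type*} {s : Finset ι} {F : ι → Nil g → ℂ}
    (hF : ∀ i ∈ s, IsSmooth (F i)) : IsSmooth fun m => ∑ i ∈ s, F i m :=
  ContDiff.sum (f := fun i v => F i (pt v)) hF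

theorem isSmooth_zero : IsSmooth (fun _ : Nil g => (0 : ℂ)) := contDiff_const

theorem hasDerivAt_lieDer_zero (hf : IsSmooth f) (V : HeisAlg g) (m : Nil g) :
    HasDerivAt (fun t : ℝ => f (expo (-(t • V)) • m)) (lieDer V f m) 0 := by
  have := hf.hasDerivAt V m 0
  rwa [zero_smul, neg_zero, expo_zero, one_smul] at this

theorem lieDer_add (hf : IsSmooth f) (hh : IsSmooth h) (V : HeisAlg g) (m : Nil g) :
    lieDer V (fun m => f m + h m) m = lieDer V f m + lieDer V h m :=
  ((hasDerivAt_lieDer_zero hf V m).add (hasDerivAt_lieDer_zero hh V m)).deriv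

theorem lieDer_const_mul (hf : IsSmooth f) (c : ℂ) (V : HeisAlg g) (m : Nil g) :
    lieDer V (fun m => c * f m) m = c * lieDer V f m :=
  ((hasDerivAt_lieDer_zero hf V m).const_mul c).deriv

theorem lieDer_conj (hf : IsSmooth f) (V : HeisAlg g) (m : Nil g) :
    lieDer V (fun m => star (f m)) m = star (lieDer V f m) :=
  (hasDerivAt_lieDer_zero hf V m).star.deriv

theorem lieDer_mul (hf : IsSmooth f) (hh : IsSmooth h) (V : HeisAlg g) (m : Nil g) :
    lieDer V (fun m => f m * h m) m = lieDer V f m * h m + f m * lieDer V h m := by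
  have := ((hasDerivAt_lieDer_zero hf V m).mul (hasDerivAt_lieDer_zero hh V m)).deriv
  simp only [zero_smul, neg_zero, expo_zero, one_smul] at this
  exact this

theorem IsSmooth.opL (hf : IsSmooth f) (α : SpR g) : IsSmooth (opL α f) := by
  have h1 : IsSmooth fun m => f m + (-1 : ℂ) *
      (((∑ i, HeisNil.lieDer (act α⁻¹ (basisX i)) (HeisNil.lieDer (act α⁻¹ (basisX i)) f) m) +
    (∑ i, HeisNil.lieDer (act α⁻¹ (basisXi i)) (HeisNil.lieDer (act α⁻¹ (basisXi i)) f) m)) +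
    HeisNil.lieDer basisT (HeisNil.lieDer basisT f) m) :=
    hf.add (((IsSmooth.sum fun i _ => (hf.lieDer _).lieDer _).add
      (IsSmooth.sum fun i _ => (hf.lieDer _).lieDer _)).add ((hf.lieDer _).lieDer _) |>.const_mul _)
  convert h1 using 2 with m
  simp only [HeisNil.opL, laplacian]
  ring

theorem isQuotientMap_pt : Topology.IsQuotientMap (pt : HeisAlg g → Nil g) := by
  have h1 : Topology.IsQuotientMap (expo : HeisAlg g → Heis g) := by
    have e : Topology.IsInducing (coords : Heis g → HeisAlg g) := ⟨rfl⟩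
    have hc : Continuous (expo : HeisAlg g → Heis g) := by
      rw [e.continuous_iff]
      exact continuous_id
    refine Topology.IsQuotientMap.of_inverse e.continuous hc ?_
    intro v
    rfl
  have h2 : Topology.IsQuotientMap (QuotientGroup.mk : Heis g → Nil g) := isQuotientMap_quot_mk
  exact h2.comp h1

theorem continuous_nil_iff {β : Type*} [TopologicalSpace β] {f : Nil g → β} :
    Continuous f ↔ Continuous fun v : HeisAlg g => f (pt v) :=
  isQuotientMap_pt.continuous_iff

theorem IsSmooth.continuous (hf : IsSmooth f) : Continuous f :=
  continuous_nil_iff.2 hf.contDiff.continuous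

instance : CompactSpace (Nil g) := by
  have h1 : IsCompact (pt '' (Set.Icc ((0, 0, 0) : HeisAlg g) ((1, 1, 1 / 2) : HeisAlg g))) :=
    isCompact_Icc.image isQuotientMap_pt.continuous
  have h2 : pt '' (Set.Icc ((0, 0, 0) : HeisAlg g) ((1, 1, 1 / 2) : HeisAlg g)) = Set.univ := by
    refine Set.eq_univ_of_forall fun m => ⟨rep m, ?_, pt_rep m⟩
    have := rep_mem m
    simp only [boxD, Set.mem_prod, Set.mem_pi, Set.mem_univ, true_imp_iff, Set.mem_Ico] at this
    obtain ⟨h1, h2, h3⟩ := this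
    exact ⟨⟨fun i => (h1 i).1, fun i => (h2 i).1, h3.1⟩, fun i => (h1 i).2.le,
      fun i => (h2 i).2.le, h3.2.le⟩
  exact ⟨h2 ▸ h1⟩

theorem measurable_of_continuous_nil {β : Type*} [TopologicalSpace β] [MeasurableSpace β]
    [BorelSpace β] {f : Nil g → β} (hf : Continuous f) : Measurable f :=
  measurable_nil_iff.2 (continuous_nil_iff.1 hf).measurable

theorem exists_bound_of_continuous (hf : Continuous f) : ∃ C : ℝ, 0 ≤ C ∧ ∀ m, ‖f m‖ ≤ C := by
  obtain ⟨C, hC⟩ := isCompact_univ.exists_bound_of_continuousOn hf.continuousOn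
  exact ⟨C, (norm_nonneg _).trans (hC (pt 0) (Set.mem_univ _)), fun m => hC m (Set.mem_univ _)⟩

theorem IsSmooth.measurable (hf : IsSmooth f) : Measurable f :=
  measurable_of_continuous_nil hf.continuous

theorem integrable_of_continuous (hf : Continuous f) : Integrable f (haarNil g) := by
  obtain ⟨C, -, hC⟩ := exists_bound_of_continuous hf
  exact Integrable.of_bound (measurable_of_continuous_nil hf).aestronglyMeasurable C
    (Filter.Eventually.of_forall hC)

theorem integral_smul_nil (w : HeisAlg g) {φ : Nil g → ℂ} (hφ : Measurable φ) :
    ∫ m, φ (expo w • m) ∂(haarNil g) = ∫ m, φ m ∂(haarNil g) := by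
  have h := measurePreserving_smul_nil w
  conv_rhs => rw [← h.map_eq]
  rw [integral_map h.measurable.aemeasurable hφ.aestronglyMeasurable]

/-- The integral of `f` translated along the flow of `V` is constant by invariance of the measure;
differentiate it under the integral sign. -/
theorem integral_lieDer (hf : IsSmooth f) (V : HeisAlg g) :
    ∫ m, lieDer V f m ∂(haarNil g) = 0 := by
  obtain ⟨C, -, hC⟩ := exists_bound_of_continuous (hf.lieDer V).continuous
  have hmeas : ∀ t : ℝ, Measurable fun m => f (expo (-(t • V)) • m) := fun t =>
    hf.measurable.comp (measurable_smul_nil _)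
  have h1 := hasDerivAt_integral_of_dominated_loc_of_deriv_le (μ := haarNil g) (𝕜 := ℝ)
    (F := fun t m => f (expo (-(t • V)) • m)) (F' := fun t m => lieDer V f (expo (-(t • V)) • m))
    (x₀ := 0) (bound := fun _ => C) (s := Set.univ) Filter.univ_mem
    (Filter.Eventually.of_forall fun t => (hmeas t).aestronglyMeasurable)
    (by simpa [expo_zero] using integrable_of_continuous hf.continuous)
    (by simpa [expo_zero] using (hf.lieDer V).measurable.aestronglyMeasurable)
    (Filter.Eventually.of_forall fun m t _ => hC _) (integrable_const C)
    (Filter.Eventually.of_forall fun m t _ => hf.hasDerivAt V m t)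
  have h2 := h1.2
  have h3 : (fun t : ℝ => ∫ m, f (expo (-(t • V)) • m) ∂(haarNil g)) =
      fun _ => ∫ m, f m ∂(haarNil g) := by
    ext t
    exact integral_smul_nil _ hf.measurable
  rw [h3] at h2
  have h4 := h2.unique (hasDerivAt_const _ _)
  simpa [expo_zero] using h4

/-- The fields `V` are skew-symmetric. -/
theorem integral_lieDer_mul_conj (hf : IsSmooth f) (hh : IsSmooth h) (V : HeisAlg g) :
    ∫ m, lieDer V f m * star (h m) ∂(haarNil g) =
      -∫ m, f m * star (lieDer V h m) ∂(haarNil g) := by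
  have h1 := integral_lieDer (hf.mul hh.conj) V
  have h2 : ∀ m, lieDer V (fun m => f m * star (h m)) m =
      lieDer V f m * star (h m) + f m * star (lieDer V h m) := fun m => by
    rw [lieDer_mul hf hh.conj, lieDer_conj hh]
  simp only [h2] at h1
  rw [integral_add (integrable_of_continuous ((hf.lieDer V).mul hh.conj).continuous)
    (integrable_of_continuous (hf.mul (hh.lieDer V).conj).continuous)] at h1
  exact eq_neg_of_add_eq_zero_left h1

theorem integral_lieDer_lieDer_mul_conj (hf : IsSmooth f) (hh : IsSmooth h) (V : HeisAlg g) :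
    ∫ m, lieDer V (lieDer V f) m * star (h m) ∂(haarNil g) =
      ∫ m, f m * star (lieDer V (lieDer V h) m) ∂(haarNil g) := by
  rw [integral_lieDer_mul_conj (hf.lieDer V) hh, integral_lieDer_mul_conj hf (hh.lieDer V), neg_neg]

/-- `L_α` is symmetric. -/
theorem integral_opL_mul_conj (hf : IsSmooth f) (hh : IsSmooth h) (α : SpR g) :
    ∫ m, opL α f m * star (h m) ∂(haarNil g) = ∫ m, f m * star (opL α h m) ∂(haarNil g) := by
  have i1 : ∀ V : HeisAlg g, Integrable (fun m => lieDer V (lieDer V f) m * star (h m))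
    (haarNil g) := fun V => integrable_of_continuous (((hf.lieDer V).lieDer V).mul hh.conj).continuous
  have i2 : ∀ V : HeisAlg g, Integrable (fun m => f m * star (lieDer V (lieDer V h) m))
    (haarNil g) := fun V => integrable_of_continuous (hf.mul ((hh.lieDer V).lieDer V).conj).continuous
  have i3 : Integrable (fun m => f m * star (h m)) (haarNil g) :=
    integrable_of_continuous (hf.mul hh.conj).continuous
  have e1 : ∀ m, opL α f m * star (h m) = f m * star (h m) -
      ((∑ i, lieDer (act α⁻¹ (basisX i)) (lieDer (act α⁻¹ (basisX i)) f) m * star (h m)) +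
       (∑ i, lieDer (act α⁻¹ (basisXi i)) (lieDer (act α⁻¹ (basisXi i)) f) m * star (h m)) +
       lieDer basisT (lieDer basisT f) m * star (h m)) := fun m => by
    simp only [opL, laplacian, ← Finset.sum_mul]
    ring
  have e2 : ∀ m, f m * star (opL α h m) = f m * star (h m) -
      ((∑ i, f m * star (lieDer (act α⁻¹ (basisX i)) (lieDer (act α⁻¹ (basisX i)) h) m)) +
       (∑ i, f m * star (lieDer (act α⁻¹ (basisXi i)) (lieDer (act α⁻¹ (basisXi i)) h) m)) +
       f m * star (lieDer basisT (lieDer basisT h) m)) := fun m => by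
    simp only [opL, laplacian, ← Finset.mul_sum, star_add, star_neg, star_sum]
    ring
  simp only [e1, e2]
  have s1 : ∀ B : Fin g → HeisAlg g, Integrable
      (fun m => ∑ i, lieDer (B i) (lieDer (B i) f) m * star (h m)) (haarNil g) := fun B =>
    integrable_finsetSum _ fun i _ => i1 _
  have s2 : ∀ B : Fin g → HeisAlg g, Integrable
      (fun m => ∑ i, f m * star (lieDer (B i) (lieDer (B i) h) m)) (haarNil g) := fun B =>
    integrable_finsetSum _ fun i _ => i2 _
  have t1 := s1 fun i => act α⁻¹ (basisX i)
  have t2 := s1 fun i => act α⁻¹ (basisXi i)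
  have t3 := s2 fun i => act α⁻¹ (basisX i)
  have t4 := s2 fun i => act α⁻¹ (basisXi i)
  have key : ∀ {a b c d : Nil g → ℂ}, Integrable a (haarNil g) → Integrable b (haarNil g) →
      Integrable c (haarNil g) → Integrable d (haarNil g) →
      ∫ m, (a m - (b m + c m + d m)) ∂(haarNil g) = (∫ m, a m ∂(haarNil g)) -
        ((∫ m, b m ∂(haarNil g)) + (∫ m, c m ∂(haarNil g)) + ∫ m, d m ∂(haarNil g)) := by
    intro a b c d ha hb hc hd
    have h1 : Integrable (fun m => b m + c m) (haarNil g) := hb.add hc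
    have h2 : Integrable (fun m => b m + c m + d m) (haarNil g) := h1.add hd
    rw [integral_sub ha h2, integral_add h1 hd, integral_add hb hc]
  rw [key i3 t1 t2 (i1 _), key i3 t3 t4 (i2 _), integral_finsetSum _ fun i _ => i1 _,
    integral_finsetSum _ fun i _ => i1 _, integral_finsetSum _ fun i _ => i2 _,
    integral_finsetSum _ fun i _ => i2 _]
  simp only [integral_lieDer_lieDer_mul_conj hf hh]

end Calculus
end HeisNil
end

/-! ### Functions of a given central frequency -/

noncomputable section
namespace HeisNil
open MeasureTheory Complex

section Sector
variable {g : ℕ}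

/-- The linear map `y ↦ α⁻¹ y`, with values in the horizontal vectors. -/
def emb (α : SpR g) : (Fin g ⊕ Fin g → ℝ) →L[ℝ] HeisAlg g :=
  LinearMap.toContinuousLinearMap
    { toFun := fun y => act α⁻¹ (y ∘ Sum.inl, y ∘ Sum.inr, 0)
      map_add' := fun y z => by
        have e : ∀ y : Fin g ⊕ Fin g → ℝ, Sum.elim (y ∘ Sum.inl) (y ∘ Sum.inr) = y :=
          fun y => Sum.elim_comp_inl_inr y
        simp only [act, e, Matrix.mulVec_add, Pi.add_apply, Prod.mk_add_mk, add_zero]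
        rfl
      map_smul' := fun c y => by
        have e : ∀ y : Fin g ⊕ Fin g → ℝ, Sum.elim (y ∘ Sum.inl) (y ∘ Sum.inr) = y :=
          fun y => Sum.elim_comp_inl_inr y
        simp only [act, e, Matrix.mulVec_smul, Pi.smul_apply, Prod.smul_mk, smul_zero,
          RingHom.id_apply]
        rfl }

theorem emb_apply (α : SpR g) (y : Fin g ⊕ Fin g → ℝ) :
    emb α y = act α⁻¹ (y ∘ Sum.inl, y ∘ Sum.inr, 0) := rfl

theorem emb_single_inl (α : SpR g) (i : Fin g) :
    emb α (Pi.single (Sum.inl i) 1) = act α⁻¹ (basisX i) := by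
  have h1 : (Pi.single (Sum.inl i) 1 : Fin g ⊕ Fin g → ℝ) ∘ Sum.inl = Pi.single i 1 := by
    ext j
    simp [Pi.single_apply]
  have h2 : (Pi.single (Sum.inl i) 1 : Fin g ⊕ Fin g → ℝ) ∘ Sum.inr = 0 := by
    ext j
    simp
  rw [emb_apply, basisX, h1, h2]

theorem emb_single_inr (α : SpR g) (i : Fin g) :
    emb α (Pi.single (Sum.inr i) 1) = act α⁻¹ (basisXi i) := by
  have h1 : (Pi.single (Sum.inr i) 1 : Fin g ⊕ Fin g → ℝ) ∘ Sum.inl = 0 := by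
    ext j
    simp
  have h2 : (Pi.single (Sum.inr i) 1 : Fin g ⊕ Fin g → ℝ) ∘ Sum.inr = Pi.single i 1 := by
    ext j
    simp [Pi.single_apply]
  rw [emb_apply, basisXi, h1, h2]

theorem opL_eq (α : SpR g) (f : Nil g → ℂ) (m : Nil g) :
    opL α f m = f m - (∑ i, lieDer (emb α (Pi.single i 1)) (lieDer (emb α (Pi.single i 1)) f) m) -
      lieDer basisT (lieDer basisT f) m := by
  simp only [opL, laplacian, Fintype.sum_sum_type, emb_single_inl, emb_single_inr]
  ring

/-- `α⁻¹` preserves the symplectic form. -/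
theorem om_act (α : SpR g) (v w : HeisAlg g) : om (act α v) (act α w) = om v w := by
  have key : ∀ v w : HeisAlg g, om v w =
      Sum.elim v.1 v.2.1 ⬝ᵥ (Matrix.J (Fin g) ℝ).mulVec (Sum.elim w.1 w.2.1) := by
    intro v w
    simp only [om, omegaForm, Matrix.J, Matrix.fromBlocks_mulVec, Sum.elim_comp_inl,
      Sum.elim_comp_inr, Matrix.zero_mulVec, Matrix.one_mulVec, zero_add, add_zero,
      Matrix.neg_mulVec, sumElim_dotProduct_sumElim, dotProduct_neg]
    rw [dotProduct_comm w.2.1]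
    ring
  have e : ∀ v : HeisAlg g, Sum.elim (act α v).1 (act α v).2.1 =
      α.1.mulVec (Sum.elim v.1 v.2.1) := fun v => by
    simp only [act]
    exact Sum.elim_comp_inl_inr (α.1.mulVec (Sum.elim v.1 v.2.1))
  have h := SymplecticGroup.mem_iff'.1 α.2
  rw [key, key, e, e]
  conv_rhs => rw [← h, ← Matrix.mulVec_mulVec, ← Matrix.mulVec_mulVec, Matrix.dotProduct_mulVec,
    Matrix.vecMul_transpose]

/-- The symplectic form in the coordinates of `emb`. -/
def omC (v y : Fin g ⊕ Fin g → ℝ) : ℝ :=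
  omegaForm (v ∘ Sum.inl) (v ∘ Sum.inr) (y ∘ Sum.inl) (y ∘ Sum.inr)

theorem om_emb (α : SpR g) (v y : Fin g ⊕ Fin g → ℝ) : om (emb α v) (emb α y) = omC v y := by
  rw [emb_apply, emb_apply, om_act]
  rfl

/-- The functions on which the centre acts by the character of frequency `ν`. -/
def IsSector (ν : ℝ) (f : Nil g → ℂ) : Prop :=
  ∀ (t : ℝ) (m : Nil g), f (expo (t • (basisT : HeisAlg g)) • m) = cexp (I * (ν * t : ℝ)) * f m

variable {f : Nil g → ℂ} {ν : ℝ}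

theorem IsSector.lieDer_basisT (hν : IsSector ν f) (m : Nil g) :
    lieDer basisT f m = -(I * ν) * f m := by
  have h : (fun t : ℝ => f (expo (-(t • (basisT : HeisAlg g))) • m)) =
      fun t : ℝ => cexp (I * (ν * (-t) : ℝ)) * f m := by
    ext t
    rw [← neg_smul, hν]
  have h1 : HasDerivAt (fun t : ℝ => cexp (I * (ν * (-t) : ℝ)) * f m) (-(I * ν) * f m) 0 := by
    have h2 : HasDerivAt (fun t : ℝ => I * ((ν * (-t) : ℝ) : ℂ)) (-(I * ν)) 0 := by
      have h3 : HasDerivAt (fun t : ℝ => ν * (-t)) (-ν) 0 := by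
        simpa using (hasDerivAt_neg (0 : ℝ)).const_mul ν
      simpa using h3.ofReal_comp.const_mul I
    simpa using h2.cexp.mul_const (f m)
  rw [lieDer, h, h1.deriv]

theorem expo_smul_smul (v w : HeisAlg g) (m : Nil g) :
    expo v • expo w • m = expo (hmul v w) • m := by
  rw [smul_smul, expo_hmul]

theorem expo_add_smul_basisT (v : HeisAlg g) (c : ℝ) (m : Nil g) :
    expo (v + c • basisT) • m = expo (c • (basisT : HeisAlg g)) • expo v • m := by
  rw [expo_smul_smul, hmul_eq_add, om_smul_left, om_basisT_left, mul_zero, mul_zero, zero_smul,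
    add_zero, add_comm]

theorem smul_basisT_comm (h : Heis g) (c : ℝ) (m : Nil g) :
    h • expo (c • (basisT : HeisAlg g)) • m = expo (c • (basisT : HeisAlg g)) • h • m := by
  obtain ⟨v, rfl⟩ := expo_surjective h
  rw [expo_smul_smul, expo_smul_smul, hmul_eq_add, hmul_eq_add, om_smul_left, om_basisT_left,
    om_smul_right, om_T_right, add_comm v]

theorem IsSector.lieDer (hν : IsSector ν f) (V : HeisAlg g) :
    IsSector ν (HeisNil.lieDer V f) := by
  intro t m
  simp only [HeisNil.lieDer]
  have h : (fun s : ℝ => f (expo (-(s • V)) • expo (t • (basisT : HeisAlg g)) • m)) =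
      fun s => cexp (I * (ν * t : ℝ)) * f (expo (-(s • V)) • m) := by
    ext s
    rw [smul_basisT_comm, hν]
  rw [h, deriv_const_mul_field]

theorem IsSector.opL (hν : IsSector ν f) (α : SpR g) : IsSector ν (opL α f) := by
  intro t m
  simp only [opL_eq, hν t m, ((hν.lieDer _).lieDer _) t m, ← Finset.mul_sum]
  ring

theorem IsSector.opL_eq (hν : IsSector ν f) (α : SpR g) (m : Nil g) :
    HeisNil.opL α f m = (1 + ν ^ 2) * f m -
      ∑ i, HeisNil.lieDer (emb α (Pi.single i 1)) (HeisNil.lieDer (emb α (Pi.single i 1)) f) m := by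
  rw [HeisNil.opL_eq, (hν.lieDer basisT).lieDer_basisT, hν.lieDer_basisT]
  linear_combination (-(ν : ℂ) ^ 2 * f m) * I_sq

/-- Along the horizontal vectors at `m`. -/
def orb (α : SpR g) (f : Nil g → ℂ) (m : Nil g) (y : Fin g ⊕ Fin g → ℝ) : ℂ :=
  f (expo (-(emb α y)) • m)

theorem IsSmooth.orb (hf : IsSmooth f) (α : SpR g) (m : Nil g) : ContDiff ℝ ∞ (orb α f m) := by
  obtain ⟨w, rfl⟩ := pt_surjective m
  have h : ContDiff ℝ ∞ fun y => hmul (-(emb α y)) w :=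
    contDiff_hmul.comp ((emb α).contDiff.neg.prodMk contDiff_const)
  exact hf.contDiff.comp h

/-- Adding `s v` to `y` differs from multiplying group elements by the central element of coordinate
`sω(v, y)/2`, which acts on the sector by a phase. -/
theorem orb_add_smul (hν : IsSector ν f) (α : SpR g) (m : Nil g) (v y : Fin g ⊕ Fin g → ℝ) (s : ℝ) :
    orb α f m (y + s • v) =
      cexp (I * (ν * (s * (-(1 / 2) * omC v y)) : ℝ)) *
        f (expo (-(s • emb α v)) • expo (-(emb α y)) • m) := by
  have h : hmul (-(s • emb α v)) (-(emb α y)) =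
      -(emb α (y + s • v)) + (s * (1 / 2 * omC v y)) • basisT := by
    rw [hmul_eq_add, om_neg_left, om_neg_right, om_smul_left, om_emb, map_add, map_smul]
    module
  rw [expo_smul_smul, h, expo_add_smul_basisT, hν, ← mul_assoc, ← Complex.exp_add]
  have : I * ((ν * (s * (-(1 / 2) * omC v y)) : ℝ) : ℂ) + I * ((ν * (s * (1 / 2 * omC v y)) : ℝ) : ℂ)
      = 0 := by
    push_cast; ring
  rw [this, Complex.exp_zero, one_mul, orb]

/-- The derivative of that phase at `s = 0` gives the magnetic potential: on the coordinates `y`,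
the field of `v` acts as `∂_v + (iν/2) ω(v, y)`. -/
theorem hasLineDerivAt_orb (hf : IsSmooth f) (hν : IsSector ν f) (α : SpR g) (m : Nil g)
    (v y : Fin g ⊕ Fin g → ℝ) :
    HasLineDerivAt ℝ (orb α f m) (orb α (lieDer (emb α v) f) m y -
      I * (ν / 2 * omC v y) * orb α f m y) y v := by
  have h1 : (fun s : ℝ => orb α f m (y + s • v)) = fun s : ℝ =>
      cexp (I * (ν * (s * (-(1 / 2) * omC v y)) : ℝ)) *
        f (expo (-(s • emb α v)) • expo (-(emb α y)) • m) :=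
    funext fun s => orb_add_smul hν α m v y s
  have h2 : HasDerivAt (fun s : ℝ => I * ((ν * (s * (-(1 / 2) * omC v y)) : ℝ) : ℂ))
      (I * (ν * (-(1 / 2) * omC v y))) 0 := by
    have h3 : HasDerivAt (fun s : ℝ => ν * (s * (-(1 / 2) * omC v y)))
        (ν * (-(1 / 2) * omC v y)) 0 := by
      simpa using ((hasDerivAt_id (0 : ℝ)).mul_const (-(1 / 2) * omC v y)).const_mul ν
    simpa using h3.ofReal_comp.const_mul I
  have h4 := h2.cexp.mul (hasDerivAt_lieDer_zero hf (emb α v) (expo (-(emb α y)) • m))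
  rw [HasLineDerivAt, h1]
  refine h4.congr_deriv ?_
  simp only [orb, zero_mul, mul_zero, ofReal_zero, Complex.exp_zero, zero_smul, neg_zero, expo_zero,
    one_smul]
  ring

end Sector
end HeisNil
end

/-! ### Averages along horizontal directions -/

noncomputable section
namespace HeisNil
open MeasureTheory Complex

section OrbitAverage
variable {g : ℕ} {f : Nil g → ℂ} {ν : ℝ}

/-- The average of `f` along horizontal vectors, against the kernel `k`. -/
def avgY (α : SpR g) (k : (Fin g ⊕ Fin g → ℝ) → ℂ) (f : Nil g → ℂ) (m : Nil g) : ℂ :=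
  ∫ y, k y * orb α f m y

theorem IsSmooth.integrable_mul_orb (hf : IsSmooth f) (α : SpR g) {k : (Fin g ⊕ Fin g → ℝ) → ℂ}
    (hk : Integrable k) (m : Nil g) : Integrable fun y => k y * HeisNil.orb α f m y := by
  obtain ⟨C, -, hC⟩ := exists_bound_of_continuous hf.continuous
  exact hk.mul_bdd (hf.orb α m).continuous.aestronglyMeasurable
    (Filter.Eventually.of_forall fun y => hC _)

theorem IsSector.avgY (hν : IsSector ν f) (α : SpR g) (k : (Fin g ⊕ Fin g → ℝ) → ℂ) :
    IsSector ν (avgY α k f) := by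
  intro t m
  simp only [HeisNil.avgY, ← integral_const_mul]
  congr 1
  ext y
  simp only [orb]
  rw [smul_basisT_comm, hν]
  ring

variable {k k' : (Fin g ⊕ Fin g → ℝ) → ℂ} {v : Fin g ⊕ Fin g → ℝ}

/-- Integration by parts in `y` moves `∂_v` to the kernel with a minus sign; the magnetic term stays
with its sign. -/
theorem avgY_lieDer (hf : IsSmooth f) (hν : IsSector ν f) (α : SpR g)
    (hk : ∀ y, HasLineDerivAt ℝ k (k' y) y v) (i0 : Integrable k) (i1 : Integrable k')
    (i2 : Integrable fun y => (omC v y : ℂ) * k y) (m : Nil g) :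
    avgY α k (lieDer (emb α v) f) m =
      avgY α (fun y => -k' y + I * (ν / 2) * omC v y * k y) f m := by
  have j2 : Integrable fun y => I * (ν / 2) * omC v y * k y := by
    simpa only [mul_assoc] using i2.const_mul (I * (ν / 2))
  have a0 := hf.integrable_mul_orb α i0 m
  have a1 := hf.integrable_mul_orb α i1 m
  have a1n : Integrable fun y => -(k' y * orb α f m y) := a1.neg
  have a2 := hf.integrable_mul_orb α j2 m
  have a3 := (hf.lieDer (emb α v)).integrable_mul_orb α i0 m
  have a4 : Integrable fun y => k y * (orb α (lieDer (emb α v) f) m y -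
      I * (ν / 2 * omC v y) * orb α f m y) := by
    refine (a3.sub a2).congr (Filter.Eventually.of_forall fun y => ?_)
    simp only [Pi.sub_apply]
    ring
  have ibp := integral_bilinear_hasLineDerivAt_right_eq_neg_left_of_integrable
    (μ := volume) (B := ContinuousLinearMap.mul ℝ ℂ) (f := k) (f' := k') (g := orb α f m)
    (g' := fun y => orb α (lieDer (emb α v) f) m y - I * (ν / 2 * omC v y) * orb α f m y)
    (v := v) a1 a4 a0 (fun y _ => hk y) (fun y _ => hasLineDerivAt_orb hf hν α m v y)
  simp only [ContinuousLinearMap.mul_apply'] at ibp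
  have e1 : ∀ y, k y * orb α (lieDer (emb α v) f) m y =
      k y * (orb α (lieDer (emb α v) f) m y - I * (ν / 2 * omC v y) * orb α f m y) +
        I * (ν / 2) * omC v y * k y * orb α f m y := fun y => by ring
  have e2 : ∀ y, (-k' y + I * (ν / 2) * omC v y * k y) * orb α f m y =
      -(k' y * orb α f m y) + I * (ν / 2) * omC v y * k y * orb α f m y := fun y => by ring
  simp only [avgY, e1, e2]
  rw [integral_add a4 a2, integral_add a1n a2, ibp, integral_neg]

theorem omC_swap (v y : Fin g ⊕ Fin g → ℝ) : omC y v = -omC v y := by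
  simp only [omC, omegaForm]
  ring

theorem continuous_omC (v : Fin g ⊕ Fin g → ℝ) : Continuous fun y => omC v y := by
  unfold omC omegaForm dotProduct
  fun_prop

/-- Moving the base point by `exp(-sV)` and exchanging it with `exp(-y)` creates a commutator, so
that `V` is replaced by `V + ω(v, y)T` inside the average. As `T` acts by `-iν`, the magnetic term
of `avgY_lieDer` changes sign: derivatives outside and inside the average twist the kernel by
opposite fields. -/
theorem lieDer_avgY (hf : IsSmooth f) (hν : IsSector ν f) (α : SpR g)
    (hk : ∀ y, HasLineDerivAt ℝ k (k' y) y v) (i0 : Integrable k) (i1 : Integrable k')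
    (i2 : Integrable fun y => (omC v y : ℂ) * k y) (m : Nil g) :
    lieDer (emb α v) (avgY α k f) m =
      avgY α (fun y => -k' y + -(I * (ν / 2)) * omC v y * k y) f m := by
  obtain ⟨C, hC0, hC⟩ := exists_bound_of_continuous (hf.lieDer (emb α v)).continuous
  obtain ⟨C', hC0', hC'⟩ := exists_bound_of_continuous (hf.lieDer basisT).continuous
  have e1 : ∀ (s : ℝ) (y : Fin g ⊕ Fin g → ℝ), orb α f (expo (-(s • emb α v)) • m) y =
      f (expo (-(s • (emb α v + omC v y • basisT))) • expo (-(emb α y)) • m) := by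
    intro s y
    rw [orb, expo_smul_smul, expo_smul_smul]
    congr 3
    rw [hmul_eq_add, hmul_eq_add]
    simp only [om_neg_left, om_neg_right, om_smul_left, om_smul_right, om_add_left, om_emb,
      om_basisT_left, omC_swap v y]
    module
  have e2 : ∀ (V : HeisAlg g) (c : ℝ) (m : Nil g),
      ‖lieDer (V + c • basisT) f m‖ ≤ ‖lieDer V f m‖ + |c| * C' := by
    intro V c m
    rw [lieDer_add_smul_basisT hf]
    refine (norm_add_le _ _).trans (add_le_add le_rfl ?_)
    rw [norm_mul, Complex.norm_real, Real.norm_eq_abs]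
    exact mul_le_mul_of_nonneg_left (hC' m) (abs_nonneg _)
  have j2 : Integrable fun y => I * (ν / 2) * omC v y * k y := by
    simpa only [mul_assoc] using i2.const_mul (I * (ν / 2))
  have meas : ∀ s : ℝ, AEStronglyMeasurable
      (fun y => k y * orb α f (expo (-(s • emb α v)) • m) y) volume := fun s =>
    (hf.integrable_mul_orb α i0 _).aestronglyMeasurable
  have a3 := (hf.lieDer (emb α v)).integrable_mul_orb α i0 m
  have a4 := (hf.lieDer basisT).integrable_mul_orb α i2 m
  have F0 : ∀ y, k y * lieDer (emb α v + omC v y • basisT) f (expo (-(emb α y)) • m) =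
      k y * orb α (lieDer (emb α v) f) m y + omC v y * k y * orb α (lieDer basisT f) m y := by
    intro y
    rw [lieDer_add_smul_basisT hf, orb, orb]
    ring
  have main := hasDerivAt_integral_of_dominated_loc_of_deriv_le (μ := volume) (𝕜 := ℝ)
    (F := fun s y => k y * orb α f (expo (-(s • emb α v)) • m) y)
    (F' := fun s y => k y * lieDer (emb α v + omC v y • basisT) f
      (expo (-(s • (emb α v + omC v y • basisT))) • expo (-(emb α y)) • m))
    (x₀ := 0) (bound := fun y => ‖k y‖ * C + ‖(omC v y : ℂ) * k y‖ * C') (s := Set.univ)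
    Filter.univ_mem (Filter.Eventually.of_forall meas)
    (hf.integrable_mul_orb α i0 _)
    (by
      simp only [zero_smul, neg_zero, expo_zero, one_smul, F0]
      exact (a3.add a4).aestronglyMeasurable)
    (Filter.Eventually.of_forall fun y s _ => by
      rw [norm_mul, norm_mul, Complex.norm_real, Real.norm_eq_abs]
      have h1 := e2 (emb α v) (omC v y)
        (expo (-(s • (emb α v + omC v y • basisT))) • expo (-(emb α y)) • m)
      have h2 := hC (expo (-(s • (emb α v + omC v y • basisT))) • expo (-(emb α y)) • m)
      nlinarith [norm_nonneg (k y)])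
    ((i0.norm.mul_const C).add (i2.norm.mul_const C'))
    (Filter.Eventually.of_forall fun y s _ => by
      simp only [e1]
      exact (hf.hasDerivAt _ _ s).const_mul (k y))
  have h1 : lieDer (emb α v) (avgY α k f) m = ∫ y, k y * lieDer (emb α v + omC v y • basisT) f
      (expo (-((0 : ℝ) • (emb α v + omC v y • basisT))) • expo (-(emb α y)) • m) :=
    main.2.deriv
  have a1 := hf.integrable_mul_orb α i1 m
  have a1n : Integrable fun y => -(k' y * orb α f m y) := a1.neg
  have a2 := hf.integrable_mul_orb α j2 m
  have h3 : avgY α k (lieDer (emb α v) f) m =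
      (∫ y, -(k' y * orb α f m y)) + ∫ y, I * (ν / 2) * omC v y * k y * orb α f m y := by
    rw [avgY_lieDer hf hν α hk i0 i1 i2, ← integral_add a1n a2, avgY]
    congr 1
    ext y
    ring
  rw [h1]
  simp only [zero_smul, neg_zero, expo_zero, one_smul, F0]
  rw [integral_add a3 a4]
  change avgY α k (lieDer (emb α v) f) m + _ = _
  have h4 : ∀ y, (omC v y : ℂ) * k y * orb α (lieDer basisT f) m y =
      (-2 : ℂ) * (I * (ν / 2) * omC v y * k y * orb α f m y) := by
    intro y
    rw [orb, hν.lieDer_basisT, orb]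
    ring
  simp only [h4]
  rw [h3, integral_const_mul, avgY]
  have e3 : ∀ y, (-k' y + -(I * (ν / 2)) * omC v y * k y) * orb α f m y =
      -(k' y * orb α f m y) + (-1 : ℂ) * (I * (ν / 2) * omC v y * k y * orb α f m y) :=
    fun y => by ring
  simp only [e3]
  rw [integral_add a1n (a2.const_mul _), integral_const_mul]
  ring

end OrbitAverage
end HeisNil
end

/-! ### Radial kernels commute with `L_α` -/

noncomputable section
namespace HeisNil
open MeasureTheory Complex

section Radial
variable {g : ℕ}

/-- The Euclidean norm squared. -/
def qY (y : Fin g ⊕ Fin g → ℝ) : ℝ := ∑ i, y i ^ 2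

theorem qY_nonneg (y : Fin g ⊕ Fin g → ℝ) : 0 ≤ qY y := Finset.sum_nonneg fun _ _ => sq_nonneg _

theorem continuous_qY : Continuous (qY : (Fin g ⊕ Fin g → ℝ) → ℝ) := by
  unfold qY
  fun_prop

theorem sq_le_qY (y : Fin g ⊕ Fin g → ℝ) (i : Fin g ⊕ Fin g) : y i ^ 2 ≤ qY y :=
  Finset.single_le_sum (f := fun i => y i ^ 2) (fun _ _ => sq_nonneg _) (Finset.mem_univ i)

theorem qY_add_smul_single (y : Fin g ⊕ Fin g → ℝ) (i : Fin g ⊕ Fin g) (t : ℝ) :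
    qY (y + t • Pi.single i 1) = qY y + (2 * y i * t + t ^ 2) := by
  have h : ∀ j, (y + t • (Pi.single i 1 : Fin g ⊕ Fin g → ℝ)) j ^ 2 =
      y j ^ 2 + if j = i then 2 * y i * t + t ^ 2 else 0 := by
    intro j
    by_cases hj : j = i
    · subst hj
      simp
      ring
    · simp [hj]
  simp only [qY, h, Finset.sum_add_distrib, Finset.sum_ite_eq', Finset.mem_univ, if_true]

theorem omC_single_inl (j : Fin g) (y : Fin g ⊕ Fin g → ℝ) :
    omC (Pi.single (Sum.inl j) 1) y = -y (Sum.inr j) := by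
  have h1 : (Pi.single (Sum.inl j) 1 : Fin g ⊕ Fin g → ℝ) ∘ Sum.inl = Pi.single j 1 := by
    ext k
    simp [Pi.single_apply]
  have h2 : (Pi.single (Sum.inl j) 1 : Fin g ⊕ Fin g → ℝ) ∘ Sum.inr = 0 := by
    ext k
    simp
  simp [omC, omegaForm, h1, h2]

theorem omC_single_inr (j : Fin g) (y : Fin g ⊕ Fin g → ℝ) :
    omC (Pi.single (Sum.inr j) 1) y = y (Sum.inl j) := by
  have h1 : (Pi.single (Sum.inr j) 1 : Fin g ⊕ Fin g → ℝ) ∘ Sum.inl = 0 := by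
    ext k
    simp
  have h2 : (Pi.single (Sum.inr j) 1 : Fin g ⊕ Fin g → ℝ) ∘ Sum.inr = Pi.single j 1 := by
    ext k
    simp [Pi.single_apply]
  simp [omC, omegaForm, h1, h2]

theorem omC_single_add_smul (i : Fin g ⊕ Fin g) (y : Fin g ⊕ Fin g → ℝ) (t : ℝ) :
    omC (Pi.single i 1) (y + t • Pi.single i 1) = omC (Pi.single i 1) y := by
  rcases i with i | i
  · simp [omC_single_inl]
  · simp [omC_single_inr]

theorem sum_omC_mul (y : Fin g ⊕ Fin g → ℝ) : ∑ i, omC (Pi.single i 1) y * y i = 0 := by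
  simp only [Fintype.sum_sum_type, omC_single_inl, omC_single_inr, neg_mul,
    Finset.sum_neg_distrib]
  rw [neg_add_eq_zero]
  exact Finset.sum_congr rfl fun _ _ => mul_comm _ _

theorem sum_omC_sq (y : Fin g ⊕ Fin g → ℝ) : ∑ i, omC (Pi.single i 1) y ^ 2 = qY y := by
  simp only [qY, Fintype.sum_sum_type, omC_single_inl, omC_single_inr, neg_sq]
  exact add_comm _ _

theorem omC_sq_le (i : Fin g ⊕ Fin g) (y : Fin g ⊕ Fin g → ℝ) :
    omC (Pi.single i 1) y ^ 2 ≤ qY y := by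
  rw [← sum_omC_sq y]
  exact Finset.single_le_sum (f := fun i => omC (Pi.single i 1) y ^ 2) (fun _ _ => sq_nonneg _)
    (Finset.mem_univ i)

/-- A profile `G` with two derivatives, all of exponential decay. -/
structure RadialProfile (G G1 G2 : ℝ → ℝ) : Prop where
  deriv : ∀ r, HasDerivAt G (G1 r) r
  deriv1 : ∀ r, HasDerivAt G1 (G2 r) r
  cont : Continuous G2
  bound : ∃ C, ∀ r, 0 ≤ r → |G r| ≤ C * Real.exp (-r) ∧ |G1 r| ≤ C * Real.exp (-r) ∧
    |G2 r| ≤ C * Real.exp (-r)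

theorem integrable_exp_neg_mul_qY {b : ℝ} (hb : 0 < b) :
    Integrable fun y : Fin g ⊕ Fin g → ℝ => Real.exp (-b * qY y) := by
  have h := (GaussianFourier.integrable_cexp_neg_mul_sum_add (ι := Fin g ⊕ Fin g)
    (b := (b : ℂ)) (by simpa using hb) 0).norm
  refine h.congr (Filter.Eventually.of_forall fun y => ?_)
  simp only [Complex.norm_exp, qY]
  congr 1
  simp [← ofReal_pow, ← ofReal_sum, ← ofReal_neg]

/-- Half of the exponential decay absorbs a factor of quadratic growth. -/
theorem integrable_poly_mul_radial {P : (Fin g ⊕ Fin g → ℝ) → ℝ} (hP : Continuous P) {M : ℝ}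
    (hM : ∀ y, |P y| ≤ M * (1 + qY y)) {G : ℝ → ℝ} (hG : Continuous G) {C : ℝ}
    (hC : ∀ r, 0 ≤ r → |G r| ≤ C * Real.exp (-r)) :
    Integrable fun y => ((P y : ℂ) * (G (qY y) : ℂ)) := by
  have hC0 : 0 ≤ C := by
    have := (abs_nonneg _).trans (hC 0 le_rfl)
    simpa using this
  have hM0 : 0 ≤ M := by
    have := (abs_nonneg _).trans (hM 0)
    simpa [qY] using this
  refine ((integrable_exp_neg_mul_qY (g := g) (b := 1 / 2) (by norm_num)).const_mul
    (2 * M * C)).mono' ?_ (Filter.Eventually.of_forall fun y => ?_)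
  · have h1 := continuous_ofReal.comp hP
    have h2 := continuous_ofReal.comp (hG.comp (continuous_qY (g := g)))
    exact (h1.mul h2).aestronglyMeasurable
  · rw [norm_mul, Complex.norm_real, Complex.norm_real, Real.norm_eq_abs, Real.norm_eq_abs]
    have hq := qY_nonneg y
    have h1 : 1 + qY y ≤ 2 * Real.exp (qY y / 2) := by
      have := Real.add_one_le_exp (qY y / 2)
      linarith
    have h2 : Real.exp (-(1 / 2) * qY y) = Real.exp (qY y / 2) * Real.exp (-qY y) := by
      rw [← Real.exp_add]
      ring_nf
    calc |P y| * |G (qY y)| ≤ (M * (1 + qY y)) * (C * Real.exp (-qY y)) :=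
          mul_le_mul (hM y) (hC _ hq) (abs_nonneg _) (by positivity)
      _ ≤ (M * (2 * Real.exp (qY y / 2))) * (C * Real.exp (-qY y)) := by gcongr
      _ = 2 * M * C * Real.exp (-(1 / 2) * qY y) := by rw [h2]; ring

variable {G G1 G2 : ℝ → ℝ} {f : Nil g → ℂ} {ν : ℝ}

theorem abs_le_one_add {a b : ℝ} (h : a ^ 2 ≤ b) : |a| ≤ 1 * (1 + b) := by
  rw [abs_le]
  constructor <;> nlinarith [sq_nonneg (a - 1), sq_nonneg (a + 1)]

theorem abs_mul_le_one_add {a c b : ℝ} (h : a ^ 2 ≤ b) (h' : c ^ 2 ≤ b) :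
    |a * c| ≤ 1 * (1 + b) := by
  rw [abs_le]
  constructor <;> nlinarith [sq_nonneg (a - c), sq_nonneg (a + c)]

/-- The kernel obtained from a radial one by one twisted differentiation. -/
def twist1 (G G1 : ℝ → ℝ) (c : ℂ) (i : Fin g ⊕ Fin g) (y : Fin g ⊕ Fin g → ℝ) : ℂ :=
  -((2 * y i * G1 (qY y) : ℝ) : ℂ) + c * omC (Pi.single i 1) y * G (qY y)

/-- The result of applying `-∂ᵢ + c ω(eᵢ, y)` twice to `G(|y|²)`; `G1` and `G2` stand for the two
derivatives of `G`. -/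
def twist2 (G G1 G2 : ℝ → ℝ) (c : ℂ) (i : Fin g ⊕ Fin g) (y : Fin g ⊕ Fin g → ℝ) : ℂ :=
  ((2 * G1 (qY y) + 4 * y i ^ 2 * G2 (qY y) : ℝ) : ℂ) -
    c * omC (Pi.single i 1) y * ((4 * y i * G1 (qY y) : ℝ) : ℂ) +
    c ^ 2 * ((omC (Pi.single i 1) y ^ 2 * G (qY y) : ℝ) : ℂ)

/-- The action of the twisted Laplacian on radial profiles. -/
def radialLap (g : ℕ) (ν : ℝ) (G G1 G2 : ℝ → ℝ) (r : ℝ) : ℝ :=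
  4 * r * G2 r + 4 * g * G1 r - ν ^ 2 / 4 * (r * G r)

/-- The terms linear in `c` carry the factor `∑ ω(eᵢ, y) yᵢ = ω(y, y) = 0`. Only `c²` survives, and
it is the same for the twists `c = iν/2` inside the average and `c = -iν/2` outside it; this is why
radial averages commute with `L_α`. -/
theorem sum_twist2 (ν : ℝ) {c : ℂ} (hc : c ^ 2 = -(ν : ℂ) ^ 2 / 4) (y : Fin g ⊕ Fin g → ℝ) :
    ∑ i, twist2 G G1 G2 c i y = (radialLap g ν G G1 G2 (qY y) : ℂ) := by
  have e : ∀ i, twist2 G G1 G2 c i y = ((2 * G1 (qY y) : ℝ) : ℂ) +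
      ((4 * G2 (qY y) : ℝ) : ℂ) * ((y i ^ 2 : ℝ) : ℂ) -
      c * ((4 * G1 (qY y) : ℝ) : ℂ) * ((omC (Pi.single i 1) y * y i : ℝ) : ℂ) +
      c ^ 2 * (G (qY y) : ℂ) * ((omC (Pi.single i 1) y ^ 2 : ℝ) : ℂ) := by
    intro i
    simp only [twist2]
    push_cast
    ring
  simp only [e, Finset.sum_add_distrib, Finset.sum_sub_distrib, ← Finset.mul_sum, ← ofReal_sum,
    sum_omC_mul, sum_omC_sq, hc]
  rw [← qY]
  simp only [Finset.sum_const, Finset.card_univ, Fintype.card_sum, Fintype.card_fin, radialLap]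
  push_cast
  simp only [nsmul_eq_mul]
  push_cast
  ring

namespace RadialProfile
theorem continuous0 (hG : RadialProfile G G1 G2) : Continuous G :=
  continuous_iff_continuousAt.2 fun r => (hG.deriv r).continuousAt

theorem continuous1 (hG : RadialProfile G G1 G2) : Continuous G1 :=
  continuous_iff_continuousAt.2 fun r => (hG.deriv1 r).continuousAt

theorem hasDerivAt_line {H H1 : ℝ → ℝ} (hH : ∀ r, HasDerivAt H (H1 r) r) (i : Fin g ⊕ Fin g)
    (y : Fin g ⊕ Fin g → ℝ) :
    HasDerivAt (fun t : ℝ => H (qY (y + t • Pi.single i 1))) (2 * y i * H1 (qY y)) 0 := by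
  have h1 : HasDerivAt (fun t : ℝ => qY (y + t • Pi.single i 1)) (2 * y i) 0 := by
    simp only [qY_add_smul_single]
    have h2 := ((hasDerivAt_id (0 : ℝ)).const_mul (2 * y i)).add ((hasDerivAt_id (0 : ℝ)).pow 2)
    simpa using h2.const_add (qY y)
  have h3 : HasDerivAt H (H1 (qY y)) (qY (y + (0 : ℝ) • Pi.single i 1)) := by
    rw [zero_smul, add_zero]
    exact hH _
  exact (h3.comp 0 h1).congr_deriv (mul_comm _ _)

theorem hasLineDerivAt0 (hG : RadialProfile G G1 G2) (i : Fin g ⊕ Fin g) (y : Fin g ⊕ Fin g → ℝ) :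
    HasLineDerivAt ℝ (fun y => (G (qY y) : ℂ)) ((2 * y i * G1 (qY y) : ℝ) : ℂ) y
      (Pi.single i 1) :=
  (hasDerivAt_line hG.deriv i y).ofReal_comp

theorem hasLineDerivAt1 (hG : RadialProfile G G1 G2) (c : ℂ) (i : Fin g ⊕ Fin g) (y : Fin g ⊕ Fin g → ℝ) :
    HasLineDerivAt ℝ (twist1 G G1 c i) (-((2 * G1 (qY y) + 4 * y i ^ 2 * G2 (qY y) : ℝ) : ℂ) +
      c * omC (Pi.single i 1) y * ((2 * y i * G1 (qY y) : ℝ) : ℂ)) y (Pi.single i 1) := by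
  have h0 := (hasDerivAt_line hG.deriv i y).ofReal_comp
  have h1 := hasDerivAt_line hG.deriv1 i y
  have h2 : HasDerivAt (fun t : ℝ => 2 * (y i + t)) 2 0 := by
    simpa using ((hasDerivAt_id (0 : ℝ)).const_add (y i)).const_mul 2
  have h3 := ((h2.mul h1).ofReal_comp.neg).add (h0.const_mul (c * omC (Pi.single i 1) y))
  rw [HasLineDerivAt]
  have e : (fun t : ℝ => twist1 G G1 c i (y + t • Pi.single i 1)) =
      (fun t : ℝ => -(((2 * (y i + t)) * G1 (qY (y + t • Pi.single i 1)) : ℝ) : ℂ) +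
        c * omC (Pi.single i 1) y * (G (qY (y + t • Pi.single i 1)) : ℂ)) := by
    ext t
    simp [twist1, omC_single_add_smul]
  rw [e]
  refine h3.congr_deriv ?_
  simp only [zero_smul, add_zero]
  push_cast
  ring

theorem integrable0 (hG : RadialProfile G G1 G2) : Integrable fun y : Fin g ⊕ Fin g → ℝ => (G (qY y) : ℂ) := by
  obtain ⟨C, hC⟩ := hG.bound
  have := integrable_poly_mul_radial (g := g) (P := fun _ => 1) continuous_const (M := 1)
    (fun y => by have := qY_nonneg y; simp; linarith) hG.continuous0 (fun r hr => (hC r hr).1)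
  simpa using this

theorem integrable_mul (hG : RadialProfile G G1 G2) {H : ℝ → ℝ} (hH : H = G ∨ H = G1 ∨ H = G2)
    {P : (Fin g ⊕ Fin g → ℝ) → ℝ} (hP : Continuous P) {M : ℝ}
    (hM : ∀ y, |P y| ≤ M * (1 + qY y)) : Integrable fun y => ((P y : ℂ) * (H (qY y) : ℂ)) := by
  obtain ⟨C, hC⟩ := hG.bound
  rcases hH with rfl | rfl | rfl
  · exact integrable_poly_mul_radial hP hM hG.continuous0 fun r hr => (hC r hr).1
  · exact integrable_poly_mul_radial hP hM hG.continuous1 fun r hr => (hC r hr).2.1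
  · exact integrable_poly_mul_radial hP hM hG.cont fun r hr => (hC r hr).2.2

theorem integrable_family (hG : RadialProfile G G1 G2) (c : ℂ) (i : Fin g ⊕ Fin g) :
    Integrable (fun y : Fin g ⊕ Fin g → ℝ => ((2 * y i * G1 (qY y) : ℝ) : ℂ)) ∧
    Integrable (fun y : Fin g ⊕ Fin g → ℝ => (omC (Pi.single i 1) y : ℂ) * (G (qY y) : ℂ)) ∧
    Integrable (twist1 (g := g) G G1 c i) ∧
    Integrable (fun y : Fin g ⊕ Fin g → ℝ =>
      (-((2 * G1 (qY y) + 4 * y i ^ 2 * G2 (qY y) : ℝ) : ℂ) +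
      c * omC (Pi.single i 1) y * ((2 * y i * G1 (qY y) : ℝ) : ℂ))) ∧
    Integrable (fun y : Fin g ⊕ Fin g → ℝ => (omC (Pi.single i 1) y : ℂ) * twist1 G G1 c i y) := by
  have cy : Continuous fun y : Fin g ⊕ Fin g → ℝ => y i := continuous_apply i
  have cw := continuous_omC (g := g) (Pi.single i 1)
  have a0 := hG.integrable_mul (H := G1) (by simp) cy (fun y => abs_le_one_add (sq_le_qY y i))
  have a1 := hG.integrable_mul (H := G) (by simp) cw (fun y => abs_le_one_add (omC_sq_le i y))
  have a2 := hG.integrable_mul (H := G1) (g := g) (by simp) (P := fun _ => 1) continuous_const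
    (M := 1) (fun y => by have := qY_nonneg y; simp; linarith)
  have a3 := hG.integrable_mul (H := G2) (by simp)
    (P := fun y => y i * y i) (cy.mul cy)
    (fun y => abs_mul_le_one_add (sq_le_qY y i) (sq_le_qY y i))
  have a4 := hG.integrable_mul (H := G1) (by simp)
    (P := fun y => omC (Pi.single i 1) y * y i) (cw.mul cy)
    (fun y => abs_mul_le_one_add (omC_sq_le i y) (sq_le_qY y i))
  have a5 := hG.integrable_mul (H := G) (by simp)
    (P := fun y => omC (Pi.single i 1) y * omC (Pi.single i 1) y) (cw.mul cw)
    (fun y => abs_mul_le_one_add (omC_sq_le i y) (omC_sq_le i y))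
  refine ⟨?_, a1, ?_, ?_, ?_⟩
  · refine (a0.const_mul 2).congr (Filter.Eventually.of_forall fun y => ?_)
    push_cast
    ring
  · refine ((a0.const_mul (-2)).add (a1.const_mul c)).congr (Filter.Eventually.of_forall fun y => ?_)
    simp only [Pi.add_apply, twist1]
    push_cast
    ring
  · refine (((a2.const_mul (-2)).add (a3.const_mul (-4))).add (a4.const_mul (2 * c))).congr
      (Filter.Eventually.of_forall fun y => ?_)
    simp only [Pi.add_apply]
    push_cast
    ring
  · refine ((a4.const_mul (-2)).add (a5.const_mul c)).congr
      (Filter.Eventually.of_forall fun y => ?_)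
    simp only [Pi.add_apply, twist1]
    push_cast
    ring

theorem integrable_twist2 (hG : RadialProfile G G1 G2) (c : ℂ) (i : Fin g ⊕ Fin g) :
    Integrable (twist2 (g := g) G G1 G2 c i) := by
  obtain ⟨-, -, -, h1, h2⟩ := hG.integrable_family (g := g) c i
  refine (h1.neg.add (h2.const_mul c)).congr (Filter.Eventually.of_forall fun y => ?_)
  simp only [Pi.add_apply, Pi.neg_apply, twist1, twist2]
  push_cast
  ring

theorem avgY_twist (hG : RadialProfile G G1 G2) (hf : IsSmooth f) (α : SpR g) {c : ℂ} (hc : c ^ 2 = -(ν : ℂ) ^ 2 / 4)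
    (m : Nil g) : ∑ i, avgY α (twist2 G G1 G2 c i) f m =
      avgY α (fun y => (radialLap g ν G G1 G2 (qY y) : ℂ)) f m := by
  simp only [avgY]
  rw [← integral_finsetSum _ fun i _ => hf.integrable_mul_orb α (hG.integrable_twist2 c i) m]
  congr 1
  ext y
  rw [← Finset.sum_mul, sum_twist2 ν hc]

theorem avgY_sum_lieDer (hG : RadialProfile G G1 G2) (hf : IsSmooth f) (hν : IsSector ν f) (α : SpR g) (m : Nil g) :
    ∑ i, avgY α (fun y => (G (qY y) : ℂ))
      (lieDer (emb α (Pi.single i 1)) (lieDer (emb α (Pi.single i 1)) f)) m =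
      avgY α (fun y => (radialLap g ν G G1 G2 (qY y) : ℂ)) f m := by
  have hc : (I * (ν / 2) : ℂ) ^ 2 = -(ν : ℂ) ^ 2 / 4 := by
    rw [mul_pow, I_sq]; ring
  rw [← hG.avgY_twist hf α hc]
  refine Finset.sum_congr rfl fun i _ => ?_
  obtain ⟨j1, j2, j3, j4, j5⟩ := hG.integrable_family (g := g) (I * (ν / 2)) i
  rw [avgY_lieDer (hf.lieDer _) (hν.lieDer _) α (hG.hasLineDerivAt0 i) hG.integrable0 j1 j2]
  have h := avgY_lieDer hf hν α (hG.hasLineDerivAt1 (I * (ν / 2)) i) j3 j4 j5 m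
  refine Eq.trans h ?_
  congr 1
  ext y
  simp only [twist1, twist2]
  push_cast
  ring

theorem sum_lieDer_avgY (hG : RadialProfile G G1 G2) (hf : IsSmooth f) (hν : IsSector ν f) (α : SpR g) (m : Nil g) :
    ∑ i, lieDer (emb α (Pi.single i 1)) (lieDer (emb α (Pi.single i 1))
      (avgY α (fun y => (G (qY y) : ℂ)) f)) m =
      avgY α (fun y => (radialLap g ν G G1 G2 (qY y) : ℂ)) f m := by
  have hc : (-(I * (ν / 2)) : ℂ) ^ 2 = -(ν : ℂ) ^ 2 / 4 := by
    rw [neg_sq, mul_pow, I_sq]; ring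
  rw [← hG.avgY_twist hf α hc]
  refine Finset.sum_congr rfl fun i _ => ?_
  obtain ⟨j1, j2, j3, j4, j5⟩ := hG.integrable_family (g := g) (-(I * (ν / 2))) i
  have e : lieDer (emb α (Pi.single i 1)) (avgY α (fun y => (G (qY y) : ℂ)) f) =
      avgY α (twist1 G G1 (-(I * (ν / 2))) i) f :=
    funext fun m => lieDer_avgY hf hν α (hG.hasLineDerivAt0 i) hG.integrable0 j1 j2 m
  rw [e, lieDer_avgY hf hν α (hG.hasLineDerivAt1 (-(I * (ν / 2))) i) j3 j4 j5 m]
  congr 1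
  ext y
  simp only [twist1, twist2]
  push_cast
  ring

theorem avgY_opL (hG : RadialProfile G G1 G2) (hf : IsSmooth f) (hν : IsSector ν f) (α : SpR g) (m : Nil g) :
    avgY α (fun y => (G (qY y) : ℂ)) (opL α f) m =
      (1 + ν ^ 2) * avgY α (fun y => (G (qY y) : ℂ)) f m -
        avgY α (fun y => (radialLap g ν G G1 G2 (qY y) : ℂ)) f m := by
  rw [← hG.avgY_sum_lieDer hf hν]
  have h1 := fun i => ((hf.lieDer (emb α (Pi.single i 1))).lieDer
    (emb α (Pi.single i 1))).integrable_mul_orb α hG.integrable0 m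
  simp only [avgY]
  rw [← integral_finsetSum _ fun i _ => h1 i, ← integral_const_mul,
    ← integral_sub ((hf.integrable_mul_orb α hG.integrable0 m).const_mul _)
      (integrable_finsetSum _ fun i _ => h1 i)]
  congr 1
  ext y
  rw [orb, hν.opL_eq, ← Finset.mul_sum]
  simp only [orb]
  ring

/-- Averaging against a radial kernel commutes with `L_α`. -/
theorem opL_avgY (hG : RadialProfile G G1 G2) (hf : IsSmooth f) (hν : IsSector ν f) (α : SpR g) (m : Nil g) :
    opL α (avgY α (fun y => (G (qY y) : ℂ)) f) m =
      avgY α (fun y => (G (qY y) : ℂ)) (opL α f) m := by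
  rw [hG.avgY_opL hf hν, (hν.avgY α _).opL_eq, hG.sum_lieDer_avgY hf hν]

end RadialProfile
end Radial
end HeisNil
end

/-! ### Coordinates adapted to `α` and the Gaussian bound on one sector -/

noncomputable section
namespace HeisNil
open MeasureTheory

section Coordinates
variable {g : ℕ}

/-- Coordinates on the Heisenberg algebra adapted to `α`. -/
def embT (α : SpR g) (p : (Fin g ⊕ Fin g → ℝ) × ℝ) : HeisAlg g := emb α p.1 + p.2 • basisT

theorem embT_eq (α : SpR g) (p : (Fin g ⊕ Fin g → ℝ) × ℝ) :
    embT α p = ((α⁻¹ : SpR g).1.mulVec p.1 ∘ Sum.inl, (α⁻¹ : SpR g).1.mulVec p.1 ∘ Sum.inr, p.2) := by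
  have e : Sum.elim (p.1 ∘ Sum.inl) (p.1 ∘ Sum.inr) = p.1 := Sum.elim_comp_inl_inr p.1
  simp only [embT, emb_apply, act, e, basisT]
  ext <;> simp

theorem continuous_embT (α : SpR g) : Continuous (embT α) := by
  unfold embT
  fun_prop

theorem embT_neg (α : SpR g) (p : (Fin g ⊕ Fin g → ℝ) × ℝ) : embT α (-p) = -embT α p := by
  simp only [embT, Prod.fst_neg, Prod.snd_neg, map_neg, neg_smul, neg_add]

theorem measurePreserving_mulVec {ι : Type*} [Fintype ι] [DecidableEq ι] {M : Matrix ι ι ℝ}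
    (hM : M.det = 1) : MeasurePreserving (fun y : ι → ℝ => M.mulVec y) volume volume := by
  refine ⟨by fun_prop, ?_⟩
  have h := Real.map_matrix_volume_pi_eq_smul_volume_pi (M := M) (by simp [hM])
  rw [hM] at h
  have e : (Matrix.toLin' M : (ι → ℝ) → (ι → ℝ)) = fun y => M.mulVec y := by
    ext1 y
    rw [Matrix.toLin'_apply]
  rw [e] at h
  simpa using h

/-- Symplectic matrices have determinant 1. -/
theorem measurePreserving_embT (α : SpR g) : MeasurePreserving (embT α) volume volume := by
  have h1 : MeasurePreserving (fun y : Fin g ⊕ Fin g → ℝ => (α⁻¹ : SpR g).1.mulVec y)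
      volume volume := measurePreserving_mulVec (SymplecticGroup.det_eq_one (α⁻¹ : SpR g).2)
  have h2 : MeasurePreserving (MeasurableEquiv.sumPiEquivProdPi fun _ : Fin g ⊕ Fin g => ℝ)
      volume volume := volume_measurePreserving_sumPiEquivProdPi _
  have h3 := (h2.comp h1).prod (MeasurePreserving.id (volume : Measure ℝ))
  have h4 : MeasurePreserving (MeasurableEquiv.prodAssoc :
      ((Fin g → ℝ) × (Fin g → ℝ)) × ℝ ≃ᵐ (Fin g → ℝ) × (Fin g → ℝ) × ℝ) volume volume :=
    volume_preserving_prodAssoc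
  have h5 := h4.comp h3
  have e : embT α = MeasurableEquiv.prodAssoc ∘ Prod.map
      ((MeasurableEquiv.sumPiEquivProdPi fun _ : Fin g ⊕ Fin g => ℝ) ∘
        fun y : Fin g ⊕ Fin g → ℝ => (α⁻¹ : SpR g).1.mulVec y) id := by
    ext1 p
    rw [embT_eq]
    rfl
  rw [e]
  exact h5

theorem zSq_embT (α : SpR g) (p : (Fin g ⊕ Fin g → ℝ) × ℝ) :
    zSq α (embT α p).1 (embT α p).2.1 = qY p.1 := by
  have e : Sum.elim ((α⁻¹ : SpR g).1.mulVec p.1 ∘ Sum.inl) ((α⁻¹ : SpR g).1.mulVec p.1 ∘ Sum.inr) =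
      (α⁻¹ : SpR g).1.mulVec p.1 := Sum.elim_comp_inl_inr _
  have h : α.1 * (α⁻¹ : SpR g).1 = 1 := by
    exact congrArg Subtype.val (mul_inv_cancel α)
  rw [embT_eq]
  simp only [zSq, e, Matrix.mulVec_mulVec, h, Matrix.one_mulVec, dotProduct, qY, sq]

/-- Lebesgue measure on one period of the centre, in adapted coordinates. -/
def slab (g : ℕ) : Measure ((Fin g ⊕ Fin g → ℝ) × ℝ) :=
  (volume : Measure (Fin g ⊕ Fin g → ℝ)).prod (volume.restrict (Set.Ico (-1 / 4 : ℝ) (1 / 4)))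

instance : SFinite (slab g) := by
  unfold slab
  infer_instance

theorem slab_eq (g : ℕ) : slab g =
    volume.restrict (Set.univ ×ˢ Set.Ico (-1 / 4 : ℝ) (1 / 4)) := by
  rw [slab, Measure.volume_eq_prod, ← Measure.prod_restrict, Measure.restrict_univ]

theorem exists_slab_gauss_le (g : ℕ) : ∃ C : ℝ, 0 < C ∧ ∀ (α : SpR g) (m : Nil g)
    (ψ : Nil g → ℝ≥0∞), Measurable ψ →
    ∫⁻ p, ENNReal.ofReal (Real.exp (-Real.pi * qY p.1)) * ψ (expo (-(embT α p)) • m) ∂(slab g) ≤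
      ENNReal.ofReal (C * siegelHeight α ^ (1 / 2 : ℝ)) * ∫⁻ m, ψ m ∂(haarNil g) := by
  obtain ⟨C, hC, h⟩ := exists_orbit_gauss_le g
  refine ⟨C, hC, fun α m ψ hψ => le_trans (le_of_eq ?_) (h α m ψ hψ)⟩
  have hmeas : Measurable fun v : HeisAlg g => ψ (expo (-v) • m) :=
    hψ.comp (measurable_expo_smul.comp ((measurable_neg).prodMk measurable_const))
  have hm2 : Measurable fun v => gaussWindow α v * ψ (expo (-v) • m) :=
    (measurable_gaussWindow α).mul hmeas
  rw [← (measurePreserving_embT α).lintegral_comp hm2, slab_eq,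
    ← lintegral_indicator (MeasurableSet.univ.prod measurableSet_Ico)]
  refine lintegral_congr fun p => ?_
  rw [gaussWindow, zSq_embT]
  have e : (embT α p).2.2 = p.2 := by rw [embT_eq]
  rw [e]
  by_cases hp : p.2 ∈ Set.Ico (-1 / 4 : ℝ) (1 / 4)
  · rw [Set.indicator_of_mem (by simpa using hp), Set.indicator_of_mem hp, mul_one]
  · rw [Set.indicator_of_notMem (by simpa using hp), Set.indicator_of_notMem hp, mul_zero, zero_mul]

/-- For the functions of a sector the bound involves the horizontal orbit only. -/
theorem exists_orb_gauss_le (g : ℕ) : ∃ C : ℝ, 0 < C ∧ ∀ (α : SpR g) (ν : ℝ) (f : Nil g → ℂ),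
    IsSmooth f → IsSector ν f → ∀ m,
    ∫⁻ y, ENNReal.ofReal (Real.exp (-Real.pi * qY y)) * ‖orb α f m y‖ₑ ^ 2 ≤
      ENNReal.ofReal (C * siegelHeight α ^ (1 / 2 : ℝ)) * ∫⁻ m, ‖f m‖ₑ ^ 2 ∂(haarNil g) := by
  obtain ⟨C, hC, h⟩ := exists_slab_gauss_le g
  refine ⟨2 * C, by positivity, fun α ν f hf hν m => ?_⟩
  have h1 := h α m (fun m => ‖f m‖ₑ ^ 2) (hf.measurable.enorm.pow_const 2)
  have e : ∀ p : (Fin g ⊕ Fin g → ℝ) × ℝ, ‖f (expo (-(embT α p)) • m)‖ₑ = ‖orb α f m p.1‖ₑ := by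
    intro p
    have : -(embT α p) = -(emb α p.1) + (-p.2) • basisT := by
      rw [embT]
      module
    rw [this, expo_add_smul_basisT, hν, enorm_mul, orb]
    have : ‖Complex.exp (Complex.I * ((ν * -p.2 : ℝ) : ℂ))‖ₑ = 1 := by
      rw [← ofReal_norm, mul_comm, Complex.norm_exp_ofReal_mul_I, ENNReal.ofReal_one]
    rw [this, one_mul]
  simp only [e] at h1
  have hm : Measurable fun y => ENNReal.ofReal (Real.exp (-Real.pi * qY y)) * ‖orb α f m y‖ₑ ^ 2 :=
    (ENNReal.measurable_ofReal.comp (Real.measurable_exp.comp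
      (continuous_qY.measurable.const_mul _))).mul
      ((hf.orb α m).continuous.measurable.enorm.pow_const 2)
  have h2 := lintegral_prod (μ := (volume : Measure (Fin g ⊕ Fin g → ℝ)))
    (ν := volume.restrict (Set.Ico (-1 / 4 : ℝ) (1 / 4)))
    (fun p => ENNReal.ofReal (Real.exp (-Real.pi * qY p.1)) * ‖orb α f m p.1‖ₑ ^ 2)
    (hm.comp measurable_fst).aemeasurable
  rw [slab, h2] at h1
  simp only [lintegral_const, Measure.restrict_apply MeasurableSet.univ, Set.univ_inter,
    Real.volume_Ico] at h1
  rw [lintegral_mul_const _ hm] at h1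
  -- On a sector the central coordinate only contributes a phase, so its integral is the length 1/2
  -- of the window, whence the factor 2 in the constant.
  have h3 : ENNReal.ofReal (1 / 4 - -1 / 4 : ℝ) = 2⁻¹ := by
    rw [show (1 / 4 - -1 / 4 : ℝ) = 2⁻¹ by norm_num, ENNReal.ofReal_inv_of_pos (by norm_num)]
    simp
  rw [h3] at h1
  have h4 : ENNReal.ofReal (2 * C * siegelHeight α ^ (1 / 2 : ℝ)) =
      2 * ENNReal.ofReal (C * siegelHeight α ^ (1 / 2 : ℝ)) := by
    rw [mul_assoc, ENNReal.ofReal_mul (by norm_num)]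
    simp
  rw [h4, mul_assoc]
  calc ∫⁻ y, ENNReal.ofReal (Real.exp (-Real.pi * qY y)) * ‖orb α f m y‖ₑ ^ 2
      = 2 * ((∫⁻ y, ENNReal.ofReal (Real.exp (-Real.pi * qY y)) * ‖orb α f m y‖ₑ ^ 2) * 2⁻¹) := by
        rw [mul_comm _ (2⁻¹ : ℝ≥0∞), ← mul_assoc, ENNReal.mul_inv_cancel (by norm_num) (by norm_num),
          one_mul]
    _ ≤ _ := by gcongr

theorem integral_exp_neg_mul_qY {b : ℝ} (hb : 0 < b) :
    ∫ y : Fin g ⊕ Fin g → ℝ, Real.exp (-b * qY y) = (Real.pi / b) ^ g := by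
  have h := GaussianFourier.integral_cexp_neg_mul_sum_add (ι := Fin g ⊕ Fin g)
    (b := (b : ℂ)) (by simpa using hb) 0
  have e : ∀ y : Fin g ⊕ Fin g → ℝ, Complex.exp (-(b : ℂ) * ∑ i, (y i : ℂ) ^ 2 +
      ∑ i, (0 : Fin g ⊕ Fin g → ℂ) i * y i) = ((Real.exp (-b * qY y) : ℝ) : ℂ) := by
    intro y
    simp [qY]
  have e2 : ((Fintype.card (Fin g ⊕ Fin g) : ℕ) / 2 : ℂ) = (g : ℕ) := by
    rw [Fintype.card_sum, Fintype.card_fin]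
    push_cast
    ring
  rw [integral_congr_ae (Filter.Eventually.of_forall e), integral_complex_ofReal, e2,
    Complex.cpow_natCast] at h
  simp only [Pi.zero_apply, ne_eq, OfNat.ofNat_ne_zero, not_false_eq_true, zero_pow,
    Finset.sum_const_zero, zero_div, Complex.exp_zero, mul_one] at h
  exact_mod_cast h

end Coordinates
end HeisNil
end

/-! ### Gaussian averages of eigenfunctions -/

noncomputable section
namespace HeisNil
open MeasureTheory Filter Topology

section Heat
variable {g : ℕ} {f : Nil g → ℂ} {ν : ℝ} {α : SpR g}

theorem radialProfile_gauss {a : ℝ} (ha : 1 ≤ a) : RadialProfile (fun r => Real.exp (-a * r))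
    (fun r => -a * Real.exp (-a * r)) (fun r => a ^ 2 * Real.exp (-a * r)) := by
  have h : ∀ r, HasDerivAt (fun r => Real.exp (-a * r)) (-a * Real.exp (-a * r)) r := by
    intro r
    have h1 : HasDerivAt (fun r => -a * r) (-a) r := by
      simpa using (hasDerivAt_id r).const_mul (-a)
    exact h1.exp.congr_deriv (mul_comm _ _)
  refine ⟨h, fun r => ((h r).const_mul (-a)).congr_deriv (by ring), by fun_prop, a ^ 2, ?_⟩
  intro r hr
  have h1 : Real.exp (-a * r) ≤ Real.exp (-r) := Real.exp_le_exp.2 (by nlinarith)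
  have h0 := Real.exp_pos (-a * r)
  have h2 := Real.exp_pos (-r)
  rw [abs_of_pos h0, abs_mul, abs_mul, abs_of_pos h0, abs_neg, abs_of_nonneg (by linarith : 0 ≤ a),
    abs_of_nonneg (sq_nonneg a)]
  have h3 : a * Real.exp (-a * r) ≤ a * Real.exp (-r) := by gcongr
  have h4 : a ≤ a ^ 2 := by nlinarith
  refine ⟨by nlinarith, by nlinarith, by gcongr⟩

/-- The Gaussian averages of `f` along horizontal vectors. -/
def gaussAvg (α : SpR g) (f : Nil g → ℂ) (m : Nil g) (a : ℝ) : ℂ :=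
  avgY α (fun y => (Real.exp (-a * qY y) : ℂ)) f m

theorem hasDerivAt_gaussAvg (hf : IsSmooth f) (m : Nil g) {a : ℝ} (ha : 1 < a) :
    HasDerivAt (gaussAvg α f m)
      (-avgY α (fun y => ((qY y * Real.exp (-a * qY y) : ℝ) : ℂ)) f m) a := by
  obtain ⟨C, hC0, hC⟩ := exists_bound_of_continuous hf.continuous
  have hG : ∀ b : ℝ, 1 ≤ b → Integrable fun y : Fin g ⊕ Fin g → ℝ => (Real.exp (-b * qY y) : ℂ) :=
    fun b hb => (radialProfile_gauss hb).integrable0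
  have hq : ∀ b : ℝ, 1 ≤ b → Integrable fun y : Fin g ⊕ Fin g → ℝ =>
      ((qY y : ℂ) * (Real.exp (-b * qY y) : ℂ)) := fun b hb =>
    (radialProfile_gauss hb).integrable_mul (H := fun r => Real.exp (-b * r)) (Or.inl rfl)
      continuous_qY (M := 1) fun y => by
        have := qY_nonneg y
        rw [abs_of_nonneg this]
        linarith
  have hmeas : ∀ b : ℝ, AEStronglyMeasurable
      (fun y => (Real.exp (-b * qY y) : ℂ) * orb α f m y) volume := fun b => by
    have h1 : Continuous fun y : Fin g ⊕ Fin g → ℝ => (Real.exp (-b * qY y) : ℂ) :=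
      Complex.continuous_ofReal.comp (Real.continuous_exp.comp (continuous_qY.const_mul _))
    exact (h1.mul (hf.orb α m).continuous).aestronglyMeasurable
  have main := hasDerivAt_integral_of_dominated_loc_of_deriv_le (μ := volume) (𝕜 := ℝ)
    (F := fun b y => (Real.exp (-b * qY y) : ℂ) * orb α f m y)
    (F' := fun b y => -((qY y : ℂ) * (Real.exp (-b * qY y) : ℂ)) * orb α f m y)
    (x₀ := a) (bound := fun y => ‖(qY y : ℂ) * (Real.exp (-1 * qY y) : ℂ)‖ * C) (s := Set.Ioi 1)
    (Ioi_mem_nhds ha) (Eventually.of_forall hmeas)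
    (hf.integrable_mul_orb α (hG a ha.le) m)
    (hf.integrable_mul_orb α (hq a ha.le).neg m).aestronglyMeasurable
    (Eventually.of_forall fun y b hb => by
      rw [norm_mul, norm_neg, norm_mul, norm_mul]
      have hb' : (1 : ℝ) < b := hb
      gcongr
      · rw [Complex.norm_real, Complex.norm_real, Real.norm_of_nonneg (Real.exp_pos _).le,
          Real.norm_of_nonneg (Real.exp_pos _).le, Real.exp_le_exp]
        have := qY_nonneg y
        nlinarith
      · exact hC _)
    ((hq 1 le_rfl).norm.mul_const C)
    (Eventually.of_forall fun y b _ => by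
      have h1 : HasDerivAt (fun b : ℝ => -b * qY y) (-qY y) b := by
        simpa using (hasDerivAt_neg b).mul_const (qY y)
      have h2 := (h1.exp.ofReal_comp).mul_const (orb α f m y)
      refine h2.congr_deriv ?_
      push_cast
      ring)
  refine main.2.congr_deriv ?_
  rw [avgY, ← integral_neg]
  congr 1
  ext y
  push_cast
  ring

/-- The differential equation of the Gaussian averages of an eigenfunction. -/
theorem gaussAvg_ode (hf : IsSmooth f) (hν : IsSector ν f) {lam : ℝ}
    (he : ∀ m, opL α f m = lam * f m) (m : Nil g) {a : ℝ} (ha : 1 ≤ a) :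
    ((4 * a ^ 2 - ν ^ 2 / 4 : ℝ) : ℂ) *
      (-avgY α (fun y => ((qY y * Real.exp (-a * qY y) : ℝ) : ℂ)) f m) =
      ((lam - 1 - ν ^ 2 - 4 * g * a : ℝ) : ℂ) * gaussAvg α f m a := by
  have h := (radialProfile_gauss ha).avgY_opL hf hν α m
  have h1 : avgY α (fun y => (Real.exp (-a * qY y) : ℂ)) (opL α f) m = lam * gaussAvg α f m a := by
    rw [gaussAvg, avgY, avgY, ← integral_const_mul]
    congr 1
    ext y
    simp only [orb, he]
    ring
  have hq : Integrable fun y : Fin g ⊕ Fin g → ℝ =>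
      ((qY y * Real.exp (-a * qY y) : ℝ) : ℂ) := by
    have := (radialProfile_gauss ha).integrable_mul (H := fun r => Real.exp (-a * r)) (Or.inl rfl)
      continuous_qY (g := g) (M := 1) fun y => by
        have := qY_nonneg y
        rw [abs_of_nonneg this]
        linarith
    simpa only [Complex.ofReal_mul] using this
  -- For the profile `e^{-ar}` the twisted Laplacian gives `((4a² - ν²/4) r - 4ga) e^{-ar}`, and `r
  -- e^{-ar}` is minus the derivative in `a`. So the eigenvalue equation becomes a first order
  -- linear equation in the variable `a`.
  have h2 : avgY α (fun y => (radialLap g ν (fun r => Real.exp (-a * r))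
      (fun r => -a * Real.exp (-a * r)) (fun r => a ^ 2 * Real.exp (-a * r)) (qY y) : ℂ)) f m =
      ((4 * a ^ 2 - ν ^ 2 / 4 : ℝ) : ℂ) *
        avgY α (fun y => ((qY y * Real.exp (-a * qY y) : ℝ) : ℂ)) f m -
      ((4 * g * a : ℝ) : ℂ) * gaussAvg α f m a := by
    rw [gaussAvg, avgY, avgY, avgY, ← integral_const_mul, ← integral_const_mul,
      ← integral_sub ((hf.integrable_mul_orb α hq m).const_mul _)
        ((hf.integrable_mul_orb α (radialProfile_gauss ha).integrable0 m).const_mul _)]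
    congr 1
    ext y
    simp only [radialLap]
    push_cast
    ring
  rw [h1, h2, ← gaussAvg] at h
  push_cast at h ⊢
  linear_combination -h

theorem qY_smul (c : ℝ) (y : Fin g ⊕ Fin g → ℝ) : qY (c • y) = c ^ 2 * qY y := by
  simp only [qY, Pi.smul_apply, smul_eq_mul, mul_pow, Finset.mul_sum]

/-- The normalised Gaussians are an approximate identity: rescale `y` by `a^{-1/2}` and let the
dominated limit act on the bounded continuous orbit function. The normalisation is `(a/π)^g` because
there are `2g` variables. -/
theorem tendsto_gaussAvg (hf : IsSmooth f) (m : Nil g) :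
    Tendsto (fun a : ℝ => ((a / Real.pi : ℝ) : ℂ) ^ g * gaussAvg α f m a) atTop (𝓝 (f m)) := by
  obtain ⟨C, hC0, hC⟩ := exists_bound_of_continuous hf.continuous
  have hcont : Continuous (orb α f m) := (hf.orb α m).continuous
  have hint : Integrable fun y : Fin g ⊕ Fin g → ℝ => (Real.exp (-1 * qY y) : ℂ) :=
    (radialProfile_gauss le_rfl).integrable0
  have h1 : Tendsto (fun a : ℝ => ∫ y, (Real.exp (-1 * qY y) : ℂ) * orb α f m ((Real.sqrt a)⁻¹ • y))
      atTop (𝓝 (∫ y : Fin g ⊕ Fin g → ℝ, (Real.exp (-1 * qY y) : ℂ) * f m)) := by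
    refine tendsto_integral_filter_of_dominated_convergence
      (fun y => ‖(Real.exp (-1 * qY y) : ℂ)‖ * C) (Eventually.of_forall fun a => ?_)
      (Eventually.of_forall fun a => Eventually.of_forall fun y => ?_) (hint.norm.mul_const C)
      (Eventually.of_forall fun y => ?_)
    · exact hint.aestronglyMeasurable.mul
        (hcont.comp (continuous_const_smul _)).aestronglyMeasurable
    · rw [norm_mul]
      exact mul_le_mul_of_nonneg_left (hC _) (norm_nonneg _)
    · refine Tendsto.const_mul _ ?_
      have h2 : Tendsto (fun a : ℝ => (Real.sqrt a)⁻¹ • y) atTop (𝓝 0) := by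
        have := (tendsto_inv_atTop_zero.comp Real.tendsto_sqrt_atTop).smul_const y
        rwa [zero_smul] at this
      have h3 := (hcont.tendsto 0).comp h2
      have h4 : orb α f m 0 = f m := by
        rw [orb, map_zero, neg_zero, expo_zero, one_smul]
      rwa [h4] at h3
  have h2 : ∫ y : Fin g ⊕ Fin g → ℝ, (Real.exp (-1 * qY y) : ℂ) * f m = (Real.pi : ℂ) ^ g * f m := by
    rw [integral_mul_const, integral_complex_ofReal, integral_exp_neg_mul_qY one_pos, div_one]
    push_cast
    rfl
  rw [h2] at h1
  have h3 := h1.const_mul (((Real.pi : ℂ) ^ g)⁻¹)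
  have hpi : ((Real.pi : ℂ) ^ g) ≠ 0 := pow_ne_zero _ (by exact_mod_cast Real.pi_ne_zero)
  rw [inv_mul_cancel_left₀ hpi] at h3
  refine h3.congr' ?_
  filter_upwards [eventually_gt_atTop 0] with a ha
  have h4 := Measure.integral_comp_smul (volume : Measure (Fin g ⊕ Fin g → ℝ))
    (fun y => (Real.exp (-a * qY y) : ℂ) * orb α f m y) (Real.sqrt a)⁻¹
  have hs : (Real.sqrt a) ^ 2 = a := Real.sq_sqrt ha.le
  have hs0 : Real.sqrt a ≠ 0 := (Real.sqrt_pos.2 ha).ne'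
  have e1 : ∀ y : Fin g ⊕ Fin g → ℝ, -a * qY ((Real.sqrt a)⁻¹ • y) = -1 * qY y := by
    intro y
    rw [qY_smul, inv_pow, hs]
    field_simp
  simp only [e1] at h4
  rw [h4]
  have e2 : |((Real.sqrt a)⁻¹ ^ Module.finrank ℝ (Fin g ⊕ Fin g → ℝ))⁻¹| = a ^ g := by
    rw [Module.finrank_fintype_fun_eq_card, Fintype.card_sum, Fintype.card_fin, inv_pow, inv_inv,
      ← two_mul, pow_mul, hs, abs_of_pos (pow_pos ha g)]
  rw [e2, Complex.real_smul, gaussAvg, avgY]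
  push_cast
  rw [div_pow]
  field_simp

end Heat
end HeisNil
end

/-! ### Mehler's formula for the heat flow -/

noncomputable section
namespace HeisNil
open MeasureTheory Filter Topology

section HeatSolution
variable {g : ℕ} {f : Nil g → ℂ} {ν : ℝ} {α : SpR g}

/-- The Gaussian parameter of Mehler's kernel at time `t`. -/
def mehlerA (w t : ℝ) : ℝ := w / 4 * (Real.cosh (w * t) / Real.sinh (w * t))

/-- The normalisation of Mehler's kernel at time `t`. -/
def mehlerC (g : ℕ) (w t : ℝ) : ℝ := (w / (4 * Real.pi * Real.sinh (w * t))) ^ g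

theorem hasDerivAt_sinh_mul (w t : ℝ) :
    HasDerivAt (fun t => Real.sinh (w * t)) (w * Real.cosh (w * t)) t := by
  have h : HasDerivAt (fun t => w * t) w t := by simpa using (hasDerivAt_id t).const_mul w
  exact h.sinh.congr_deriv (mul_comm _ _)

theorem hasDerivAt_cosh_mul (w t : ℝ) :
    HasDerivAt (fun t => Real.cosh (w * t)) (w * Real.sinh (w * t)) t := by
  have h : HasDerivAt (fun t => w * t) w t := by simpa using (hasDerivAt_id t).const_mul w
  exact h.cosh.congr_deriv (mul_comm _ _)

/-- The Riccati equation: the speed of `A` cancels the leading coefficient `4a² - ν²/4` of the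
equation of `gaussAvg` for `w = |ν|`. -/
theorem hasDerivAt_mehlerA {w t : ℝ} (hw : 0 < w) (ht : 0 < t) :
    HasDerivAt (mehlerA w) (-(4 * mehlerA w t ^ 2 - w ^ 2 / 4)) t := by
  have hs : Real.sinh (w * t) ≠ 0 := (Real.sinh_pos_iff.2 (mul_pos hw ht)).ne'
  have h := ((hasDerivAt_cosh_mul w t).div (hasDerivAt_sinh_mul w t) hs).const_mul (w / 4)
  refine h.congr_deriv ?_
  have h2 := Real.cosh_sq (w * t)
  rw [mehlerA]
  field_simp
  linear_combination (w ^ 2 * 0) * h2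

/-- The logarithmic derivative `-4gA` compensates the term `-4ga` on the right of that equation. -/
theorem hasDerivAt_mehlerC {w t : ℝ} (hw : 0 < w) (ht : 0 < t) :
    HasDerivAt (mehlerC g w) (-(4 * g * mehlerA w t) * mehlerC g w t) t := by
  have hs : Real.sinh (w * t) ≠ 0 := (Real.sinh_pos_iff.2 (mul_pos hw ht)).ne'
  have hpi := Real.pi_ne_zero
  have h1 : HasDerivAt (fun t => w / (4 * Real.pi * Real.sinh (w * t)))
      (-(4 * mehlerA w t) * (w / (4 * Real.pi * Real.sinh (w * t)))) t := by
    have h := (hasDerivAt_const t w).div ((hasDerivAt_sinh_mul w t).const_mul (4 * Real.pi))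
      (mul_ne_zero (by positivity) hs)
    refine h.congr_deriv ?_
    rw [mehlerA]
    field_simp
    ring
  refine (h1.pow g).congr_deriv ?_
  rcases Nat.eq_zero_or_pos g with rfl | hg
  · simp
  · obtain ⟨k, rfl⟩ := Nat.exists_eq_succ_of_ne_zero hg.ne'
    simp only [mehlerC, Nat.succ_eq_add_one, Nat.add_sub_cancel, pow_succ]
    ring

/-- As `coth ≥ 1`, the Gaussian parameter stays bounded below at all times; with `|ν| ≥ 4π` the
Gaussians are never wider than `e^{-π|y|²}`. -/
theorem div_four_le_mehlerA {w t : ℝ} (hw : 0 < w) (ht : 0 < t) : w / 4 ≤ mehlerA w t := by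
  have hs : 0 < Real.sinh (w * t) := Real.sinh_pos_iff.2 (mul_pos hw ht)
  have h : 1 ≤ Real.cosh (w * t) / Real.sinh (w * t) := by
    rw [le_div_iff₀ hs, one_mul]
    exact (Real.sinh_lt_cosh _).le
  rw [mehlerA]
  nlinarith

theorem tendsto_mehlerA {w : ℝ} (hw : 0 < w) : Tendsto (mehlerA w) (𝓝[>] 0) atTop := by
  have h1 : Tendsto (fun t => Real.sinh (w * t)) (𝓝[>] 0) (𝓝[>] 0) := by
    refine tendsto_nhdsWithin_of_tendsto_nhds_of_eventually_within _ ?_ ?_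
    · have h : Continuous fun t => Real.sinh (w * t) := by fun_prop
      have := h.tendsto 0
      simp only [mul_zero, Real.sinh_zero] at this
      exact this.mono_left nhdsWithin_le_nhds
    · filter_upwards [self_mem_nhdsWithin] with t ht
      exact Real.sinh_pos_iff.2 (mul_pos hw ht)
  have h2 : Tendsto (fun t => Real.cosh (w * t)) (𝓝[>] 0) (𝓝 1) := by
    have h : Continuous fun t => Real.cosh (w * t) := by fun_prop
    have := h.tendsto 0
    simp only [mul_zero, Real.cosh_zero] at this
    exact this.mono_left nhdsWithin_le_nhds
  have h3 := (h2.pos_mul_atTop one_pos (tendsto_inv_nhdsGT_zero.comp h1)).const_mul_atTop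
    (by positivity : 0 < w / 4)
  exact h3

theorem mehlerC_eq {w t : ℝ} (hw : 0 < w) (ht : 0 < t) :
    mehlerC g w t = (Real.cosh (w * t) ^ g)⁻¹ * (mehlerA w t / Real.pi) ^ g := by
  have hs : Real.sinh (w * t) ≠ 0 := (Real.sinh_pos_iff.2 (mul_pos hw ht)).ne'
  have hc : Real.cosh (w * t) ≠ 0 := (Real.cosh_pos _).ne'
  have hpi := Real.pi_ne_zero
  rw [← inv_pow, ← mul_pow, mehlerC, mehlerA]
  congr 1
  field_simp

/-- The heat flow of an eigenfunction through Mehler's kernel. -/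
theorem mehler_gaussAvg (hf : IsSmooth f) (hν : IsSector ν f) {lam : ℝ}
    (he : ∀ m, opL α f m = lam * f m) (hw : 4 < |ν|) (m : Nil g) {t : ℝ} (ht : 0 < t) :
    (mehlerC g |ν| t : ℂ) * gaussAvg α f m (mehlerA |ν| t) =
      (Real.exp (-(lam - 1 - ν ^ 2) * t) : ℂ) * f m := by
  set w := |ν| with hwdef
  have hw0 : 0 < w := by linarith
  have hw2 : ν ^ 2 = w ^ 2 := (sq_abs ν).symm
  have hA : ∀ t, 0 < t → 1 < mehlerA w t := fun t ht => by
    have := div_four_le_mehlerA hw0 ht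
    linarith
  set F : ℝ → ℂ := fun t => (Real.exp ((lam - 1 - ν ^ 2) * t) : ℂ) *
    ((mehlerC g w t : ℂ) * gaussAvg α f m (mehlerA w t)) with hF
  -- The equations of `A`, of `C` and of the Gaussian averages combine so that `F` is constant on `t
  -- > 0`; its limit at `0` is `f m`.
  have hderiv : ∀ t, 0 < t → HasDerivAt F 0 t := by
    intro t ht
    have h1 := (hasDerivAt_gaussAvg (α := α) hf m (hA t ht)).scomp t (hasDerivAt_mehlerA hw0 ht)
    have h2 := (hasDerivAt_mehlerC (g := g) hw0 ht).ofReal_comp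
    have h3 : HasDerivAt (fun t => (lam - 1 - ν ^ 2) * t) (lam - 1 - ν ^ 2) t := by
      simpa using (hasDerivAt_id t).const_mul (lam - 1 - ν ^ 2)
    have h4 := h3.exp.ofReal_comp.mul (h2.mul h1)
    refine h4.congr_deriv ?_
    have ode := gaussAvg_ode hf hν he m (hA t ht).le
    rw [hw2] at ode
    simp only [Function.comp_apply, Complex.real_smul, Pi.mul_apply]
    rw [hw2]
    push_cast at ode ⊢
    linear_combination (-(Complex.exp ((lam - 1 - w ^ 2) * t)) * (mehlerC g w t : ℂ)) * ode
  have hconst : ∀ t', 0 < t' → F t' = F t := by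
    intro t' ht'
    exact isOpen_Ioi.is_const_of_deriv_eq_zero (isPreconnected_Ioi)
      (fun x hx => (hderiv x hx).differentiableAt.differentiableWithinAt)
      (fun x hx => (hderiv x hx).deriv) (Set.mem_Ioi.2 ht') (Set.mem_Ioi.2 ht)
  have hlim : Tendsto F (𝓝[>] 0) (𝓝 (f m)) := by
    have h1 := (tendsto_gaussAvg (α := α) hf m).comp (tendsto_mehlerA hw0)
    have h2 : Tendsto (fun t => (((Real.cosh (w * t) ^ g)⁻¹ *
        Real.exp ((lam - 1 - ν ^ 2) * t) : ℝ) : ℂ)) (𝓝[>] 0) (𝓝 1) := by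
      have h : ContinuousAt (fun t => (((Real.cosh (w * t) ^ g)⁻¹ *
        Real.exp ((lam - 1 - ν ^ 2) * t) : ℝ) : ℂ)) 0 := by
        refine Complex.continuous_ofReal.continuousAt.comp ?_
        refine ContinuousAt.mul (ContinuousAt.inv₀ (by fun_prop) ?_) (by fun_prop)
        simp
      have := h.tendsto
      simp only [mul_zero, Real.cosh_zero, one_pow, inv_one, Real.exp_zero, mul_one,
        Complex.ofReal_one] at this
      exact this.mono_left nhdsWithin_le_nhds
    have h3 := h2.mul h1
    rw [one_mul] at h3
    refine h3.congr' ?_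
    filter_upwards [self_mem_nhdsWithin] with t ht
    simp only [hF, Function.comp_apply, mehlerC_eq hw0 ht]
    push_cast
    ring
  have hlim2 : Tendsto F (𝓝[>] 0) (𝓝 (F t)) := by
    refine tendsto_const_nhds.congr' ?_
    filter_upwards [self_mem_nhdsWithin] with t' ht'
    exact (hconst t' ht').symm
  have h := tendsto_nhds_unique hlim2 hlim
  rw [← h, hF, ← mul_assoc, ← Complex.ofReal_mul, ← Real.exp_add]
  rw [show -(lam - 1 - ν ^ 2) * t + (lam - 1 - ν ^ 2) * t = 0 by ring, Real.exp_zero,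
    Complex.ofReal_one, one_mul]

theorem lintegral_mul_sq_le {X : Type*} [MeasurableSpace X] {μ : Measure X} {A B : X → ℝ≥0∞}
    (hA : AEMeasurable A μ) (hB : AEMeasurable B μ) :
    (∫⁻ x, A x * B x ∂μ) ^ 2 ≤ (∫⁻ x, A x ^ 2 ∂μ) * ∫⁻ x, B x ^ 2 ∂μ := by
  have h := ENNReal.lintegral_mul_le_Lp_mul_Lq μ Real.HolderConjugate.two_two hA hB
  calc (∫⁻ x, A x * B x ∂μ) ^ 2
      ≤ ((∫⁻ x, A x ^ (2 : ℝ) ∂μ) ^ (1 / 2 : ℝ) * (∫⁻ x, B x ^ (2 : ℝ) ∂μ) ^ (1 / 2 : ℝ)) ^ 2 := by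
        gcongr
        exact h
    _ = _ := by
        rw [mul_pow, ← ENNReal.rpow_natCast, ← ENNReal.rpow_natCast, ← ENNReal.rpow_mul,
          ← ENNReal.rpow_mul]
        norm_num

/-- Cauchy–Schwarz with `e^{-a|y|²}` split into two equal factors: one integrates to `(π/a)^g`, the
other leaves `e^{-a|y|²} ≤ e^{-π|y|²}` against `|f|²`. -/
theorem enorm_gaussAvg_sq_le (hf : IsSmooth f) (m : Nil g) {a : ℝ} (ha : Real.pi ≤ a) :
    ‖gaussAvg α f m a‖ₑ ^ 2 ≤ ENNReal.ofReal ((Real.pi / a) ^ g) *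
      ∫⁻ y, ENNReal.ofReal (Real.exp (-Real.pi * qY y)) * ‖orb α f m y‖ₑ ^ 2 := by
  have ha0 : 0 < a := Real.pi_pos.trans_le ha
  have hexp : Measurable fun y : Fin g ⊕ Fin g → ℝ =>
      ENNReal.ofReal (Real.exp (-(a / 2) * qY y)) :=
    ENNReal.measurable_ofReal.comp (Real.measurable_exp.comp (continuous_qY.measurable.const_mul _))
  have horb : Measurable fun y => ‖orb α f m y‖ₑ := (hf.orb α m).continuous.measurable.enorm
  have hsq : ∀ y : Fin g ⊕ Fin g → ℝ, ENNReal.ofReal (Real.exp (-(a / 2) * qY y)) *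
      ENNReal.ofReal (Real.exp (-(a / 2) * qY y)) = ENNReal.ofReal (Real.exp (-a * qY y)) := by
    intro y
    rw [← ENNReal.ofReal_mul (Real.exp_pos _).le, ← Real.exp_add]
    ring_nf
  have h1 : ‖gaussAvg α f m a‖ₑ ≤ ∫⁻ y, ENNReal.ofReal (Real.exp (-(a / 2) * qY y)) *
      (ENNReal.ofReal (Real.exp (-(a / 2) * qY y)) * ‖orb α f m y‖ₑ) := by
    refine (enorm_integral_le_lintegral_enorm _).trans (le_of_eq (lintegral_congr fun y => ?_))
    rw [enorm_mul, ← mul_assoc, hsq, ← ofReal_norm, Complex.norm_real,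
      Real.norm_of_nonneg (Real.exp_pos _).le]
  have h2 : ∫⁻ y : Fin g ⊕ Fin g → ℝ, ENNReal.ofReal (Real.exp (-(a / 2) * qY y)) ^ 2 =
      ENNReal.ofReal ((Real.pi / a) ^ g) := by
    simp only [sq, hsq]
    rw [← integral_exp_neg_mul_qY ha0, ofReal_integral_eq_lintegral_ofReal
      (integrable_exp_neg_mul_qY ha0) (Eventually.of_forall fun _ => (Real.exp_pos _).le)]
  calc ‖gaussAvg α f m a‖ₑ ^ 2 ≤ (∫⁻ y, ENNReal.ofReal (Real.exp (-(a / 2) * qY y)) *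
      (ENNReal.ofReal (Real.exp (-(a / 2) * qY y)) * ‖orb α f m y‖ₑ)) ^ 2 := by gcongr
    _ ≤ _ := lintegral_mul_sq_le hexp.aemeasurable (hexp.mul horb).aemeasurable
    _ ≤ _ := by
      rw [h2]
      gcongr with y
      rw [mul_pow, sq (ENNReal.ofReal _), hsq]
      gcongr
      have := qY_nonneg y
      nlinarith

end HeatSolution
end HeisNil
end

/-! ### Pointwise bounds on one central frequency -/

noncomputable section
namespace HeisNil
open MeasureTheory Filter Topology

section SectorBound
variable {g : ℕ} {ν : ℝ} {α : SpR g} {ι : Type*} {S : Finset ι} {F : ι → Nil g → ℂ} {lam : ι → ℝ}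

theorem IsSector.sum (hF : ∀ i ∈ S, IsSector ν (F i)) : IsSector ν fun m => ∑ i ∈ S, F i m := by
  intro t m
  simp only [Finset.mul_sum]
  exact Finset.sum_congr rfl fun i hi => hF i hi t m

theorem IsSector.const_mul {f : Nil g → ℂ} (hf : IsSector ν f) (c : ℂ) :
    IsSector ν fun m => c * f m := by
  intro t m
  simp only [hf t m]
  ring

theorem opL_add {f h : Nil g → ℂ} (hf : IsSmooth f) (hh : IsSmooth h) (α : SpR g) (m : Nil g) :
    opL α (fun m => f m + h m) m = opL α f m + opL α h m := by
  have h1 : ∀ V : HeisAlg g, lieDer V (lieDer V fun m => f m + h m) m =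
      lieDer V (lieDer V f) m + lieDer V (lieDer V h) m := by
    intro V
    have e : lieDer V (fun m => f m + h m) = fun m => lieDer V f m + lieDer V h m :=
      funext fun m => lieDer_add hf hh V m
    rw [e, lieDer_add (hf.lieDer V) (hh.lieDer V)]
  simp only [opL_eq, h1, Finset.sum_add_distrib]
  ring

theorem opL_const_mul {f : Nil g → ℂ} (hf : IsSmooth f) (c : ℂ) (α : SpR g) (m : Nil g) :
    opL α (fun m => c * f m) m = c * opL α f m := by
  have h1 : ∀ V : HeisAlg g, lieDer V (lieDer V fun m => c * f m) m =
      c * lieDer V (lieDer V f) m := by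
    intro V
    have e : lieDer V (fun m => c * f m) = fun m => c * lieDer V f m :=
      funext fun m => lieDer_const_mul hf c V m
    rw [e, lieDer_const_mul (hf.lieDer V)]
  simp only [opL_eq, h1, ← Finset.mul_sum]
  ring

theorem gaussAvg_sum (hF : ∀ i ∈ S, IsSmooth (F i)) (m : Nil g) {a : ℝ} (ha : 1 ≤ a) :
    gaussAvg α (fun m => ∑ i ∈ S, F i m) m a = ∑ i ∈ S, gaussAvg α (F i) m a := by
  simp only [gaussAvg, avgY]
  rw [← integral_finsetSum _ fun i hi =>
    (hF i hi).integrable_mul_orb α (radialProfile_gauss ha).integrable0 m]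
  congr 1
  ext y
  simp only [orb, Finset.mul_sum]

/-- The left side is `(w / (4π sinh(wt) cosh(wt)))^g`, and `sinh(wt) cosh(wt) ≥ wt`. The frequency
thus disappears from the bound. -/
theorem mehlerC_sq_mul_le {w t : ℝ} (hw : 0 < w) (ht : 0 < t) :
    mehlerC g w t ^ 2 * (Real.pi / mehlerA w t) ^ g ≤ (1 / (4 * Real.pi * t)) ^ g := by
  have hs : 0 < Real.sinh (w * t) := Real.sinh_pos_iff.2 (mul_pos hw ht)
  have hc : 1 ≤ Real.cosh (w * t) := Real.one_le_cosh _
  have hc0 : 0 < Real.cosh (w * t) := by linarith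
  have hst : w * t ≤ Real.sinh (w * t) := Real.self_le_sinh_iff.2 (mul_pos hw ht).le
  have hpi := Real.pi_pos
  have e : mehlerC g w t ^ 2 * (Real.pi / mehlerA w t) ^ g =
      (w / (4 * Real.pi * (Real.sinh (w * t) * Real.cosh (w * t)))) ^ g := by
    rw [mehlerC, mehlerA, ← pow_mul, mul_comm g 2, pow_mul, ← mul_pow]
    congr 1
    field_simp
  rw [e]
  refine pow_le_pow_left₀ (by positivity) ?_ g
  rw [div_le_div_iff₀ (by positivity) (by positivity)]
  have h1 : w * t ≤ Real.sinh (w * t) * Real.cosh (w * t) := by nlinarith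
  nlinarith

/-- Mehler's kernel depends on the frequency but not on the eigenvalue, so the damped sum is one
Gaussian average of the undamped sum, to which the orbit bound applies. -/
theorem exists_heat_bound (g : ℕ) : ∃ C : ℝ, 0 < C ∧ ∀ (α : SpR g) (ν : ℝ) {ι : Type} (S : Finset ι)
    (F : ι → Nil g → ℂ) (lam : ι → ℝ), 4 * Real.pi ≤ |ν| → (∀ i ∈ S, IsSmooth (F i)) →
    (∀ i ∈ S, IsSector ν (F i)) → (∀ i ∈ S, ∀ m, opL α (F i) m = lam i * F i m) →
    ∀ (m : Nil g) (t : ℝ), 0 < t →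
    ‖∑ i ∈ S, (Real.exp (-(lam i - 1 - ν ^ 2) * t) : ℂ) * F i m‖ ^ 2 ≤
      (1 / (4 * Real.pi * t)) ^ g * (C * siegelHeight α ^ (1 / 2 : ℝ)) *
        ∫ m, ‖∑ i ∈ S, F i m‖ ^ 2 ∂(haarNil g) := by
  obtain ⟨C, hC, h⟩ := exists_orb_gauss_le g
  refine ⟨C, hC, fun α ν ι S F lam hν hF hs he m t ht => ?_⟩
  have hpi := Real.pi_gt_three
  have hw0 : 0 < |ν| := by linarith
  have hA := div_four_le_mehlerA hw0 ht
  have hApi : Real.pi ≤ mehlerA |ν| t := by linarith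
  have hA0 : 0 < mehlerA |ν| t := by linarith
  have hH : 0 < siegelHeight α := siegelHeight_pos α
  set h0 : Nil g → ℂ := fun m => ∑ i ∈ S, F i m with hh0
  have hsm : IsSmooth h0 := IsSmooth.sum hF
  have e1 : ∑ i ∈ S, (Real.exp (-(lam i - 1 - ν ^ 2) * t) : ℂ) * F i m =
      (mehlerC g |ν| t : ℂ) * gaussAvg α h0 m (mehlerA |ν| t) := by
    rw [hh0, gaussAvg_sum hF m (by linarith), Finset.mul_sum]
    exact Finset.sum_congr rfl fun i hi =>
      (mehler_gaussAvg (hF i hi) (hs i hi) (he i hi) (by linarith) m ht).symm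
  have hint : Integrable (fun m => ‖h0 m‖ ^ 2) (haarNil g) := by
    refine (integrable_of_continuous (hsm.mul hsm.conj).continuous).norm.congr
      (Eventually.of_forall fun m => ?_)
    simp [sq]
  have e2 : ∫⁻ m, ‖h0 m‖ₑ ^ 2 ∂(haarNil g) = ENNReal.ofReal (∫ m, ‖h0 m‖ ^ 2 ∂(haarNil g)) := by
    rw [ofReal_integral_eq_lintegral_ofReal hint (Eventually.of_forall fun _ => sq_nonneg _)]
    refine lintegral_congr fun m => ?_
    rw [ENNReal.ofReal_pow (norm_nonneg _), ofReal_norm]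
  have hN : 0 ≤ ∫ m, ‖h0 m‖ ^ 2 ∂(haarNil g) := integral_nonneg fun _ => sq_nonneg _
  have h1 := (enorm_gaussAvg_sq_le (α := α) hsm m hApi).trans
    (mul_le_mul_right (h α ν h0 hsm (IsSector.sum hs) m) _)
  rw [e2, ← ENNReal.ofReal_mul (by positivity), ← ENNReal.ofReal_mul (by positivity), ← ofReal_norm,
    ← ENNReal.ofReal_pow (norm_nonneg _), ENNReal.ofReal_le_ofReal_iff (by positivity)] at h1
  rw [e1, norm_mul, mul_pow, Complex.norm_real, Real.norm_eq_abs, sq_abs]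
  have h2 := mehlerC_sq_mul_le (g := g) hw0 ht
  calc mehlerC g |ν| t ^ 2 * ‖gaussAvg α h0 m (mehlerA |ν| t)‖ ^ 2
      ≤ mehlerC g |ν| t ^ 2 * ((Real.pi / mehlerA |ν| t) ^ g *
        (C * siegelHeight α ^ (1 / 2 : ℝ) * ∫ m, ‖h0 m‖ ^ 2 ∂(haarNil g))) := by gcongr
    _ = mehlerC g |ν| t ^ 2 * (Real.pi / mehlerA |ν| t) ^ g *
        (C * siegelHeight α ^ (1 / 2 : ℝ) * ∫ m, ‖h0 m‖ ^ 2 ∂(haarNil g)) := by ring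
    _ ≤ (1 / (4 * Real.pi * t)) ^ g *
        (C * siegelHeight α ^ (1 / 2 : ℝ) * ∫ m, ‖h0 m‖ ^ 2 ∂(haarNil g)) := by gcongr
    _ = _ := by ring

/-- Recover `F i` from `lam i ^ (s/2) * F i` through `Γ(s/2) λ^{-s/2} = ∫ t^{s/2-1} e^{-λt} dt` and
apply the heat bound under the integral. It contributes `t^{-g/2} e^{-(1+ν²)t}`, integrable at 0
because `s > g`, and the remaining Gamma integral gives the power of `1 + ν²`. The exponent of the
height is halved because the heat bound is for squares. -/
theorem exists_sector_bound (g : ℕ) {s : ℝ} (hs : (g : ℝ) < s) : ∃ C : ℝ, 0 < C ∧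
    ∀ (α : SpR g) (ν : ℝ) {ι : Type} (S : Finset ι)
    (F : ι → Nil g → ℂ) (lam : ι → ℝ), 4 * Real.pi ≤ |ν| → (∀ i ∈ S, 0 < lam i) →
    (∀ i ∈ S, IsSmooth (F i)) →
    (∀ i ∈ S, IsSector ν (F i)) → (∀ i ∈ S, ∀ m, opL α (F i) m = lam i * F i m) →
    ∀ m : Nil g, ‖∑ i ∈ S, F i m‖ ≤ C * (1 + ν ^ 2) ^ (-((s - g) / 2)) *
      siegelHeight α ^ (1 / 4 : ℝ) *
        Real.sqrt (∫ m, ‖∑ i ∈ S, (lam i ^ (s / 2) : ℝ) * F i m‖ ^ 2 ∂(haarNil g)) := by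
  obtain ⟨C, hC, h⟩ := exists_heat_bound g
  have hg0 : (0 : ℝ) ≤ g := Nat.cast_nonneg g
  have hs0 : 0 < s / 2 := by linarith
  have hsg : 0 < (s - g) / 2 := by linarith
  have hG : 0 < Real.Gamma (s / 2) := Real.Gamma_pos_of_pos hs0
  have hG' : 0 < Real.Gamma ((s - g) / 2) := Real.Gamma_pos_of_pos hsg
  have hpi := Real.pi_pos
  set B : ℝ := (1 / (4 * Real.pi)) ^ ((g : ℝ) / 2) * Real.sqrt C with hB
  have hB0 : 0 < B := by positivity
  refine ⟨Real.Gamma ((s - g) / 2) / Real.Gamma (s / 2) * B, by positivity,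
    fun α ν ι S F lam hν hlam hF hsec he m => ?_⟩
  have hH : 0 < siegelHeight α := siegelHeight_pos α
  have hr : 0 < 1 + ν ^ 2 := by positivity
  set N : ℝ := ∫ m, ‖∑ i ∈ S, ((lam i ^ (s / 2) : ℝ) : ℂ) * F i m‖ ^ 2 ∂(haarNil g) with hN
  have hN0 : 0 ≤ N := integral_nonneg fun _ => sq_nonneg _
  set K : ℝ := B * siegelHeight α ^ (1 / 4 : ℝ) * Real.sqrt N with hK
  have hK0 : 0 ≤ K := by positivity
  have hgint : ∀ {a r : ℝ}, 0 < a → 0 < r →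
      IntegrableOn (fun t : ℝ => t ^ (a - 1) * Real.exp (-(r * t))) (Set.Ioi 0) := by
    intro a r ha hr
    have := integrableOn_rpow_mul_exp_neg_mul_rpow (p := 1) (s := a - 1) (b := r)
      (by linarith) one_pos hr
    simpa [neg_mul] using this
  -- the pointwise heat estimate
  have hpt : ∀ t : ℝ, 0 < t →
      ‖∑ i ∈ S, ((t ^ (s / 2 - 1) * Real.exp (-(lam i * t)) : ℝ) : ℂ) *
        (((lam i ^ (s / 2) : ℝ) : ℂ) * F i m)‖ ≤
      K * (t ^ ((s - g) / 2 - 1) * Real.exp (-((1 + ν ^ 2) * t))) := by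
    intro t ht
    have h1 := h α ν S (fun i m => ((lam i ^ (s / 2) : ℝ) : ℂ) * F i m) lam hν
      (fun i hi => (hF i hi).const_mul _)
      (fun i hi => (hsec i hi).const_mul _)
      (fun i hi m => by
        rw [opL_const_mul (hF i hi), he i hi]
        ring) m t ht
    rw [← hN] at h1
    have e1 : ∑ i ∈ S, ((t ^ (s / 2 - 1) * Real.exp (-(lam i * t)) : ℝ) : ℂ) *
        (((lam i ^ (s / 2) : ℝ) : ℂ) * F i m) =
        ((t ^ (s / 2 - 1) * Real.exp (-((1 + ν ^ 2) * t)) : ℝ) : ℂ) *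
        ∑ i ∈ S, (Real.exp (-(lam i - 1 - ν ^ 2) * t) : ℂ) *
          (((lam i ^ (s / 2) : ℝ) : ℂ) * F i m) := by
      rw [Finset.mul_sum]
      refine Finset.sum_congr rfl fun i _ => ?_
      rw [← mul_assoc _ (Real.exp _ : ℂ), ← Complex.ofReal_mul, mul_assoc (t ^ _), ← Real.exp_add]
      ring_nf
    have h2 : ‖∑ i ∈ S, (Real.exp (-(lam i - 1 - ν ^ 2) * t) : ℂ) *
          (((lam i ^ (s / 2) : ℝ) : ℂ) * F i m)‖ ≤ t ^ (-((g : ℝ) / 2)) * K := by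
      refine (Real.le_sqrt (norm_nonneg _) ((sq_nonneg _).trans h1) |>.2 h1).trans (le_of_eq ?_)
      have e2 : (1 / (4 * Real.pi * t)) ^ g = ((1 / (4 * Real.pi)) ^ ((g : ℝ) / 2)) ^ 2 *
          (t ^ (-((g : ℝ) / 2))) ^ 2 := by
        rw [← Real.rpow_natCast, ← Real.rpow_natCast, ← Real.rpow_natCast, ← Real.rpow_mul ht.le,
          ← Real.rpow_mul (by positivity), one_div, mul_inv, Real.mul_rpow (by positivity)
          (by positivity), Real.inv_rpow ht.le, one_div]
        push_cast
        rw [← Real.rpow_neg ht.le]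
        ring_nf
      have e3 : siegelHeight α ^ (1 / 2 : ℝ) = (siegelHeight α ^ (1 / 4 : ℝ)) ^ 2 := by
        rw [← Real.rpow_natCast, ← Real.rpow_mul hH.le]
        norm_num
      have e4 : (1 / (4 * Real.pi * t)) ^ g * (C * siegelHeight α ^ (1 / 2 : ℝ)) * N =
          (t ^ (-((g : ℝ) / 2)) * K) ^ 2 := by
        rw [e2, e3, hK, hB]
        have := Real.sq_sqrt hC.le
        have := Real.sq_sqrt hN0
        simp only [mul_pow, Real.sq_sqrt hC.le, Real.sq_sqrt hN0]
        ring
      rw [e4, Real.sqrt_sq (by positivity)]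
    rw [e1, norm_mul, Complex.norm_real, Real.norm_of_nonneg (by positivity)]
    calc _ ≤ t ^ (s / 2 - 1) * Real.exp (-((1 + ν ^ 2) * t)) * (t ^ (-((g : ℝ) / 2)) * K) := by
          gcongr
      _ = (t ^ (s / 2 - 1) * t ^ (-((g : ℝ) / 2))) * Real.exp (-((1 + ν ^ 2) * t)) * K := by ring
      _ = _ := by
        rw [← Real.rpow_add ht]
        ring_nf
  -- the Gamma integral
  have hgam : ∀ i ∈ S, ∫ t in Set.Ioi (0 : ℝ),
      ((t ^ (s / 2 - 1) * Real.exp (-(lam i * t)) : ℝ) : ℂ) * (((lam i ^ (s / 2) : ℝ) : ℂ) * F i m) =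
      (Real.Gamma (s / 2) : ℂ) * F i m := by
    intro i hi
    have hl := hlam i hi
    rw [integral_mul_const, integral_complex_ofReal,
      Real.integral_rpow_mul_exp_neg_mul_Ioi hs0 hl, ← mul_assoc, ← Complex.ofReal_mul]
    congr 2
    rw [one_div, Real.inv_rpow hl.le, mul_right_comm, inv_mul_cancel₀ (by positivity), one_mul]
  have hint : ∀ i ∈ S, IntegrableOn (fun t : ℝ =>
      ((t ^ (s / 2 - 1) * Real.exp (-(lam i * t)) : ℝ) : ℂ) *
        (((lam i ^ (s / 2) : ℝ) : ℂ) * F i m)) (Set.Ioi 0) := fun i hi =>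
    ((hgint hs0 (hlam i hi)).ofReal).mul_const _
  have e : (Real.Gamma (s / 2) : ℂ) * ∑ i ∈ S, F i m = ∫ t in Set.Ioi (0 : ℝ), ∑ i ∈ S,
      ((t ^ (s / 2 - 1) * Real.exp (-(lam i * t)) : ℝ) : ℂ) *
        (((lam i ^ (s / 2) : ℝ) : ℂ) * F i m) := by
    rw [integral_finsetSum _ hint, Finset.mul_sum]
    exact Finset.sum_congr rfl fun i hi => (hgam i hi).symm
  have h3 : ‖(Real.Gamma (s / 2) : ℂ) * ∑ i ∈ S, F i m‖ ≤
      K * ((1 / (1 + ν ^ 2)) ^ ((s - g) / 2) * Real.Gamma ((s - g) / 2)) := by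
    rw [e, ← Real.integral_rpow_mul_exp_neg_mul_Ioi hsg hr, ← integral_const_mul]
    refine norm_integral_le_of_norm_le ((hgint hsg hr).const_mul K) ?_
    exact (ae_restrict_mem measurableSet_Ioi).mono fun t ht => hpt t ht
  rw [norm_mul, Complex.norm_real, Real.norm_of_nonneg hG.le, mul_comm, ← le_div_iff₀ hG] at h3
  refine h3.trans (le_of_eq ?_)
  rw [hK, one_div (1 + ν ^ 2), Real.inv_rpow hr.le, ← Real.rpow_neg hr.le]
  field_simp

end SectorBound
end HeisNil
end

/-! ### Averaging operators on `L²(M)` -/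

noncomputable section
namespace HeisNil
open MeasureTheory Filter Topology

section Averaging
variable {g : ℕ} {α : SpR g} {k : (Fin g ⊕ Fin g → ℝ) × ℝ → ℂ} {u v : Nil g → ℂ}

/-- Measurable kernels of Gaussian decay in the horizontal directions. -/
structure IsKernel (k : (Fin g ⊕ Fin g → ℝ) × ℝ → ℂ) : Prop where
  meas : Measurable k
  bound : ∃ C : ℝ, 0 ≤ C ∧ ∀ p, ‖k p‖ ≤ C * Real.exp (-Real.pi * qY p.1)

/-- The average of `u` over one period of the centre and all horizontal directions. -/
def avgQ (α : SpR g) (k : (Fin g ⊕ Fin g → ℝ) × ℝ → ℂ) (u : Nil g → ℂ) (m : Nil g) : ℂ :=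
  ∫ p, k p * u (expo (-(embT α p)) • m) ∂(slab g)

theorem measurable_translate (α : SpR g) :
    Measurable fun x : Nil g × ((Fin g ⊕ Fin g → ℝ) × ℝ) => expo (-(embT α x.2)) • x.1 := by
  have h : Measurable fun p : (Fin g ⊕ Fin g → ℝ) × ℝ => -(embT α p) :=
    (continuous_embT α).neg.measurable
  exact measurable_expo_smul.comp ((h.comp measurable_snd).prodMk measurable_fst)

theorem measurable_translate_left (α : SpR g) (m : Nil g) :
    Measurable fun p : (Fin g ⊕ Fin g → ℝ) × ℝ => expo (-(embT α p)) • m := by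
  have h : Measurable fun p : (Fin g ⊕ Fin g → ℝ) × ℝ => -(embT α p) :=
    (continuous_embT α).neg.measurable
  have h2 : Measurable fun p : (Fin g ⊕ Fin g → ℝ) × ℝ => (-(embT α p), m) :=
    h.prodMk measurable_const
  exact measurable_expo_smul.comp h2

theorem eLpNorm_two_sq {X : Type*} [MeasurableSpace X] {μ : Measure X} (u : X → ℂ) :
    eLpNorm u 2 μ ^ 2 = ∫⁻ x, ‖u x‖ₑ ^ 2 ∂μ := by
  rw [eLpNorm_eq_lintegral_rpow_enorm_toReal (by norm_num) (by norm_num), ← ENNReal.rpow_natCast,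
    ← ENNReal.rpow_mul]
  simp

theorem lintegral_slab_gauss (g : ℕ) :
    ∫⁻ p, ENNReal.ofReal (Real.exp (-Real.pi * qY p.1)) ∂(slab g) ≠ ⊤ := by
  have hm : Measurable fun y : Fin g ⊕ Fin g → ℝ => ENNReal.ofReal (Real.exp (-Real.pi * qY y)) :=
    ENNReal.measurable_ofReal.comp (Real.measurable_exp.comp
      (continuous_qY.measurable.const_mul _))
  have h2 := lintegral_prod (μ := (volume : Measure (Fin g ⊕ Fin g → ℝ)))
    (ν := volume.restrict (Set.Ico (-1 / 4 : ℝ) (1 / 4)))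
    (fun p => ENNReal.ofReal (Real.exp (-Real.pi * qY p.1))) (hm.comp measurable_fst).aemeasurable
  rw [slab, h2]
  simp only [lintegral_const, Measure.restrict_apply MeasurableSet.univ, Set.univ_inter,
    Real.volume_Ico]
  rw [lintegral_mul_const _ hm, ← ofReal_integral_eq_lintegral_ofReal
    (integrable_exp_neg_mul_qY Real.pi_pos) (Eventually.of_forall fun _ => (Real.exp_pos _).le)]
  exact ENNReal.mul_ne_top ENNReal.ofReal_ne_top ENNReal.ofReal_ne_top

/-- Averaging maps `L²` to bounded functions. -/
theorem IsKernel.exists_lintegral_le (hk : IsKernel k) (α : SpR g) : ∃ K : ℝ, 0 ≤ K ∧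
    ∀ u : Nil g → ℂ, Measurable u → ∀ m, ∫⁻ p, ‖k p * u (expo (-(embT α p)) • m)‖ₑ ∂(slab g) ≤
      ENNReal.ofReal K * eLpNorm u 2 (haarNil g) := by
  obtain ⟨C, hC0, hC⟩ := hk.bound
  obtain ⟨D, hD, hgauss⟩ := exists_slab_gauss_le g
  set E : ((Fin g ⊕ Fin g → ℝ) × ℝ) → ℝ≥0∞ :=
    fun p => ENNReal.ofReal (Real.exp (-(Real.pi / 2) * qY p.1)) with hE
  have hEm : Measurable E := ENNReal.measurable_ofReal.comp (Real.measurable_exp.comp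
      ((continuous_qY.measurable.comp measurable_fst).const_mul _))
  have hE2 : ∀ p, E p * E p = ENNReal.ofReal (Real.exp (-Real.pi * qY p.1)) := by
    intro p
    rw [hE, ← ENNReal.ofReal_mul (Real.exp_pos _).le, ← Real.exp_add]
    ring_nf
  set A : ℝ≥0∞ := ∫⁻ p, ENNReal.ofReal (Real.exp (-Real.pi * qY p.1)) ∂(slab g) with hA
  have hAtop : A ≠ ⊤ := lintegral_slab_gauss g
  set H : ℝ := D * siegelHeight α ^ (1 / 2 : ℝ)
  refine ⟨C * Real.sqrt (A.toReal * H), by positivity, fun u hu m => ?_⟩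
  have hum : Measurable fun p => ‖u (expo (-(embT α p)) • m)‖ₑ :=
    (hu.comp (measurable_translate_left α m)).enorm
  have hum1 : Measurable fun p => E p * ‖u (expo (-(embT α p)) • m)‖ₑ := hEm.mul hum
  have hum2 : Measurable fun p => E p * (E p * ‖u (expo (-(embT α p)) • m)‖ₑ) := hEm.mul hum1
  have h1 : ∫⁻ p, ‖k p * u (expo (-(embT α p)) • m)‖ₑ ∂(slab g) ≤
      ENNReal.ofReal C * ∫⁻ p, E p * (E p * ‖u (expo (-(embT α p)) • m)‖ₑ) ∂(slab g) := by
    rw [← lintegral_const_mul _ hum2]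
    refine lintegral_mono fun p => ?_
    rw [enorm_mul, ← mul_assoc (E p), hE2, ← mul_assoc, ← ENNReal.ofReal_mul hC0]
    gcongr
    rw [← ofReal_norm]
    exact ENNReal.ofReal_le_ofReal (hC p)
  have h2 : (∫⁻ p, E p * (E p * ‖u (expo (-(embT α p)) • m)‖ₑ) ∂(slab g)) ^ 2 ≤
      (ENNReal.ofReal (Real.sqrt (A.toReal * H)) * eLpNorm u 2 (haarNil g)) ^ 2 := by
    refine (lintegral_mul_sq_le hEm.aemeasurable hum1.aemeasurable).trans ?_
    rw [mul_pow, eLpNorm_two_sq, ← ENNReal.ofReal_pow (Real.sqrt_nonneg _)]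
    have hH : 0 ≤ H := by
      have := siegelHeight_pos α
      positivity
    rw [Real.sq_sqrt (by positivity), ENNReal.ofReal_mul ENNReal.toReal_nonneg,
      ENNReal.ofReal_toReal hAtop]
    simp only [mul_pow, sq (E _), hE2]
    rw [← hA, mul_assoc]
    exact mul_le_mul_right (hgauss α m (fun m => ‖u m‖ₑ ^ 2) (hu.enorm.pow_const 2)) _
  have h3 := (ENNReal.pow_right_strictMono two_ne_zero).le_iff_le.1 h2
  refine h1.trans ?_
  rw [ENNReal.ofReal_mul hC0, mul_assoc]
  gcongr

theorem IsKernel.integrable (hk : IsKernel k) (α : SpR g) (hu : Measurable u)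
    (hu2 : eLpNorm u 2 (haarNil g) ≠ ⊤) (m : Nil g) :
    Integrable (fun p => k p * u (expo (-(embT α p)) • m)) (slab g) := by
  obtain ⟨K, -, hK⟩ := hk.exists_lintegral_le α
  exact ⟨(hk.meas.mul (hu.comp (measurable_translate_left α m))).aestronglyMeasurable,
    (hK u hu m).trans_lt (ENNReal.mul_lt_top ENNReal.ofReal_lt_top hu2.lt_top)⟩

theorem measurable_avgQ (hk : IsKernel k) (α : SpR g) (hu : Measurable u) :
    Measurable (avgQ α k u) := by
  have h : StronglyMeasurable fun x : Nil g × ((Fin g ⊕ Fin g → ℝ) × ℝ) =>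
      k x.2 * u (expo (-(embT α x.2)) • x.1) :=
    ((hk.meas.comp measurable_snd).mul (hu.comp (measurable_translate α))).stronglyMeasurable
  exact h.integral_prod_right'.measurable

/-- The bound holds at every point, not only almost everywhere, since the averages run over an orbit
of full dimension; so evaluation of an average at a point is a functional on `L²`. -/
theorem IsKernel.exists_bound (hk : IsKernel k) (α : SpR g) : ∃ K : ℝ, 0 ≤ K ∧
    ∀ u : L2 g, ∀ m, ‖avgQ α k u m‖ ≤ K * ‖u‖ := by
  obtain ⟨K, hK0, hK⟩ := hk.exists_lintegral_le α
  refine ⟨K, hK0, fun u m => ?_⟩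
  have h1 := (enorm_integral_le_lintegral_enorm _).trans
    (hK u (Lp.stronglyMeasurable u).measurable m)
  rw [← Lp.enorm_def, ← ofReal_norm, ← ofReal_norm, ← ENNReal.ofReal_mul hK0] at h1
  exact (ENNReal.ofReal_le_ofReal_iff (by positivity)).1 h1

/-- The `L²` bound, applied to the difference, shows that the average at each point depends on the
class only. -/
theorem avgQ_congr (hk : IsKernel k) (α : SpR g) (hu : Measurable u) (hv : Measurable v)
    (h : u =ᵐ[haarNil g] v) (m : Nil g) : avgQ α k u m = avgQ α k v m := by
  obtain ⟨K, -, hK⟩ := hk.exists_lintegral_le α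
  have hsub : Measurable fun m => u m - v m := hu.sub hv
  have hmul : Measurable fun p =>
      k p * (u (expo (-(embT α p)) • m) - v (expo (-(embT α p)) • m)) :=
    hk.meas.mul (hsub.comp (measurable_translate_left α m))
  have h1 := hK (fun m => u m - v m) hsub m
  have h2 : eLpNorm (fun m => u m - v m) 2 (haarNil g) = 0 := by
    rw [eLpNorm_eq_zero_iff hsub.aestronglyMeasurable (by norm_num)]
    filter_upwards [h] with m hm
    simp [hm]
  rw [h2, mul_zero, nonpos_iff_eq_zero, lintegral_eq_zero_iff
    hmul.enorm] at h1
  refine integral_congr_ae ?_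
  filter_upwards [h1] with p hp
  simp only [Pi.zero_apply, enorm_eq_zero] at hp
  exact sub_eq_zero.1 (by rw [← mul_sub]; exact hp)

theorem L2.measurable (u : L2 g) : Measurable u := (Lp.stronglyMeasurable u).measurable

theorem L2.eLpNorm_ne_top (u : L2 g) : eLpNorm u 2 (haarNil g) ≠ ⊤ := Lp.eLpNorm_ne_top u

theorem memLp_avgQ (hk : IsKernel k) (α : SpR g) (u : L2 g) :
    MemLp (avgQ α k u) 2 (haarNil g) := by
  obtain ⟨K, -, hK⟩ := hk.exists_bound α
  exact MemLp.of_bound (measurable_avgQ hk α (L2.measurable u)).aestronglyMeasurable (K * ‖u‖)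
    (Eventually.of_forall (hK u))

theorem norm_le_of_bound {u : L2 g} {C : ℝ} (hC : 0 ≤ C) (h : ∀ᵐ m ∂(haarNil g), ‖u m‖ ≤ C) :
    ‖u‖ ≤ C := by
  have := Lp.norm_le_of_ae_bound hC h
  have e : measureUnivNNReal (haarNil g) = 1 := by
    rw [← ENNReal.coe_inj, coe_measureUnivNNReal, measure_univ, ENNReal.coe_one]
  rwa [e, NNReal.coe_one, Real.one_rpow, one_mul] at this

/-- The averaging operator on `L²`. -/
def avgOp (hk : IsKernel k) (α : SpR g) : L2 g →L[ℂ] L2 g :=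
  LinearMap.mkContinuous
    { toFun := fun u => (memLp_avgQ hk α u).toLp
      map_add' := fun u v => by
        rw [← MemLp.toLp_add]
        refine MemLp.toLp_congr _ _ (Eventually.of_forall fun m => ?_)
        have h1 : avgQ α k (u + v : L2 g) m = avgQ α k (fun m => u m + v m) m :=
          avgQ_congr hk α (L2.measurable _) ((L2.measurable _).add (L2.measurable _))
            (Lp.coeFn_add u v) m
        rw [h1, Pi.add_apply]
        simp only [avgQ, mul_add]
        exact integral_add (hk.integrable α (L2.measurable u) (L2.eLpNorm_ne_top u) m)
          (hk.integrable α (L2.measurable v) (L2.eLpNorm_ne_top v) m)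
      map_smul' := fun c u => by
        rw [RingHom.id_apply, ← MemLp.toLp_const_smul]
        refine MemLp.toLp_congr _ _ (Eventually.of_forall fun m => ?_)
        have h1 : avgQ α k (c • u : L2 g) m = avgQ α k (fun m => c * u m) m :=
          avgQ_congr hk α (L2.measurable _) ((L2.measurable _).const_mul c)
            (Lp.coeFn_smul c u) m
        rw [h1, Pi.smul_apply, smul_eq_mul]
        simp only [avgQ, ← integral_const_mul]
        congr 1
        ext p
        ring }
    (hk.exists_bound α).choose
    (fun u => by
      have h := (hk.exists_bound α).choose_spec
      refine norm_le_of_bound (mul_nonneg h.1 (norm_nonneg _)) ?_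
      filter_upwards [(memLp_avgQ hk α u).coeFn_toLp] with m hm
      exact (le_of_eq (congrArg norm hm)).trans (h.2 u m))

theorem coeFn_avgOp (hk : IsKernel k) (α : SpR g) (u : L2 g) :
    avgOp hk α u =ᵐ[haarNil g] avgQ α k u := (memLp_avgQ hk α u).coeFn_toLp

end Averaging
end HeisNil
end

/-! ### Hilbert–Schmidt operators -/

noncomputable section
namespace HeisNil
open MeasureTheory Filter Topology

section HilbertSchmidt
variable {E : Type*} [NormedAddCommGroup E] [InnerProductSpace ℂ E] [CompleteSpace E]

/-- Bessel's inequality for the vector that represents `φ`. -/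
theorem sum_norm_sq_le_of_orthonormal {ι : Type*} {e : ι → E} (he : Orthonormal ℂ e)
    (φ : E →L[ℂ] ℂ) (S : Finset ι) : ∑ i ∈ S, ‖φ (e i)‖ ^ 2 ≤ ‖φ‖ ^ 2 := by
  set w := (InnerProductSpace.toDual ℂ E).symm φ with hw
  have h1 : ∀ x, φ x = inner ℂ w x := fun x => by
    rw [hw, InnerProductSpace.toDual_symm_apply]
  have h2 : ‖w‖ = ‖φ‖ := by rw [hw, LinearIsometryEquiv.norm_map]
  rw [← h2]
  refine le_trans (le_of_eq ?_) (he.sum_inner_products_le (s := S) w)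
  refine Finset.sum_congr rfl fun i _ => ?_
  rw [h1, ← inner_conj_symm, RCLike.norm_conj]

/-- Hilbert–Schmidt operators are compact. -/
theorem isCompactOperator_of_sum_norm_sq_le (A : E →L[ℂ] E) {C : ℝ}
    (hC : ∀ (w : Set E), Orthonormal ℂ (fun x : w => (x : E)) → ∀ S : Finset w,
      ∑ i ∈ S, ‖A i‖ ^ 2 ≤ C) : IsCompactOperator A := by
  classical
  obtain ⟨w, b, hb⟩ := exists_hilbertBasis ℂ E
  have horth : Orthonormal ℂ (fun x : w => (x : E)) := hb ▸ b.orthonormal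
  have hsum : Summable fun i : w => ‖A i‖ ^ 2 :=
    summable_of_sum_le (fun _ => sq_nonneg _) (hC w horth)
  set AF : Finset w → E →L[ℂ] E := fun S => ∑ i ∈ S, (innerSL ℂ (i : E)).smulRight (A i) with hAF
  have hcomp : ∀ S, IsCompactOperator (AF S) := by
    intro S
    have h1 : ∀ i : w, IsCompactOperator ((innerSL ℂ (i : E)).smulRight (A i)) := fun i =>
      (isCompactOperator_of_locallyCompactSpace_rng
        (ContinuousLinearMap.toSpanSingleton ℂ (A i)) :
          IsCompactOperator _).comp_clm (innerSL ℂ (i : E))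
    induction S using Finset.induction_on with
    | empty => simpa [hAF] using isCompactOperator_zero
    | insert i S hi ih =>
      have e : AF (insert i S) = (innerSL ℂ (i : E)).smulRight (A i) + AF S := Finset.sum_insert hi
      rw [e]
      exact (h1 i).add ih
  -- Outside a large finite part of the basis, Cauchy–Schwarz bounds the operator norm by the square
  -- root of a tail of `∑ ‖A eᵢ‖²`; so `A` is a norm limit of finite rank operators.
  have hlim : Tendsto AF atTop (𝓝 A) := by
    rw [Metric.tendsto_atTop]
    intro ε hε
    obtain ⟨S, hS⟩ := summable_iff_vanishing_norm.1 hsum ((ε / 2) ^ 2) (by positivity)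
    refine ⟨S, fun T hT => ?_⟩
    rw [dist_eq_norm, norm_sub_rev]
    refine lt_of_le_of_lt (ContinuousLinearMap.opNorm_le_bound _ (by positivity : 0 ≤ ε / 2)
      fun x => ?_) (by linarith)
    have h1 : HasSum (fun i : w => inner ℂ (i : E) x • (i : E)) x := by
      have := b.hasSum_repr x
      simpa only [b.repr_apply_apply, hb] using this
    have h2 : Tendsto (fun U : Finset w => ∑ i ∈ U, inner ℂ (i : E) x • A i - AF T x) atTop
        (𝓝 ((A - AF T) x)) := by
      have h3 := (A.hasSum h1)
      simp only [map_smul] at h3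
      exact h3.sub_const _
    refine le_of_tendsto h2.norm ?_
    filter_upwards [eventually_ge_atTop T] with U hU
    have h4 : ∑ i ∈ U, inner ℂ (i : E) x • A i - AF T x =
        ∑ i ∈ U \ T, inner ℂ (i : E) x • A i := by
      rw [hAF, sub_eq_iff_eq_add, ← Finset.sum_sdiff hU]
      congr 1
      simp
    rw [h4]
    have h5 : ∑ i ∈ U \ T, ‖A i‖ ^ 2 ≤ (ε / 2) ^ 2 := by
      have := hS (U \ T) (Finset.disjoint_left.2 fun i hi hiS =>
        (Finset.mem_sdiff.1 hi).2 (hT hiS))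
      rw [Real.norm_eq_abs] at this
      exact (le_abs_self _).trans this.le
    have h6 : ∑ i ∈ U \ T, ‖inner ℂ (i : E) x‖ ^ 2 ≤ ‖x‖ ^ 2 := horth.sum_inner_products_le x
    calc ‖∑ i ∈ U \ T, inner ℂ (i : E) x • A i‖
        ≤ ∑ i ∈ U \ T, ‖inner ℂ (i : E) x‖ * ‖A i‖ :=
          (norm_sum_le _ _).trans (Finset.sum_le_sum fun i _ => (norm_smul_le _ _))
      _ ≤ ε / 2 * ‖x‖ := by
          refine abs_le_of_sq_le_sq' ?_ (by positivity) |>.2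
          refine (Finset.sum_mul_sq_le_sq_mul_sq _ _ _).trans ?_
          rw [mul_pow, mul_comm]
          exact mul_le_mul h5 h6 (Finset.sum_nonneg fun _ _ => sq_nonneg _) (by positivity)
  exact isCompactOperator_of_tendsto hlim (Eventually.of_forall hcomp)

end HilbertSchmidt

/-! ### Compactness of the averaging operators -/

section AveragingOperator
variable {g : ℕ} {α : SpR g} {k : (Fin g ⊕ Fin g → ℝ) × ℝ → ℂ} {u v : Nil g → ℂ}

theorem avgQ_add (hk : IsKernel k) (α : SpR g) (u v : L2 g) (m : Nil g) :
    avgQ α k (u + v : L2 g) m = avgQ α k u m + avgQ α k v m := by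
  have h1 : avgQ α k (u + v : L2 g) m = avgQ α k (fun m => u m + v m) m :=
    avgQ_congr hk α (L2.measurable _) ((L2.measurable _).add (L2.measurable _))
      (Lp.coeFn_add u v) m
  rw [h1]
  simp only [avgQ, mul_add]
  exact integral_add (hk.integrable α (L2.measurable u) (L2.eLpNorm_ne_top u) m)
    (hk.integrable α (L2.measurable v) (L2.eLpNorm_ne_top v) m)

theorem avgQ_smul (hk : IsKernel k) (α : SpR g) (c : ℂ) (u : L2 g) (m : Nil g) :
    avgQ α k (c • u : L2 g) m = c * avgQ α k u m := by
  have h1 : avgQ α k (c • u : L2 g) m = avgQ α k (fun m => c * u m) m :=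
    avgQ_congr hk α (L2.measurable _) ((L2.measurable _).const_mul c) (Lp.coeFn_smul c u) m
  rw [h1]
  simp only [avgQ, ← integral_const_mul]
  congr 1
  ext p
  ring

/-- The evaluation at `m` of the averages. -/
def avgEval (hk : IsKernel k) (α : SpR g) (m : Nil g) : L2 g →L[ℂ] ℂ :=
  LinearMap.mkContinuous
    { toFun := fun u => avgQ α k u m
      map_add' := fun u v => avgQ_add hk α u v m
      map_smul' := fun c u => avgQ_smul hk α c u m }
    (hk.exists_bound α).choose (fun u => (hk.exists_bound α).choose_spec.2 u m)

theorem norm_avgEval_le (hk : IsKernel k) (α : SpR g) (m : Nil g) :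
    ‖avgEval hk α m‖ ≤ (hk.exists_bound α).choose :=
  LinearMap.mkContinuous_norm_le _ (hk.exists_bound α).choose_spec.1 _

theorem L2.norm_sq_eq (u : L2 g) : ‖u‖ ^ 2 = ∫ m, ‖u m‖ ^ 2 ∂(haarNil g) := by
  have h := L2.inner_def (𝕜 := ℂ) u u
  rw [inner_self_eq_norm_sq_to_K] at h
  have e : ∀ m, inner ℂ (u m) (u m) = ((‖u m‖ ^ 2 : ℝ) : ℂ) := fun m => by
    rw [inner_self_eq_norm_sq_to_K]
    simp
  simp only [e, integral_complex_ofReal] at h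
  rw [← RCLike.ofReal_pow] at h
  exact Complex.ofReal_injective h

/-- Evaluations of the averages have norm at most `K`, so Bessel gives `∑ |(A eᵢ)(m)|² ≤ K²` at each
point; integrate over the probability space `M`. -/
theorem isCompactOperator_avgOp (hk : IsKernel k) (α : SpR g) : IsCompactOperator (avgOp hk α) := by
  set K := (hk.exists_bound α).choose
  refine isCompactOperator_of_sum_norm_sq_le (C := K ^ 2) _ fun w hw S => ?_
  have h1 : ∀ u : L2 g, ‖avgOp hk α u‖ ^ 2 = ∫ m, ‖avgEval hk α m u‖ ^ 2 ∂(haarNil g) := by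
    intro u
    rw [L2.norm_sq_eq]
    refine integral_congr_ae ?_
    filter_upwards [coeFn_avgOp hk α u] with m hm
    rw [hm]
    rfl
  have hint : ∀ u : L2 g, Integrable (fun m => ‖avgEval hk α m u‖ ^ 2) (haarNil g) := by
    intro u
    exact (memLp_avgQ hk α u).integrable_norm_pow (p := 2) (by norm_num)
  simp only [h1]
  rw [← integral_finsetSum _ fun i _ => hint _]
  calc ∫ m, ∑ i ∈ S, ‖avgEval hk α m i‖ ^ 2 ∂(haarNil g) ≤ ∫ _, K ^ 2 ∂(haarNil g) := by
        refine integral_mono (integrable_finsetSum _ fun i _ => hint _) (integrable_const _)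
          fun m => ?_
        refine (sum_norm_sq_le_of_orthonormal hw (avgEval hk α m) S).trans ?_
        exact pow_le_pow_left₀ (norm_nonneg _) (norm_avgEval_le hk α m) 2
    _ = K ^ 2 := by simp

theorem measurePreserving_neg_slab : MeasurePreserving (fun p => -p) (slab g) (slab g) := by
  -- The half-open interval is not symmetric; up to a null set it may be replaced by the open one.
  have h : slab g = (volume : Measure (Fin g ⊕ Fin g → ℝ)).prod
      (volume.restrict (Set.Ioo (-1 / 4 : ℝ) (1 / 4))) := by
    rw [slab, Measure.restrict_congr_set Ioo_ae_eq_Ico]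
  have h1 := (Measure.measurePreserving_neg (volume : Measure ℝ)).restrict_preimage
      (measurableSet_Ioo (a := (-1 / 4 : ℝ)) (b := 1 / 4))
  have e : (Neg.neg : ℝ → ℝ) ⁻¹' (Set.Ioo (-1 / 4 : ℝ) (1 / 4)) = Set.Ioo (-1 / 4 : ℝ) (1 / 4) := by
    ext t
    simp only [Set.mem_preimage, Set.mem_Ioo]
    constructor <;> rintro ⟨h1, h2⟩ <;> constructor <;> linarith
  rw [e] at h1
  rw [h]
  exact (Measure.measurePreserving_neg (volume : Measure (Fin g ⊕ Fin g → ℝ))).prod h1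

theorem IsKernel.integrable_prod (hk : IsKernel k) (α : SpR g) (hu : Measurable u)
    (hu2 : eLpNorm u 2 (haarNil g) ≠ ⊤) (hv : Measurable v) (hv2 : eLpNorm v 2 (haarNil g) ≠ ⊤) :
    Integrable (fun x : Nil g × ((Fin g ⊕ Fin g → ℝ) × ℝ) =>
      v x.1 * (k x.2 * u (expo (-(embT α x.2)) • x.1))) ((haarNil g).prod (slab g)) := by
  obtain ⟨K, -, hK⟩ := hk.exists_lintegral_le α
  have h1 : Measurable fun x : Nil g × ((Fin g ⊕ Fin g → ℝ) × ℝ) =>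
      k x.2 * u (expo (-(embT α x.2)) • x.1) :=
    (hk.meas.comp measurable_snd).mul (hu.comp (measurable_translate α))
  have h2 : Measurable fun x : Nil g × ((Fin g ⊕ Fin g → ℝ) × ℝ) =>
      v x.1 * (k x.2 * u (expo (-(embT α x.2)) • x.1)) := (hv.comp measurable_fst).mul h1
  have h3 : ∀ m, Measurable fun p => k p * u (expo (-(embT α p)) • m) := fun m =>
    hk.meas.mul (hu.comp (measurable_translate_left α m))
  refine ⟨h2.aestronglyMeasurable, ?_⟩
  rw [HasFiniteIntegral, lintegral_prod _ h2.enorm.aemeasurable]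
  have hv1 : MemLp v 1 (haarNil g) :=
    (MemLp.mono_exponent ⟨hv.aestronglyMeasurable, hv2.lt_top⟩ (by norm_num))
  calc ∫⁻ m, ∫⁻ p, ‖v m * (k p * u (expo (-(embT α p)) • m))‖ₑ ∂(slab g) ∂(haarNil g)
      ≤ ∫⁻ m, ‖v m‖ₑ * (ENNReal.ofReal K * eLpNorm u 2 (haarNil g)) ∂(haarNil g) := by
        refine lintegral_mono fun m => ?_
        simp only [enorm_mul (v m)]
        rw [lintegral_const_mul _ (h3 m).enorm]
        exact mul_le_mul_right (hK u hu m) _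
    _ < ⊤ := by
        rw [lintegral_mul_const _ hv.enorm]
        refine ENNReal.mul_lt_top ?_ (ENNReal.mul_lt_top ENNReal.ofReal_lt_top hu2.lt_top)
        have := hv1.2
        rwa [eLpNorm_one_eq_lintegral_enorm] at this

end AveragingOperator
end HeisNil
end

/-! ### Self-adjointness of the averaging operators -/

noncomputable section
namespace HeisNil
open MeasureTheory Filter Topology

section Symmetry
variable {g : ℕ} {α : SpR g} {k : (Fin g ⊕ Fin g → ℝ) × ℝ → ℂ} {u v : Nil g → ℂ}

/-- By Fubini the pairing is an integral over `p` of correlations of `u` and `v` translated by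
`exp(-p)`. Replacing `p` by `-p` and translating `M` exchanges the roles of `u` and `v`, and the
Hermitian symmetry of the kernel supplies the conjugate. -/
theorem integral_conj_mul_avgQ (hk : IsKernel k) (hkc : ∀ p, k (-p) = star (k p)) (α : SpR g)
    (hu : Measurable u) (hu2 : eLpNorm u 2 (haarNil g) ≠ ⊤) (hv : Measurable v)
    (hv2 : eLpNorm v 2 (haarNil g) ≠ ⊤) :
    ∫ m, star (v m) * avgQ α k u m ∂(haarNil g) =
      ∫ m, u m * star (avgQ α k v m) ∂(haarNil g) := by
  have hvs : Measurable fun m => star (v m) := Complex.continuous_conj.measurable.comp hv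
  have hvs2 : eLpNorm (fun m => star (v m)) 2 (haarNil g) ≠ ⊤ := by
    rwa [eLpNorm_congr_norm_ae (g := v) (Eventually.of_forall fun m => norm_star _)]
  have hus : Measurable fun m => star (u m) := Complex.continuous_conj.measurable.comp hu
  have hus2 : eLpNorm (fun m => star (u m)) 2 (haarNil g) ≠ ⊤ := by
    rwa [eLpNorm_congr_norm_ae (g := u) (Eventually.of_forall fun m => norm_star _)]
  have h1 := hk.integrable_prod α hu hu2 hvs hvs2
  have h2 := hk.integrable_prod α hv hv2 hus hus2
  have e1 : ∀ m, star (v m) * avgQ α k u m =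
      ∫ p, star (v m) * (k p * u (expo (-(embT α p)) • m)) ∂(slab g) := fun m => by
    rw [avgQ, integral_const_mul]
  have e2 : ∀ m, star (u m) * avgQ α k v m =
      ∫ p, star (u m) * (k p * v (expo (-(embT α p)) • m)) ∂(slab g) := fun m => by
    rw [avgQ, integral_const_mul]
  have e3 : ∀ m, u m * star (avgQ α k v m) = star (star (u m) * avgQ α k v m) := fun m => by
    simp [mul_comm]
  simp only [e3]
  rw [show ∫ m, star (star (u m) * avgQ α k v m) ∂(haarNil g) =
    star (∫ m, star (u m) * avgQ α k v m ∂(haarNil g)) from integral_conj]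
  simp only [e1, e2]
  rw [integral_integral_swap
      (f := fun m p => star (v m) * (k p * u (expo (-(embT α p)) • m))) h1,
    integral_integral_swap
      (f := fun m p => star (u m) * (k p * v (expo (-(embT α p)) • m))) h2,
    ← measurePreserving_neg_slab.integral_comp (Homeomorph.neg _).measurableEmbedding]
  rw [show star (∫ p, ∫ m, star (u m) * (k p * v (expo (-(embT α p)) • m)) ∂(haarNil g) ∂(slab g)) =
    ∫ p, star (∫ m, star (u m) * (k p * v (expo (-(embT α p)) • m)) ∂(haarNil g)) ∂(slab g)
    from integral_conj.symm]
  refine integral_congr_ae (Eventually.of_forall fun p => ?_)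
  simp only
  rw [show star (∫ m, star (u m) * (k p * v (expo (-(embT α p)) • m)) ∂(haarNil g)) =
    ∫ m, star (star (u m) * (k p * v (expo (-(embT α p)) • m))) ∂(haarNil g)
    from integral_conj.symm]
  have hm : Measurable fun m => star (v m) * (k (-p) * u (expo (-(embT α (-p))) • m)) :=
    hvs.mul ((hu.comp (measurable_smul_nil _)).const_mul _)
  rw [← integral_smul_nil (-(embT α p)) hm]
  refine integral_congr_ae (Eventually.of_forall fun m => ?_)
  simp only
  rw [embT_neg, neg_neg, hkc, smul_smul, show expo (embT α p) * expo (-(embT α p)) = 1 by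
    rw [expo_neg, mul_inv_cancel], one_smul]
  simp
  ring

theorem isSymmetric_avgOp (hk : IsKernel k) (hkc : ∀ p, k (-p) = star (k p)) (α : SpR g) :
    (avgOp hk α).IsSymmetric := by
  intro u v
  rw [L2.inner_def, L2.inner_def]
  have h := integral_conj_mul_avgQ hk hkc α (L2.measurable v) (L2.eLpNorm_ne_top v)
    (L2.measurable u) (L2.eLpNorm_ne_top u)
  refine Eq.trans (integral_congr_ae ?_) (h.symm.trans (integral_congr_ae ?_))
  · filter_upwards [coeFn_avgOp hk α u] with m hm
    simp only [ContinuousLinearMap.coe_coe, RCLike.inner_apply]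
    rw [hm]
    rfl
  · filter_upwards [coeFn_avgOp hk α v] with m hm
    simp only [ContinuousLinearMap.coe_coe, RCLike.inner_apply]
    rw [hm, mul_comm]
    rfl

end Symmetry
end HeisNil
end

/-! ### Kernels that project to one frequency -/

noncomputable section
namespace HeisNil
open MeasureTheory Filter Topology Complex

section SectorKernel
variable {g : ℕ} {α : SpR g} {G : ℝ → ℝ} {ν : ℝ} {u : Nil g → ℂ}

/-- The radial kernel which projects to the sector of frequency `ν`. -/
def secKer (G : ℝ → ℝ) (ν : ℝ) (p : (Fin g ⊕ Fin g → ℝ) × ℝ) : ℂ :=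
  (G (qY p.1) : ℂ) * cexp (I * (ν * p.2 : ℝ))

theorem norm_cexp_I_mul (t : ℝ) : ‖cexp (I * (t : ℝ))‖ = 1 := by
  rw [mul_comm, norm_exp_ofReal_mul_I]

theorem isKernel_secKer (hG : Measurable G)
    (hb : ∃ C : ℝ, 0 ≤ C ∧ ∀ r, 0 ≤ r → |G r| ≤ C * Real.exp (-Real.pi * r)) (ν : ℝ) :
    IsKernel (secKer (g := g) G ν) := by
  obtain ⟨C, hC0, hC⟩ := hb
  refine ⟨?_, C, hC0, fun p => ?_⟩
  · have h1 : Measurable fun p : (Fin g ⊕ Fin g → ℝ) × ℝ => (G (qY p.1) : ℂ) :=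
      measurable_ofReal.comp (hG.comp (continuous_qY.measurable.comp measurable_fst))
    have h2 : Measurable fun p : (Fin g ⊕ Fin g → ℝ) × ℝ => cexp (I * (ν * p.2 : ℝ)) := by
      have : Continuous fun p : (Fin g ⊕ Fin g → ℝ) × ℝ => cexp (I * (ν * p.2 : ℝ)) := by fun_prop
      exact this.measurable
    exact h1.mul h2
  · rw [secKer, norm_mul, norm_cexp_I_mul, mul_one, norm_real, Real.norm_eq_abs]
    exact hC _ (qY_nonneg _)

theorem star_cexp_I_mul (t : ℝ) : star (cexp (I * (t : ℝ))) = cexp (I * ((-t : ℝ) : ℂ)) := by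
  rw [RCLike.star_def, ← exp_conj]
  simp

theorem qY_neg (y : Fin g ⊕ Fin g → ℝ) : qY (-y) = qY y := by
  simp [qY]

theorem secKer_neg (G : ℝ → ℝ) (ν : ℝ) (p : (Fin g ⊕ Fin g → ℝ) × ℝ) :
    secKer G ν (-p) = star (secKer G ν p) := by
  simp only [secKer, Prod.fst_neg, Prod.snd_neg, qY_neg, star_mul, star_cexp_I_mul]
  rw [mul_comm]
  simp

theorem neg_embT (α : SpR g) (p : (Fin g ⊕ Fin g → ℝ) × ℝ) :
    -(embT α p) = -(emb α p.1) + (-p.2) • basisT := by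
  rw [embT]
  module

/-- On a sector the averages reduce to averages over the horizontal directions. -/
theorem IsSector.avgQ_secKer (hu : IsSector ν u) (α : SpR g) (G : ℝ → ℝ) (m : Nil g) :
    HeisNil.avgQ α (HeisNil.secKer G ν) u m =
      HeisNil.avgY α (fun y => (G (qY y) : ℂ)) u m / 2 := by
  have e : ∀ p : (Fin g ⊕ Fin g → ℝ) × ℝ, HeisNil.secKer G ν p * u (expo (-(embT α p)) • m) =
      ((G (qY p.1) : ℂ) * HeisNil.orb α u m p.1) * 1 := by
    intro p
    rw [neg_embT, expo_add_smul_basisT, hu, HeisNil.secKer, HeisNil.orb, mul_one, mul_assoc,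
      ← mul_assoc (cexp _), ← exp_add]
    simp
  simp only [HeisNil.avgQ, e, slab]
  rw [integral_prod_mul (fun y => (G (qY y) : ℂ) * HeisNil.orb α u m y) fun _ : ℝ => (1 : ℂ)]
  rw [HeisNil.avgY, div_eq_mul_inv]
  congr 1
  simp
  norm_num

/-- The Fourier coefficients of a function along the centre. -/
def hatU (α : SpR g) (ν : ℝ) (u : Nil g → ℂ) (x : Fin g ⊕ Fin g → ℝ) : ℂ :=
  ∫ t in Set.Ico (-1 / 4 : ℝ) (1 / 4), cexp (I * (-(ν * t) : ℝ)) * u (pt (embT α (x, t)))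

theorem pt_embT_add_half (α : SpR g) (u : Nil g → ℂ) (x : Fin g ⊕ Fin g → ℝ) :
    Function.Periodic (fun t : ℝ => u (pt (embT α (x, t)))) (1 / 2) := by
  intro t
  have h : embT α (x, t + 1 / 2) = hmul (embT α (x, t)) (lat (0, 0, 1)) := by
    have h1 : (lat (0, 0, 1) : HeisAlg g) = (1 / 2 : ℝ) • basisT := by
      ext <;> simp [lat, basisT, castVec]
    rw [h1, hmul_eq_add, om_smul_right, om_T_right, embT, embT]
    module
  simp only
  rw [h, pt_hmul_lat]

theorem periodic_cexp (n : ℤ) :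
    Function.Periodic (fun t : ℝ => cexp (I * (-(4 * Real.pi * n * t) : ℝ))) (1 / 2) := by
  intro t
  simp only
  have : I * ((-(4 * Real.pi * n * (t + 1 / 2)) : ℝ) : ℂ) =
      I * ((-(4 * Real.pi * n * t) : ℝ) : ℂ) + (-n : ℤ) * (2 * Real.pi * I) := by
    push_cast
    ring
  rw [this, exp_add, exp_int_mul_two_pi_mul_I, mul_one]

theorem periodic_mul_pt_embT (α : SpR g) (n : ℤ) (u : Nil g → ℂ) (x : Fin g ⊕ Fin g → ℝ) :
    Function.Periodic (fun t : ℝ => cexp (I * (-(4 * Real.pi * n * t) : ℝ)) *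
      u (pt (embT α (x, t)))) (1 / 2) := fun t => by
  have h1 := periodic_cexp n t
  have h2 := pt_embT_add_half α u x t
  simp only at h1 h2 ⊢
  rw [h1, h2]

theorem integral_Ico_sub_of_periodic {φ : ℝ → ℂ} (h : Function.Periodic φ (1 / 2)) (c : ℝ) :
    ∫ t in Set.Ico (-1 / 4 : ℝ) (1 / 4), φ (c - t) = ∫ t in Set.Ico (-1 / 4 : ℝ) (1 / 4), φ t := by
  rw [integral_Ico_eq_integral_Ioc, integral_Ico_eq_integral_Ioc,
    ← intervalIntegral.integral_of_le (by norm_num), ← intervalIntegral.integral_of_le (by norm_num),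
    intervalIntegral.integral_comp_sub_left φ c]
  have := h.intervalIntegral_add_eq (c - 1 / 4) (-1 / 4)
  convert this using 2 <;> ring

theorem hmul_neg_embT (α : SpR g) (y z : Fin g ⊕ Fin g → ℝ) (t τ : ℝ) :
    hmul (-(embT α (y, t))) (embT α (z, τ)) =
      embT α (z - y, (τ - 1 / 2 * omC y z) - t) := by
  rw [hmul_eq_add, om_neg_left, embT, embT, embT]
  simp only [om_add_left, om_add_right, om_smul_left, om_smul_right, om_T_right, om_basisT_left,
    om_emb, map_sub]
  module

/-- At frequency `4πn` the integrand has period 1/2 in the central coordinate, so the central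
integral may be shifted and only sees the Fourier coefficient `hatU`. In the horizontal variables a
twisted convolution with the radial profile remains. -/
theorem avgQ_secKer_pt {n : ℤ} (hk : IsKernel (secKer (g := g) G (4 * Real.pi * n))) (α : SpR g)
    (hu : Measurable u) (hu2 : eLpNorm u 2 (haarNil g) ≠ ⊤) (z : Fin g ⊕ Fin g → ℝ) (τ : ℝ) :
    avgQ α (secKer G (4 * Real.pi * n)) u (pt (embT α (z, τ))) =
      cexp (I * (4 * Real.pi * n * τ : ℝ)) * ∫ x, hatU α (4 * Real.pi * n) u x *
        ((G (qY (z - x)) : ℂ) * cexp (I * (-(4 * Real.pi * n * (1 / 2 * omC (z - x) z)) : ℝ))) := by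
  set ν : ℝ := 4 * Real.pi * n with hν
  have h1 := hk.integrable α hu hu2 (pt (embT α (z, τ)))
  rw [avgQ, slab, integral_prod _ h1, ← integral_const_mul]
  rw [← integral_sub_left_eq_self (fun x => cexp (I * (ν * τ : ℝ)) * (hatU α ν u x *
        ((G (qY (z - x)) : ℂ) * cexp (I * (-(ν * (1 / 2 * omC (z - x) z)) : ℝ))))) volume z]
  refine integral_congr_ae (Eventually.of_forall fun y => ?_)
  simp only [sub_sub_cancel]
  set c := τ - 1 / 2 * omC y z with hc
  have h2 := integral_Ico_sub_of_periodic (periodic_mul_pt_embT α n u (z - y)) c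
  rw [← hν] at h2
  rw [hatU, ← h2]
  rw [mul_comm (∫ t in Set.Ico (-1 / 4 : ℝ) (1 / 4), _), ← integral_const_mul,
    ← integral_const_mul]
  refine integral_congr_ae (Eventually.of_forall fun t => ?_)
  simp only [expo_smul_pt, hmul_neg_embT]
  rw [← hc, secKer]
  simp only
  have e : cexp (I * (ν * t : ℝ)) = cexp (I * (ν * τ : ℝ)) *
      cexp (I * (-(ν * (1 / 2 * omC y z)) : ℝ)) * cexp (I * (-(ν * (c - t)) : ℝ)) := by
    rw [← exp_add, ← exp_add]
    congr 1
    rw [hc]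
    push_cast
    ring
  rw [e]
  ring

end SectorKernel
end HeisNil
end

/-! ### Smooth radial cut-offs -/

noncomputable section
namespace HeisNil
open MeasureTheory Filter Topology Complex

section BumpProfile
variable {g : ℕ}

/-- A smooth cut-off of width `ε`. -/
def bumpG (ε r : ℝ) : ℝ := Real.smoothTransition (1 - r / ε)

theorem contDiff_bumpG (ε : ℝ) : ContDiff ℝ ∞ (bumpG ε) := by
  have h : ContDiff ℝ ∞ fun r : ℝ => 1 - r / ε := by fun_prop
  exact Real.smoothTransition.contDiff.comp h

theorem bumpG_eq_zero {ε r : ℝ} (hε : 0 < ε) (hr : ε ≤ r) : bumpG ε r = 0 := by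
  refine Real.smoothTransition.zero_of_nonpos ?_
  have := (one_le_div hε).2 hr
  linarith

theorem exists_abs_le_mul_exp {H : ℝ → ℝ} (hH : Continuous H) {R : ℝ} (hR : ∀ r, R ≤ r → H r = 0)
    {a : ℝ} (ha : 0 ≤ a) : ∃ C : ℝ, 0 ≤ C ∧ ∀ r, 0 ≤ r → |H r| ≤ C * Real.exp (-a * r) := by
  obtain ⟨M, hM⟩ := (isCompact_Icc (a := (0 : ℝ)) (b := R)).exists_bound_of_continuousOn
    hH.continuousOn
  refine ⟨|M| * Real.exp (a * R), by positivity, fun r hr => ?_⟩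
  rcases le_total R r with h | h
  · rw [hR r h, abs_zero]
    positivity
  · have h1 := hM r ⟨hr, h⟩
    rw [Real.norm_eq_abs] at h1
    rw [mul_assoc, ← Real.exp_add]
    refine (h1.trans (le_abs_self _)).trans (le_mul_of_one_le_right (abs_nonneg _) ?_)
    refine Real.one_le_exp ?_
    nlinarith

theorem deriv_eq_zero_of_eq_zero {H : ℝ → ℝ} {R : ℝ} (hR : ∀ r, R ≤ r → H r = 0) {r : ℝ}
    (hr : R + 1 ≤ r) : deriv H r = 0 := by
  have h : H =ᶠ[𝓝 r] fun _ => 0 := by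
    filter_upwards [lt_mem_nhds (show R < r by linarith)] with x hx
    exact hR x hx.le
  rw [h.deriv_eq, deriv_const]

/-- The vanishing beyond `R` is one-sided, which suffices because profiles are evaluated at `|y|² ≥
0` only. -/
theorem radialProfile_of_contDiff {G : ℝ → ℝ} (hG : ContDiff ℝ ∞ G) {R : ℝ}
    (hR : ∀ r, R ≤ r → G r = 0) : RadialProfile G (deriv G) (deriv (deriv G)) := by
  have hG1 : ContDiff ℝ ∞ (deriv G) := hG.iterate_deriv 1
  have hG2 : ContDiff ℝ ∞ (deriv (deriv G)) := hG1.iterate_deriv 1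
  have z1 : ∀ r, R + 1 ≤ r → deriv G r = 0 := fun r hr => deriv_eq_zero_of_eq_zero hR hr
  have z2 : ∀ r, R + 1 + 1 ≤ r → deriv (deriv G) r = 0 := fun r hr =>
    deriv_eq_zero_of_eq_zero z1 hr
  refine ⟨fun r => (hG.differentiable (by simp) r).hasDerivAt,
    fun r => (hG1.differentiable (by simp) r).hasDerivAt, hG2.continuous, ?_⟩
  obtain ⟨C0, h0, b0⟩ := exists_abs_le_mul_exp hG.continuous hR zero_le_one
  obtain ⟨C1, h1, b1⟩ := exists_abs_le_mul_exp hG1.continuous z1 zero_le_one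
  obtain ⟨C2, h2, b2⟩ := exists_abs_le_mul_exp hG2.continuous z2 zero_le_one
  refine ⟨C0 + C1 + C2, fun r hr => ?_⟩
  have e := (Real.exp_pos (-r)).le
  have b0' := b0 r hr
  have b1' := b1 r hr
  have b2' := b2 r hr
  rw [neg_one_mul] at b0' b1' b2'
  refine ⟨b0'.trans ?_, b1'.trans ?_, b2'.trans ?_⟩ <;> gcongr <;> linarith

theorem isKernel_secKer_of_contDiff {G : ℝ → ℝ} (hG : ContDiff ℝ ∞ G) {R : ℝ}
    (hR : ∀ r, R ≤ r → G r = 0) (ν : ℝ) : IsKernel (secKer (g := g) G ν) :=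
  isKernel_secKer hG.continuous.measurable
    (exists_abs_le_mul_exp hG.continuous hR Real.pi_pos.le) ν

end BumpProfile

/-! ### Smoothness of the averages -/

section Smoothness
variable {g : ℕ} {α : SpR g} {G : ℝ → ℝ} {ν : ℝ} {u : Nil g → ℂ}

theorem integrable_slab_pt (α : SpR g) (ν : ℝ) (hu : Measurable u)
    (hu2 : eLpNorm u 2 (haarNil g) ≠ ⊤) :
    Integrable (fun p : (Fin g ⊕ Fin g → ℝ) × ℝ => (Real.exp (-Real.pi * qY p.1) : ℂ) *
      (cexp (I * (-(ν * p.2) : ℝ)) * u (pt (embT α p)))) (slab g) := by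
  have hk : IsKernel (secKer (g := g) (fun r => Real.exp (-Real.pi * r)) ν) :=
    isKernel_secKer (by fun_prop) ⟨1, zero_le_one, fun r _ => by
      rw [one_mul, abs_of_pos (Real.exp_pos _)]⟩ ν
  have h1 := (measurePreserving_neg_slab (g := g)).integrable_comp_of_integrable
    (hk.integrable α hu hu2 (pt 0))
  refine h1.congr (Eventually.of_forall fun p => ?_)
  have e : expo (-(embT α (-p))) • (pt 0 : Nil g) = pt (embT α p) := by
    rw [embT_neg, neg_neg, expo_smul_pt, hmul_eq_add]
    simp [om, omegaForm]
  simp only [Function.comp_apply, e, secKer, Prod.fst_neg, Prod.snd_neg, qY_neg]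
  rw [mul_assoc, mul_neg]

/-- The Gaussian average of `u` at the base point converges absolutely; on a compact set the
Gaussian weight can be divided out. -/
theorem locallyIntegrable_hatU (α : SpR g) (ν : ℝ) (hu : Measurable u)
    (hu2 : eLpNorm u 2 (haarNil g) ≠ ⊤) : LocallyIntegrable (hatU α ν u) := by
  have h1 := integrable_slab_pt α ν hu hu2
  rw [slab] at h1
  have h2 := h1.integral_prod_left
  simp only [integral_const_mul] at h2
  have h3 : Integrable fun x : Fin g ⊕ Fin g → ℝ =>
      (Real.exp (-Real.pi * qY x) : ℂ) * hatU α ν u x := h2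
  rw [locallyIntegrable_iff]
  intro K hK
  have hc : ContinuousOn (fun x : Fin g ⊕ Fin g → ℝ => (Real.exp (Real.pi * qY x) : ℂ)) K := by
    have := continuous_qY (g := g)
    fun_prop
  refine (h3.integrableOn.continuousOn_mul hc hK).congr_fun (fun x _ => ?_) hK.measurableSet
  simp only
  rw [← mul_assoc, ← ofReal_mul, ← Real.exp_add]
  simp

theorem contDiff_qY : ContDiff ℝ ∞ (qY : (Fin g ⊕ Fin g → ℝ) → ℝ) := by
  unfold qY
  fun_prop

theorem contDiff_omC : ContDiff ℝ ∞ fun p : (Fin g ⊕ Fin g → ℝ) × (Fin g ⊕ Fin g → ℝ) =>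
    omC p.1 p.2 := by
  unfold omC omegaForm dotProduct
  simp only [Function.comp_apply]
  fun_prop

theorem isCompact_qY_le (R : ℝ) : IsCompact {y : Fin g ⊕ Fin g → ℝ | qY y ≤ R} := by
  refine Metric.isCompact_of_isClosed_isBounded (isClosed_le continuous_qY continuous_const) ?_
  refine (Metric.isBounded_closedBall (x := 0) (r := Real.sqrt R)).subset fun y hy => ?_
  rw [mem_closedBall_zero_iff, pi_norm_le_iff_of_nonneg (Real.sqrt_nonneg _)]
  intro i
  rw [Real.norm_eq_abs]
  exact Real.abs_le_sqrt ((sq_le_qY y i).trans hy)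

/-- The kernel is smooth and compactly supported in `y = z - x`, but its phase also depends on `z`;
this is a convolution with a smooth parameter, evaluated on the diagonal. -/
theorem contDiff_twisted_convolution (hG : ContDiff ℝ ∞ G) {R : ℝ} (hR : ∀ r, R ≤ r → G r = 0)
    {h : (Fin g ⊕ Fin g → ℝ) → ℂ} (hh : LocallyIntegrable h) (c : ℝ) :
    ContDiff ℝ ∞ fun z => ∫ x, h x *
      ((G (qY (z - x)) : ℂ) * cexp (I * (-(c * (1 / 2 * omC (z - x) z)) : ℝ))) := by
  have hs : ContDiffOn ℝ ∞ (fun p : (Fin g ⊕ Fin g → ℝ) × (Fin g ⊕ Fin g → ℝ) =>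
      (G (qY p.2) : ℂ) * cexp (I * (-(c * (1 / 2 * omC p.2 p.1)) : ℝ)))
      (Set.univ ×ˢ Set.univ) := by
    have h1 : ContDiff ℝ ∞ fun p : (Fin g ⊕ Fin g → ℝ) × (Fin g ⊕ Fin g → ℝ) =>
        (G (qY p.2) : ℂ) :=
      ofRealCLM.contDiff.comp (hG.comp (contDiff_qY.comp contDiff_snd))
    have h2 : ContDiff ℝ ∞ fun p : (Fin g ⊕ Fin g → ℝ) × (Fin g ⊕ Fin g → ℝ) =>
        -(c * (1 / 2 * omC p.2 p.1)) :=
      (contDiff_const.mul (contDiff_const.mul (contDiff_omC.comp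
        (contDiff_snd.prodMk contDiff_fst)))).neg
    have h3 : ContDiff ℝ ∞ fun p : (Fin g ⊕ Fin g → ℝ) × (Fin g ⊕ Fin g → ℝ) =>
        I * (-(c * (1 / 2 * omC p.2 p.1)) : ℝ) :=
      contDiff_const.mul (ofRealCLM.contDiff.comp h2)
    exact (h1.mul h3.cexp).contDiffOn
  have h := contDiffOn_convolution_right_with_param_comp (𝕜 := ℝ) (n := ⊤) (μ := volume)
    (ContinuousLinearMap.mul ℝ ℂ) (s := Set.univ)
    (v := fun z : Fin g ⊕ Fin g → ℝ => z) contDiffOn_id isOpen_univ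
    (g := fun z y => (G (qY y) : ℂ) * cexp (I * (-(c * (1 / 2 * omC y z)) : ℝ)))
    (isCompact_qY_le R) (fun z y _ hy => by
      rw [hR _ (not_le.1 hy).le]
      simp) hh hs
  rw [contDiffOn_univ] at h
  exact h

/-- The inverse of the adapted coordinates. -/
def embTInv (α : SpR g) (w : HeisAlg g) : (Fin g ⊕ Fin g → ℝ) × ℝ :=
  (α.1.mulVec (Sum.elim w.1 w.2.1), w.2.2)

theorem embT_embTInv (α : SpR g) (w : HeisAlg g) : embT α (embTInv α w) = w := by
  have h : (α⁻¹ : SpR g).1 * α.1 = 1 := congrArg Subtype.val (inv_mul_cancel α)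
  rw [embT_eq, embTInv]
  simp only [Matrix.mulVec_mulVec, h, Matrix.one_mulVec]
  rfl

theorem contDiff_embTInv (α : SpR g) : ContDiff ℝ ∞ (embTInv α) := by
  have h1 : ContDiff ℝ ∞ fun w : HeisAlg g => (Sum.elim w.1 w.2.1 : Fin g ⊕ Fin g → ℝ) := by
    rw [contDiff_pi]
    rintro (i | i)
    · simp only [Sum.elim_inl]
      fun_prop
    · simp only [Sum.elim_inr]
      fun_prop
  have h2 : ContDiff ℝ ∞ fun y : Fin g ⊕ Fin g → ℝ => α.1.mulVec y := by
    rw [contDiff_pi]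
    intro i
    unfold Matrix.mulVec dotProduct
    fun_prop
  exact (h2.comp h1).prodMk (contDiff_snd.comp contDiff_snd)

theorem isSmooth_avgQ (hG : ContDiff ℝ ∞ G) {R : ℝ} (hR : ∀ r, R ≤ r → G r = 0) (α : SpR g)
    (n : ℤ) (hu : Measurable u) (hu2 : eLpNorm u 2 (haarNil g) ≠ ⊤) :
    IsSmooth (avgQ α (secKer G (4 * Real.pi * n)) u) := by
  have hk : IsKernel (secKer (g := g) G (4 * Real.pi * n)) := isKernel_secKer_of_contDiff hG hR _
  have e : (fun w : HeisAlg g => avgQ α (secKer G (4 * Real.pi * n)) u (QuotientGroup.mk (expo w))) =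
      fun w => cexp (I * (4 * Real.pi * n * (embTInv α w).2 : ℝ)) *
        ∫ x, hatU α (4 * Real.pi * n) u x * ((G (qY ((embTInv α w).1 - x)) : ℂ) *
          cexp (I * (-(4 * Real.pi * n * (1 / 2 * omC ((embTInv α w).1 - x) (embTInv α w).1)) : ℝ)))
      := by
    ext1 w
    have := avgQ_secKer_pt hk α hu hu2 (embTInv α w).1 (embTInv α w).2
    rw [Prod.mk.eta, embT_embTInv] at this
    exact this
  unfold IsSmooth
  rw [e]
  refine ContDiff.mul ?_ ((contDiff_twisted_convolution hG hR
    (locallyIntegrable_hatU α (4 * Real.pi * n) hu hu2) _).comp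
      (contDiff_fst.comp (contDiff_embTInv α)))
  exact (contDiff_const.mul (ofRealCLM.contDiff.comp (contDiff_const.mul
    (contDiff_snd.comp (contDiff_embTInv α))))).cexp

theorem isSector_avgQ {n : ℤ} (hk : IsKernel (secKer (g := g) G (4 * Real.pi * n))) (α : SpR g)
    (hu : Measurable u) (hu2 : eLpNorm u 2 (haarNil g) ≠ ⊤) :
    IsSector (4 * Real.pi * n) (avgQ α (secKer G (4 * Real.pi * n)) u) := by
  intro t m
  obtain ⟨w, rfl⟩ := pt_surjective m
  obtain ⟨⟨z, τ⟩, rfl⟩ : ∃ p, w = embT α p := ⟨_, (embT_embTInv α w).symm⟩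
  have e : hmul (t • basisT) (embT α (z, τ)) = embT α (z, t + τ) := by
    rw [hmul_eq_add, om_smul_left, om_basisT_left, embT, embT]
    module
  rw [expo_smul_pt, e, avgQ_secKer_pt hk α hu hu2, avgQ_secKer_pt hk α hu hu2, ← mul_assoc,
    ← exp_add]
  congr 2
  push_cast
  ring

end Smoothness
end HeisNil
end

/-! ### Twisted convolutions detect functions -/

noncomputable section
namespace HeisNil
open MeasureTheory Filter Topology Complex

section Completeness
variable {g : ℕ} {α : SpR g} {u : Nil g → ℂ}

theorem bumpG_le_one (ε r : ℝ) : bumpG ε r ≤ 1 := Real.smoothTransition.le_one _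

theorem bumpG_nonneg (ε r : ℝ) : 0 ≤ bumpG ε r := Real.smoothTransition.nonneg _

theorem bumpG_sq_mul {δ : ℝ} (hδ : 0 < δ) (r : ℝ) : bumpG (δ ^ 2) (δ ^ 2 * r) = bumpG 1 r := by
  rw [bumpG, bumpG, mul_div_cancel_left₀ _ (by positivity), div_one]

theorem integrable_bumpG_qY {ε : ℝ} (hε : 0 < ε) :
    Integrable fun y : Fin g ⊕ Fin g → ℝ => bumpG ε (qY y) := by
  refine Continuous.integrable_of_hasCompactSupport
    ((contDiff_bumpG ε).continuous.comp continuous_qY) ?_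
  refine HasCompactSupport.intro (isCompact_qY_le ε) fun y hy => ?_
  exact bumpG_eq_zero hε (not_le.1 hy).le

theorem integral_bumpG_qY_pos {ε : ℝ} (hε : 0 < ε) :
    0 < ∫ y : Fin g ⊕ Fin g → ℝ, bumpG ε (qY y) := by
  refine Continuous.integral_pos_of_hasCompactSupport_nonneg_nonzero
    ((contDiff_bumpG ε).continuous.comp continuous_qY) ?_ (fun y => bumpG_nonneg _ _) (x := 0) ?_
  · refine HasCompactSupport.intro (isCompact_qY_le ε) fun y hy => ?_
    exact bumpG_eq_zero hε (not_le.1 hy).le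
  · simp [qY, bumpG, Real.smoothTransition.one]

/-- Lebesgue differentiation for twisted convolutions with radial cut-offs. -/
theorem ae_eq_zero_of_twisted_convolution {h : (Fin g ⊕ Fin g → ℝ) → ℂ}
    (hh : LocallyIntegrable h) (c : ℝ)
    (h0 : ∀ ε : ℝ, 0 < ε → ∀ z, ∫ x, h x * ((bumpG ε (qY (z - x)) : ℂ) *
      cexp (I * (-(c * (1 / 2 * omC (z - x) z)) : ℝ))) = 0) : h =ᵐ[volume] 0 := by
  filter_upwards [IsUnifLocDoublingMeasure.ae_tendsto_average_norm_sub volume hh 1] with z hz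
  have hav := hz (fun _ : ℝ => z) (fun δ => δ) (l := 𝓝[>] 0) tendsto_id
    (by filter_upwards [self_mem_nhdsWithin] with δ hδ
        rw [one_mul]
        exact Metric.mem_closedBall_self (le_of_lt hδ))
  set N := Fintype.card (Fin g ⊕ Fin g) with hN
  -- The total mass of the kernel at scale `δ`, after rescaling. The phase tends to 1 as `δ → 0`, so
  -- the limit of `J` is the positive mass of the cut-off.
  set J : ℝ → ℂ := fun δ => ∫ y : Fin g ⊕ Fin g → ℝ, (bumpG 1 (qY y) : ℂ) *
    cexp (I * (-(c * (1 / 2 * (δ * omC y z))) : ℝ)) with hJ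
  have homc : Continuous fun y => omC y z :=
    contDiff_omC.continuous.comp (continuous_id.prodMk continuous_const)
  have hbc : ∀ ε, Continuous fun y : Fin g ⊕ Fin g → ℝ => (bumpG ε (qY y) : ℂ) := fun ε =>
    continuous_ofReal.comp ((contDiff_bumpG ε).continuous.comp continuous_qY)
  have hJc : Tendsto J (𝓝[>] 0) (𝓝 (J 0)) := by
    have hcont : Continuous J := by
      refine continuous_of_dominated (bound := fun y => bumpG 1 (qY y)) (fun δ => ?_)
        (fun δ => Eventually.of_forall fun y => ?_) (integrable_bumpG_qY one_pos)
        (Eventually.of_forall fun y => by fun_prop)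
      · have h2 : Continuous fun y => cexp (I * (-(c * (1 / 2 * (δ * omC y z))) : ℝ)) := by
          fun_prop
        exact ((hbc 1).mul h2).aestronglyMeasurable
      · rw [norm_mul, norm_cexp_I_mul, mul_one, norm_real, Real.norm_eq_abs,
          abs_of_nonneg (bumpG_nonneg _ _)]
    exact (hcont.tendsto 0).mono_left nhdsWithin_le_nhds
  have hJ0 : J 0 ≠ 0 := by
    have : J 0 = ((∫ y : Fin g ⊕ Fin g → ℝ, bumpG 1 (qY y) : ℝ) : ℂ) := by
      rw [hJ, ← integral_complex_ofReal]
      simp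
    rw [this, ofReal_ne_zero]
    exact (integral_bumpG_qY_pos one_pos).ne'
  -- As the convolution vanishes, `h(z)` times the mass is minus the convolution of `h - h(z)`, at
  -- most the integral of `|h - h(z)|` over the ball. The ball is a cube of side `2δ`, whence `2^N`;
  -- at a Lebesgue point the right side tends to 0.
  have key : ∀ δ : ℝ, 0 < δ → ‖h z‖ * ‖J δ‖ ≤
      2 ^ N * ⨍ y in Metric.closedBall z δ, ‖h y - h z‖ := by
    intro δ hδ
    have hδ2 : 0 < δ ^ 2 := by positivity
    set Ψ : (Fin g ⊕ Fin g → ℝ) → ℂ := fun y => (bumpG (δ ^ 2) (qY y) : ℂ) *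
      cexp (I * (-(c * (1 / 2 * omC y z)) : ℝ)) with hΨ
    have hΨc : Continuous Ψ := by
      have h2 : Continuous fun y => cexp (I * (-(c * (1 / 2 * omC y z)) : ℝ)) := by fun_prop
      exact (hbc _).mul h2
    have hΨn : ∀ y, ‖Ψ y‖ ≤ 1 := fun y => by
      rw [hΨ, norm_mul, norm_cexp_I_mul, mul_one, norm_real, Real.norm_eq_abs,
        abs_of_nonneg (bumpG_nonneg _ _)]
      exact bumpG_le_one _ _
    have hΨ0 : ∀ x, x ∉ Metric.closedBall z δ → Ψ (z - x) = 0 := by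
      intro x hx
      have : δ ^ 2 ≤ qY (z - x) := by
        by_contra hlt
        refine hx ?_
        rw [Metric.mem_closedBall, dist_comm, dist_eq_norm, pi_norm_le_iff_of_nonneg hδ.le]
        intro i
        rw [Real.norm_eq_abs]
        exact abs_le_of_sq_le_sq ((sq_le_qY (z - x) i).trans (not_le.1 hlt).le) hδ.le
      rw [hΨ]
      simp only
      rw [bumpG_eq_zero hδ2 this]
      simp
    have hΨz : Continuous fun x => Ψ (z - x) := hΨc.comp (continuous_const.sub continuous_id)
    have hΨs : HasCompactSupport fun x => Ψ (z - x) :=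
      HasCompactSupport.intro (isCompact_closedBall z δ) hΨ0
    have i1 : Integrable fun x => h x * Ψ (z - x) :=
      hh.integrable_smul_right_of_hasCompactSupport hΨz hΨs
    have i2 : Integrable fun x => h z * Ψ (z - x) :=
      (hΨz.integrable_of_hasCompactSupport hΨs).const_mul _
    have e1 : ∫ x, Ψ (z - x) = (δ ^ N : ℝ) * J δ := by
      rw [integral_sub_left_eq_self Ψ volume z]
      have h3 := Measure.integral_comp_smul (volume : Measure (Fin g ⊕ Fin g → ℝ)) Ψ δ
      have e2 : ∀ y, Ψ (δ • y) = (bumpG 1 (qY y) : ℂ) *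
          cexp (I * (-(c * (1 / 2 * (δ * omC y z))) : ℝ)) := by
        intro y
        have : omC (δ • y) z = δ * omC y z := by
          rw [← om_emb 1, ← om_emb 1, map_smul, om_smul_left]
        simp only [hΨ, qY_smul, bumpG_sq_mul hδ, this]
      simp only [e2] at h3
      rw [Module.finrank_fintype_fun_eq_card, ← hN, abs_of_pos (by positivity)] at h3
      rw [hJ]
      simp only
      rw [h3, real_smul, ← mul_assoc, ← ofReal_mul, mul_inv_cancel₀ (by positivity), ofReal_one,
        one_mul]
    have e3 : h z * ((δ ^ N : ℝ) * J δ) = -∫ x, (h x - h z) * Ψ (z - x) := by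
      have e4 : ∫ x, h x * Ψ (z - x) = 0 := h0 (δ ^ 2) hδ2 z
      have e5 : ∫ x, (h x - h z) * Ψ (z - x) = ∫ x, (h x * Ψ (z - x) - h z * Ψ (z - x)) := by
        simp only [sub_mul]
      rw [e5, integral_sub i1 i2, e4, integral_const_mul, e1, zero_sub, neg_neg]
    have hball : IntegrableOn (fun x => ‖h x - h z‖) (Metric.closedBall z δ) := by
      refine Integrable.norm ?_
      exact (hh.integrableOn_isCompact (isCompact_closedBall z δ)).sub
        (integrableOn_const (isCompact_closedBall z δ).measure_lt_top.ne)
    have e6 : ‖∫ x, (h x - h z) * Ψ (z - x)‖ ≤ ∫ x in Metric.closedBall z δ, ‖h x - h z‖ := by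
      rw [← integral_indicator Metric.isClosed_closedBall.measurableSet]
      refine norm_integral_le_of_norm_le
        (hball.integrable_indicator Metric.isClosed_closedBall.measurableSet)
        (Eventually.of_forall fun x => ?_)
      by_cases hx : x ∈ Metric.closedBall z δ
      · rw [Set.indicator_of_mem hx, norm_mul]
        exact mul_le_of_le_one_right (norm_nonneg _) (hΨn _)
      · rw [Set.indicator_of_notMem hx, hΨ0 x hx, mul_zero, norm_zero]
    rw [setAverage_eq, smul_eq_mul, Measure.real, Real.volume_pi_closedBall _ hδ.le, ← hN,
      ENNReal.toReal_ofReal (by positivity), mul_pow, mul_inv]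
    have e7 := congrArg norm e3
    rw [norm_neg, norm_mul, norm_mul, norm_real, Real.norm_eq_abs,
      abs_of_pos (by positivity)] at e7
    rw [← mul_assoc, ← mul_assoc, mul_inv_cancel₀ (by positivity), one_mul,
      ← div_eq_inv_mul, le_div_iff₀ (by positivity)]
    calc ‖h z‖ * ‖J δ‖ * δ ^ N = ‖h z‖ * (δ ^ N * ‖J δ‖) := by ring
      _ ≤ _ := e7.trans_le e6
  have h1 : Tendsto (fun δ => ‖h z‖ * ‖J δ‖) (𝓝[>] 0) (𝓝 (‖h z‖ * ‖J 0‖)) :=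
    hJc.norm.const_mul _
  have h2 := hav.const_mul ((2 : ℝ) ^ N)
  rw [mul_zero] at h2
  have h3 := le_of_tendsto_of_tendsto h1 h2
    (by filter_upwards [self_mem_nhdsWithin] with δ hδ using key δ hδ)
  have h4 : 0 < ‖J 0‖ := norm_pos_iff.2 hJ0
  have h5 : ‖h z‖ ≤ 0 := by
    by_contra hlt
    exact absurd h3 (not_le.2 (mul_pos (not_le.1 hlt) h4))
  simpa using h5

end Completeness
end HeisNil
end

/-! ### Fourier uniqueness in the centre -/

noncomputable section
namespace HeisNil
open MeasureTheory Filter Topology Complex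

section FourierUniqueness
variable {g : ℕ} {α : SpR g} {u : Nil g → ℂ}

/-- Parseval's identity on an interval of length 1/2. -/
theorem ae_eq_zero_of_fourier {f : ℝ → ℂ}
    (hf : MemLp f 2 (volume.restrict (Set.Ico (-1 / 4 : ℝ) (1 / 4))))
    (h : ∀ n : ℤ, ∫ t in Set.Ico (-1 / 4 : ℝ) (1 / 4),
      cexp (I * (-(4 * Real.pi * n * t) : ℝ)) * f t = 0) :
    f =ᵐ[volume.restrict (Set.Ico (-1 / 4 : ℝ) (1 / 4))] 0 := by
  rw [Measure.restrict_congr_set Ico_ae_eq_Ioc] at hf ⊢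
  have hab : (-1 / 4 : ℝ) < 1 / 4 := by norm_num
  have h1 := hasSum_sq_fourierCoeffOn hab hf
  have h2 : ∀ n : ℤ, fourierCoeffOn hab f n = 0 := by
    intro n
    rw [fourierCoeffOn_eq_integral, intervalIntegral.integral_of_le hab.le,
      ← integral_Ico_eq_integral_Ioc]
    have e : ∀ t : ℝ, fourier (-n) (t : AddCircle ((1 / 4 : ℝ) - -1 / 4)) • f t =
        cexp (I * (-(4 * Real.pi * n * t) : ℝ)) * f t := by
      intro t
      rw [fourier_coe_apply, smul_eq_mul]
      congr 2
      push_cast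
      norm_num
      ring
    simp only [e, h n, smul_zero]
  simp only [h2, norm_zero, ne_eq, OfNat.ofNat_ne_zero, not_false_eq_true, zero_pow] at h1
  have h3 := h1.unique hasSum_zero
  rw [smul_eq_zero, intervalIntegral.integral_of_le hab.le] at h3
  have h4 := h3.resolve_left (by norm_num)
  rw [integral_eq_zero_iff_of_nonneg (fun _ => sq_nonneg _)
    (hf.integrable_norm_pow (p := 2) (by norm_num))] at h4
  filter_upwards [h4] with t ht
  simpa using ht

theorem lintegral_slab_sq_lt_top (α : SpR g) (hu : Measurable u)
    (hu2 : eLpNorm u 2 (haarNil g) ≠ ⊤) :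
    ∫⁻ p, ENNReal.ofReal (Real.exp (-Real.pi * qY p.1)) * ‖u (pt (embT α p))‖ₑ ^ 2 ∂(slab g) < ⊤ := by
  obtain ⟨C, -, h⟩ := exists_slab_gauss_le g
  have h1 := h α (pt 0) (fun m => ‖u m‖ₑ ^ 2) (hu.enorm.pow_const 2)
  rw [← eLpNorm_two_sq] at h1
  rw [← measurePreserving_neg_slab.lintegral_comp_emb
    (Homeomorph.neg ((Fin g ⊕ Fin g → ℝ) × ℝ)).measurableEmbedding]
  have e : ∀ p, expo (-(embT α p)) • (pt 0 : Nil g) = pt (embT α (-p)) := by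
    intro p
    rw [embT_neg, expo_smul_pt, hmul_eq_add]
    simp [om, omegaForm]
  simp only [e] at h1
  simp only [Prod.fst_neg, qY_neg]
  exact h1.trans_lt (ENNReal.mul_lt_top ENNReal.ofReal_lt_top (ENNReal.pow_lt_top hu2.lt_top))

theorem measurable_pt_embT (α : SpR g) :
    Measurable fun p : (Fin g ⊕ Fin g → ℝ) × ℝ => pt (embT α p) :=
  measurable_pt.comp (continuous_embT α).measurable

theorem ae_slab_eq_zero (α : SpR g) (hu : Measurable u) (hu2 : eLpNorm u 2 (haarNil g) ≠ ⊤)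
    (h : ∀ n : ℤ, hatU α (4 * Real.pi * n) u =ᵐ[volume] 0) :
    ∀ᵐ p ∂(slab g), u (pt (embT α p)) = 0 := by
  have hm : Measurable fun p : (Fin g ⊕ Fin g → ℝ) × ℝ => u (pt (embT α p)) :=
    hu.comp (measurable_pt_embT α)
  have hm2 : Measurable fun p : (Fin g ⊕ Fin g → ℝ) × ℝ =>
      ENNReal.ofReal (Real.exp (-Real.pi * qY p.1)) * ‖u (pt (embT α p))‖ₑ ^ 2 :=
    (ENNReal.measurable_ofReal.comp (Real.measurable_exp.comp
      ((continuous_qY.measurable.comp measurable_fst).const_mul _))).mul (hm.enorm.pow_const 2)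
  have h1 := lintegral_slab_sq_lt_top α hu hu2
  rw [slab, lintegral_prod _ hm2.aemeasurable] at h1
  have h2 := ae_lt_top hm2.lintegral_prod_right' h1.ne
  have hset : MeasurableSet {p : (Fin g ⊕ Fin g → ℝ) × ℝ | u (pt (embT α p)) = 0} :=
    hm (measurableSet_singleton 0)
  rw [slab, Measure.ae_prod_iff_ae_ae hset]
  filter_upwards [ae_all_iff.2 h, h2] with x hx hx2
  have hmx : Measurable fun t : ℝ => u (pt (embT α (x, t))) := hm.comp measurable_prodMk_left
  rw [lintegral_const_mul _ (hmx.enorm.pow_const 2)] at hx2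
  refine ae_eq_zero_of_fourier ⟨hmx.aestronglyMeasurable, ?_⟩ hx
  have h3 : ∫⁻ t in Set.Ico (-1 / 4 : ℝ) (1 / 4), ‖u (pt (embT α (x, t)))‖ₑ ^ 2 < ⊤ := by
    by_contra htop
    rw [not_lt_top_iff.1 htop, ENNReal.mul_top (by simp [Real.exp_pos])] at hx2
    exact lt_irrefl _ hx2
  rw [← eLpNorm_two_sq] at h3
  by_contra htop
  rw [not_lt_top_iff.1 htop] at h3
  simp at h3

theorem ae_eq_zero_of_hatU (α : SpR g) (hu : Measurable u) (hu2 : eLpNorm u 2 (haarNil g) ≠ ⊤)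
    (h : ∀ n : ℤ, hatU α (4 * Real.pi * n) u =ᵐ[volume] 0) : u =ᵐ[haarNil g] 0 := by
  have h1 := ae_slab_eq_zero α hu hu2 h
  rw [slab_eq, ae_restrict_iff' (MeasurableSet.univ.prod measurableSet_Ico)] at h1
  have hset : MeasurableSet {w : HeisAlg g | w.2.2 ∈ Set.Ico (-1 / 4 : ℝ) (1 / 4) → u (pt w) = 0} := by
    have m1 : MeasurableSet {w : HeisAlg g | w.2.2 ∈ Set.Ico (-1 / 4 : ℝ) (1 / 4)} :=
      (measurable_snd.comp measurable_snd) measurableSet_Ico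
    have m2 : MeasurableSet {w : HeisAlg g | u (pt w) = 0} :=
      (hu.comp measurable_pt) (measurableSet_singleton 0)
    exact m1.imp m2
  have h2 : ∀ᵐ w : HeisAlg g, w.2.2 ∈ Set.Ico (-1 / 4 : ℝ) (1 / 4) → u (pt w) = 0 := by
    rw [← (measurePreserving_embT α).map_eq,
      ae_map_iff (continuous_embT α).measurable.aemeasurable hset]
    filter_upwards [h1] with p hp ht
    rw [embT_eq] at ht
    exact hp ⟨Set.mem_univ _, ht⟩
  -- Central translation by `-1/4` carries the window `[0, 1/2)` of the fundamental box to the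
  -- window `[-1/4, 1/4)` of the slab.
  have h3 := (measurePreserving_hmul_left (g := g) ((-1 / 4 : ℝ) • basisT)).quasiMeasurePreserving.ae h2
  have hmz : Measurable fun m : Nil g => ‖u m‖ₑ := hu.enorm
  have hms : Measurable fun m : Nil g => ‖u (expo ((-1 / 4 : ℝ) • (basisT : HeisAlg g)) • m)‖ₑ :=
    hmz.comp (measurable_smul_nil _)
  have h4 : ∫⁻ m, ‖u m‖ₑ ∂(haarNil g) = 0 := by
    rw [← lintegral_smul_nil ((-1 / 4 : ℝ) • basisT) hmz,
      lintegral_haarNil hms]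
    simp only [mul_eq_zero, OfNat.ofNat_ne_zero, false_or]
    have hmp : Measurable fun w : HeisAlg g =>
        ‖u (expo ((-1 / 4 : ℝ) • (basisT : HeisAlg g)) • pt w)‖ₑ := hms.comp measurable_pt
    rw [lintegral_eq_zero_iff hmp]
    rw [EventuallyEq, ae_restrict_iff' measurableSet_boxD]
    filter_upwards [h3] with w hw hwD
    simp only [Pi.zero_apply, enorm_eq_zero, expo_smul_pt]
    refine hw ?_
    obtain ⟨-, -, h5⟩ := hwD
    rw [hmul_eq_add, om_smul_left, om_basisT_left]
    simp only [Set.mem_Ico, basisT, Prod.snd_add, Prod.smul_mk, smul_eq_mul] at h5 ⊢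
    constructor <;> linarith [h5.1, h5.2]
  rw [lintegral_eq_zero_iff hmz] at h4
  filter_upwards [h4] with m hm
  simpa using hm

/-- An `L²` function all of whose averages vanish is zero. -/
theorem L2.eq_zero_of_avgQ (α : SpR g) (u : L2 g)
    (h : ∀ (n : ℤ) (ε : ℝ), 0 < ε →
      avgQ α (secKer (bumpG ε) (4 * Real.pi * n)) u =ᵐ[haarNil g] 0) : u = 0 := by
  refine (Lp.eq_zero_iff_ae_eq_zero).2
    (ae_eq_zero_of_hatU α (L2.measurable u) (L2.eLpNorm_ne_top u) fun n => ?_)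
  refine ae_eq_zero_of_twisted_convolution
    (locallyIntegrable_hatU α _ (L2.measurable u) (L2.eLpNorm_ne_top u)) (4 * Real.pi * n)
    fun ε hε z => ?_
  have hz : ∀ r, ε ≤ r → bumpG ε r = 0 := fun r hr => bumpG_eq_zero hε hr
  have hk := isKernel_secKer_of_contDiff (g := g) (contDiff_bumpG ε) hz (4 * Real.pi * n)
  have h1 := (isSmooth_avgQ (contDiff_bumpG ε) hz α n (L2.measurable u)
    (L2.eLpNorm_ne_top u)).contDiff.continuous
  have h2 := ae_pt_of_ae (h n ε hε)
  have h3 : (fun w : HeisAlg g => avgQ α (secKer (bumpG ε) (4 * Real.pi * n)) u (pt w)) =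
      fun _ => 0 := (Continuous.ae_eq_iff_eq volume h1 continuous_const).1 h2
  have h4 := congrFun h3 (embT α (z, 0))
  rw [avgQ_secKer_pt hk α (L2.measurable u) (L2.eLpNorm_ne_top u)] at h4
  simpa using h4

end FourierUniqueness
end HeisNil
end

/-! ### Joint eigenfunctions -/

noncomputable section
namespace HeisNil
open MeasureTheory Filter Topology Complex

section Eigenfunctions
variable {g : ℕ} {α : SpR g} {f h : Nil g → ℂ} {G : ℝ → ℝ}

theorem IsSmooth.memLp (hf : IsSmooth f) : MemLp f 2 (haarNil g) := by
  obtain ⟨C, -, hC⟩ := exists_bound_of_continuous hf.continuous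
  exact MemLp.of_bound hf.measurable.aestronglyMeasurable C (Eventually.of_forall hC)

/-- The class in `L²` of a smooth function. -/
def IsSmooth.toL2 (hf : IsSmooth f) : L2 g := hf.memLp.toLp

theorem IsSmooth.coeFn_toL2 (hf : IsSmooth f) : hf.toL2 =ᵐ[haarNil g] f := hf.memLp.coeFn_toLp

theorem IsSmooth.eq_of_ae_eq (hf : IsSmooth f) (hh : IsSmooth h) (e : f =ᵐ[haarNil g] h) :
    f = h := by
  have h1 := ae_pt_of_ae e
  have h2 : (fun w : HeisAlg g => f (pt w)) = fun w => h (pt w) :=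
    (Continuous.ae_eq_iff_eq volume hf.contDiff.continuous hh.contDiff.continuous).1 h1
  ext m
  obtain ⟨w, rfl⟩ := pt_surjective m
  exact congrFun h2 w

theorem inner_eq_integral {u v : L2 g} (hu : u =ᵐ[haarNil g] f) (hv : v =ᵐ[haarNil g] h) :
    inner ℂ u v = ∫ m, h m * star (f m) ∂(haarNil g) := by
  rw [L2.inner_def]
  refine integral_congr_ae ?_
  filter_upwards [hu, hv] with m h1 h2
  rw [RCLike.inner_apply, h1, h2]
  rfl

/-- The joint eigenspaces of the centre and of `L_α`. -/
def secEig (α : SpR g) (n : ℤ) (lam : ℝ) : Submodule ℂ (L2 g) where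
  carrier := {u | ∃ f : Nil g → ℂ, IsSmooth f ∧ IsSector (4 * Real.pi * n) f ∧
    (∀ m, opL α f m = (lam : ℂ) * f m) ∧ u =ᵐ[haarNil g] f}
  add_mem' := by
    rintro u v ⟨f, hf, hfs, hfe, hu⟩ ⟨h, hh, hhs, hhe, hv⟩
    refine ⟨fun m => f m + h m, hf.add hh, fun t m => ?_, fun m => ?_, ?_⟩
    · simp only
      rw [hfs, hhs, mul_add]
    · rw [opL_add hf hh, hfe, hhe, mul_add]
    · filter_upwards [Lp.coeFn_add u v, hu, hv] with m h1 h2 h3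
      rw [h1, Pi.add_apply, h2, h3]
  zero_mem' := by
    refine ⟨fun _ => 0, isSmooth_zero, fun t m => by simp, fun m => ?_, Lp.coeFn_zero _ _ _⟩
    have := opL_const_mul (isSmooth_zero (g := g)) 0 α m
    simpa using this
  smul_mem' := by
    rintro c u ⟨f, hf, hfs, hfe, hu⟩
    refine ⟨fun m => c * f m, hf.const_mul c, hfs.const_mul c, fun m => ?_, ?_⟩
    · rw [opL_const_mul hf, hfe]
      ring
    · filter_upwards [Lp.coeFn_smul c u, hu] with m h1 h2
      rw [h1, Pi.smul_apply, h2, smul_eq_mul]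

/-- Averages of smooth functions of a sector commute with `L_α`. -/
theorem avgQ_opL (hG : ContDiff ℝ ∞ G) {R : ℝ} (hR : ∀ r, R ≤ r → G r = 0) {ν : ℝ}
    (hf : IsSmooth f) (hν : IsSector ν f) (α : SpR g) (m : Nil g)
    (hs : IsSmooth (avgQ α (secKer G ν) f)) :
    avgQ α (secKer G ν) (opL α f) m = opL α (avgQ α (secKer G ν) f) m := by
  have hP := radialProfile_of_contDiff hG hR
  have e : avgY α (fun y => (G (qY y) : ℂ)) f = fun m => 2 * avgQ α (secKer G ν) f m := by
    ext m
    rw [hν.avgQ_secKer]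
    ring
  rw [(hν.opL α).avgQ_secKer, ← hP.opL_avgY hf hν, e, opL_const_mul hs]
  ring

end Eigenfunctions

/-! ### Completeness of the joint eigenspaces -/

section SpectralDecomposition
variable {g : ℕ} {α : SpR g} {G : ℝ → ℝ} {R : ℝ} {n : ℤ} {μ : ℂ}

/-- The smooth representative of an eigenvector of an averaging operator. -/
def eigRep (α : SpR g) (G : ℝ → ℝ) (n : ℤ) (μ : ℂ) (v : L2 g) (m : Nil g) : ℂ :=
  μ⁻¹ * avgQ α (secKer G (4 * Real.pi * n)) v m

theorem isSmooth_eigRep (hG : ContDiff ℝ ∞ G) (hR : ∀ r, R ≤ r → G r = 0) (α : SpR g) (n : ℤ)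
    (μ : ℂ) (v : L2 g) : IsSmooth (eigRep α G n μ v) :=
  (isSmooth_avgQ hG hR α n (L2.measurable v) (L2.eLpNorm_ne_top v)).const_mul _

theorem isSector_eigRep (hk : IsKernel (secKer (g := g) G (4 * Real.pi * n))) (α : SpR g)
    (μ : ℂ) (v : L2 g) : IsSector (4 * Real.pi * n) (eigRep α G n μ v) :=
  (isSector_avgQ hk α (L2.measurable v) (L2.eLpNorm_ne_top v)).const_mul _

theorem ae_eq_eigRep (hk : IsKernel (secKer (g := g) G (4 * Real.pi * n))) (hμ : μ ≠ 0) {v : L2 g}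
    (hv : v ∈ Module.End.eigenspace (avgOp hk α : L2 g →ₗ[ℂ] L2 g) μ) :
    v =ᵐ[haarNil g] eigRep α G n μ v := by
  have h1 : avgOp hk α v = μ • v := Module.End.mem_eigenspace_iff.1 hv
  have h2 := coeFn_avgOp hk α v
  rw [h1] at h2
  filter_upwards [h2, Lp.coeFn_smul μ v] with m hm1 hm2
  rw [eigRep, ← hm1, hm2, Pi.smul_apply, smul_eq_mul, inv_mul_cancel_left₀ hμ]

theorem avgQ_eigRep (hG : ContDiff ℝ ∞ G) (hR : ∀ r, R ≤ r → G r = 0)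
    (hk : IsKernel (secKer (g := g) G (4 * Real.pi * n))) (hμ : μ ≠ 0) {v : L2 g}
    (hv : v ∈ Module.End.eigenspace (avgOp hk α : L2 g →ₗ[ℂ] L2 g) μ) :
    avgQ α (secKer G (4 * Real.pi * n)) (eigRep α G n μ v) = fun m => μ * eigRep α G n μ v m := by
  ext m
  rw [← avgQ_congr hk α (L2.measurable v) (isSmooth_eigRep hG hR α n μ v).measurable
    (ae_eq_eigRep hk hμ hv) m, eigRep, mul_inv_cancel_left₀ hμ]

/-- `L_α` commutes with the average on smooth functions of the sector, hence preserves its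
eigenspaces; for `μ ≠ 0` these consist of such functions, because an eigenvector is `μ⁻¹` times its
own average. -/
theorem toL2_opL_eigRep_mem (hG : ContDiff ℝ ∞ G) (hR : ∀ r, R ≤ r → G r = 0)
    (hk : IsKernel (secKer (g := g) G (4 * Real.pi * n))) (hμ : μ ≠ 0) {v : L2 g}
    (hv : v ∈ Module.End.eigenspace (avgOp hk α : L2 g →ₗ[ℂ] L2 g) μ) :
    ((isSmooth_eigRep hG hR α n μ v).opL α).toL2 ∈
      Module.End.eigenspace (avgOp hk α : L2 g →ₗ[ℂ] L2 g) μ := by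
  set hf := isSmooth_eigRep hG hR α n μ v
  set w := (hf.opL α).toL2 with hw
  have hwe : w =ᵐ[haarNil g] opL α (eigRep α G n μ v) := (hf.opL α).coeFn_toL2
  rw [Module.End.mem_eigenspace_iff]
  refine Lp.ext ?_
  have h1 := avgQ_eigRep hG hR hk hμ hv
  filter_upwards [coeFn_avgOp hk α w, Lp.coeFn_smul μ w, hwe] with m hm1 hm2 hm3
  refine hm1.trans ?_
  rw [hm2, Pi.smul_apply, hm3, smul_eq_mul, avgQ_congr hk α (L2.measurable w)
    (hf.opL α).measurable hwe m, avgQ_opL hG hR hf (isSector_eigRep hk α μ v) α m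
      (by rw [h1]; exact hf.const_mul μ), h1, opL_const_mul hf]

theorem eigRep_add (hk : IsKernel (secKer (g := g) G (4 * Real.pi * n))) (v w : L2 g) :
    eigRep α G n μ (v + w) = fun m => eigRep α G n μ v m + eigRep α G n μ w m := by
  ext m
  rw [eigRep, avgQ_add hk, mul_add]
  rfl

theorem eigRep_smul (hk : IsKernel (secKer (g := g) G (4 * Real.pi * n))) (c : ℂ) (v : L2 g) :
    eigRep α G n μ (c • v) = fun m => c * eigRep α G n μ v m := by
  ext m
  rw [eigRep, avgQ_smul hk, eigRep]
  ring

/-- The operator `L_α` on an eigenspace of an averaging operator. -/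
def opLEig (hG : ContDiff ℝ ∞ G) (hR : ∀ r, R ≤ r → G r = 0)
    (hk : IsKernel (secKer (g := g) G (4 * Real.pi * n))) (α : SpR g) (hμ : μ ≠ 0) :
    Module.End.eigenspace (avgOp hk α : L2 g →ₗ[ℂ] L2 g) μ →ₗ[ℂ]
      Module.End.eigenspace (avgOp hk α : L2 g →ₗ[ℂ] L2 g) μ where
  toFun v := ⟨_, toL2_opL_eigRep_mem hG hR hk hμ v.2⟩
  map_add' v w := by
    refine Subtype.ext (Lp.ext ?_)
    have h1 := ((isSmooth_eigRep hG hR α n μ (v + w : L2 g)).opL α).coeFn_toL2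
    have h2 := ((isSmooth_eigRep hG hR α n μ (v : L2 g)).opL α).coeFn_toL2
    have h3 := ((isSmooth_eigRep hG hR α n μ (w : L2 g)).opL α).coeFn_toL2
    filter_upwards [h1, h2, h3, Lp.coeFn_add
      (((isSmooth_eigRep hG hR α n μ (v : L2 g)).opL α).toL2)
      (((isSmooth_eigRep hG hR α n μ (w : L2 g)).opL α).toL2)] with m e1 e2 e3 e4
    refine e1.trans (Eq.trans ?_ e4.symm)
    rw [Pi.add_apply, e2, e3, eigRep_add hk,
      opL_add (isSmooth_eigRep hG hR α n μ _) (isSmooth_eigRep hG hR α n μ _)]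
  map_smul' c v := by
    refine Subtype.ext (Lp.ext ?_)
    have h1 := ((isSmooth_eigRep hG hR α n μ (c • v : L2 g)).opL α).coeFn_toL2
    have h2 := ((isSmooth_eigRep hG hR α n μ (v : L2 g)).opL α).coeFn_toL2
    filter_upwards [h1, h2, Lp.coeFn_smul c
      (((isSmooth_eigRep hG hR α n μ (v : L2 g)).opL α).toL2)] with m e1 e2 e4
    refine e1.trans (Eq.trans ?_ e4.symm)
    rw [Pi.smul_apply, e2, eigRep_smul hk, opL_const_mul (isSmooth_eigRep hG hR α n μ _)]
    rfl

theorem opLEig_coe_ae (hG : ContDiff ℝ ∞ G) (hR : ∀ r, R ≤ r → G r = 0)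
    (hk : IsKernel (secKer (g := g) G (4 * Real.pi * n))) (hμ : μ ≠ 0)
    (v : Module.End.eigenspace (avgOp hk α : L2 g →ₗ[ℂ] L2 g) μ) :
    ((opLEig hG hR hk α hμ v : L2 g) : Nil g → ℂ) =ᵐ[haarNil g]
      opL α (eigRep α G n μ (v : L2 g)) :=
  ((isSmooth_eigRep hG hR α n μ (v : L2 g)).opL α).coeFn_toL2

theorem isSymmetric_opLEig (hG : ContDiff ℝ ∞ G) (hR : ∀ r, R ≤ r → G r = 0)
    (hk : IsKernel (secKer (g := g) G (4 * Real.pi * n))) (α : SpR g) (hμ : μ ≠ 0) :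
    (opLEig hG hR hk α hμ).IsSymmetric := by
  intro v w
  rw [Submodule.coe_inner, Submodule.coe_inner,
    inner_eq_integral (opLEig_coe_ae hG hR hk hμ v) (ae_eq_eigRep hk hμ w.2),
    inner_eq_integral (ae_eq_eigRep hk hμ v.2) (opLEig_coe_ae hG hR hk hμ w)]
  exact (integral_opL_mul_conj (isSmooth_eigRep hG hR α n μ (w : L2 g))
    (isSmooth_eigRep hG hR α n μ (v : L2 g)) α).symm

/-- The eigenspaces of averaging operators are spanned by eigenfunctions of `L_α`. -/
theorem inner_eq_zero_of_mem_eigenspace (hG : ContDiff ℝ ∞ G) (hR : ∀ r, R ≤ r → G r = 0)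
    (hk : IsKernel (secKer (g := g) G (4 * Real.pi * n))) (hμ : μ ≠ 0) {r : L2 g}
    (hr : ∀ (lam : ℝ), ∀ v ∈ secEig α n lam, inner ℂ v r = 0) {v : L2 g}
    (hv : v ∈ Module.End.eigenspace (avgOp hk α : L2 g →ₗ[ℂ] L2 g) μ) : inner ℂ v r = 0 := by
  -- By compactness the eigenspace is finite dimensional, so the symmetric operator `L_α` has there
  -- an orthonormal basis of eigenvectors; each of them lies in some `secEig`.
  have := ContinuousLinearMap.finite_dimensional_eigenspace (isCompactOperator_avgOp hk α) μ hμ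
  have hD := isSymmetric_opLEig hG hR hk α hμ
  set b := hD.eigenvectorBasis rfl with hb
  have h1 : ∀ i, inner ℂ ((b i : Module.End.eigenspace (avgOp hk α : L2 g →ₗ[ℂ] L2 g) μ) : L2 g) r
      = 0 := by
    intro i
    refine hr (hD.eigenvalues rfl i) _ ⟨eigRep α G n μ (b i : L2 g), isSmooth_eigRep hG hR α n μ _,
      isSector_eigRep hk α μ _, fun m => ?_, ae_eq_eigRep hk hμ (b i).2⟩
    have h2 := hD.apply_eigenvectorBasis rfl i
    rw [← hb] at h2
    have h3 := opLEig_coe_ae hG hR hk hμ (b i)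
    rw [h2] at h3
    have h4 : opL α (eigRep α G n μ (b i : L2 g)) =
        fun m => ((hD.eigenvalues rfl i : ℝ) : ℂ) * eigRep α G n μ (b i : L2 g) m := by
      refine ((isSmooth_eigRep hG hR α n μ _).opL α).eq_of_ae_eq
        ((isSmooth_eigRep hG hR α n μ _).const_mul _) ?_
      filter_upwards [h3, Lp.coeFn_smul ((hD.eigenvalues rfl i : ℝ) : ℂ) (b i : L2 g),
        ae_eq_eigRep hk hμ (b i).2] with m e1 e2 e3
      rw [← e1, ← e3]
      exact e2
    exact congrFun h4 m
  have h5 := b.sum_repr ⟨v, hv⟩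
  have h6 : v = ∑ i, b.repr ⟨v, hv⟩ i • (b i : L2 g) := by
    have h7 := congrArg Subtype.val h5
    rw [AddSubmonoidClass.coe_finsetSum] at h7
    exact h7.symm
  rw [h6, sum_inner]
  refine Finset.sum_eq_zero fun i _ => ?_
  rw [inner_smul_left, h1, mul_zero]

/-- By self-adjointness the image of `r` is orthogonal to every eigenspace of the averaging
operator: to the kernel trivially, to the others by the previous lemma. The spectral theorem for
compact operators leaves only zero. -/
theorem avgOp_eq_zero_of_orthogonal (hG : ContDiff ℝ ∞ G) (hR : ∀ r, R ≤ r → G r = 0)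
    (hk : IsKernel (secKer (g := g) G (4 * Real.pi * n))) {r : L2 g}
    (hr : ∀ (lam : ℝ), ∀ v ∈ secEig α n lam, inner ℂ v r = 0) : avgOp hk α r = 0 := by
  have hsym := isSymmetric_avgOp hk (secKer_neg G _) α
  have h1 := ContinuousLinearMap.orthogonalComplement_iSup_eigenspaces_eq_bot
    (isCompactOperator_avgOp hk α) hsym
  have h2 : avgOp hk α r ∈
      (⨆ μ, Module.End.eigenspace (avgOp hk α : L2 g →ₗ[ℂ] L2 g) μ)ᗮ := by
    rw [Submodule.mem_orthogonal]
    intro v hv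
    induction hv using Submodule.iSup_induction' with
    | mem μ v hv =>
      have h3 : inner ℂ v (avgOp hk α r) = inner ℂ (avgOp hk α v) r := (hsym v r).symm
      have h4 : avgOp hk α v = μ • v := Module.End.mem_eigenspace_iff.1 hv
      rw [h3, h4, inner_smul_left]
      by_cases hμ : μ = 0
      · rw [hμ, map_zero, zero_mul]
      · rw [inner_eq_zero_of_mem_eigenspace hG hR hk hμ hr hv, mul_zero]
    | zero => exact inner_zero_left _
    | add v w _ _ h3 h4 => rw [inner_add_left, h3, h4, add_zero]
  rw [h1] at h2
  exact (Submodule.mem_bot ℂ).1 h2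

/-- Completeness of the joint eigenspaces. -/
theorem eq_zero_of_orthogonal_secEig (α : SpR g) {r : L2 g}
    (hr : ∀ (n : ℤ) (lam : ℝ), ∀ v ∈ secEig α n lam, inner ℂ v r = 0) : r = 0 := by
  refine L2.eq_zero_of_avgQ α r fun n ε hε => ?_
  have hz : ∀ r, ε ≤ r → bumpG ε r = 0 := fun r hr => bumpG_eq_zero hε hr
  have hk := isKernel_secKer_of_contDiff (g := g) (contDiff_bumpG ε) hz (4 * Real.pi * n)
  have h1 := avgOp_eq_zero_of_orthogonal (contDiff_bumpG ε) hz hk (hr n)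
  have h2 := coeFn_avgOp hk α r
  rw [h1] at h2
  filter_upwards [h2, Lp.coeFn_zero ℂ 2 (haarNil g)] with m e1 e2
  rw [← e1, e2]

end SpectralDecomposition
end HeisNil
end

/-! ### Orthogonality, positivity and finite dimension -/

noncomputable section
namespace HeisNil
open MeasureTheory Filter Topology Complex

section JointEigenspaces
variable {g : ℕ} {α : SpR g} {n n' : ℤ} {lam lam' : ℝ} {u v : L2 g} {f h : Nil g → ℂ}

theorem secEig_le_eigenspaceL (α : SpR g) (n : ℤ) (lam : ℝ) :
    secEig α n lam ≤ eigenspaceL α lam := by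
  rintro u ⟨f, hf, -, he, hu⟩
  exact Submodule.le_topologicalClosure _ (Submodule.subset_span ⟨f, hf, he, hu⟩)

/-- The central field is skew-symmetric and acts on the two functions by different imaginary
scalars. -/
theorem integral_mul_star_eq_zero_of_sector {ν ν' : ℝ} (hf : IsSmooth f) (hh : IsSmooth h)
    (hν : IsSector ν f) (hν' : IsSector ν' h) (hne : ν ≠ ν') :
    ∫ m, f m * star (h m) ∂(haarNil g) = 0 := by
  have h1 := integral_lieDer_mul_conj hf hh basisT
  simp only [hν.lieDer_basisT, hν'.lieDer_basisT] at h1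
  have e1 : ∀ m, -(I * ν) * f m * star (h m) = -(I * ν) * (f m * star (h m)) := fun m => by ring
  have e2 : ∀ m, f m * star (-(I * ν') * h m) = (I * ν') * (f m * star (h m)) := fun m => by
    simp only [star_mul, star_neg, RCLike.star_def, conj_I, conj_ofReal]
    ring
  simp only [e1, e2, integral_const_mul] at h1
  have h2 : I * ((ν : ℂ) - ν') * ∫ m, f m * star (h m) ∂(haarNil g) = 0 := by
    linear_combination -h1
  rcases mul_eq_zero.1 h2 with h3 | h3
  · rcases mul_eq_zero.1 h3 with h4 | h4
    · exact absurd h4 I_ne_zero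
    · exact absurd (ofReal_injective (sub_eq_zero.1 h4)) hne
  · exact h3

theorem integral_mul_star_eq_zero_of_eigenvalue (hf : IsSmooth f) (hh : IsSmooth h)
    (he : ∀ m, opL α f m = (lam : ℂ) * f m) (he' : ∀ m, opL α h m = (lam' : ℂ) * h m)
    (hne : lam ≠ lam') : ∫ m, f m * star (h m) ∂(haarNil g) = 0 := by
  have h1 := integral_opL_mul_conj hf hh α
  simp only [he, he'] at h1
  have e1 : ∀ m, (lam : ℂ) * f m * star (h m) = lam * (f m * star (h m)) := fun m => by ring
  have e2 : ∀ m, f m * star ((lam' : ℂ) * h m) = lam' * (f m * star (h m)) := fun m => by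
    simp only [star_mul, RCLike.star_def, conj_ofReal]
    ring
  simp only [e1, e2, integral_const_mul] at h1
  have h2 : ((lam : ℂ) - lam') * ∫ m, f m * star (h m) ∂(haarNil g) = 0 := by
    linear_combination h1
  rcases mul_eq_zero.1 h2 with h3 | h3
  · exact absurd (ofReal_injective (sub_eq_zero.1 h3)) hne
  · exact h3

theorem inner_eq_zero_of_secEig (hu : u ∈ secEig α n lam) (hv : v ∈ secEig α n' lam')
    (hne : (n, lam) ≠ (n', lam')) : inner ℂ u v = 0 := by
  obtain ⟨f, hf, hfs, hfe, huf⟩ := hu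
  obtain ⟨h, hh, hhs, hhe, hvh⟩ := hv
  rw [inner_eq_integral huf hvh]
  by_cases hn : n = n'
  · refine integral_mul_star_eq_zero_of_eigenvalue hh hf hhe hfe fun hl => hne ?_
    rw [hn, hl]
  · refine integral_mul_star_eq_zero_of_sector hh hf hhs hfs fun hl => hn ?_
    have h1 : (n' : ℝ) = n := mul_left_cancel₀ (by positivity) hl
    exact_mod_cast h1.symm

theorem integral_lieDer_lieDer_mul_star_self (hf : IsSmooth f) (V : HeisAlg g) :
    ∫ m, lieDer V (lieDer V f) m * star (f m) ∂(haarNil g) =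
      -((∫ m, ‖lieDer V f m‖ ^ 2 ∂(haarNil g) : ℝ) : ℂ) := by
  rw [integral_lieDer_mul_conj (hf.lieDer V) hf V, ← integral_complex_ofReal]
  congr 1
  refine integral_congr_ae (Eventually.of_forall fun m => ?_)
  simp only
  rw [RCLike.star_def, mul_conj, normSq_eq_norm_sq]

/-- The eigenvalues of `L_α` are positive. -/
theorem eigenvalue_pos (hf : IsSmooth f) (he : ∀ m, opL α f m = (lam : ℂ) * f m)
    (hf0 : ∫ m, ‖f m‖ ^ 2 ∂(haarNil g) ≠ 0) : 0 < lam := by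
  set N := ∫ m, ‖f m‖ ^ 2 ∂(haarNil g) with hN
  have hN0 : 0 < N := lt_of_le_of_ne (integral_nonneg fun _ => sq_nonneg _) hf0.symm
  have i0 : Integrable (fun m => f m * star (f m)) (haarNil g) :=
    integrable_of_continuous (hf.mul hf.conj).continuous
  have i1 : ∀ V : HeisAlg g, Integrable (fun m => lieDer V (lieDer V f) m * star (f m))
    (haarNil g) := fun V => integrable_of_continuous (((hf.lieDer V).lieDer V).mul hf.conj).continuous
  have e0 : ∫ m, f m * star (f m) ∂(haarNil g) = (N : ℂ) := by
    rw [hN, ← integral_complex_ofReal]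
    refine integral_congr_ae (Eventually.of_forall fun m => ?_)
    simp only
    rw [RCLike.star_def, mul_conj, normSq_eq_norm_sq]
  have e1 : ∫ m, opL α f m * star (f m) ∂(haarNil g) = (lam : ℂ) * N := by
    rw [← e0, ← integral_const_mul]
    refine integral_congr_ae (Eventually.of_forall fun m => ?_)
    simp only
    rw [he, mul_assoc]
  have e2 : ∫ m, opL α f m * star (f m) ∂(haarNil g) = (N : ℂ) +
      ((∑ i, ((∫ m, ‖lieDer (act α⁻¹ (basisX i)) f m‖ ^ 2 ∂(haarNil g) : ℝ) : ℂ)) +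
      (∑ i, ((∫ m, ‖lieDer (act α⁻¹ (basisXi i)) f m‖ ^ 2 ∂(haarNil g) : ℝ) : ℂ)) +
      ((∫ m, ‖lieDer basisT f m‖ ^ 2 ∂(haarNil g) : ℝ) : ℂ)) := by
    have e3 : ∀ m, opL α f m * star (f m) = f m * star (f m) -
        ((∑ i, lieDer (act α⁻¹ (basisX i)) (lieDer (act α⁻¹ (basisX i)) f) m * star (f m)) +
        (∑ i, lieDer (act α⁻¹ (basisXi i)) (lieDer (act α⁻¹ (basisXi i)) f) m * star (f m)) +
        lieDer basisT (lieDer basisT f) m * star (f m)) := by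
      intro m
      rw [opL, laplacian, ← Finset.sum_mul, ← Finset.sum_mul]
      ring
    have j1 : Integrable (fun m => ∑ i, lieDer (act α⁻¹ (basisX i))
        (lieDer (act α⁻¹ (basisX i)) f) m * star (f m)) (haarNil g) :=
      integrable_finsetSum _ fun i _ => i1 _
    have j2 : Integrable (fun m => ∑ i, lieDer (act α⁻¹ (basisXi i))
        (lieDer (act α⁻¹ (basisXi i)) f) m * star (f m)) (haarNil g) :=
      integrable_finsetSum _ fun i _ => i1 _
    have j3 : Integrable (fun m => (∑ i, lieDer (act α⁻¹ (basisX i))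
        (lieDer (act α⁻¹ (basisX i)) f) m * star (f m)) + ∑ i, lieDer (act α⁻¹ (basisXi i))
        (lieDer (act α⁻¹ (basisXi i)) f) m * star (f m)) (haarNil g) := j1.add j2
    have j4 : Integrable (fun m => (∑ i, lieDer (act α⁻¹ (basisX i))
        (lieDer (act α⁻¹ (basisX i)) f) m * star (f m)) + (∑ i, lieDer (act α⁻¹ (basisXi i))
        (lieDer (act α⁻¹ (basisXi i)) f) m * star (f m)) +
        lieDer basisT (lieDer basisT f) m * star (f m)) (haarNil g) := j3.add (i1 _)
    simp only [e3]
    rw [integral_sub i0 j4, integral_add j3 (i1 _), integral_add j1 j2,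
      integral_finsetSum _ fun i _ => i1 _, integral_finsetSum _ fun i _ => i1 _, e0]
    simp only [integral_lieDer_lieDer_mul_star_self hf, Finset.sum_neg_distrib]
    ring
  rw [e1] at e2
  have e4 : lam * N = N + ((∑ i, ∫ m, ‖lieDer (act α⁻¹ (basisX i)) f m‖ ^ 2 ∂(haarNil g)) +
      (∑ i, ∫ m, ‖lieDer (act α⁻¹ (basisXi i)) f m‖ ^ 2 ∂(haarNil g)) +
      ∫ m, ‖lieDer basisT f m‖ ^ 2 ∂(haarNil g)) := by
    exact_mod_cast e2
  have hpos : ∀ V : HeisAlg g, 0 ≤ ∫ m, ‖lieDer V f m‖ ^ 2 ∂(haarNil g) := fun V =>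
    integral_nonneg fun _ => sq_nonneg _
  -- By skew-symmetry of the fields, `⟨L_α f, f⟩` is `‖f‖²` plus a sum of squares.
  have h1 : N ≤ lam * N := by
    rw [e4]
    have a1 := Finset.sum_nonneg fun i (_ : i ∈ Finset.univ) => hpos (act α⁻¹ (basisX i))
    have a2 := Finset.sum_nonneg fun i (_ : i ∈ Finset.univ) => hpos (act α⁻¹ (basisXi i))
    have a3 := hpos basisT
    linarith
  by_contra hneg
  nlinarith [not_lt.1 hneg]

theorem eq_zero_of_secEig_nonpos (hl : lam ≤ 0) (hu : u ∈ secEig α n lam) : u = 0 := by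
  obtain ⟨f, hf, -, he, huf⟩ := hu
  by_contra hne
  refine absurd (eigenvalue_pos hf he ?_) (not_lt.2 hl)
  have e : ∫ m, ‖f m‖ ^ 2 ∂(haarNil g) = ‖u‖ ^ 2 := by
    rw [L2.norm_sq_eq]
    refine integral_congr_ae ?_
    filter_upwards [huf] with m hm
    rw [hm]
  rw [e]
  exact pow_ne_zero 2 (norm_ne_zero_iff.2 hne)

/-- The joint eigenspaces of nonzero central frequency are finite dimensional. -/
theorem finiteDimensional_secEig (α : SpR g) (hn : n ≠ 0) (lam : ℝ) :
    FiniteDimensional ℂ (secEig α n lam) := by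
  set ν : ℝ := 4 * Real.pi * n with hν
  have hpi := Real.pi_gt_three
  have hν4 : 4 * Real.pi ≤ |ν| := by
    rw [hν, abs_mul, abs_of_pos (by positivity)]
    have : (1 : ℝ) ≤ |(n : ℝ)| := by exact_mod_cast Int.one_le_abs hn
    nlinarith
  have hw : 0 < |ν| := by linarith
  have ha : Real.pi ≤ mehlerA |ν| 1 :=
    le_trans (by linarith) (div_four_le_mehlerA hw one_pos)
  have hk : IsKernel (secKer (g := g) (fun r => Real.exp (-mehlerA |ν| 1 * r)) ν) := by
    refine isKernel_secKer (by fun_prop) ⟨1, zero_le_one, fun r hr => ?_⟩ ν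
    rw [one_mul, abs_of_pos (Real.exp_pos _)]
    refine Real.exp_le_exp.2 ?_
    nlinarith
  set c : ℂ := ofReal (mehlerC g |ν| 1) with hc
  -- Mehler's formula at time 1 says that one fixed Gaussian average acts on the whole space
  -- `secEig` as this nonzero scalar (the 1/2 is the length of the centre). The space therefore lies
  -- in an eigenspace of a compact operator.
  set μ : ℂ := ((Real.exp (-(lam - 1 - ν ^ 2) * 1) : ℝ) : ℂ) / c / 2 with hμ
  have hc0 : c ≠ 0 := by
    rw [hc, ofReal_ne_zero, mehlerC]
    have : 0 < Real.sinh (|ν| * 1) := Real.sinh_pos_iff.2 (by linarith)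
    positivity
  have hμ0 : μ ≠ 0 :=
    div_ne_zero (div_ne_zero (ofReal_ne_zero.2 (Real.exp_pos _).ne') hc0) two_ne_zero
  have := ContinuousLinearMap.finite_dimensional_eigenspace (isCompactOperator_avgOp hk α) μ hμ0
  refine Submodule.finiteDimensional_of_le (S₂ := Module.End.eigenspace
    (avgOp hk α : L2 g →ₗ[ℂ] L2 g) μ) fun u hu => ?_
  obtain ⟨f, hf, hfs, he, huf⟩ := hu
  rw [Module.End.mem_eigenspace_iff]
  refine Lp.ext ?_
  filter_upwards [coeFn_avgOp hk α u, Lp.coeFn_smul μ u, huf] with m h1 h2 h3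
  refine h1.trans ?_
  rw [h2, Pi.smul_apply, h3, smul_eq_mul, avgQ_congr hk α (L2.measurable u) hf.measurable huf m,
    hfs.avgQ_secKer]
  have h4 := mehler_gaussAvg hf hfs he (by linarith) m one_pos
  rw [gaussAvg, ← hc] at h4
  rw [hμ, div_mul_eq_mul_div, div_mul_eq_mul_div, ← h4, mul_div_cancel_left₀ _ hc0]

/-- Functions of zero average along the centre are orthogonal to the invariant ones. -/
theorem ZeroFibreAverage.inner_eq_zero (hu : ZeroFibreAverage u) (hv : v ∈ secEig α 0 lam) :
    inner ℂ v u = 0 := by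
  obtain ⟨f, hf, hfs, -, hvf⟩ := hv
  rw [inner_eq_integral hvf (EventuallyEq.refl _ _)]
  have hinv : ∀ (t : ℝ) m, f (expo (t • (basisT : HeisAlg g)) • m) = f m := by
    intro t m
    rw [hfs]
    simp
  obtain ⟨C, hC0, hC⟩ := exists_bound_of_continuous hf.continuous
  have hum := L2.measurable u
  have hfm : Measurable fun m => star (f m) := Complex.continuous_conj.measurable.comp hf.measurable
  have hmeas : Measurable fun x : Nil g × ℝ => expo (x.2 • (basisT : HeisAlg g)) • x.1 := by
    have h1 : Measurable fun x : Nil g × ℝ => x.2 • (basisT : HeisAlg g) :=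
      measurable_snd.smul_const _
    exact measurable_expo_smul.comp (h1.prodMk measurable_fst)
  have hFm : Measurable fun x : Nil g × ℝ =>
      u (expo (x.2 • (basisT : HeisAlg g)) • x.1) * star (f x.1) :=
    (hum.comp hmeas).mul (hfm.comp measurable_fst)
  have hu1 : Integrable u (haarNil g) := (Lp.memLp u).integrable (by norm_num)
  have hint : Integrable (fun x : Nil g × ℝ =>
      u (expo (x.2 • (basisT : HeisAlg g)) • x.1) * star (f x.1))
      ((haarNil g).prod (volume.restrict (Set.Ioc (0 : ℝ) (1 / 2)))) := by
    have hU : Integrable (fun x : Nil g × ℝ => u (expo (x.2 • (basisT : HeisAlg g)) • x.1))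
        ((haarNil g).prod (volume.restrict (Set.Ioc (0 : ℝ) (1 / 2)))) := by
      have hUm : Measurable fun x : Nil g × ℝ => u (expo (x.2 • (basisT : HeisAlg g)) • x.1) :=
        hum.comp hmeas
      refine ⟨hUm.aestronglyMeasurable, ?_⟩
      rw [HasFiniteIntegral, lintegral_prod_symm _ hUm.enorm.aemeasurable]
      have e : ∀ t : ℝ, ∫⁻ m, ‖u (expo (t • (basisT : HeisAlg g)) • m)‖ₑ ∂(haarNil g) =
          ∫⁻ m, ‖u m‖ₑ ∂(haarNil g) := fun t => lintegral_smul_nil _ hum.enorm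
      simp only [e, lintegral_const, Measure.restrict_apply MeasurableSet.univ, Set.univ_inter,
        Real.volume_Ioc]
      exact ENNReal.mul_lt_top hu1.2 ENNReal.ofReal_lt_top
    refine hU.mul_bdd (c := C) (hfm.comp measurable_fst).aestronglyMeasurable
      (Eventually.of_forall fun x => ?_)
    rw [norm_star]
    exact hC _
  -- The pairing with a central invariant `f` is averaged over the fibre: by Fubini the average
  -- vanishes, while by invariance of the measure it is half the pairing.
  have h1 : ∫ t in Set.Ioc (0 : ℝ) (1 / 2), ∫ m, u (expo (t • (basisT : HeisAlg g)) • m) *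
      star (f m) ∂(haarNil g) = 0 := by
    rw [← integral_integral_swap (f := fun m t => u (expo (t • (basisT : HeisAlg g)) • m) *
      star (f m)) hint]
    refine (integral_congr_ae ?_).trans (integral_zero _ _)
    filter_upwards [hu] with m hm
    rw [intervalIntegral.integral_of_le (by norm_num)] at hm
    rw [integral_mul_const, hm, zero_mul]
  have h2 : ∀ t : ℝ, ∫ m, u (expo (t • (basisT : HeisAlg g)) • m) * star (f m) ∂(haarNil g) =
      ∫ m, u m * star (f m) ∂(haarNil g) := by
    intro t
    have hm2 : Measurable fun m => u m * star (f m) := hum.mul hfm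
    rw [← integral_smul_nil (t • basisT) hm2]
    simp only [hinv]
  simp only [h2, integral_const, smul_eq_zero] at h1
  refine h1.resolve_left ?_
  simp [Measure.real]

end JointEigenspaces
end HeisNil
end

/-! ### Bessel's inequality for orthogonal families of subspaces -/

noncomputable section
namespace HeisNil
open MeasureTheory Filter Topology

section OrthogonalProjections
variable {E ι : Type*} [NormedAddCommGroup E] [InnerProductSpace ℂ E]
  {V : ι → Submodule ℂ E} [∀ i, (V i).HasOrthogonalProjection]

theorem sum_norm_sq_starProjection_le
    (hV : OrthogonalFamily ℂ (fun i => V i) fun i => (V i).subtypeₗᵢ) (S : Finset ι) (u : E) :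
    ∑ i ∈ S, ‖(V i).starProjection u‖ ^ 2 ≤ ‖u‖ ^ 2 := by
  have h1 : ‖∑ i ∈ S, (V i).starProjection u‖ ^ 2 = ∑ i ∈ S, ‖(V i).starProjection u‖ ^ 2 :=
    hV.norm_sum (fun i => (V i).orthogonalProjectionOnto u) S
  have h2 : RCLike.re (inner ℂ u (∑ i ∈ S, (V i).starProjection u)) =
      ∑ i ∈ S, ‖(V i).starProjection u‖ ^ 2 := by
    rw [inner_sum, map_sum]
    refine Finset.sum_congr rfl fun i _ => ?_
    have h3 : inner ℂ u ((V i).starProjection u) =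
        inner ℂ ((V i).starProjection u) ((V i).starProjection u) := by
      have h4 := (V i).starProjection_inner_eq_zero u ((V i).starProjection u)
        (Submodule.starProjection_apply_mem _ _)
      rw [inner_sub_left, sub_eq_zero] at h4
      exact h4
    rw [h3, inner_self_eq_norm_sq]
  have h5 := @norm_sub_sq ℂ E _ _ _ u (∑ i ∈ S, (V i).starProjection u)
  rw [h1, h2] at h5
  nlinarith [sq_nonneg ‖u - ∑ i ∈ S, (V i).starProjection u‖]

theorem summable_starProjection [CompleteSpace E]
    (hV : OrthogonalFamily ℂ (fun i => V i) fun i => (V i).subtypeₗᵢ) (u : E) :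
    Summable fun i => (V i).starProjection u := by
  have h := hV.summable_iff_norm_sq_summable fun i => (V i).orthogonalProjectionOnto u
  exact h.2 (summable_of_sum_le (fun _ => sq_nonneg _) fun S =>
    sum_norm_sq_starProjection_le hV S u)

theorem inner_starProjection_right {K : Submodule ℂ E} [K.HasOrthogonalProjection] {v : E}
    (hv : v ∈ K) (u : E) : inner ℂ v (K.starProjection u) = inner ℂ v u := by
  have h := K.starProjection_inner_eq_zero u v hv
  rw [← inner_conj_symm, ← inner_conj_symm v u]
  rw [inner_sub_left, sub_eq_zero] at h
  rw [h]

theorem starProjection_starProjection_of_le {K L : Submodule ℂ E} [K.HasOrthogonalProjection]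
    [L.HasOrthogonalProjection] (h : K ≤ L) (u : E) :
    K.starProjection (L.starProjection u) = K.starProjection u := by
  refine Submodule.eq_starProjection_of_mem_of_inner_eq_zero
    (Submodule.starProjection_apply_mem _ _) fun w hw => ?_
  rw [inner_sub_left, sub_eq_zero, ← inner_conj_symm, ← inner_conj_symm _ w,
    inner_starProjection_right hw, inner_starProjection_right (h hw)]

end OrthogonalProjections

/-! ### The expansion of a function of zero fibre average -/

section SectorFamily
variable {g : ℕ} {α : SpR g} {u : L2 g}

/-- The indices of the joint eigenspaces: nonzero frequencies and positive eigenvalues. -/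
abbrev SecIdx : Type := {n : ℤ // n ≠ 0} × {lam : ℝ // 0 < lam}

/-- The joint eigenspaces of nonzero central frequency. -/
def secFam (α : SpR g) (i : SecIdx) : Submodule ℂ (L2 g) := secEig α i.1 i.2

instance (α : SpR g) (i : SecIdx) : FiniteDimensional ℂ (secFam α i) :=
  finiteDimensional_secEig α i.1.2 i.2

theorem orthogonalFamily_secFam (α : SpR g) :
    OrthogonalFamily ℂ (fun i => secFam α i) fun i => (secFam α i).subtypeₗᵢ := by
  intro i j hij v w
  refine inner_eq_zero_of_secEig v.2 w.2 fun h => hij ?_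
  rw [Prod.mk.injEq] at h
  exact Prod.ext (Subtype.ext h.1) (Subtype.ext h.2)

/-- The component of `u` in a joint eigenspace. -/
def secProj (α : SpR g) (u : L2 g) (i : SecIdx) : L2 g := (secFam α i).starProjection u

theorem secProj_mem (α : SpR g) (u : L2 g) (i : SecIdx) : secProj α u i ∈ secEig α i.1 i.2 :=
  Submodule.starProjection_apply_mem (secFam α i) u

/-- By Bessel the projections sum to some `w`, and `u - w` is orthogonal to every joint eigenspace:
for `n ≠ 0` and positive eigenvalue by construction, for `n = 0` because both `u` and the
projections are orthogonal to the central invariants, and for nonpositive eigenvalues because those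
spaces are zero. Completeness gives `u = w`. -/
theorem hasSum_secProj (α : SpR g) (hu : ZeroFibreAverage u) : HasSum (secProj α u) u := by
  have hs : Summable (secProj α u) := summable_starProjection (orthogonalFamily_secFam α) u
  obtain ⟨w, hw⟩ := hs
  suffices h : u - w = 0 by
    exact (sub_eq_zero.1 h).symm ▸ hw
  refine eq_zero_of_orthogonal_secEig α fun n lam v hv => ?_
  have h1 : HasSum (fun i => inner ℂ v (secProj α u i)) (inner ℂ v w) :=
    (innerSL ℂ v).hasSum hw
  rw [inner_sub_right, sub_eq_zero]
  rcases le_or_gt lam 0 with hl | hl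
  · rw [eq_zero_of_secEig_nonpos hl hv, inner_zero_left, inner_zero_left]
  by_cases hn : n = 0
  · subst hn
    rw [hu.inner_eq_zero hv]
    refine (h1.unique ?_).symm
    have h2 : ∀ i, inner ℂ v (secProj α u i) = 0 := fun i =>
      inner_eq_zero_of_secEig hv (secProj_mem α u i) fun h => i.1.2 (congrArg Prod.fst h).symm
    simp only [h2]
    exact hasSum_zero
  · set j : SecIdx := (⟨n, hn⟩, ⟨lam, hl⟩) with hj
    have h2 : ∀ i, i ≠ j → inner ℂ v (secProj α u i) = 0 := fun i hi =>
      inner_eq_zero_of_secEig hv (secProj_mem α u i) fun h => hi (by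
        rw [Prod.mk.injEq] at h
        exact Prod.ext (Subtype.ext h.1.symm) (Subtype.ext h.2.symm))
    rw [h1.unique (hasSum_single j h2)]
    exact (inner_starProjection_right (K := secFam α j) hv u).symm

theorem orthogonalFamily_fst (α : SpR g) (lam : {lam : ℝ // 0 < lam}) :
    OrthogonalFamily ℂ (fun n : {n : ℤ // n ≠ 0} => secFam α (n, lam))
      fun n => (secFam α (n, lam)).subtypeₗᵢ := by
  intro n n' hn v w
  exact orthogonalFamily_secFam α (fun h => hn (congrArg Prod.fst h)) v w

/-- For fixed `lam` the joint eigenspaces are orthogonal subspaces of the eigenspace of `L_α`, so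
Bessel applies inside it. Only this inequality is needed; the eigenspace need not be shown to be the
sum of its sectors. -/
theorem tsum_secProj_le_sobNorm (s : ℝ) (α : SpR g) (u : L2 g) :
    (∑' i : SecIdx, ENNReal.ofReal ((i.2 : ℝ) ^ s) * ‖secProj α u i‖ₑ ^ 2) ^ (1 / 2 : ℝ) ≤
      sobNorm s α u := by
  refine ENNReal.rpow_le_rpow ?_ (by norm_num)
  rw [ENNReal.tsum_prod (f := fun (n : {n : ℤ // n ≠ 0}) (lam : {lam : ℝ // 0 < lam}) =>
    ENNReal.ofReal ((lam : ℝ) ^ s) *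
    ‖secProj α u (n, lam)‖ₑ ^ 2), ENNReal.tsum_comm]
  calc ∑' (lam : {lam : ℝ // 0 < lam}) (n : {n : ℤ // n ≠ 0}),
        ENNReal.ofReal ((lam : ℝ) ^ s) * ‖secProj α u (n, lam)‖ₑ ^ 2
      ≤ ∑' (lam : {lam : ℝ // 0 < lam}), ENNReal.ofReal ((lam : ℝ) ^ s) *
        ‖(eigenspaceL α lam).starProjection u‖ₑ ^ (2 : ℕ) := by
        refine ENNReal.tsum_le_tsum fun lam => ?_
        rw [ENNReal.tsum_mul_left]
        refine mul_le_mul_right ?_ _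
        rw [ENNReal.tsum_eq_iSup_sum]
        refine iSup_le fun S => ?_
        have h1 := sum_norm_sq_starProjection_le (orthogonalFamily_fst α lam) S
          ((eigenspaceL α lam).starProjection u)
        have h2 : ∀ n, (secFam α (n, lam)).starProjection ((eigenspaceL α lam).starProjection u) =
            secProj α u (n, lam) := fun n =>
          starProjection_starProjection_of_le (K := secFam α (n, lam)) (secEig_le_eigenspaceL α n lam) u
        simp only [h2] at h1
        simp only [← ofReal_norm, ← ENNReal.ofReal_pow (norm_nonneg _)]
        rw [← ENNReal.ofReal_sum_of_nonneg fun _ _ => sq_nonneg _]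
        exact ENNReal.ofReal_le_ofReal h1
    _ ≤ _ := ENNReal.tsum_comp_le_tsum_of_injective Subtype.val_injective
        fun lam : ℝ => ENNReal.ofReal (lam ^ s) *
          ‖(eigenspaceL α lam).starProjection u‖ₑ ^ (2 : ℕ)

/-- The smooth representative of the component in a joint eigenspace. -/
def secRep (α : SpR g) (u : L2 g) (i : SecIdx) : Nil g → ℂ := (secProj_mem α u i).choose

theorem isSmooth_secRep (α : SpR g) (u : L2 g) (i : SecIdx) : IsSmooth (secRep α u i) :=
  (secProj_mem α u i).choose_spec.1

theorem isSector_secRep (α : SpR g) (u : L2 g) (i : SecIdx) :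
    IsSector (4 * Real.pi * (i.1 : ℤ)) (secRep α u i) :=
  (secProj_mem α u i).choose_spec.2.1

theorem opL_secRep (α : SpR g) (u : L2 g) (i : SecIdx) (m : Nil g) :
    opL α (secRep α u i) m = ((i.2 : ℝ) : ℂ) * secRep α u i m :=
  (secProj_mem α u i).choose_spec.2.2.1 m

theorem ae_eq_secRep (α : SpR g) (u : L2 g) (i : SecIdx) :
    secProj α u i =ᵐ[haarNil g] secRep α u i :=
  (secProj_mem α u i).choose_spec.2.2.2

theorem Lp_coeFn_sum {ι : Type*} (S : Finset ι) (w : ι → L2 g) {F : ι → Nil g → ℂ}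
    (h : ∀ i ∈ S, w i =ᵐ[haarNil g] F i) :
    (∑ i ∈ S, w i : L2 g) =ᵐ[haarNil g] fun m => ∑ i ∈ S, F i m := by
  classical
  induction S using Finset.induction_on with
  | empty =>
    simp only [Finset.sum_empty]
    exact Lp.coeFn_zero _ _ _
  | insert i S hi ih =>
    simp only [Finset.sum_insert hi]
    filter_upwards [Lp.coeFn_add (w i) (∑ i ∈ S, w i), h i (Finset.mem_insert_self i S),
      ih fun j hj => h j (Finset.mem_insert_of_mem hj)] with m h1 h2 h3
    rw [h1, Pi.add_apply, h2, h3]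

theorem integral_norm_sq_sum_secRep (s : ℝ) (α : SpR g) (u : L2 g) (S : Finset SecIdx) :
    ∫ m, ‖∑ i ∈ S, (((i.2 : ℝ) ^ (s / 2) : ℝ) : ℂ) * secRep α u i m‖ ^ 2 ∂(haarNil g) =
      ∑ i ∈ S, (i.2 : ℝ) ^ s * ‖secProj α u i‖ ^ 2 := by
  set c : SecIdx → ℂ := fun i => (((i.2 : ℝ) ^ (s / 2) : ℝ) : ℂ) with hc
  have h1 : (∑ i ∈ S, c i • secProj α u i : L2 g) =ᵐ[haarNil g]
      fun m => ∑ i ∈ S, c i * secRep α u i m := by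
    refine Lp_coeFn_sum S _ fun i _ => ?_
    filter_upwards [Lp.coeFn_smul (c i) (secProj α u i), ae_eq_secRep α u i] with m h2 h3
    rw [h2, Pi.smul_apply, h3, smul_eq_mul]
  have h2 : ‖(∑ i ∈ S, c i • secProj α u i : L2 g)‖ ^ 2 =
      ∑ i ∈ S, ‖c i • secProj α u i‖ ^ 2 :=
    (orthogonalFamily_secFam α).norm_sum
      (fun i => c i • (secFam α i).orthogonalProjectionOnto u) S
  rw [L2.norm_sq_eq] at h2
  rw [show ∫ m, ‖∑ i ∈ S, c i * secRep α u i m‖ ^ 2 ∂(haarNil g) = _ from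
    (integral_congr_ae (by filter_upwards [h1] with m hm; rw [hm])).trans h2]
  refine Finset.sum_congr rfl fun i _ => ?_
  rw [norm_smul, mul_pow, hc, Complex.norm_real, Real.norm_eq_abs, sq_abs, ← Real.rpow_natCast,
    ← Real.rpow_mul i.2.2.le]
  norm_num

end SectorFamily
end HeisNil
end

/-! ### Summation over the frequencies and the Sobolev bound -/

noncomputable section
namespace HeisNil
open MeasureTheory Filter Topology

section SobolevBound
variable {g : ℕ} {α : SpR g} {u : L2 g}

/-- The uniform bound for finite sums of components. -/
theorem exists_sum_secRep_bound (g : ℕ) {s : ℝ} (hs : (g : ℝ) + 1 / 2 < s) : ∃ C : ℝ, 0 < C ∧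
    ∀ (α : SpR g) (u : L2 g) (S : Finset SecIdx) (m : Nil g),
    ‖∑ i ∈ S, secRep α u i m‖ ≤ C * siegelHeight α ^ (1 / 4 : ℝ) *
      Real.sqrt (∑ i ∈ S, (i.2 : ℝ) ^ s * ‖secProj α u i‖ ^ 2) := by
  classical
  obtain ⟨C, hC, h⟩ := exists_sector_bound g (s := s) (by linarith)
  -- The exponent `2(s - g)` exceeds 1 exactly when `s > g + 1/2`.
  have hsum : Summable fun n : ℤ => |(n : ℝ)| ^ (-(2 * (s - g))) :=
    Real.summable_abs_int_rpow (by linarith)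
  set W := ∑' n : ℤ, |(n : ℝ)| ^ (-(2 * (s - g))) with hW
  have hW0 : 0 ≤ W := tsum_nonneg fun n => by positivity
  refine ⟨C * Real.sqrt (W + 1), by positivity, fun α u S m => ?_⟩
  have hH := siegelHeight_pos α
  set H := siegelHeight α ^ (1 / 4 : ℝ) with hHd
  have hH0 : 0 < H := by positivity
  set w : {n : ℤ // n ≠ 0} → ℝ := fun n => (1 + (4 * Real.pi * (n : ℤ)) ^ 2) ^ (-((s - g) / 2))
    with hw
  set N := S.image Prod.fst with hN
  set T : {n : ℤ // n ≠ 0} → Finset SecIdx := fun n => S.filter fun i => i.1 = n with hT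
  set a : SecIdx → ℝ := fun i => (i.2 : ℝ) ^ s * ‖secProj α u i‖ ^ 2 with ha
  have ha0 : ∀ i, 0 ≤ a i := fun i => mul_nonneg (Real.rpow_nonneg i.2.2.le _) (sq_nonneg _)
  have hmaps : ∀ i ∈ S, i.1 ∈ N := fun i hi => Finset.mem_image_of_mem _ hi
  have hpi := Real.pi_gt_three
  have h1 : ∀ n ∈ N, ‖∑ i ∈ T n, secRep α u i m‖ ≤ C * H * (w n * Real.sqrt (∑ i ∈ T n, a i)) := by
    intro n _
    have h2 := h α (4 * Real.pi * (n : ℤ)) (T n) (secRep α u) (fun i => (i.2 : ℝ))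
      (by
        rw [abs_mul, abs_of_pos (by positivity)]
        have : (1 : ℝ) ≤ |((n : ℤ) : ℝ)| := by exact_mod_cast Int.one_le_abs n.2
        nlinarith) (fun i _ => i.2.2) (fun i _ => isSmooth_secRep α u i)
      (fun i hi => by
        rw [← (Finset.mem_filter.1 hi).2]
        exact isSector_secRep α u i) (fun i _ => opL_secRep α u i) m
    rw [integral_norm_sq_sum_secRep] at h2
    refine h2.trans (le_of_eq ?_)
    rw [hw, hHd]
    ring
  have hw2 : ∑ n ∈ N, w n ^ 2 ≤ W + 1 := by
    have h3 : ∀ n : {n : ℤ // n ≠ 0}, w n ^ 2 ≤ |((n : ℤ) : ℝ)| ^ (-(2 * (s - g))) := by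
      intro n
      have hn1 : (1 : ℝ) ≤ |((n : ℤ) : ℝ)| := by exact_mod_cast Int.one_le_abs n.2
      have hb : |((n : ℤ) : ℝ)| ^ (2 : ℝ) ≤ 1 + (4 * Real.pi * (n : ℤ)) ^ 2 := by
        rw [Real.rpow_two, mul_pow, sq_abs]
        have h4 : (1 : ℝ) ≤ (4 * Real.pi) ^ 2 := by nlinarith
        nlinarith [le_mul_of_one_le_left (sq_nonneg ((n : ℤ) : ℝ)) h4]
      rw [hw]
      simp only
      rw [← Real.rpow_natCast, ← Real.rpow_mul (by positivity), neg_mul_eq_mul_neg,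
        Real.rpow_mul (abs_nonneg _)]
      rw [show -((s - g) / 2) * ((2 : ℕ) : ℝ) = -(s - g) by push_cast; ring]
      exact Real.rpow_le_rpow_of_nonpos (by positivity) hb (by linarith)
    calc ∑ n ∈ N, w n ^ 2 ≤ ∑ n ∈ N, |((n : ℤ) : ℝ)| ^ (-(2 * (s - g))) :=
          Finset.sum_le_sum fun n _ => h3 n
      _ = ∑ n ∈ N.image Subtype.val, |(n : ℝ)| ^ (-(2 * (s - g))) :=
          (Finset.sum_image (f := fun n : ℤ => |(n : ℝ)| ^ (-(2 * (s - g)))) (s := N)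
            (g := Subtype.val) Subtype.val_injective.injOn).symm
      _ ≤ W := hsum.sum_le_tsum _ fun n _ => by positivity
      _ ≤ W + 1 := by linarith
  have hsq : ∑ n ∈ N, Real.sqrt (∑ i ∈ T n, a i) ^ 2 = ∑ i ∈ S, a i := by
    rw [← Finset.sum_fiberwise_of_maps_to hmaps]
    exact Finset.sum_congr rfl fun n _ => Real.sq_sqrt (Finset.sum_nonneg fun i _ => ha0 i)
  -- Cauchy–Schwarz over the frequencies separates the weights, which are square summable, from the
  -- energies of the sectors.
  have hcs : ∑ n ∈ N, w n * Real.sqrt (∑ i ∈ T n, a i) ≤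
      Real.sqrt (W + 1) * Real.sqrt (∑ i ∈ S, a i) := by
    rw [← Real.sqrt_mul (by linarith)]
    refine Real.le_sqrt_of_sq_le ((Finset.sum_mul_sq_le_sq_mul_sq _ _ _).trans ?_)
    rw [hsq]
    exact mul_le_mul_of_nonneg_right hw2 (Finset.sum_nonneg fun i _ => ha0 i)
  rw [← Finset.sum_fiberwise_of_maps_to hmaps]
  calc ‖∑ n ∈ N, ∑ i ∈ S with i.1 = n, secRep α u i m‖
      ≤ ∑ n ∈ N, C * H * (w n * Real.sqrt (∑ i ∈ T n, a i)) :=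
        (norm_sum_le _ _).trans (Finset.sum_le_sum h1)
    _ = C * H * ∑ n ∈ N, w n * Real.sqrt (∑ i ∈ T n, a i) := by rw [Finset.mul_sum]
    _ ≤ C * H * (Real.sqrt (W + 1) * Real.sqrt (∑ i ∈ S, a i)) := by gcongr
    _ = _ := by ring

/-- The bound for finite sums, applied to tails, makes the series of representatives Cauchy in the
sup norm. Its continuous limit represents `u`, since the same series converges to `u` in `L²`. -/
theorem supNorm_le {C : ℝ} (hC : 0 ≤ C) (hu : ZeroFibreAverage u) {a : SecIdx → ℝ}
    (ha : Summable a) (ha0 : ∀ i, 0 ≤ a i)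
    (h : ∀ (S : Finset SecIdx) (m : Nil g), ‖∑ i ∈ S, secRep α u i m‖ ≤
      C * Real.sqrt (∑ i ∈ S, a i)) :
    supNorm u ≤ ENNReal.ofReal (C * Real.sqrt (∑' i, a i)) := by
  classical
  set F : SecIdx → C(Nil g, ℂ) := fun i => ⟨secRep α u i, (isSmooth_secRep α u i).continuous⟩
    with hF
  have hFs : ∀ S : Finset SecIdx, ‖∑ i ∈ S, F i‖ ≤ C * Real.sqrt (∑ i ∈ S, a i) := by
    intro S
    rw [ContinuousMap.norm_le _ (by positivity)]
    intro m
    rw [ContinuousMap.sum_apply]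
    exact h S m
  have hsum : Summable F := by
    rw [summable_iff_vanishing_norm]
    intro ε hε
    -- Dividing by `C + 1` instead of `C` allows `C = 0`.
    obtain ⟨S, hS⟩ := summable_iff_vanishing_norm.1 ha ((ε / (C + 1)) ^ 2) (by positivity)
    refine ⟨S, fun T hT => (hFs T).trans_lt ?_⟩
    have h1 := hS T hT
    rw [Real.norm_of_nonneg (Finset.sum_nonneg fun i _ => ha0 i)] at h1
    have h2 : Real.sqrt (∑ i ∈ T, a i) < ε / (C + 1) :=
      (Real.sqrt_lt' (by positivity)).2 h1
    calc C * Real.sqrt (∑ i ∈ T, a i) ≤ C * (ε / (C + 1)) := by gcongr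
      _ < ε := by
        rw [mul_div_assoc', div_lt_iff₀ (by positivity)]
        nlinarith
  obtain ⟨f, hf⟩ := hsum
  have hnorm : ‖f‖ ≤ C * Real.sqrt (∑' i, a i) := by
    refine le_of_tendsto (Filter.Tendsto.norm hf) (Eventually.of_forall fun S => (hFs S).trans ?_)
    gcongr
    exact ha.sum_le_tsum S fun i _ => ha0 i
  have hfL : MemLp f 2 (haarNil g) :=
    MemLp.of_bound (measurable_of_continuous_nil f.continuous).aestronglyMeasurable ‖f‖
      (Eventually.of_forall fun m => f.norm_coe_le_norm m)
  have hlim : Tendsto (fun S : Finset SecIdx => ∑ i ∈ S, secProj α u i) atTop (𝓝 hfL.toLp) := by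
    rw [tendsto_iff_norm_sub_tendsto_zero]
    refine squeeze_zero (fun _ => norm_nonneg _) (fun S => ?_)
      (tendsto_iff_norm_sub_tendsto_zero.1 hf)
    refine norm_le_of_bound (norm_nonneg _) ?_
    filter_upwards [Lp.coeFn_sub (∑ i ∈ S, secProj α u i) hfL.toLp, hfL.coeFn_toLp,
      Lp_coeFn_sum S (secProj α u) fun i _ => ae_eq_secRep α u i] with m h1 h2 h3
    rw [h1, Pi.sub_apply, h2, h3]
    have := (∑ i ∈ S, F i - f).norm_coe_le_norm m
    rwa [ContinuousMap.sub_apply, ContinuousMap.sum_apply] at this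
  have hu2 : u = hfL.toLp := tendsto_nhds_unique (hasSum_secProj α hu) hlim
  have hae : u =ᵐ[haarNil g] f := by
    rw [hu2]
    exact hfL.coeFn_toLp
  refine (iInf₂_le f hae).trans (iSup_le fun m => ?_)
  rw [← ofReal_norm]
  exact ENNReal.ofReal_le_ofReal ((f.norm_coe_le_norm m).trans hnorm)

theorem supNorm_le_mul_sobNorm {s C : ℝ} (hC : 0 ≤ C) (hu : u ∈ sobSpace s α)
    (h : ∀ (S : Finset SecIdx) (m : Nil g), ‖∑ i ∈ S, secRep α u i m‖ ≤
      C * Real.sqrt (∑ i ∈ S, (i.2 : ℝ) ^ s * ‖secProj α u i‖ ^ 2)) :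
    supNorm u ≤ ENNReal.ofReal C * sobNorm s α u := by
  set a : SecIdx → ℝ := fun i => (i.2 : ℝ) ^ s * ‖secProj α u i‖ ^ 2 with ha
  have ha0 : ∀ i, 0 ≤ a i := fun i => mul_nonneg (Real.rpow_nonneg i.2.2.le _) (sq_nonneg _)
  have e : ∀ i, ENNReal.ofReal ((i.2 : ℝ) ^ s) * ‖secProj α u i‖ₑ ^ 2 = ENNReal.ofReal (a i) := by
    intro i
    rw [ha, ENNReal.ofReal_mul (Real.rpow_nonneg i.2.2.le _), ENNReal.ofReal_pow (norm_nonneg _),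
      ofReal_norm]
  have h1 := tsum_secProj_le_sobNorm s α u
  simp only [e] at h1
  have hfin : ∑' i, ENNReal.ofReal (a i) ≠ ⊤ := by
    intro htop
    rw [htop, ENNReal.top_rpow_of_pos (by norm_num)] at h1
    exact absurd hu.2 (not_lt.2 h1)
  have hsum : Summable a := by
    have := ENNReal.summable_toReal hfin
    simpa only [ENNReal.toReal_ofReal (ha0 _)] using this
  refine (supNorm_le hC hu.1 hsum ha0 h).trans ?_
  rw [ENNReal.ofReal_mul hC]
  refine mul_le_mul_right (le_trans (le_of_eq ?_) h1) _
  rw [Real.sqrt_eq_rpow, ← ENNReal.ofReal_rpow_of_nonneg (tsum_nonneg ha0) (by norm_num),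
    ENNReal.ofReal_tsum_of_nonneg ha0 hsum]

end SobolevBound
end HeisNil
end

theorem mainTheorem10 (g : ℕ) (hg : 1 ≤ g) (s : ℝ) (hs : (g : ℝ) + 1 / 2 < s) :
    ∃ C : ℝ, 0 < C ∧ ∀ α : HeisNil.SpR g,
      HeisNil.bestSobolev s α ≤
        ENNReal.ofReal (C * HeisNil.siegelHeight α ^ (1 / 4 : ℝ)) := by
  obtain ⟨C, hC, h⟩ := HeisNil.exists_sum_secRep_bound g hs
  refine ⟨C, hC, fun α => iSup_le fun u => iSup₂_le fun hu _ => ENNReal.div_le_of_le_mul ?_⟩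
  have hH := HeisNil.siegelHeight_pos α
  exact HeisNil.supNorm_le_mul_sobNorm (by positivity) hu (h α u)
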